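/- An oriented polygonal knot is a simple closed polygon in $\mathbb{R}^3$ with an orientation. Two of them are isotopic if they are related by a finite sequence of elementary moves and their inverses, an elementary move replacing an edge $AB$ by $AC\cup CB$ when the (possibly degenerate) triangle $ABC$ meets the knot only in $AB$ and the result is again a simple polygon. Let $\mathcal{K}$ be the set of isotopy classes of oriented knots. A crossing change lets one strand of a knot pass once, transversally, through another strand: it replaces an edge $AB$ of a polygonal knot by $AC\cup CB$, where the triangle $ABC$ is nondegenerate and meets the knot, apart from $AB$, in exactly one point, which is interior both to the triangle and to an edge of the knot. The Gordian graph is the graph with vertex set $\mathcal{K}$ in which two distinct classes are adjacent if they have representatives that differ by one crossing change. **Proposition.** For every finite subset $S\subset\mathcal{K}$, the complement of $S$ in the Gordian graph, that is, the subgraph induced on $\mathcal{K}\setminus S$, is connected (and in particular nonempty). -/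

import Mathlib

/-! Tame knots in `ℝ³` are represented by oriented simple closed polygons. -/

namespace GordianGraph

/-- The directed edges of the closed polygon with cyclic vertex list `l`: if `l = [v₀, …, vₙ₋₁]`,
they are `(v₀, v₁), (v₁, v₂), …, (vₙ₋₁, v₀)`. -/
def polygonEdges (l : List (Fin 3 → ℝ)) : List ((Fin 3 → ℝ) × (Fin 3 → ℝ)) :=
  l.zip (l.rotate 1)

/-- The half-open segment `[e.1, e.2)`, containing its starting point but not its end point. -/
def halfOpenEdge (e : (Fin 3 → ℝ) × (Fin 3 → ℝ)) : Set (Fin 3 → ℝ) :=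
  AffineMap.lineMap (k := ℝ) e.1 e.2 '' Set.Ico (0 : ℝ) 1

/-- An oriented polygonal knot in `ℝ³`: a closed polygon, oriented by the order of its vertices,
that does not meet itself. As the half-open edges of a closed polygon are traversed one after the
other, the curve is simple exactly when they are pairwise disjoint. -/
structure PolygonalKnot where
  vertices : List (Fin 3 → ℝ)
  three_le_length : 3 ≤ vertices.length
  pairwise_disjoint : (polygonEdges vertices).Pairwise
    (fun e f => Disjoint (halfOpenEdge e) (halfOpenEdge f))

/-- The set of points of a polygonal knot. -/
def PolygonalKnot.support (K : PolygonalKnot) : Set (Fin 3 → ℝ) :=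
  ⋃ e ∈ polygonEdges K.vertices, segment ℝ e.1 e.2

/-- `K'` is obtained from `K` by replacing the edge from `A` to `B` by the two edges from `A` to `C`
and from `C` to `B`. The starting points of the vertex lists are irrelevant. -/
def ReplacesEdge (K K' : PolygonalKnot) (A B C : Fin 3 → ℝ) : Prop :=
  ∃ l : List (Fin 3 → ℝ),
    K.vertices.IsRotated (A :: B :: l) ∧ K'.vertices.IsRotated (A :: C :: B :: l)

/-- An elementary (triangle) move: an edge `AB` of `K` is replaced by `AC ∪ CB`, where the triangle
`ABC` meets `K` only in the edge `AB`. The triangle may be degenerate; as `K'` is a simple polygon,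
`C` then lies between `A` and `B`, and the move just subdivides the edge. -/
def TriangleMove (K K' : PolygonalKnot) : Prop :=
  ∃ A B C : Fin 3 → ℝ, ReplacesEdge K K' A B C ∧
    convexHull ℝ {A, B, C} ∩ K.support = segment ℝ A B

/-- Isotopy of oriented polygonal knots: the equivalence relation generated by triangle moves. -/
def isotopySetoid : Setoid PolygonalKnot := Relation.EqvGen.setoid TriangleMove

/-- The set of isotopy classes of oriented knots. -/
def KnotType : Type := Quotient isotopySetoid

/-- The isotopy class of a polygonal knot. -/
def PolygonalKnot.knotType (K : PolygonalKnot) : KnotType := Quotient.mk isotopySetoid K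

/-- A crossing change: one strand `AB` of `K` is pushed across a nondegenerate triangle `ABC` to
`AC ∪ CB`, and on its way passes exactly once through another strand of `K`. Namely, apart from the
edge `AB`, the triangle meets `K` in a single point `P`, which is interior to the triangle and
interior to some edge `XY` of `K` (so that this edge crosses the triangle transversally). -/
def CrossingChange (K K' : PolygonalKnot) : Prop :=
  ∃ A B C P : Fin 3 → ℝ, ReplacesEdge K K' A B C ∧
    AffineIndependent ℝ ![A, B, C] ∧
    convexHull ℝ {A, B, C} ∩ K.support = segment ℝ A B ∪ {P} ∧
    (∃ a b c : ℝ, 0 < a ∧ 0 < b ∧ 0 < c ∧ a + b + c = 1 ∧ P = a • A + b • B + c • C) ∧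
    ∃ e ∈ polygonEdges K.vertices, P ∈ openSegment ℝ e.1 e.2

/-- The Gordian graph: its vertices are the knot types, and two distinct knot types are adjacent if
some representative of one is turned into a representative of the other by one crossing change. -/
def gordianGraph : SimpleGraph KnotType :=
  SimpleGraph.fromRel fun κ κ' =>
    ∃ K K' : PolygonalKnot, K.knotType = κ ∧ K'.knotType = κ' ∧ CrossingChange K K'

end GordianGraph

namespace GordianGraph

open Topology Filter Set

section LocalSystems

variable {E : Type*} {Γ : Type*} [Group Γ]

/-- `f` is a potential of the two-point function `φ` on `D` near `x`. -/
def Pot [TopologicalSpace E] (φ : E → E → Γ) (D : Set E) (x : E) (f : E → Γ) : Prop :=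
  ∀ᶠ p in 𝓝[D] x ×ˢ 𝓝[D] x, φ p.1 p.2 = (f p.1)⁻¹ * f p.2

/-- A function on the dense set `D` that is constant near `x`. -/
def LocConst {A : Type*} [TopologicalSpace E] (u : E → A) (D : Set E) (x : E) : Prop :=
  ∀ᶠ p in 𝓝[D] x ×ˢ 𝓝[D] x, u p.1 = u p.2

/-- A local system with group `Γ` on `Y`, given by parallel transport between nearby points of a
dense set `D`. -/
def IsSystem [TopologicalSpace E] (φ : E → E → Γ) (D Y : Set E) : Prop :=
  ∀ x ∈ Y, ∃ f, Pot φ D x f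

def IsTrivialOn [TopologicalSpace E] (φ : E → E → Γ) (D Y : Set E) : Prop :=
  ∃ f, ∀ x ∈ Y, Pot φ D x f

theorem eventually_prod_self {l : Filter E} {p : E → E → Prop} :
    (∀ᶠ q in l ×ˢ l, p q.1 q.2) ↔ ∃ N ∈ l, ∀ a ∈ N, ∀ b ∈ N, p a b := by
  rw [eventually_prod_self_iff]

section Topological
variable [TopologicalSpace E] {φ ψ : E → E → Γ} {D Y : Set E} {x : E} {f g : E → Γ}

theorem pot_iff : Pot φ D x f ↔ ∃ N, IsOpen N ∧ x ∈ N ∧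
    ∀ a ∈ N ∩ D, ∀ b ∈ N ∩ D, φ a b = (f a)⁻¹ * f b := by
  unfold Pot
  rw [eventually_prod_self (p := fun a b => φ a b = (f a)⁻¹ * f b)]
  constructor
  · rintro ⟨N, hN, h⟩
    obtain ⟨U, hU, hxU, hUN⟩ := mem_nhdsWithin.1 hN
    exact ⟨U, hU, hxU, fun a ha b hb => h a (hUN ha) b (hUN hb)⟩
  · rintro ⟨N, hN, hx, h⟩
    exact ⟨N ∩ D, mem_nhdsWithin.2 ⟨N, hN, hx, subset_rfl⟩, h⟩

theorem locConst_iff {A : Type*} {u : E → A} : LocConst u D x ↔ ∃ N, IsOpen N ∧ x ∈ N ∧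
    ∀ a ∈ N ∩ D, ∀ b ∈ N ∩ D, u a = u b := by
  unfold LocConst
  rw [eventually_prod_self (p := fun a b => u a = u b)]
  constructor
  · rintro ⟨N, hN, h⟩
    obtain ⟨U, hU, hxU, hUN⟩ := mem_nhdsWithin.1 hN
    exact ⟨U, hU, hxU, fun a ha b hb => h a (hUN ha) b (hUN hb)⟩
  · rintro ⟨N, hN, hx, h⟩
    exact ⟨N ∩ D, mem_nhdsWithin.2 ⟨N, hN, hx, subset_rfl⟩, h⟩

theorem Pot.congr (h : Pot φ D x f) (hfg : ∀ᶠ y in 𝓝[D] x, f y = g y) : Pot φ D x g := by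
  have := hfg.prod_mk hfg
  unfold Pot at *
  filter_upwards [h, this] with p h1 h2
  rw [h1, h2.1, h2.2]

theorem Pot.congr_system (h : Pot φ D x f)
    (hφ : ∀ᶠ p in 𝓝[D] x ×ˢ 𝓝[D] x, φ p.1 p.2 = ψ p.1 p.2) : Pot ψ D x f := by
  unfold Pot at *
  filter_upwards [h, hφ] with p h1 h2
  rw [← h2, h1]

theorem Pot.const_mul (h : Pot φ D x f) (c : Γ) : Pot φ D x (fun y => c * f y) := by
  unfold Pot at *
  filter_upwards [h] with p h1
  rw [h1]; group

theorem Pot.locConst (h : Pot φ D x f) (h' : Pot φ D x g) :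
    LocConst (fun y => g y * (f y)⁻¹) D x := by
  unfold Pot LocConst at *
  filter_upwards [h, h'] with p h1 h2
  rw [h1] at h2
  rw [mul_inv_eq_iff_eq_mul, mul_assoc, ← mul_right_inj (g p.2)⁻¹]
  have h3 := congrArg (fun z => z⁻¹) h2
  simp only [mul_inv_rev, inv_inv] at h3
  rw [← h3]; group

theorem Pot.mono {D' : Set E} (h : Pot φ D x f) (hD : D' ⊆ D) : Pot φ D' x f := by
  unfold Pot at *
  exact h.filter_mono (Filter.prod_mono (nhdsWithin_mono _ hD) (nhdsWithin_mono _ hD))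

theorem Pot.map {Δ : Type*} [Group Δ] (h : Pot φ D x f) (m : Γ →* Δ) :
    Pot (fun a b => m (φ a b)) D x (fun y => m (f y)) := by
  unfold Pot at *
  filter_upwards [h] with p h1
  rw [h1]; simp

theorem Pot.eventually (h : Pot φ D x f) : ∀ᶠ y in 𝓝 x, Pot φ D y f := by
  obtain ⟨N, hN, hx, h⟩ := pot_iff.1 h
  filter_upwards [hN.mem_nhds hx] with y hy
  exact pot_iff.2 ⟨N, hN, hy, h⟩

theorem LocConst.eq_of_isPreconnected {A : Type*} {u : E → A} (hD : Dense D) {C : Set E}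
    (hC : IsPreconnected C) (hu : ∀ x ∈ C, LocConst u D x) {P Q : E}
    (hP : P ∈ C) (hPD : P ∈ D) (hQ : Q ∈ C) (hQD : Q ∈ D) : u P = u Q := by
  set U1 : Set E := {x | ∀ᶠ y in 𝓝[D] x, u y = u P}
  set U2 : Set E := {x | ∀ᶠ y in 𝓝[D] x, u y ≠ u P}
  have o : ∀ p : E → Prop, IsOpen {x | ∀ᶠ y in 𝓝[D] x, p y} := by
    intro p
    rw [isOpen_iff_mem_nhds]
    intro x hx
    obtain ⟨V, hV, hxV, h⟩ := eventually_nhdsWithin_iff.1 hx |> eventually_nhds_iff.1 |>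
      fun ⟨t, h1, h2, h3⟩ => (⟨t, h2, h3, h1⟩ : ∃ t, IsOpen t ∧ x ∈ t ∧ ∀ y ∈ t, y ∈ D → p y)
    filter_upwards [hV.mem_nhds hxV] with z hz
    exact eventually_nhdsWithin_iff.2 (by filter_upwards [hV.mem_nhds hz] with w hw using h w hw)
  have hne : ∀ x : E, (𝓝[D] x).NeBot := fun x => mem_closure_iff_nhdsWithin_neBot.1 (hD x)
  have hdis : Disjoint U1 U2 := by
    rw [Set.disjoint_left]
    intro x h1 h2
    have := hne x
    obtain ⟨y, hy⟩ := ((show ∀ᶠ y in 𝓝[D] x, u y = u P from h1).and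
      (show ∀ᶠ y in 𝓝[D] x, u y ≠ u P from h2)).exists
    exact hy.2 hy.1
  have hcov : C ⊆ U1 ∪ U2 := by
    intro x hx
    obtain ⟨N, hN, hxN, h⟩ := locConst_iff.1 (hu x hx)
    have := hne x
    have hmem : N ∩ D ∈ 𝓝[D] x := mem_nhdsWithin.2 ⟨N, hN, hxN, subset_rfl⟩
    obtain ⟨y, hy⟩ := Filter.nonempty_of_mem hmem
    by_cases hyP : u y = u P
    · left; filter_upwards [hmem] with z hz; rw [h z hz y hy, hyP]
    · right; filter_upwards [hmem] with z hz; rw [h z hz y hy]; exact hyP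
  have key := hC.subset_left_of_subset_union (o _) (o _) hdis hcov
    ⟨P, hP, by
      obtain ⟨N, hN, hxN, h⟩ := locConst_iff.1 (hu P hP)
      have hmem : N ∩ D ∈ 𝓝[D] P := mem_nhdsWithin.2 ⟨N, hN, hxN, subset_rfl⟩
      filter_upwards [hmem] with z hz; exact h z hz P ⟨hxN, hPD⟩⟩
  have := key hQ
  exact ((eventually_nhdsWithin_iff.1 this).self_of_nhds hQD).symm

end Topological

theorem Pot.mul {Γ : Type*} [CommGroup Γ] [TopologicalSpace E] {φ ψ : E → E → Γ} {D : Set E}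
    {x : E} {f g : E → Γ} (h : Pot φ D x f) (h' : Pot ψ D x g) :
    Pot (fun a b => φ a b * ψ a b) D x (fun y => f y * g y) := by
  unfold Pot at *
  filter_upwards [h, h'] with p h1 h2
  rw [h1, h2, mul_inv]
  exact mul_mul_mul_comm _ _ _ _

/-- The properties of the germs of potentials that are used to continue them along segments. -/
structure IsPotentialSheaf [TopologicalSpace E] (D : Set E) (G : E → (E → Γ) → Prop) : Prop where
  eventually : ∀ {x f}, G x f → ∀ᶠ y in 𝓝 x, G y f
  congr : ∀ {x f g}, G x f → (∀ᶠ y in 𝓝[D] x, f y = g y) → G x g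
  const_mul : ∀ {x f}, G x f → ∀ c, G x fun y => c * f y
  locConst : ∀ {x f g}, G x f → G x g → LocConst (fun y => g y * (f y)⁻¹) D x

theorem isPotentialSheaf_pot [TopologicalSpace E] (φ : E → E → Γ) (D : Set E) :
    IsPotentialSheaf D (Pot φ D) :=
  ⟨Pot.eventually, Pot.congr, Pot.const_mul, Pot.locConst⟩

section Normed
variable [NormedAddCommGroup E] [NormedSpace ℝ E] {φ : E → E → Γ} {D Y : Set E}
  {G : E → (E → Γ) → Prop}

theorem exists_tube_potential (hG : IsPotentialSheaf D G) (hD : Dense D) {δ : ℝ} (hδ : 0 < δ) {W v : E}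
    (hloc : ∀ y ∈ segment ℝ W (W + v), ∃ f, ∀ z ∈ Metric.ball y δ, G z f)
    {n : ℕ} (hn : 0 < n) (hv : ‖v‖ / n < δ / 2) (k : ℕ) (hk : k ≤ n) :
    ∃ f, ∀ z ∈ Metric.thickening (δ / 2) (segment ℝ W (W + ((k : ℝ) / n) • v)), G z f := by
  have hn' : (0 : ℝ) < n := by exact_mod_cast hn
  have hmem : ∀ t : ℝ, 0 ≤ t → t ≤ 1 → W + t • v ∈ segment ℝ W (W + v) := by
    intro t h0 h1
    exact ⟨1 - t, t, by linarith, h0, by ring, by module⟩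
  induction k with
  | zero =>
    obtain ⟨f, hf⟩ := hloc W (left_mem_segment ℝ _ _)
    refine ⟨f, fun z hz => hf z ?_⟩
    simp only [CharP.cast_eq_zero, zero_div, zero_smul, add_zero, segment_same,
      Metric.thickening_singleton, Metric.mem_ball] at hz ⊢
    linarith
  | succ k ih =>
    obtain ⟨f, hf⟩ := ih (by omega)
    set y := W + (((k + 1 : ℕ) : ℝ) / n) • v with hy
    set y0 := W + ((k : ℝ) / n) • v with hy0
    have hk' : ((k + 1 : ℕ) : ℝ) ≤ n := by exact_mod_cast hk
    have hkk : ((k : ℕ) : ℝ) ≤ n := by push_cast at hk'; linarith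
    obtain ⟨f', hf'⟩ := hloc y (hmem _ (by positivity) ((div_le_one hn').2 hk'))
    set T := Metric.thickening (δ / 2) (segment ℝ W y0) with hT
    have hdist : ‖y - y0‖ < δ / 2 := by
      have : y - y0 = (1 / n : ℝ) • v := by
        rw [hy, hy0]; push_cast
        rw [add_sub_add_left_eq_sub, ← sub_smul]; congr 1; field_simp; ring
      rw [this, norm_smul]
      simp only [one_div, norm_inv, Real.norm_natCast]
      rw [inv_mul_eq_div]; exact hv
    have hy0T : y0 ∈ T := Metric.self_subset_thickening (by linarith) _ (right_mem_segment ℝ _ _)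
    have hy0B : y0 ∈ Metric.ball y δ := by
      rw [Metric.mem_ball, dist_eq_norm, ← norm_neg, neg_sub]; linarith
    have hTo : IsOpen T := Metric.isOpen_thickening
    have hconv : Convex ℝ (T ∩ Metric.ball y δ) :=
      ((convex_segment _ _).thickening _).inter (convex_ball _ _)
    obtain ⟨P0, hP0⟩ := hD.inter_open_nonempty _ (hTo.inter Metric.isOpen_ball) ⟨y0, hy0T, hy0B⟩
    obtain ⟨c, hc⟩ : ∃ c, c * f' P0 = f P0 := ⟨f P0 * (f' P0)⁻¹, by group⟩
    have hagree : ∀ z ∈ T ∩ Metric.ball y δ, z ∈ D → f z = c * f' z := by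
      intro z hz hzD
      have := LocConst.eq_of_isPreconnected (u := fun y => f y * (f' y)⁻¹) hD hconv.isPreconnected
        (fun x hx => hG.locConst (hf' x hx.2) (hf x hx.1)) hz hzD hP0.1 hP0.2
      rw [← hc, mul_inv_cancel_right] at this
      rw [← this]; group
    classical
    refine ⟨fun z => if z ∈ T then f z else c * f' z, fun z hz => ?_⟩
    by_cases hzT : z ∈ T
    · refine hG.congr (hf z hzT) ?_
      filter_upwards [mem_nhdsWithin_of_mem_nhds (hTo.mem_nhds hzT)] with w hw
      rw [if_pos hw]
    · have hzB : z ∈ Metric.ball y δ := by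
        obtain ⟨w, hw, hzw⟩ := Metric.mem_thickening_iff.1 hz
        obtain ⟨a, b, ha, hb, hab, rfl⟩ := hw
        by_cases hle : b * ((k + 1 : ℕ) : ℝ) ≤ k
        · exfalso; apply hzT
          refine Metric.mem_thickening_iff.2 ⟨_, ?_, hzw⟩
          by_cases hk0 : k = 0
          · subst hk0
            have : b = 0 := by push_cast at hle; nlinarith
            subst this
            obtain rfl : a = 1 := by linarith
            simpa using left_mem_segment ℝ W _
          have hkpos : (0 : ℝ) < k := by exact_mod_cast Nat.pos_of_ne_zero hk0
          refine ⟨1 - b * ((k + 1 : ℕ) : ℝ) / (k : ℝ), b * ((k + 1 : ℕ) : ℝ) / (k : ℝ), ?_,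
            by positivity, by ring, ?_⟩
          · rw [sub_nonneg, div_le_one hkpos]; exact hle
          · have e1 : a = 1 - b := by linarith
            have e2 : b * ((k + 1 : ℕ) : ℝ) / k * ((k : ℝ) / n) = b * (((k + 1 : ℕ) : ℝ) / n) := by
              field_simp
            rw [hy, hy0, e1, smul_add, smul_add, smul_smul, smul_smul, e2]; module
        · push Not at hle
          rw [Metric.mem_ball]
          have e1 : a = 1 - b := by linarith
          have hb1 : b ≤ 1 := by linarith
          have : dist (a • W + b • y) y ≤ ‖y - y0‖ := by
            have h1 : a • W + b • y - y = (-(1 - b) * ((k + 1 : ℕ) : ℝ)) • (y - y0) := by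
              have : y - y0 = (1 / n : ℝ) • v := by
                rw [hy, hy0]; push_cast
                rw [add_sub_add_left_eq_sub, ← sub_smul]; congr 1; field_simp; ring
              rw [this, hy, e1, smul_smul]
              have : -(1 - b) * ((k + 1 : ℕ) : ℝ) * (1 / n) =
                - (1 - b) * (((k + 1 : ℕ) : ℝ) / n) := by field_simp
              rw [this]; module
            rw [dist_eq_norm, h1, norm_smul]
            have : ‖-(1 - b) * ((k + 1 : ℕ) : ℝ)‖ ≤ 1 := by
              rw [Real.norm_eq_abs, abs_le]; push_cast at hle ⊢
              constructor <;> nlinarith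
            nlinarith [norm_nonneg (y - y0)]
          calc dist z y ≤ dist z _ + dist _ y := dist_triangle _ (a • W + b • y) _
            _ < δ := by linarith
      refine hG.congr (hG.const_mul (hf' z hzB) c) ?_
      filter_upwards [mem_nhdsWithin_of_mem_nhds (Metric.isOpen_ball.mem_nhds hzB),
        self_mem_nhdsWithin] with w hw hwD
      split_ifs with h
      · exact (hagree w ⟨h, hw⟩ hwD).symm
      · rfl

theorem exists_thickening_potential (hG : IsPotentialSheaf D G) (hD : Dense D)
    (hφ : ∀ x ∈ Y, ∃ f, G x f) {W x : E}
    (hseg : segment ℝ W x ⊆ Y) :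
    ∃ ε > 0, ∃ f, ∀ z ∈ Metric.thickening ε (segment ℝ W x), G z f := by
  have hcomp : IsCompact (segment ℝ W x) := by
    rw [← convexHull_pair (𝕜 := ℝ)]; exact (Set.toFinite {W, x}).isCompact_convexHull ℝ
  obtain ⟨δ, hδ, h⟩ := lebesgue_number_lemma_of_metric
    (c := fun N : {N : Set E // IsOpen N ∧ ∃ f, ∀ z ∈ N, G z f} => N.1) hcomp
    (fun N => N.2.1) (by
      intro y hy
      obtain ⟨f, hf⟩ := hφ y (hseg hy)
      obtain ⟨N, hN', hN, hyN⟩ := eventually_nhds_iff.1 (hG.eventually hf)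
      exact mem_iUnion.2 ⟨⟨N, hN, f, hN'⟩, hyN⟩)
  obtain ⟨n, hn⟩ := exists_nat_gt (‖x - W‖ / (δ / 2))
  have hn0 : (0 : ℝ) < n := lt_of_le_of_lt (by positivity) hn
  have hn0' : 0 < n := by exact_mod_cast hn0
  refine ⟨δ / 2, by linarith, ?_⟩
  have := exists_tube_potential (v := x - W) (W := W) hG hD hδ (n := n) (by
    rw [add_sub_cancel]
    intro y hy
    obtain ⟨N, hN⟩ := h y hy
    obtain ⟨f, hf⟩ := N.2.2
    exact ⟨f, fun z hz => hf z (hN hz)⟩) hn0' (by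
      rw [div_lt_iff₀ hn0]; rw [div_lt_iff₀ (by linarith)] at hn; linarith) n le_rfl
  rwa [div_self hn0.ne', one_smul, add_sub_cancel] at this

theorem IsPotentialSheaf.exists_global (hG : IsPotentialSheaf D G) (hD : Dense D) (hY : IsOpen Y)
    {W : E} (hW : W ∈ Y) (hs : StarConvex ℝ W Y) (hφ : ∀ x ∈ Y, ∃ f, G x f) :
    ∃ f, ∀ x ∈ Y, G x f := by
  obtain ⟨f0, hf0⟩ := hφ W hW
  have hne : (𝓝[D] W).NeBot := mem_closure_iff_nhdsWithin_neBot.1 (hD W)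
  have hex : ∀ x : E, ∃ ε > 0, ∃ f, x ∈ Y →
      (∀ z ∈ Metric.thickening ε (segment ℝ W x), G z f) ∧ ∀ᶠ y in 𝓝[D] W, f y = f0 y := by
    intro x
    by_cases hx : x ∈ Y
    · obtain ⟨ε, hε, f, hf⟩ := exists_thickening_potential hG hD hφ
        (starConvex_iff_segment_subset.1 hs hx)
      have hWt : W ∈ Metric.thickening ε (segment ℝ W x) :=
        Metric.self_subset_thickening hε _ (left_mem_segment ℝ _ _)
      obtain ⟨N, hN, hWN, h⟩ := locConst_iff.1 (hG.locConst (hf W hWt) hf0)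
      obtain ⟨P, hPD, hPN⟩ := hD.exists_mem_open hN ⟨W, hWN⟩
      refine ⟨ε, hε, fun y => (f0 P * (f P)⁻¹) * f y, fun _ => ⟨fun z hz => hG.const_mul (hf z hz) _,
        ?_⟩⟩
      filter_upwards [mem_nhdsWithin.2 ⟨N, hN, hWN, subset_rfl⟩] with y hy
      have := h P ⟨hPN, hPD⟩ y hy
      rw [this]; group
    · exact ⟨1, one_pos, 1, fun h => absurd h hx⟩
  choose ε hε F hF using hex
  refine ⟨fun Q => F Q Q, fun x hx => hG.congr ((hF x hx).1 x
    (Metric.self_subset_thickening (hε x) _ (right_mem_segment ℝ _ _))) ?_⟩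
  filter_upwards [self_mem_nhdsWithin, mem_nhdsWithin_of_mem_nhds (hY.mem_nhds hx),
    mem_nhdsWithin_of_mem_nhds (Metric.ball_mem_nhds x (hε x))] with Q hQD hQY hQx
  set C := Metric.thickening (ε x) (segment ℝ W x) ∩ Metric.thickening (ε Q) (segment ℝ W Q)
  have hCc : Convex ℝ C := ((convex_segment _ _).thickening _).inter
    ((convex_segment _ _).thickening _)
  have hCo : IsOpen C := Metric.isOpen_thickening.inter Metric.isOpen_thickening
  have hWC : W ∈ C := ⟨Metric.self_subset_thickening (hε _) _ (left_mem_segment ℝ _ _),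
    Metric.self_subset_thickening (hε _) _ (left_mem_segment ℝ _ _)⟩
  have hQC : Q ∈ C := ⟨Metric.mem_thickening_iff.2 ⟨x, right_mem_segment ℝ _ _, hQx⟩,
    Metric.self_subset_thickening (hε _) _ (right_mem_segment ℝ _ _)⟩
  have h1 := (hF x hx).2
  have h2 := (hF Q hQY).2
  obtain ⟨P, hP1, hP2, hPD, hPC⟩ := ((h1.and (h2.and (eventually_mem_nhdsWithin.and
    (mem_nhdsWithin_of_mem_nhds (hCo.mem_nhds hWC))))).exists)
  have := LocConst.eq_of_isPreconnected (u := fun y => F x y * (F Q y)⁻¹) hD hCc.isPreconnected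
    (fun z hz => hG.locConst ((hF Q hQY).1 z hz.2) ((hF x hx).1 z hz.1)) hQC hQD hPC hPD
  simp only [hP1, hP2, mul_inv_cancel] at this
  exact mul_inv_eq_one.1 this

/-- Local systems on star-shaped open sets are trivial. -/
theorem IsSystem.isTrivialOn_of_starConvex (hD : Dense D) (hY : IsOpen Y) {W : E} (hW : W ∈ Y)
    (hs : StarConvex ℝ W Y) (hφ : IsSystem φ D Y) : IsTrivialOn φ D Y :=
  (isPotentialSheaf_pot φ D).exists_global hD hY hW hs hφ

end Normed
end LocalSystems

section FourCovers
variable {E : Type*} [NormedAddCommGroup E] [NormedSpace ℝ E] {Γ : Type*} [Group Γ]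

/-- A cover of `O` by four star-shaped open sets arranged in a cycle, like the complement of a line
in a ball. -/
structure FourCover (O : Set E) (U W : Bool → Set E) : Prop where
  isOpen_U : ∀ i, IsOpen (U i)
  isOpen_W : ∀ i, IsOpen (W i)
  star_U : ∀ i, ∃ w ∈ U i, StarConvex ℝ w (U i)
  star_W : ∀ i, ∃ w ∈ W i, StarConvex ℝ w (W i)
  disj_U : Disjoint (U false) (U true)
  disj_W : Disjoint (W false) (W true)
  sub_U : ∀ i, U i ⊆ O
  sub_W : ∀ i, W i ⊆ O
  cover : ∀ x ∈ O, ∃ i, x ∈ U i ∨ x ∈ W i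
  inter_conn : ∀ i j, IsPreconnected (U i ∩ W j)
  inter_nonempty : ∀ i j, (U i ∩ W j).Nonempty

/-- Potentials on the four pieces that agree on three of the four intersections and differ by the
holonomy `κ` on the fourth. -/
structure HolonomyData (φ : E → E → Γ) (D : Set E) (U W : Bool → Set E) (κ : Γ)
    (f g : Bool → E → Γ) : Prop where
  pot_U : ∀ i, ∀ x ∈ U i, Pot φ D x (f i)
  pot_W : ∀ i, ∀ x ∈ W i, Pot φ D x (g i)
  compat : ∀ i j, ∀ P ∈ U i ∩ W j, P ∈ D → f i P = (bif i && j then κ else 1) * g j P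

variable {O O' D : Set E} {U W U' W' : Bool → Set E} {φ : E → E → Γ}

theorem IsPreconnected.exists_ratio (hD : Dense D) {C : Set E} (hC : IsPreconnected C)
    (hCo : IsOpen C) (hne : C.Nonempty)
    {f g : E → Γ} (hf : ∀ x ∈ C, Pot φ D x f) (hg : ∀ x ∈ C, Pot φ D x g) :
    ∃ c, ∀ P ∈ C, P ∈ D → f P = c * g P := by
  obtain ⟨P0, hP0⟩ := hD.inter_open_nonempty _ hCo hne
  refine ⟨f P0 * (g P0)⁻¹, fun P hP hPD => ?_⟩
  have := LocConst.eq_of_isPreconnected (u := fun y => f y * (g y)⁻¹) hD hC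
    (fun x hx => (hg x hx).locConst (hf x hx)) hP hPD hP0.1 hP0.2
  rw [← this]; group

theorem IsSystem.mono {Y Y' D' : Set E} (h : IsSystem φ D Y) (hY : Y' ⊆ Y) (hD : D' ⊆ D) :
    IsSystem φ D' Y' := fun x hx => by
  obtain ⟨f, hf⟩ := h x (hY hx)
  exact ⟨f, hf.mono hD⟩

theorem FourCover.exists_holonomy (hc : FourCover O U W) (hD : Dense D) (hφ : IsSystem φ D O) :
    ∃ κ f g, HolonomyData φ D U W κ f g := by
  have hU : ∀ i, IsTrivialOn φ D (U i) := fun i => by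
    obtain ⟨w, hw, hs⟩ := hc.star_U i
    exact (hφ.mono (hc.sub_U i) subset_rfl).isTrivialOn_of_starConvex hD (hc.isOpen_U i) hw hs
  have hW : ∀ i, IsTrivialOn φ D (W i) := fun i => by
    obtain ⟨w, hw, hs⟩ := hc.star_W i
    exact (hφ.mono (hc.sub_W i) subset_rfl).isTrivialOn_of_starConvex hD (hc.isOpen_W i) hw hs
  choose f hf using hU
  choose g hg using hW
  have rat : ∀ i j, ∀ a b : Γ, ∃ c, ∀ P ∈ U i ∩ W j, P ∈ D → a * f i P = c * (b * g j P) :=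
    fun i j a b => IsPreconnected.exists_ratio hD (hc.inter_conn i j)
      ((hc.isOpen_U i).inter (hc.isOpen_W j)) (hc.inter_nonempty i j)
      (fun x hx => (hf i x hx.1).const_mul a) (fun x hx => (hg j x hx.2).const_mul b)
  obtain ⟨b0, h00⟩ := rat false false 1 1
  obtain ⟨a1, h10⟩ := rat true false 1 b0
  obtain ⟨b1, h01⟩ := rat false true 1 1
  obtain ⟨κ, h11⟩ := rat true true a1⁻¹ b1
  refine ⟨κ, fun i => bif i then fun P => a1⁻¹ * f true P else f false,
    fun j => bif j then fun P => b1 * g true P else fun P => b0 * g false P, ?_, ?_, ?_⟩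
  · rintro (_ | _) x hx
    · exact hf _ x hx
    · exact (hf _ x hx).const_mul _
  · rintro (_ | _) x hx
    · exact (hg _ x hx).const_mul _
    · exact (hg _ x hx).const_mul _
  · rintro (_ | _) (_ | _) P hP hPD
    · simpa using h00 P hP hPD
    · simpa using h01 P hP hPD
    · have := h10 P hP hPD
      simp only [one_mul] at this
      simp only [cond_true, cond_false, Bool.and_false, one_mul, this]; group
    · simpa using h11 P hP hPD

theorem FourCover.isTrivialOn_of_holonomy (hc : FourCover O U W) {f g : Bool → E → Γ}
    (h : HolonomyData φ D U W 1 f g) : IsTrivialOn φ D O := by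
  classical
  have hcomp : ∀ i j, ∀ P ∈ U i ∩ W j, P ∈ D → f i P = g j P := fun i j P hP hPD => by
    have := h.compat i j P hP hPD
    simpa using this
  set F : E → Γ := fun P => if P ∈ U false then f false P else if P ∈ U true then f true P else
    if P ∈ W false then g false P else g true P with hF
  have h1 : ∀ i, ∀ P ∈ U i, F P = f i P := by
    rintro (_ | _) P hP
    · simp [hF, hP]
    · have : P ∉ U false := fun h' => Set.disjoint_left.1 hc.disj_U h' hP
      simp [hF, hP, this]
  have h2 : ∀ j, ∀ P ∈ W j, P ∈ D → F P = g j P := by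
    intro j P hP hPD
    by_cases h0 : P ∈ U false
    · rw [h1 _ _ h0, hcomp _ _ P ⟨h0, hP⟩ hPD]
    by_cases h0' : P ∈ U true
    · rw [h1 _ _ h0', hcomp _ _ P ⟨h0', hP⟩ hPD]
    rcases j with _ | _
    · simp [hF, h0, h0', hP]
    · have : P ∉ W false := fun h' => Set.disjoint_left.1 hc.disj_W h' hP
      simp [hF, h0, h0', this]
  refine ⟨F, fun x hx => ?_⟩
  obtain ⟨i, hi | hi⟩ := hc.cover x hx
  · refine (h.pot_U i x hi).congr ?_
    filter_upwards [mem_nhdsWithin_of_mem_nhds ((hc.isOpen_U i).mem_nhds hi)] with P hP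
    exact (h1 i P hP).symm
  · refine (h.pot_W i x hi).congr ?_
    filter_upwards [mem_nhdsWithin_of_mem_nhds ((hc.isOpen_W i).mem_nhds hi),
      self_mem_nhdsWithin] with P hP hPD
    exact (h2 i P hP hPD).symm

theorem FourCover.holonomy_eq_one (hc : FourCover O U W) (hD : Dense D) {κ : Γ}
    {f g : Bool → E → Γ} (h : HolonomyData φ D U W κ f g) (ht : IsTrivialOn φ D O) : κ = 1 := by
  obtain ⟨F, hF⟩ := ht
  have hpre : ∀ {s : Set E}, (∃ w ∈ s, StarConvex ℝ w s) → IsPreconnected s := by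
    rintro s ⟨w, hw, hs⟩
    exact (hs.isPathConnected hw).isConnected.isPreconnected
  have hU : ∀ i, ∃ c, ∀ P ∈ U i, P ∈ D → F P = c * f i P := fun i =>
    IsPreconnected.exists_ratio hD (hpre (hc.star_U i)) (hc.isOpen_U i)
      ((hc.star_U i).imp fun _ h => h.1) (fun x hx => hF x (hc.sub_U i hx)) (h.pot_U i)
  have hW : ∀ i, ∃ c, ∀ P ∈ W i, P ∈ D → F P = c * g i P := fun i =>
    IsPreconnected.exists_ratio hD (hpre (hc.star_W i)) (hc.isOpen_W i)
      ((hc.star_W i).imp fun _ h => h.1) (fun x hx => hF x (hc.sub_W i hx)) (h.pot_W i)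
  choose a ha using hU
  choose b hb using hW
  have key : ∀ i j, a i * (bif i && j then κ else 1) = b j := by
    intro i j
    obtain ⟨P, hP, hPD⟩ := hD.inter_open_nonempty _ ((hc.isOpen_U i).inter (hc.isOpen_W j))
      (hc.inter_nonempty i j)
    have e := ha i P hP.1 hPD
    rw [hb j P hP.2 hPD, h.compat i j P hP hPD, ← mul_assoc] at e
    exact (mul_right_cancel e).symm
  have h00 := key false false
  have h01 := key false true
  have h10 := key true false
  have h11 := key true true
  simp only [Bool.and_self, Bool.and_false, Bool.and_true, cond_false, cond_true, mul_one]
    at h00 h01 h10 h11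
  rw [h10, ← h00, h01] at h11
  exact mul_eq_left.1 h11

theorem HolonomyData.mono {κ : Γ} {f g : Bool → E → Γ} (h : HolonomyData φ D U W κ f g)
    (hU : ∀ i, U' i ⊆ U i) (hW : ∀ i, W' i ⊆ W i) : HolonomyData φ D U' W' κ f g :=
  ⟨fun i x hx => h.pot_U i x (hU i hx), fun i x hx => h.pot_W i x (hW i hx),
    fun i j P hP => h.compat i j P ⟨hU i hP.1, hW j hP.2⟩⟩

theorem FourCover.isTrivialOn_of_sub (hc : FourCover O U W) (hc' : FourCover O' U' W')
    (hU : ∀ i, U' i ⊆ U i) (hW : ∀ i, W' i ⊆ W i) (hD : Dense D) (hφ : IsSystem φ D O)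
    (ht : IsTrivialOn φ D O') : IsTrivialOn φ D O := by
  obtain ⟨κ, f, g, h⟩ := hc.exists_holonomy hD hφ
  obtain rfl := hc'.holonomy_eq_one hD (h.mono hU hW) ht
  exact hc.isTrivialOn_of_holonomy h

theorem FourCover.mul_isTrivialOn {Γ : Type*} [CommGroup Γ] {φ ψ : E → E → Γ}
    (h2 : ∀ a b : Γ, a ≠ 1 → b ≠ 1 → a * b = 1) (hc : FourCover O U W) (hD : Dense D)
    (hφ : IsSystem φ D O) (hψ : IsSystem ψ D O) (hφ' : ¬ IsTrivialOn φ D O)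
    (hψ' : ¬ IsTrivialOn ψ D O) : IsTrivialOn (fun a b => φ a b * ψ a b) D O := by
  obtain ⟨κ, f, g, h⟩ := hc.exists_holonomy hD hφ
  obtain ⟨κ', f', g', h'⟩ := hc.exists_holonomy hD hψ
  have hκ : κ ≠ 1 := by rintro rfl; exact hφ' (hc.isTrivialOn_of_holonomy h)
  have hκ' : κ' ≠ 1 := by rintro rfl; exact hψ' (hc.isTrivialOn_of_holonomy h')
  refine hc.isTrivialOn_of_holonomy (f := fun i P => f i P * f' i P)
    (g := fun i P => g i P * g' i P) ⟨fun i x hx => (h.pot_U i x hx).mul (h'.pot_U i x hx),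
    fun i x hx => (h.pot_W i x hx).mul (h'.pot_W i x hx), fun i j P hP hPD => ?_⟩
  rw [h.compat i j P hP hPD, h'.compat i j P hP hPD]
  have := h2 κ κ' hκ hκ'
  rcases i with _ | _ <;> rcases j with _ | _ <;>
    simp only [Bool.and_self, Bool.and_false, Bool.and_true, cond_false, cond_true, one_mul]
  rw [mul_mul_mul_comm, this, one_mul]

end FourCovers

section Meridians
variable {E : Type*} [NormedAddCommGroup E] [NormedSpace ℝ E] {Γ : Type*} [Group Γ]
  {K D : Set E} {φ : E → E → Γ}

/-- Near `x` the set `K` looks like a (possibly bent) line: small balls around `x` have a four-piece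
cover off `K`, which restricts to such covers at the other points of `K` nearby. -/
def NiceAt (K : Set E) (x : E) : Prop :=
  ∀ ρ > 0, ∃ r, 0 < r ∧ r < ρ ∧ ∃ U W, FourCover (Metric.ball x r \ K) U W ∧
    ∀ x' ∈ K ∩ Metric.ball x r, ∀ δ > 0, ∃ r', 0 < r' ∧ r' < δ ∧ ∃ U' W',
      FourCover (Metric.ball x' r' \ K) U' W' ∧ (∀ i, U' i ⊆ U i) ∧ ∀ i, W' i ⊆ W i

/-- The local system `φ` has no holonomy around `K` near `x`. -/
def MeridianTrivial (φ : E → E → Γ) (D K : Set E) (x : E) : Prop :=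
  ∃ f, ∀ᶠ y in 𝓝 x, y ∉ K → Pot φ D y f

theorem FourCover.isPreconnected {O : Set E} {U W : Bool → Set E} (h : FourCover O U W) :
    IsPreconnected O := by
  have hpre : ∀ {s : Set E}, (∃ w ∈ s, StarConvex ℝ w s) → IsPreconnected s := by
    rintro s ⟨w, hw, hs⟩
    exact (hs.isPathConnected hw).isConnected.isPreconnected
  have hO : O = ((U false ∪ W false) ∪ U true) ∪ W true := by
    apply Subset.antisymm
    · intro x hx
      obtain ⟨i, hi⟩ := h.cover x hx
      rcases i with _ | _ <;> rcases hi with hi | hi <;> simp [hi]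
    · exact union_subset (union_subset (union_subset (h.sub_U _) (h.sub_W _)) (h.sub_U _))
        (h.sub_W _)
  rw [hO]
  have n1 := h.inter_nonempty false false
  have n2 := h.inter_nonempty true false
  have n3 := h.inter_nonempty true true
  refine IsPreconnected.union' ?_ (IsPreconnected.union' ?_ (IsPreconnected.union' ?_
    (hpre (h.star_U _)) (hpre (h.star_W _))) (hpre (h.star_U _))) (hpre (h.star_W _))
  · obtain ⟨p, hp⟩ := n3; exact ⟨p, Or.inr hp.1, hp.2⟩
  · obtain ⟨p, hp⟩ := n2; exact ⟨p, Or.inr hp.2, hp.1⟩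
  · exact n1

theorem isPotentialSheaf_compl (hD : Dense D) (hDK : D ⊆ Kᶜ)
    (hn : ∀ x ∈ K, NiceAt K x) :
    IsPotentialSheaf D (fun x f => ∀ᶠ y in 𝓝 x, y ∉ K → Pot φ D y f) where
  eventually h := h.eventually_nhds
  congr {x f g} h hfg := by
    have h2 : ∀ᶠ y in 𝓝 x, ∀ᶠ z in 𝓝[D] y, f z = g z :=
      (eventually_eventually_nhds.2 (eventually_nhdsWithin_iff.1 hfg)).mono
        fun y hy => eventually_nhdsWithin_iff.2 hy
    filter_upwards [h, h2] with y h1 h2 hy using (h1 hy).congr h2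
  const_mul h c := h.mono fun y hy hyK => (hy hyK).const_mul c
  locConst {x f g} hf hg := by
    by_cases hx : x ∈ K
    · obtain ⟨ρ, hρ, hsub⟩ := Metric.eventually_nhds_iff_ball.1 (hf.and hg)
      obtain ⟨r, hr, hrρ, U, W, hc, -⟩ := hn x hx ρ hρ
      refine locConst_iff.2 ⟨Metric.ball x r, Metric.isOpen_ball, Metric.mem_ball_self hr, ?_⟩
      intro a ha b hb
      exact LocConst.eq_of_isPreconnected (u := fun y => g y * (f y)⁻¹) hD hc.isPreconnected
        (fun z hz => ((hsub z (Metric.ball_subset_ball hrρ.le hz.1)).1 hz.2).locConst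
          ((hsub z (Metric.ball_subset_ball hrρ.le hz.1)).2 hz.2))
        ⟨ha.1, hDK ha.2⟩ ha.2 ⟨hb.1, hDK hb.2⟩ hb.2
    · exact (hf.self_of_nhds hx).locConst (hg.self_of_nhds hx)

theorem meridianTrivial_of_isTrivialOn {x : E} {r : ℝ} (hr : 0 < r)
    (h : IsTrivialOn φ D (Metric.ball x r \ K)) : MeridianTrivial φ D K x := by
  obtain ⟨f, hf⟩ := h
  refine ⟨f, ?_⟩
  filter_upwards [Metric.ball_mem_nhds x hr] with y hy hyK using hf y ⟨hy, hyK⟩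

theorem MeridianTrivial.isTrivialOn {x : E} (h : MeridianTrivial φ D K x) :
    ∃ ρ > 0, ∀ r ≤ ρ, IsTrivialOn φ D (Metric.ball x r \ K) := by
  obtain ⟨f, hf⟩ := h
  obtain ⟨ρ, hρ, hsub⟩ := Metric.eventually_nhds_iff_ball.1 hf
  exact ⟨ρ, hρ, fun r hr => ⟨f, fun z hz => hsub z (Metric.ball_subset_ball hr hz.1) hz.2⟩⟩

theorem NiceAt.meridianTrivial_of_near (hD : Dense D) (hφ : IsSystem φ D Kᶜ) {x : E}
    (hn : NiceAt K x) : ∀ᶠ x' in 𝓝 x, x' ∈ K → MeridianTrivial φ D K x' →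
      MeridianTrivial φ D K x := by
  obtain ⟨r, hr, -, U, W, hc, hsub⟩ := hn 1 one_pos
  filter_upwards [Metric.ball_mem_nhds x hr] with x' hx' hx'K ht
  obtain ⟨ρ, hρ, ht⟩ := ht.isTrivialOn
  obtain ⟨r', hr', hr'ρ, U', W', hc', hU, hW⟩ := hsub x' ⟨hx'K, hx'⟩ ρ hρ
  exact meridianTrivial_of_isTrivialOn hr (hc.isTrivialOn_of_sub hc' hU hW hD
    (hφ.mono (fun z hz => hz.2) subset_rfl) (ht r' hr'ρ.le))

theorem MeridianTrivial.all (hD : Dense D) (hφ : IsSystem φ D Kᶜ)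
    (hn : ∀ x ∈ K, NiceAt K x) (hK : IsPreconnected K) {x : E} (hx : x ∈ K)
    (h : MeridianTrivial φ D K x) : ∀ y ∈ K, MeridianTrivial φ D K y := by
  set A : Set E := {x | ∀ᶠ y in 𝓝 x, y ∈ K → MeridianTrivial φ D K y}
  set B : Set E := {x | ∀ᶠ y in 𝓝 x, y ∈ K → ¬ MeridianTrivial φ D K y}
  have hop : ∀ p : E → Prop, IsOpen {x | ∀ᶠ y in 𝓝 x, p y} := fun p =>
    isOpen_iff_mem_nhds.2 fun x hx => Filter.Eventually.eventually_nhds hx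
  have hA : ∀ y ∈ K, MeridianTrivial φ D K y → y ∈ A := by
    rintro y - ⟨f, hf⟩
    exact hf.eventually_nhds.mono fun z hz _ => ⟨f, hz⟩
  have hB : ∀ y ∈ K, ¬ MeridianTrivial φ D K y → y ∈ B := fun y hy hyt =>
    ((hn y hy).meridianTrivial_of_near hD hφ).mono fun z hz hzK hzt => hyt (hz hzK hzt)
  by_contra! hcon
  obtain ⟨y, hy, hyt⟩ := hcon
  obtain ⟨z, hz, hzA, hzB⟩ := hK A B (hop _) (hop _) (fun z hz => by
    by_cases hzt : MeridianTrivial φ D K z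
    · exact Or.inl (hA z hz hzt)
    · exact Or.inr (hB z hz hzt)) ⟨x, hx, hA x hx h⟩ ⟨y, hy, hB y hy hyt⟩
  exact (Eventually.self_of_nhds hzB hz) (Eventually.self_of_nhds hzA hz)

theorem MeridianTrivial.isTrivialOn_compl (hD : Dense D) (hDK : D ⊆ Kᶜ)
    (hφ : IsSystem φ D Kᶜ) (hn : ∀ x ∈ K, NiceAt K x) (hK : IsPreconnected K) {x : E} (hx : x ∈ K)
    (h : MeridianTrivial φ D K x) : IsTrivialOn φ D Kᶜ := by
  have hall := h.all hD hφ hn hK hx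
  obtain ⟨f, hf⟩ := (isPotentialSheaf_compl (φ := φ) hD hDK hn).exists_global hD isOpen_univ
    (mem_univ (0 : E)) (starConvex_univ _) (fun y _ => by
      by_cases hy : y ∈ K
      · exact hall y hy
      · obtain ⟨f, hf⟩ := hφ y hy
        exact ⟨f, hf.eventually.mono fun z hz _ => hz⟩)
  exact ⟨f, fun y hy => (hf y (mem_univ _)).self_of_nhds hy⟩

theorem NiceAt.meridianTrivial_mul {Γ : Type*} [CommGroup Γ] {φ ψ : E → E → Γ}
    (h2 : ∀ a b : Γ, a ≠ 1 → b ≠ 1 → a * b = 1) (hD : Dense D) {x : E} (hn : NiceAt K x) {N : Set E}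
    (hN : N ∈ 𝓝 x) (hφ : IsSystem φ D (N \ K)) (hψ : IsSystem ψ D (N \ K))
    (hφ' : ¬ MeridianTrivial φ D K x) (hψ' : ¬ MeridianTrivial ψ D K x) :
    MeridianTrivial (fun a b => φ a b * ψ a b) D K x := by
  obtain ⟨ρ, hρ, hsub⟩ := Metric.mem_nhds_iff.1 hN
  obtain ⟨r, hr, hrρ, U, W, hc, -⟩ := hn ρ hρ
  have hs : Metric.ball x r \ K ⊆ N \ K :=
    Set.sdiff_subset_sdiff_left ((Metric.ball_subset_ball hrρ.le).trans hsub)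
  exact meridianTrivial_of_isTrivialOn hr (hc.mul_isTrivialOn h2 hD (hφ.mono hs subset_rfl)
    (hψ.mono hs subset_rfl) (fun h => hφ' (meridianTrivial_of_isTrivialOn hr h))
    (fun h => hψ' (meridianTrivial_of_isTrivialOn hr h)))

/-- The first cohomology of the complement of a knot with coefficients in a group of order two has
at most one nontrivial class. -/
theorem isTrivialOn_mul_of_not {Γ : Type*} [CommGroup Γ] {φ ψ : E → E → Γ}
    (h2 : ∀ a b : Γ, a ≠ 1 → b ≠ 1 → a * b = 1) (hD : Dense D) (hDK : D ⊆ Kᶜ)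
    (hn : ∀ x ∈ K, NiceAt K x) (hK : IsConnected K)
    (hφ : IsSystem φ D Kᶜ) (hψ : IsSystem ψ D Kᶜ) (hφ' : ¬ IsTrivialOn φ D Kᶜ)
    (hψ' : ¬ IsTrivialOn ψ D Kᶜ) : IsTrivialOn (fun a b => φ a b * ψ a b) D Kᶜ := by
  obtain ⟨x, hx⟩ := hK.nonempty
  refine MeridianTrivial.isTrivialOn_compl hD hDK (fun y hy => ?_) hn hK.isPreconnected hx
    ((hn x hx).meridianTrivial_mul h2 hD univ_mem (hφ.mono (fun z hz => hz.2) subset_rfl)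
      (hψ.mono (fun z hz => hz.2) subset_rfl)
      (fun h => hφ' (h.isTrivialOn_compl hD hDK hφ hn hK.isPreconnected hx))
      (fun h => hψ' (h.isTrivialOn_compl hD hDK hψ hn hK.isPreconnected hx)))
  obtain ⟨f, hf⟩ := hφ y hy
  obtain ⟨g, hg⟩ := hψ y hy
  exact ⟨_, hf.mul hg⟩

theorem NiceAt.congr {S : Set E} {x : E} (h : NiceAt S x) {ρ : ℝ} (hρ : 0 < ρ)
    (hS : ∀ y ∈ Metric.ball x ρ, y ∈ S ↔ y ∈ K) : NiceAt K x := by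
  have hd : ∀ {y r}, Metric.ball y r ⊆ Metric.ball x ρ →
      Metric.ball y r \ K = Metric.ball y r \ S := by
    intro y r hy
    ext z
    constructor
    · rintro ⟨h1, h2⟩; exact ⟨h1, fun h => h2 ((hS z (hy h1)).1 h)⟩
    · rintro ⟨h1, h2⟩; exact ⟨h1, fun h => h2 ((hS z (hy h1)).2 h)⟩
  intro ρ' hρ'
  obtain ⟨r, hr, hr', U, W, hc, hsub⟩ := h (min ρ ρ') (lt_min hρ hρ')
  have hrρ : Metric.ball x r ⊆ Metric.ball x ρ :=
    Metric.ball_subset_ball (hr'.le.trans (min_le_left _ _))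
  refine ⟨r, hr, hr'.trans_le (min_le_right _ _), U, W, by rwa [hd hrρ], ?_⟩
  rintro x' ⟨hx'K, hx'⟩ δ hδ
  obtain ⟨η, hη, hηs⟩ := Metric.isOpen_iff.1 Metric.isOpen_ball x' hx'
  obtain ⟨r', h1, h2, U', W', hc', hU, hW⟩ := hsub x' ⟨(hS x' (hrρ hx')).2 hx'K, hx'⟩
    (min δ η) (lt_min hδ hη)
  refine ⟨r', h1, h2.trans_le (min_le_left _ _), U', W', ?_, hU, hW⟩
  rwa [hd ((Metric.ball_subset_ball (h2.le.trans (min_le_right _ _))).trans (hηs.trans hrρ))]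

end Meridians

section Models
variable {E : Type*} [NormedAddCommGroup E] [NormedSpace ℝ E]

/-- `1` or `-1`. -/
def boolSign (i : Bool) : ℝ := bif i then 1 else -1

theorem map_comb_sub (c : E →L[ℝ] ℝ) (x p q : E) {s t : ℝ} (h : s + t = 1) :
    c (s • p + t • q - x) = s * c (p - x) + t * c (q - x) := by
  obtain rfl : s = 1 - t := by linarith
  simp only [map_sub, map_add, map_smul, smul_eq_mul]
  ring

theorem comb_pos {s t u v : ℝ} (hs : 0 ≤ s) (ht : 0 ≤ t) (h : s + t = 1) (hu : 0 < u) (hv : 0 < v) :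
    0 < s * u + t * v :=
  convex_Ioi (0 : ℝ) hu hv hs ht h

theorem convex_side (x : E) (r s : ℝ) (c : E →L[ℝ] ℝ) :
    Convex ℝ {p | p ∈ Metric.ball x r ∧ 0 < s * c (p - x)} := by
  intro p hp q hq a b ha hb hab
  refine ⟨convex_ball x r hp.1 hq.1 ha hb hab, ?_⟩
  have := comb_pos ha hb hab hp.2 hq.2
  rw [map_comb_sub c x p q hab]
  linarith

theorem exists_add_smul_mem_ball (x v : E) {r : ℝ} (hr : 0 < r) :
    ∃ t : ℝ, 0 < t ∧ x + t • v ∈ Metric.ball x r := by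
  have hpos : 0 < r / (2 * (‖v‖ + 1)) := by positivity
  refine ⟨r / (2 * (‖v‖ + 1)), hpos, ?_⟩
  rw [Metric.mem_ball, dist_eq_norm, add_sub_cancel_left, norm_smul, Real.norm_eq_abs,
    abs_of_pos hpos, div_mul_eq_mul_div, div_lt_iff₀ (by positivity)]
  nlinarith [norm_nonneg v]

theorem straight_fourCover {x : E} {b w : E →L[ℝ] ℝ} {eb ew : E} (hbb : b eb = 1) (hbw : b ew = 0)
    (hwb : w eb = 0) (hww : w ew = 1) {r : ℝ} (hr : 0 < r) :
    FourCover (Metric.ball x r \ {p | b (p - x) = 0 ∧ w (p - x) = 0})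
      (fun i => {p | p ∈ Metric.ball x r ∧ 0 < boolSign i * w (p - x)})
      (fun i => {p | p ∈ Metric.ball x r ∧ 0 < boolSign i * b (p - x)}) := by
  have hopen : ∀ (c : E →L[ℝ] ℝ) (s : ℝ),
      IsOpen {p | p ∈ Metric.ball x r ∧ 0 < s * c (p - x)} := fun c s =>
    Metric.isOpen_ball.inter
      (isOpen_lt continuous_const (by fun_prop) : IsOpen {p | 0 < s * c (p - x)})
  have hne : ∀ i j, ({p | p ∈ Metric.ball x r ∧ 0 < boolSign i * w (p - x)} ∩
      {p | p ∈ Metric.ball x r ∧ 0 < boolSign j * b (p - x)}).Nonempty := by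
    intro i j
    obtain ⟨t, ht, hb⟩ := exists_add_smul_mem_ball x (boolSign i • ew + boolSign j • eb) hr
    refine ⟨_, ⟨hb, ?_⟩, ⟨hb, ?_⟩⟩ <;> rcases i with _ | _ <;> rcases j with _ | _ <;>
      simp [boolSign, hbb, hbw, hwb, hww, ht]
  have hdisj : ∀ c : E →L[ℝ] ℝ, Disjoint {p | p ∈ Metric.ball x r ∧ 0 < boolSign false * c (p - x)}
      {p | p ∈ Metric.ball x r ∧ 0 < boolSign true * c (p - x)} := by
    intro c
    rw [Set.disjoint_left]
    rintro p ⟨-, h1⟩ ⟨-, h2⟩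
    simp only [boolSign, cond_false, cond_true] at h1 h2
    linarith
  refine ⟨fun i => hopen _ _, fun i => hopen _ _, fun i => ?_, fun i => ?_, hdisj _, hdisj _,
    ?_, ?_, ?_, fun i j => ((convex_side _ _ _ _).inter (convex_side _ _ _ _)).isPreconnected, hne⟩
  · obtain ⟨p, hp⟩ := hne i true
    exact ⟨p, hp.1, convex_side _ _ _ _ hp.1⟩
  · obtain ⟨p, hp⟩ := hne true i
    exact ⟨p, hp.2, convex_side _ _ _ _ hp.2⟩
  · rintro i p ⟨h1, h2⟩
    exact ⟨h1, fun h => by rw [h.2, mul_zero] at h2; exact h2.false⟩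
  · rintro i p ⟨h1, h2⟩
    exact ⟨h1, fun h => by rw [h.1, mul_zero] at h2; exact h2.false⟩
  · rintro p ⟨h1, h2⟩
    simp only [Set.mem_ofPred_eq, not_and_or] at h2
    rcases h2 with h2 | h2
    · rcases lt_or_gt_of_ne h2 with h | h
      · exact ⟨false, Or.inr ⟨h1, by simpa [boolSign] using h⟩⟩
      · exact ⟨true, Or.inr ⟨h1, by simpa [boolSign] using h⟩⟩
    · rcases lt_or_gt_of_ne h2 with h | h
      · exact ⟨false, Or.inl ⟨h1, by simpa [boolSign] using h⟩⟩
      · exact ⟨true, Or.inl ⟨h1, by simpa [boolSign] using h⟩⟩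

theorem niceAt_straight {x : E} {b w : E →L[ℝ] ℝ} {eb ew : E} (hbb : b eb = 1) (hbw : b ew = 0)
    (hwb : w eb = 0) (hww : w ew = 1) : NiceAt {p | b (p - x) = 0 ∧ w (p - x) = 0} x := by
  intro ρ hρ
  refine ⟨ρ / 2, by linarith, by linarith, _, _, straight_fourCover hbb hbw hwb hww (by linarith),
    ?_⟩
  rintro x' ⟨⟨h1, h2⟩, hx'⟩ δ hδ
  obtain ⟨η, hη, hηs⟩ := Metric.isOpen_iff.1 Metric.isOpen_ball x' hx'
  have hm : 0 < min δ η := lt_min hδ hη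
  have eb' : ∀ p, b (p - x') = b (p - x) := fun p => by
    rw [show p - x' = (p - x) - (x' - x) by abel, map_sub, h1, sub_zero]
  have ew' : ∀ p, w (p - x') = w (p - x) := fun p => by
    rw [show p - x' = (p - x) - (x' - x) by abel, map_sub, h2, sub_zero]
  have hc := straight_fourCover (x := x') hbb hbw hwb hww (half_pos hm)
  simp only [eb', ew'] at hc
  have hsub : Metric.ball x' (min δ η / 2) ⊆ Metric.ball x (ρ / 2) :=
    (Metric.ball_subset_ball (by linarith [min_le_right δ η])).trans hηs
  exact ⟨min δ η / 2, by linarith, by linarith [min_le_left δ η], _, _, hc,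
    fun i p hp => ⟨hsub hp.1, hp.2⟩, fun i p hp => ⟨hsub hp.1, hp.2⟩⟩

/-- The union of two rays from `x`, in the coordinates `a`, `b`, `w`. -/
def bentLine (x : E) (a b w : E →L[ℝ] ℝ) : Set E :=
  {p | w (p - x) = 0 ∧ ((0 ≤ a (p - x) ∧ b (p - x) = 0) ∨ (a (p - x) = 0 ∧ 0 ≤ b (p - x)))}

theorem bent_fourCover {x : E} {a b w : E →L[ℝ] ℝ} {ea eb ew : E} (haa : a ea = 1) (hab : a eb = 0)
    (haw : a ew = 0) (hba : b ea = 0) (hbb : b eb = 1) (hbw : b ew = 0) (hwa : w ea = 0)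
    (hwb : w eb = 0) (hww : w ew = 1) {r : ℝ} (hr : 0 < r) :
    FourCover (Metric.ball x r \ bentLine x a b w)
      (fun i => {p | p ∈ Metric.ball x r ∧ 0 < boolSign i * w (p - x)})
      (fun i => {p | p ∈ Metric.ball x r ∧ bif i then 0 < a (p - x) ∧ 0 < b (p - x) else
        a (p - x) < 0 ∨ b (p - x) < 0}) := by
  have hneg : ∀ {s t u v : ℝ}, 0 ≤ s → 0 ≤ t → s + t = 1 → u < 0 → v < 0 → s * u + t * v < 0 := by
    intro s t u v hs ht hst hu hv
    have := comb_pos hs ht hst (neg_pos.2 hu) (neg_pos.2 hv)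
    linarith
  have hconvW : Convex ℝ {p | p ∈ Metric.ball x r ∧ (0 < a (p - x) ∧ 0 < b (p - x))} := by
    intro p hp q hq c d hc hd hcd
    refine ⟨convex_ball x r hp.1 hq.1 hc hd hcd, ?_⟩
    rw [map_comb_sub _ x p q hcd, map_comb_sub _ x p q hcd]
    exact ⟨comb_pos hc hd hcd hp.2.1 hq.2.1, comb_pos hc hd hcd hp.2.2 hq.2.2⟩
  have hstarW : ∀ p0 ∈ Metric.ball x r, a (p0 - x) < 0 → b (p0 - x) < 0 →
      StarConvex ℝ p0 {p | p ∈ Metric.ball x r ∧ (a (p - x) < 0 ∨ b (p - x) < 0)} := by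
    intro p0 hp0 ha0 hb0 q hq c d hc hd hcd
    refine ⟨convex_ball x r hp0 hq.1 hc hd hcd, ?_⟩
    rw [map_comb_sub _ x _ _ hcd, map_comb_sub _ x _ _ hcd]
    exact hq.2.imp (hneg hc hd hcd ha0) (hneg hc hd hcd hb0)
  have hne : ∀ α β γ : ℝ, ∃ t : ℝ, 0 < t ∧ ∃ p ∈ Metric.ball x r, a (p - x) = t * α ∧ b (p - x) = t * β ∧
      w (p - x) = t * γ := by
    intro α β γ
    obtain ⟨t, ht, hp⟩ := exists_add_smul_mem_ball x (α • ea + β • eb + γ • ew) hr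
    refine ⟨t, ht, _, hp, ?_⟩
    simp [haa, hab, haw, hba, hbb, hbw, hwa, hwb, hww]
  have hltw : ∀ (c : E →L[ℝ] ℝ) (s : ℝ), IsOpen {p | 0 < s * c (p - x)} := fun c s =>
    isOpen_lt continuous_const (by fun_prop)
  have hlt : ∀ c : E →L[ℝ] ℝ, IsOpen {p | 0 < c (p - x)} := fun c =>
    isOpen_lt continuous_const (by fun_prop)
  have hgt : ∀ c : E →L[ℝ] ℝ, IsOpen {p | c (p - x) < 0} := fun c =>
    isOpen_lt (by fun_prop) continuous_const
  have hopen : ∀ i : Bool, IsOpen {p | p ∈ Metric.ball x r ∧ bif i then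
      0 < a (p - x) ∧ 0 < b (p - x) else a (p - x) < 0 ∨ b (p - x) < 0} := by
    rintro (_ | _)
    · exact Metric.isOpen_ball.inter ((hgt a).union (hgt b))
    · exact Metric.isOpen_ball.inter ((hlt a).inter (hlt b))
  refine ⟨fun i => Metric.isOpen_ball.inter (hltw w _), hopen,
    fun i => ?_, fun i => ?_, ?_, ?_, ?_, ?_, ?_, fun i j => ?_, fun i j => ?_⟩
  · obtain ⟨t, ht, p, hp, -, -, h3⟩ := hne 0 0 (boolSign i)
    have : p ∈ {p | p ∈ Metric.ball x r ∧ 0 < boolSign i * w (p - x)} := by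
      refine ⟨hp, ?_⟩
      rw [h3]; rcases i with _ | _ <;> simp [boolSign] <;> linarith
    exact ⟨p, this, convex_side _ _ _ _ this⟩
  · rcases i with _ | _
    · obtain ⟨t, ht, p, hp, h1, h2, -⟩ := hne (-1) (-1) 0
      exact ⟨p, ⟨hp, by simp only [cond_false]; left; linarith⟩,
        hstarW p hp (by linarith) (by linarith)⟩
    · obtain ⟨t, ht, p, hp, h1, h2, -⟩ := hne 1 1 0
      have : p ∈ {p | p ∈ Metric.ball x r ∧ (0 < a (p - x) ∧ 0 < b (p - x))} :=
        ⟨hp, by constructor <;> linarith⟩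
      exact ⟨p, this, hconvW this⟩
  · rw [Set.disjoint_left]
    rintro p ⟨-, h1⟩ ⟨-, h2⟩
    simp only [boolSign, cond_false, cond_true] at h1 h2
    linarith
  · rw [Set.disjoint_left]
    rintro p ⟨-, h1⟩ ⟨-, h2⟩
    simp only [cond_false, cond_true] at h1 h2
    rcases h1 with h | h <;> linarith
  · rintro i p ⟨h1, h2⟩
    exact ⟨h1, fun h => by rw [h.1, mul_zero] at h2; exact h2.false⟩
  · rintro (_ | _) p ⟨h1, h2⟩
    · refine ⟨h1, fun h => ?_⟩
      simp only [cond_false] at h2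
      rcases h2 with h2 | h2 <;> rcases h.2 with h | h <;> linarith
    · refine ⟨h1, fun h => ?_⟩
      simp only [cond_true] at h2
      rcases h.2 with h | h <;> linarith
  · rintro p ⟨h1, h2⟩
    by_cases hw : w (p - x) = 0
    · by_cases hlt : a (p - x) < 0 ∨ b (p - x) < 0
      · exact ⟨false, Or.inr ⟨h1, hlt⟩⟩
      · push Not at hlt
        refine ⟨true, Or.inr ⟨h1, ?_⟩⟩
        simp only [cond_true]
        refine ⟨lt_of_le_of_ne hlt.1 fun h => h2 ⟨hw, Or.inr ⟨h.symm, hlt.2⟩⟩,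
          lt_of_le_of_ne hlt.2 fun h => h2 ⟨hw, Or.inl ⟨hlt.1, h.symm⟩⟩⟩
    · rcases lt_or_gt_of_ne hw with h | h
      · exact ⟨false, Or.inl ⟨h1, by simpa [boolSign] using h⟩⟩
      · exact ⟨true, Or.inl ⟨h1, by simpa [boolSign] using h⟩⟩
  · rcases j with _ | _
    · obtain ⟨t, ht, p, hp, h1, h2, h3⟩ := hne (-1) (-1) (boolSign i)
      have h4 : 0 < boolSign i * w (p - x) := by
        rw [h3]; rcases i with _ | _ <;> simp [boolSign] <;> linarith
      have hs := (convex_side x r (boolSign i) w ⟨hp, h4⟩).inter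
        (hstarW p hp (by linarith) (by linarith))
      exact (hs.isPathConnected ⟨⟨hp, h4⟩, hp, Or.inl (by linarith)⟩).isConnected.isPreconnected
    · exact ((convex_side _ _ _ _).inter hconvW).isPreconnected
  · obtain ⟨t, ht, p, hp, h1, h2, h3⟩ := hne (boolSign j) (boolSign j) (boolSign i)
    refine ⟨p, ⟨hp, ?_⟩, hp, ?_⟩
    · rw [h3]; rcases i with _ | _ <;> simp [boolSign] <;> linarith
    · rw [h1, h2]; rcases j with _ | _ <;> simp [boolSign] <;> linarith

theorem niceAt_bent {x : E} {a b w : E →L[ℝ] ℝ} {ea eb ew : E} (haa : a ea = 1) (hab : a eb = 0)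
    (haw : a ew = 0) (hba : b ea = 0) (hbb : b eb = 1) (hbw : b ew = 0) (hwa : w ea = 0)
    (hwb : w eb = 0) (hww : w ew = 1) : NiceAt (bentLine x a b w) x := by
  intro ρ hρ
  refine ⟨ρ / 2, by linarith, by linarith, _, _,
    bent_fourCover haa hab haw hba hbb hbw hwa hwb hww (by linarith), ?_⟩
  rintro x' ⟨⟨h0, h1⟩, hx'⟩ δ hδ
  obtain ⟨η, hη, hηs⟩ := Metric.isOpen_iff.1 Metric.isOpen_ball x' hx'
  have e : ∀ (c : E →L[ℝ] ℝ), c (x' - x) = 0 → ∀ p, c (p - x') = c (p - x) := fun c hc p => by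
    rw [show p - x' = (p - x) - (x' - x) by abel, map_sub, hc, sub_zero]
  by_cases hx : a (x' - x) = 0 ∧ b (x' - x) = 0
  · have hm : 0 < min δ η := lt_min hδ hη
    have hsub : Metric.ball x' (min δ η / 2) ⊆ Metric.ball x (ρ / 2) :=
      (Metric.ball_subset_ball (by linarith [min_le_right δ η])).trans hηs
    have hc := bent_fourCover (x := x') haa hab haw hba hbb hbw hwa hwb hww (half_pos hm)
    simp only [bentLine, e a hx.1, e b hx.2, e w h0] at hc
    exact ⟨min δ η / 2, by linarith, by linarith [min_le_left δ η], _, _, hc,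
      fun i p hp => ⟨hsub hp.1, hp.2⟩, fun i p hp => ⟨hsub hp.1, hp.2⟩⟩
  have main : ∀ c d : E →L[ℝ] ℝ, (∀ r' > 0, FourCover
      (Metric.ball x' r' \ {p | c (p - x') = 0 ∧ w (p - x') = 0})
      (fun i => {p | p ∈ Metric.ball x' r' ∧ 0 < boolSign i * w (p - x')})
      (fun i => {p | p ∈ Metric.ball x' r' ∧ 0 < boolSign i * c (p - x')})) →
      c (x' - x) = 0 → 0 < d (x' - x) →
      ((c = b ∧ d = a) ∨ (c = a ∧ d = b)) → ∃ r', 0 < r' ∧ r' < δ ∧ ∃ U' W',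
      FourCover (Metric.ball x' r' \ bentLine x a b w) U' W' ∧
      (∀ i, U' i ⊆ {p | p ∈ Metric.ball x (ρ / 2) ∧ 0 < boolSign i * w (p - x)}) ∧
      ∀ i, W' i ⊆ {p | p ∈ Metric.ball x (ρ / 2) ∧ bif i then 0 < a (p - x) ∧ 0 < b (p - x) else
        a (p - x) < 0 ∨ b (p - x) < 0} := by
    intro c d hfc hc hd hcd
    obtain ⟨ζ, hζ, hζs⟩ := Metric.isOpen_iff.1 (isOpen_lt continuous_const
      (by fun_prop : Continuous fun p => d (p - x)) : IsOpen {p | 0 < d (p - x)}) x' hd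
    have hm : 0 < min (min δ η) ζ := lt_min (lt_min hδ hη) hζ
    set r' := min (min δ η) ζ / 2
    have hr1 : r' < δ := by
      have := min_le_left (min δ η) ζ; have := min_le_left δ η; simp only [r']; linarith
    have hr2 : r' ≤ η := by
      have := min_le_left (min δ η) ζ; have := min_le_right δ η; simp only [r']; linarith
    have hr3 : r' ≤ ζ := by
      have := min_le_right (min δ η) ζ; simp only [r']; linarith
    have hsub : Metric.ball x' r' ⊆ Metric.ball x (ρ / 2) :=
      (Metric.ball_subset_ball hr2).trans hηs
    have hdp : ∀ p ∈ Metric.ball x' r', 0 < d (p - x) := fun p hp =>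
      hζs (Metric.ball_subset_ball hr3 hp)
    have hfc := hfc r' (half_pos hm)
    simp only [e w h0, e c hc] at hfc
    refine ⟨r', half_pos hm, hr1,
      fun i => {p | p ∈ Metric.ball x' r' ∧ 0 < boolSign i * w (p - x)},
      fun i => {p | p ∈ Metric.ball x' r' ∧ 0 < boolSign i * c (p - x)}, ?_,
      fun i p hp => ⟨hsub hp.1, hp.2⟩, ?_⟩
    rotate_left
    · rintro (_ | _) p ⟨hp, hp2⟩ <;> refine ⟨hsub hp, ?_⟩ <;>
        simp only [boolSign, cond_true, cond_false] at hp2 ⊢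
      · rcases hcd with ⟨rfl, rfl⟩ | ⟨rfl, rfl⟩
        · right; linarith
        · left; linarith
      · have := hdp p hp
        rcases hcd with ⟨rfl, rfl⟩ | ⟨rfl, rfl⟩
        · exact ⟨this, by linarith⟩
        · exact ⟨by linarith, this⟩
    · convert hfc using 1
      ext p
      simp only [mem_diff, bentLine, Set.mem_ofPred_eq]
      refine and_congr_right fun hp => not_congr ?_
      have := hdp p hp
      rcases hcd with ⟨rfl, rfl⟩ | ⟨rfl, rfl⟩
      · constructor
        · rintro ⟨h, h' | h'⟩
          · exact ⟨h'.2, h⟩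
          · linarith
        · rintro ⟨h, h'⟩; exact ⟨h', Or.inl ⟨this.le, h⟩⟩
      · constructor
        · rintro ⟨h, h' | h'⟩
          · linarith
          · exact ⟨h'.1, h⟩
        · rintro ⟨h, h'⟩; exact ⟨h', Or.inr ⟨h, this.le⟩⟩
  rcases h1 with ⟨h1, h2⟩ | ⟨h1, h2⟩
  · exact main b a (fun r' hr' => straight_fourCover hbb hbw hwb hww hr') h2
      (h1.lt_of_ne fun h => hx ⟨h.symm, h2⟩) (Or.inl ⟨rfl, rfl⟩)
  · exact main a b (fun r' hr' => straight_fourCover haa haw hwa hww hr') h1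
      (h2.lt_of_ne fun h => hx ⟨h1, h.symm⟩) (Or.inr ⟨rfl, rfl⟩)

end Models

section Regluing
variable {E : Type*} [NormedAddCommGroup E] [NormedSpace ℝ E] {Γ : Type*} [Group Γ]
  {D Y : Set E} {G : E → (E → Γ) → Prop}

/-- A sheaf of potentials that has local sections on `Y` is the sheaf of potentials of a local
system on `Y`. -/
theorem IsPotentialSheaf.exists_system (hG : IsPotentialSheaf D G) (hD : Dense D)
    (hY : ∀ x ∈ Y, ∃ f, G x f) :
    ∃ φ : E → E → Γ, ∀ x ∈ Y, ∀ f, G x f ↔ Pot φ D x f := by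
  classical
  set C : E → E → (E → Γ) → Prop := fun P Q f =>
    ∃ y r, P ∈ Metric.ball y r ∧ Q ∈ Metric.ball y r ∧ ∀ z ∈ Metric.ball y r, G z f
  set φ : E → E → Γ := fun P Q => if h : ∃ f, C P Q f then (h.choose P)⁻¹ * h.choose Q else 1
  have key : ∀ x f, G x f → Pot φ D x f := by
    intro x f hf
    obtain ⟨ρ, hρ, hsub⟩ := Metric.eventually_nhds_iff_ball.1 (hG.eventually hf)
    refine pot_iff.2 ⟨Metric.ball x ρ, Metric.isOpen_ball, Metric.mem_ball_self hρ, ?_⟩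
    rintro P ⟨hP, hPD⟩ Q ⟨hQ, hQD⟩
    have h : ∃ f, C P Q f := ⟨f, x, ρ, hP, hQ, hsub⟩
    simp only [φ, dif_pos h]
    obtain ⟨y, r, hPy, hQy, hy⟩ := h.choose_spec
    have := LocConst.eq_of_isPreconnected (u := fun z => f z * (h.choose z)⁻¹) hD
      ((convex_ball x ρ).inter (convex_ball y r)).isPreconnected
      (fun z hz => hG.locConst (hy z hz.2) (hsub z hz.1)) ⟨hP, hPy⟩ hPD ⟨hQ, hQy⟩ hQD
    have h3 : f Q = f P * (h.choose P)⁻¹ * h.choose Q := by rw [this]; group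
    rw [h3]; group
  refine ⟨φ, fun x hx g => ⟨key x g, fun hg => ?_⟩⟩
  obtain ⟨f, hf⟩ := hY x hx
  obtain ⟨N, hN, hxN, hc⟩ := locConst_iff.1 ((key x f hf).locConst hg)
  obtain ⟨P, hPD, hPN⟩ := hD.exists_mem_open hN ⟨x, hxN⟩
  refine hG.congr (hG.const_mul hf (g P * (f P)⁻¹)) ?_
  filter_upwards [mem_nhdsWithin.2 ⟨N, hN, hxN, subset_rfl⟩] with Q hQ
  rw [hc P ⟨hPN, hPD⟩ Q hQ]; group

end Regluing

section Dihedral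

/-- Orientation character of the dihedral group. -/
def dihedralSign (m : ℕ) : DihedralGroup m →* ℤˣ where
  toFun g := match g with
    | .r _ => 1
    | .sr _ => -1
  map_one' := rfl
  map_mul' := by rintro (i | i) (j | j) <;> simp

@[simp] theorem dihedralSign_r {m : ℕ} (i : ZMod m) :
    dihedralSign m (DihedralGroup.r i) = 1 := rfl

@[simp] theorem dihedralSign_sr {m : ℕ} (i : ZMod m) :
    dihedralSign m (DihedralGroup.sr i) = -1 := rfl

/-- Translation part of a dihedral symmetry of `ZMod m`. -/
def dihedralShift {m : ℕ} : DihedralGroup m → ZMod m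
  | .r i => i
  | .sr i => -i

/-- The dihedral group acting on `ZMod m` by `x ↦ ± x + i`. -/
def dihedralAct {m : ℕ} (g : DihedralGroup m) (x : ZMod m) : ZMod m :=
  dihedralShift g + ((dihedralSign m g : ℤˣ) : ℤ) * x

theorem dihedralAct_mul {m : ℕ} (g g' : DihedralGroup m) (x : ZMod m) :
    dihedralAct (g * g') x = dihedralAct g (dihedralAct g' x) := by
  rcases g with i | i <;> rcases g' with j | j <;>
    simp [dihedralAct, dihedralShift] <;> ring

theorem dihedralAct_one {m : ℕ} (x : ZMod m) : dihedralAct (1 : DihedralGroup m) x = x := by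
  change dihedralAct (DihedralGroup.r 0) x = x
  simp [dihedralAct, dihedralShift]

theorem units_int_mul_eq_one {a b : ℤˣ} (ha : a ≠ 1) (hb : b ≠ 1) : a * b = 1 := by
  rw [(Int.units_eq_one_or a).resolve_left ha, (Int.units_eq_one_or b).resolve_left hb]; rfl

end Dihedral

section Colorable
variable {E : Type*} [TopologicalSpace E] {m : ℕ}

/-- A flat section of the affine local system over `ZMod m` given by `φ`. -/
def IsFlat (φ : E → E → DihedralGroup m) (D Y : Set E) (h : E → ZMod m) : Prop :=
  ∀ x ∈ Y, ∀ᶠ p in 𝓝[D] x ×ˢ 𝓝[D] x, h p.1 = dihedralAct (φ p.1 p.2) (h p.2)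

/-- `φ` is a dihedral local system on `Y` whose orientation character is nontrivial and that has no
flat section. -/
structure IsColoring (φ : E → E → DihedralGroup m) (D Y : Set E) : Prop where
  isSystem : IsSystem φ D Y
  sign : ¬ IsTrivialOn (fun a b => dihedralSign m (φ a b)) D Y
  not_flat : ∀ h, ¬ IsFlat φ D Y h

/-- The complement of `K` has a dihedral coloring. -/
def Colorable (m : ℕ) (K : Set E) : Prop :=
  ∃ (D : Set E) (φ : E → E → DihedralGroup m), Dense D ∧ D ⊆ Kᶜ ∧ IsColoring φ D Kᶜ

theorem eventually_image_iff (Ψ : E ≃ₜ E) {D : Set E} {x : E} {R : E → E → Prop} :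
    (∀ᶠ p in 𝓝[Ψ '' D] (Ψ x) ×ˢ 𝓝[Ψ '' D] (Ψ x), R p.1 p.2) ↔
      ∀ᶠ p in 𝓝[D] x ×ˢ 𝓝[D] x, R (Ψ p.1) (Ψ p.2) := by
  rw [← Ψ.isEmbedding.map_nhdsWithin_eq, Filter.prod_map_map_eq, eventually_map]

theorem Colorable.image {K : Set E} (h : Colorable m K) (Ψ : E ≃ₜ E) : Colorable m (Ψ '' K) := by
  obtain ⟨D, φ, hD, hDK, hφ⟩ := h
  have hp : ∀ {Γ : Type} [Group Γ] {φ : E → E → Γ} {x : E} {f : E → Γ},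
      Pot (fun a b => φ (Ψ.symm a) (Ψ.symm b)) (Ψ '' D) (Ψ x) f ↔ Pot φ D x (f ∘ Ψ) := by
    intro Γ _ φ x f
    unfold Pot
    rw [eventually_image_iff Ψ (R := fun a b => φ (Ψ.symm a) (Ψ.symm b) = (f a)⁻¹ * f b)]
    simp
  have hc : (Ψ '' K)ᶜ = Ψ '' Kᶜ := (image_compl_eq Ψ.bijective).symm
  refine ⟨Ψ '' D, fun a b => φ (Ψ.symm a) (Ψ.symm b), ?_, ?_, ⟨?_, ?_, ?_⟩⟩
  · rw [Ψ.image_eq_preimage_symm]; exact hD.preimage Ψ.symm.isOpenMap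
  · rw [hc]; exact image_mono hDK
  · rw [hc]
    rintro _ ⟨x, hx, rfl⟩
    obtain ⟨f, hf⟩ := hφ.isSystem x hx
    exact ⟨f ∘ Ψ.symm, hp.2 (by convert hf; ext; simp)⟩
  · rw [hc]
    rintro ⟨f, hf⟩
    exact hφ.sign ⟨f ∘ Ψ, fun x hx => (hp (φ := fun a b => dihedralSign m (φ a b))).1
      (hf _ (mem_image_of_mem _ hx))⟩
  · rw [hc]
    intro h hh
    refine hφ.not_flat (h ∘ Ψ) fun x hx => ?_
    have := (eventually_image_iff Ψ (R := fun a b => h a =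
      dihedralAct (φ (Ψ.symm a) (Ψ.symm b)) (h b))).1 (hh _ (mem_image_of_mem _ hx))
    simpa using this

end Colorable

/-- Euclidean three-space. -/
abbrev Space : Type := Fin 3 → ℝ

section Segments

theorem mem_halfOpenEdge {A B P : Space} :
    P ∈ halfOpenEdge (A, B) ↔ ∃ t : ℝ, 0 ≤ t ∧ t < 1 ∧ P = (1 - t) • A + t • B := by
  simp only [halfOpenEdge, mem_image, mem_Ico, AffineMap.lineMap_apply_module]
  exact ⟨fun ⟨t, h, e⟩ => ⟨t, h.1, h.2, e.symm⟩, fun ⟨t, h, h', e⟩ => ⟨t, ⟨h, h'⟩, e.symm⟩⟩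

theorem mem_segment_iff {E : Type*} [AddCommGroup E] [Module ℝ E] {A B P : E} :
    P ∈ segment ℝ A B ↔ ∃ t : ℝ, 0 ≤ t ∧ t ≤ 1 ∧ P = (1 - t) • A + t • B := by
  constructor
  · rintro ⟨a, b, ha, hb, hab, rfl⟩
    exact ⟨b, hb, by linarith, by rw [← hab, add_sub_cancel_right]⟩
  · rintro ⟨t, h0, h1, rfl⟩
    exact ⟨1 - t, t, by linarith, h0, by ring, rfl⟩

theorem mem_openSegment_iff {E : Type*} [AddCommGroup E] [Module ℝ E] {A B P : E} :
    P ∈ openSegment ℝ A B ↔ ∃ t : ℝ, 0 < t ∧ t < 1 ∧ P = (1 - t) • A + t • B := by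
  constructor
  · rintro ⟨a, b, ha, hb, hab, rfl⟩
    exact ⟨b, hb, by linarith, by rw [← hab, add_sub_cancel_right]⟩
  · rintro ⟨t, h0, h1, rfl⟩
    exact ⟨1 - t, t, by linarith, h0, by ring, rfl⟩

theorem left_mem_halfOpenEdge (A B : Space) : A ∈ halfOpenEdge (A, B) :=
  mem_halfOpenEdge.2 ⟨0, le_rfl, one_pos, by simp⟩

theorem halfOpenEdge_subset (A B : Space) : halfOpenEdge (A, B) ⊆ segment ℝ A B := fun P hP => by
  obtain ⟨t, h0, h1, rfl⟩ := mem_halfOpenEdge.1 hP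
  exact mem_segment_iff.2 ⟨t, h0, h1.le, rfl⟩

theorem halfOpenEdge_union_right (A B : Space) :
    halfOpenEdge (A, B) ∪ {B} = segment ℝ A B := by
  apply Subset.antisymm
  · rintro P (hP | rfl)
    · exact halfOpenEdge_subset _ _ hP
    · exact right_mem_segment ℝ _ _
  · intro P hP
    obtain ⟨t, h0, h1, rfl⟩ := mem_segment_iff.1 hP
    rcases h1.lt_or_eq with h | rfl
    · exact Or.inl (mem_halfOpenEdge.2 ⟨t, h0, h, rfl⟩)
    · right; simp

theorem right_notMem_halfOpenEdge {A B : Space} (h : A ≠ B) : B ∉ halfOpenEdge (A, B) := by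
  intro hB
  obtain ⟨t, h0, h1, e⟩ := mem_halfOpenEdge.1 hB
  have : (1 - t) • (A - B) = 0 := by
    have e' : (1 - t) • (A - B) = ((1 - t) • A + t • B) - B := by module
    rw [e', ← e, sub_self]
  rcases smul_eq_zero.1 this with h2 | h2
  · linarith
  · exact h (sub_eq_zero.1 h2)

theorem halfOpenEdge_split {A B C : Space} (hC : C ∈ openSegment ℝ A B) :
    halfOpenEdge (A, C) ∪ halfOpenEdge (C, B) = halfOpenEdge (A, B) := by
  obtain ⟨s, hs0, hs1, rfl⟩ := mem_openSegment_iff.1 hC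
  have h1s : 0 < 1 - s := by linarith
  apply Subset.antisymm
  · rintro P (hP | hP) <;> obtain ⟨t, h0, h1, rfl⟩ := mem_halfOpenEdge.1 hP <;>
      rw [mem_halfOpenEdge]
    · exact ⟨t * s, by positivity, by nlinarith, by module⟩
    · exact ⟨s + t * (1 - s), by positivity, by nlinarith, by module⟩
  · intro P hP
    obtain ⟨t, h0, h1, rfl⟩ := mem_halfOpenEdge.1 hP
    rcases lt_or_ge t s with h | h
    · left
      refine mem_halfOpenEdge.2 ⟨t / s, by positivity, (div_lt_one hs0).2 h, ?_⟩
      have : t = t / s * s := by field_simp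
      nth_rw 1 [this]; nth_rw 2 [this]; module
    · right
      have h2 : 0 ≤ t - s := by linarith
      refine mem_halfOpenEdge.2 ⟨(t - s) / (1 - s), by positivity,
        (div_lt_one h1s).2 (by linarith), ?_⟩
      have : t = s + (t - s) / (1 - s) * (1 - s) := by field_simp; ring
      set u := (t - s) / (1 - s)
      rw [this]; module

theorem disjoint_halfOpenEdge_split {A B C : Space} (hAB : A ≠ B) (hC : C ∈ openSegment ℝ A B) :
    Disjoint (halfOpenEdge (A, C)) (halfOpenEdge (C, B)) := by
  obtain ⟨s, hs0, hs1, rfl⟩ := mem_openSegment_iff.1 hC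
  rw [Set.disjoint_left]
  intro P h1 h2
  obtain ⟨t, ht0, ht1, rfl⟩ := mem_halfOpenEdge.1 h1
  obtain ⟨u, hu0, hu1, e⟩ := mem_halfOpenEdge.1 h2
  have : (s + u * (1 - s) - t * s) • (A - B) = 0 := by
    rw [← sub_eq_zero] at e
    rw [← e]; module
  rcases smul_eq_zero.1 this with h | h
  · nlinarith
  · exact hAB (sub_eq_zero.1 h)

end Segments

section Paths

/-- The directed edges of an open polygonal path. -/
def pathEdges (p : List Space) : List (Space × Space) := p.zip p.tail

/-- The points of an open polygonal path without its end point. -/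
def halfPath (p : List Space) : Set Space := ⋃ e ∈ pathEdges p, halfOpenEdge e

/-- The points of an open polygonal path. -/
def pathSupport (p : List Space) : Set Space := ⋃ e ∈ pathEdges p, segment ℝ e.1 e.2

/-- The half-open edges of an open polygonal path are pairwise disjoint. -/
def PathSimple (p : List Space) : Prop :=
  (pathEdges p).Pairwise fun e f => Disjoint (halfOpenEdge e) (halfOpenEdge f)

@[simp] theorem pathEdges_nil : pathEdges [] = [] := rfl
@[simp] theorem pathEdges_singleton (a : Space) : pathEdges [a] = [] := rfl
@[simp] theorem pathEdges_cons_cons (a b : Space) (p : List Space) :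
    pathEdges (a :: b :: p) = (a, b) :: pathEdges (b :: p) := rfl

theorem pathEdges_append (p : List Space) (a : Space) (q : List Space) :
    pathEdges (p ++ a :: q) = pathEdges (p ++ [a]) ++ pathEdges (a :: q) := by
  induction p with
  | nil => simp
  | cons b p ih =>
    cases p with
    | nil => simp
    | cons c p => simp only [List.cons_append, pathEdges_cons_cons] at ih ⊢; rw [ih]

theorem mem_pathSupport {p : List Space} {P : Space} :
    P ∈ pathSupport p ↔ ∃ e ∈ pathEdges p, P ∈ segment ℝ e.1 e.2 := by
  simp [pathSupport]

theorem mem_halfPath {p : List Space} {P : Space} :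
    P ∈ halfPath p ↔ ∃ e ∈ pathEdges p, P ∈ halfOpenEdge e := by
  simp [halfPath]

@[simp] theorem pathSupport_singleton (a : Space) : pathSupport [a] = ∅ := by simp [pathSupport]

@[simp] theorem pathSupport_cons_cons (a b : Space) (p : List Space) :
    pathSupport (a :: b :: p) = segment ℝ a b ∪ pathSupport (b :: p) := by
  simp [pathSupport, iUnion_or, iUnion_union_distrib]

@[simp] theorem halfPath_singleton (a : Space) : halfPath [a] = ∅ := by simp [halfPath]

@[simp] theorem halfPath_cons_cons (a b : Space) (p : List Space) :
    halfPath (a :: b :: p) = halfOpenEdge (a, b) ∪ halfPath (b :: p) := by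
  simp [halfPath, iUnion_or, iUnion_union_distrib]

theorem pathSupport_append (p : List Space) (a : Space) (q : List Space) :
    pathSupport (p ++ a :: q) = pathSupport (p ++ [a]) ∪ pathSupport (a :: q) := by
  simp only [pathSupport, pathEdges_append p a q, List.mem_append, iUnion_or, iUnion_union_distrib]

theorem halfPath_append (p : List Space) (a : Space) (q : List Space) :
    halfPath (p ++ a :: q) = halfPath (p ++ [a]) ∪ halfPath (a :: q) := by
  simp only [halfPath, pathEdges_append p a q, List.mem_append, iUnion_or, iUnion_union_distrib]

theorem pathSimple_append (p : List Space) (a : Space) (q : List Space) :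
    PathSimple (p ++ a :: q) ↔ PathSimple (p ++ [a]) ∧ PathSimple (a :: q) ∧
      Disjoint (halfPath (p ++ [a])) (halfPath (a :: q)) := by
  simp only [PathSimple, pathEdges_append p a q, List.pairwise_append, halfPath,
    disjoint_iUnion_left, disjoint_iUnion_right]
  grind

theorem pathSimple_cons_cons (a b : Space) (p : List Space) :
    PathSimple (a :: b :: p) ↔ PathSimple (b :: p) ∧
      Disjoint (halfOpenEdge (a, b)) (halfPath (b :: p)) := by
  simp only [PathSimple, pathEdges_cons_cons, List.pairwise_cons, halfPath, disjoint_iUnion_right]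
  grind

theorem halfPath_subset (p : List Space) : halfPath p ⊆ pathSupport p := by
  intro P hP
  obtain ⟨e, he, hP⟩ := mem_halfPath.1 hP
  exact mem_pathSupport.2 ⟨e, he, halfOpenEdge_subset _ _ hP⟩

theorem pathSupport_subset_halfPath (p : List Space) (a : Space) :
    pathSupport (p ++ [a]) ⊆ halfPath (p ++ [a]) ∪ {a} := by
  induction p with
  | nil => simp
  | cons b p ih =>
    cases p with
    | nil => simp [← halfOpenEdge_union_right]
    | cons c p =>
      simp only [List.cons_append, pathSupport_cons_cons, halfPath_cons_cons] at ih ⊢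
      have hc : c ∈ halfPath (c :: (p ++ [a])) := by
        cases p with
        | nil => simp [left_mem_halfOpenEdge]
        | cons d p => simp [left_mem_halfOpenEdge]
      rw [← halfOpenEdge_union_right]
      rintro P ((h | h) | h)
      · exact Or.inl (Or.inl h)
      · left; right; rw [mem_singleton_iff.1 h]; exact hc
      · rcases ih h with h | h
        · exact Or.inl (Or.inr h)
        · exact Or.inr h

theorem mem_pathSupport_of_mem {p : List Space} (hp : 2 ≤ p.length) {a : Space} (ha : a ∈ p) :
    a ∈ pathSupport p := by
  induction p with
  | nil => simp at ha
  | cons b p ih =>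
    cases p with
    | nil => simp at hp
    | cons c p =>
      rw [pathSupport_cons_cons]
      rcases List.mem_cons.1 ha with rfl | ha
      · exact Or.inl (left_mem_segment ℝ _ _)
      · cases p with
        | nil => simp at ha; subst ha; exact Or.inl (right_mem_segment ℝ _ _)
        | cons d p => exact Or.inr (ih (by simp) ha)

theorem mem_of_mem_pathEdges {p : List Space} {e : Space × Space} (he : e ∈ pathEdges p) :
    e.1 ∈ p ∧ e.2 ∈ p :=
  ⟨(List.of_mem_zip he).1, List.mem_of_mem_tail (List.of_mem_zip he).2⟩

theorem pathSupport_subset_convexHull {p : List Space} :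
    pathSupport p ⊆ convexHull ℝ {x : Space | x ∈ p} := by
  intro P hP
  obtain ⟨e, he, hP⟩ := mem_pathSupport.1 hP
  have h := mem_of_mem_pathEdges he
  exact (convex_convexHull ℝ _).segment_subset (subset_convexHull ℝ {x : Space | x ∈ p} h.1)
    (subset_convexHull ℝ {x : Space | x ∈ p} h.2) hP

end Paths

section Polygons

theorem polygonEdges_cons (a : Space) (l : List Space) :
    polygonEdges (a :: l) = pathEdges (a :: (l ++ [a])) := by
  have : pathEdges (a :: (l ++ [a])) = ((a :: l) ++ [a]).zip ((l ++ [a]) ++ []) := by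
    simp [pathEdges]
  rw [this, List.zip_append (by simp)]
  simp [polygonEdges]

theorem polygonEdges_rotate (l : List Space) (n : ℕ) :
    polygonEdges (l.rotate n) = (polygonEdges l).rotate n := by
  unfold polygonEdges
  rw [List.rotate_rotate, add_comm, ← List.rotate_rotate]
  simp only [List.zip]
  rw [List.zipWith_rotate_distrib _ _ _ _ (by simp)]

/-- A cyclic list of vertices of a simple closed polygon. -/
def IsPolygon (l : List Space) : Prop :=
  3 ≤ l.length ∧ (polygonEdges l).Pairwise fun e f => Disjoint (halfOpenEdge e) (halfOpenEdge f)

/-- The knot with the given vertices. -/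
def knotOf (l : List Space) (h : IsPolygon l) : PolygonalKnot := ⟨l, h.1, h.2⟩

theorem PolygonalKnot.isPolygon (K : PolygonalKnot) : IsPolygon K.vertices :=
  ⟨K.three_le_length, K.pairwise_disjoint⟩

/-- The points of a closed polygon. -/
def polygonSupport (l : List Space) : Set Space := ⋃ e ∈ polygonEdges l, segment ℝ e.1 e.2

theorem polygonEdges_isRotated {l l' : List Space} (h : l ~r l') :
    (polygonEdges l).Perm (polygonEdges l') := by
  obtain ⟨n, rfl⟩ := h
  rw [polygonEdges_rotate]
  exact (List.rotate_perm _ _).symm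

theorem IsPolygon.isRotated {l l' : List Space} (h : IsPolygon l) (hr : l ~r l') :
    IsPolygon l' :=
  ⟨hr.perm.length_eq ▸ h.1, ((polygonEdges_isRotated hr).pairwise_iff
    fun h => Disjoint.symm h).1 h.2⟩

theorem polygonSupport_isRotated {l l' : List Space} (hr : l ~r l') :
    polygonSupport l = polygonSupport l' := by
  unfold polygonSupport
  ext P
  simp only [mem_iUnion, (polygonEdges_isRotated hr).mem_iff]

theorem polygonSupport_cons (a : Space) (l : List Space) :
    polygonSupport (a :: l) = pathSupport (a :: (l ++ [a])) := by
  rw [polygonSupport, polygonEdges_cons]; rfl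

theorem polygonSupport_cons_cons (A B : Space) (l : List Space) :
    polygonSupport (A :: B :: l) = segment ℝ A B ∪ pathSupport (B :: (l ++ [A])) := by
  rw [polygonSupport_cons, List.cons_append, pathSupport_cons_cons]

theorem isPolygon_cons_iff {A B : Space} {l : List Space} :
    IsPolygon (A :: B :: l) ↔ l ≠ [] ∧ PathSimple (B :: (l ++ [A])) ∧
      Disjoint (halfOpenEdge (A, B)) (halfPath (B :: (l ++ [A]))) := by
  rw [IsPolygon, polygonEdges_cons, ← PathSimple, List.cons_append, pathSimple_cons_cons]
  refine and_congr_left fun _ => ?_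
  cases l <;> simp

theorem isPolygon_insert_iff {A B C : Space} {l : List Space} :
    IsPolygon (A :: C :: B :: l) ↔ PathSimple (B :: (l ++ [A])) ∧
      Disjoint (halfOpenEdge (A, C)) (halfOpenEdge (C, B)) ∧
      Disjoint (halfOpenEdge (A, C) ∪ halfOpenEdge (C, B)) (halfPath (B :: (l ++ [A]))) := by
  rw [isPolygon_cons_iff, List.cons_append, pathSimple_cons_cons, halfPath_cons_cons,
    disjoint_union_right, disjoint_union_left]
  simp only [ne_eq, reduceCtorEq, not_false_eq_true, true_and]
  tauto

theorem mem_halfPath_of_mem {p : List Space} {a b : Space} (hb : b ∈ p) :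
    b ∈ halfPath (p ++ [a]) := by
  induction p with
  | nil => simp at hb
  | cons c p ih =>
    cases p with
    | nil => simp at hb; subst hb; simp [left_mem_halfOpenEdge]
    | cons d p =>
      rw [List.cons_append, List.cons_append, halfPath_cons_cons]
      rcases List.mem_cons.1 hb with rfl | hb
      · exact Or.inl (left_mem_halfOpenEdge _ _)
      · exact Or.inr (ih hb)

theorem IsPolygon.ne {A B : Space} {l : List Space} (h : IsPolygon (A :: B :: l)) : A ≠ B := by
  rintro rfl
  exact Set.disjoint_left.1 (isPolygon_cons_iff.1 h).2.2 (left_mem_halfOpenEdge _ _)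
    (mem_halfPath_of_mem (p := A :: l) (by simp))

theorem isPolygon_subdivide_iff {A B C : Space} {l : List Space} (hAB : A ≠ B)
    (hC : C ∈ openSegment ℝ A B) (hl : l ≠ []) :
    IsPolygon (A :: C :: B :: l) ↔ IsPolygon (A :: B :: l) := by
  rw [isPolygon_insert_iff, isPolygon_cons_iff, halfOpenEdge_split hC]
  simp [disjoint_halfOpenEdge_split hAB hC, hl]

theorem segment_split {E : Type*} [AddCommGroup E] [Module ℝ E] {A B C : E}
    (hC : C ∈ openSegment ℝ A B) :
    segment ℝ A C ∪ segment ℝ C B = segment ℝ A B := by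
  obtain ⟨s, hs0, hs1, rfl⟩ := mem_openSegment_iff.1 hC
  have h1s : 0 < 1 - s := by linarith
  apply Subset.antisymm
  · rintro P (hP | hP) <;> obtain ⟨t, h0, h1, rfl⟩ := mem_segment_iff.1 hP <;>
      rw [mem_segment_iff]
    · exact ⟨t * s, by positivity, by nlinarith, by module⟩
    · exact ⟨s + t * (1 - s), by positivity, by nlinarith, by module⟩
  · intro P hP
    obtain ⟨t, h0, h1, rfl⟩ := mem_segment_iff.1 hP
    rcases lt_or_ge t s with h | h
    · left
      refine mem_segment_iff.2 ⟨t / s, by positivity, (div_le_one hs0).2 h.le, ?_⟩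
      have : t = t / s * s := by field_simp
      nth_rw 1 [this]; nth_rw 2 [this]; module
    · right
      have h2 : 0 ≤ t - s := by linarith
      refine mem_segment_iff.2 ⟨(t - s) / (1 - s), by positivity,
        (div_le_one h1s).2 (by linarith), ?_⟩
      have : t = s + (t - s) / (1 - s) * (1 - s) := by field_simp; ring
      set u := (t - s) / (1 - s)
      rw [this]; module

theorem polygonSupport_subdivide {A B C : Space} {l : List Space}
    (hC : C ∈ openSegment ℝ A B) :
    polygonSupport (A :: C :: B :: l) = polygonSupport (A :: B :: l) := by
  rw [polygonSupport_cons_cons, polygonSupport_cons_cons, List.cons_append, pathSupport_cons_cons,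
    ← segment_split hC, union_assoc]

end Polygons

section KnotTypes

theorem knotType_eq_of_triangleMove {K K' : PolygonalKnot} (h : TriangleMove K K') :
    K.knotType = K'.knotType :=
  Quotient.sound (Relation.EqvGen.rel _ _ h)

theorem convexHull_of_mem_segment {A B C : Space} (hC : C ∈ segment ℝ A B) :
    convexHull ℝ {A, B, C} = segment ℝ A B := by
  apply Subset.antisymm
  · refine convexHull_min ?_ (convex_segment _ _)
    rintro x (rfl | rfl | rfl)
    · exact left_mem_segment ℝ _ _
    · exact right_mem_segment ℝ _ _
    · exact hC
  · rw [← convexHull_pair]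
    exact convexHull_mono (by intro x; simp; tauto)

theorem triangleMove_subdivide {K K' : PolygonalKnot} {A B C : Space} {l : List Space}
    (hK : K.vertices ~r (A :: B :: l)) (hK' : K'.vertices ~r (A :: C :: B :: l))
    (hC : C ∈ openSegment ℝ A B) : TriangleMove K K' := by
  refine ⟨A, B, C, ⟨l, hK, hK'⟩, ?_⟩
  rw [convexHull_of_mem_segment (openSegment_subset_segment ℝ _ _ hC), inter_eq_left]
  change _ ⊆ polygonSupport K.vertices
  rw [polygonSupport_isRotated hK, polygonSupport_cons_cons]
  exact subset_union_left

theorem knotType_eq_of_isRotated {K K' : PolygonalKnot} (h : K.vertices ~r K'.vertices) :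
    K.knotType = K'.knotType := by
  obtain ⟨A, B, l, hl⟩ : ∃ A B l, K.vertices = A :: B :: l := by
    match h' : K.vertices with
    | A :: B :: l => exact ⟨A, B, l, rfl⟩
    | [] => exact absurd K.three_le_length (by simp [h'])
    | [a] => exact absurd K.three_le_length (by simp [h'])
  have hp := K.isPolygon
  rw [hl] at hp
  set C := (1 - (1 / 2 : ℝ)) • A + (1 / 2 : ℝ) • B
  have hC : C ∈ openSegment ℝ A B :=
    mem_openSegment_iff.2 ⟨1 / 2, by norm_num, by norm_num, rfl⟩
  set M := knotOf _ ((isPolygon_subdivide_iff hp.ne hC (isPolygon_cons_iff.1 hp).1).2 hp)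
  rw [knotType_eq_of_triangleMove (triangleMove_subdivide (K := K) (K' := M) (l := l) (hl ▸ .refl _)
    (.refl _) hC)]
  exact (knotType_eq_of_triangleMove (triangleMove_subdivide (l := l) (h.symm.trans (hl ▸ .refl _))
    (.refl _) hC)).symm

/-- Two knot types that are joined by a path in the Gordian graph inside `G`. -/
def Linked (G : Set KnotType) (κ κ' : KnotType) : Prop :=
  ∃ (h : κ ∈ G) (h' : κ' ∈ G), (gordianGraph.induce G).Reachable ⟨κ, h⟩ ⟨κ', h'⟩

theorem Linked.refl {G : Set KnotType} {κ : KnotType} (h : κ ∈ G) : Linked G κ κ :=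
  ⟨h, h, .refl _⟩

theorem Linked.symm {G : Set KnotType} {κ κ' : KnotType} (h : Linked G κ κ') : Linked G κ' κ :=
  ⟨h.2.1, h.1, h.2.2.symm⟩

theorem Linked.trans {G : Set KnotType} {κ κ' κ'' : KnotType} (h : Linked G κ κ')
    (h' : Linked G κ' κ'') : Linked G κ κ'' :=
  ⟨h.1, h'.2.1, h.2.2.trans h'.2.2⟩

theorem Linked.of_crossingChange {G : Set KnotType} {K K' : PolygonalKnot}
    (h : CrossingChange K K') (hK : K.knotType ∈ G) (hK' : K'.knotType ∈ G) :
    Linked G K.knotType K'.knotType := by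
  by_cases he : K.knotType = K'.knotType
  · rw [← he]; exact .refl hK
  · refine ⟨hK, hK', SimpleGraph.Adj.reachable ?_⟩
    rw [SimpleGraph.comap_adj]
    exact (SimpleGraph.fromRel_adj _ _ _).2 ⟨he, Or.inl ⟨K, K', rfl, rfl, h⟩⟩

end KnotTypes

section Triangles

variable {A B C D P : Space}

theorem affineIndependent_triple_iff : AffineIndependent ℝ ![A, B, C] ↔
    ∀ x y : ℝ, x • (B - A) + y • (C - A) = 0 → x = 0 ∧ y = 0 := by
  rw [affineIndependent_iff]
  constructor
  · intro h x y hxy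
    have := h Finset.univ ![-x - y, x, y] (by simp [Fin.sum_univ_three]; ring) (by
      simp only [Fin.sum_univ_three, Matrix.cons_val_zero, Matrix.cons_val_one, Matrix.cons_val]
      rw [← hxy]; module)
    exact ⟨this 1 (Finset.mem_univ _), this 2 (Finset.mem_univ _)⟩
  · intro h s w hw hws i hi
    have e1 : ∑ i, (if i ∈ s then w i else 0) = 0 := by
      rw [Finset.sum_ite_mem, Finset.univ_inter, hw]
    have e2 : ∑ i, (if i ∈ s then w i else 0) • ![A, B, C] i = 0 := by
      simp_rw [ite_smul, zero_smul]
      rw [Finset.sum_ite_mem, Finset.univ_inter, hws]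
    set w' : Fin 3 → ℝ := fun i => if i ∈ s then w i else 0
    rw [Fin.sum_univ_three] at e1 e2
    change w' 0 + w' 1 + w' 2 = 0 at e1
    change w' 0 • A + w' 1 • B + w' 2 • C = 0 at e2
    have e3 : w' 0 = - w' 1 - w' 2 := by linarith
    have := h (w' 1) (w' 2) (by rw [← e2, e3]; module)
    have hi' : w' i = 0 := by fin_cases i <;> simp [this, e3]
    simpa [w', hi] using hi'

theorem barycentric_unique (h : AffineIndependent ℝ ![A, B, C]) {a b c a' b' c' : ℝ}
    (h1 : a + b + c = 1) (h2 : a' + b' + c' = 1)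
    (he : a • A + b • B + c • C = a' • A + b' • B + c' • C) : a = a' ∧ b = b' ∧ c = c' := by
  have := affineIndependent_triple_iff.1 h (b - b') (c - c') (by
    have e1 : a = 1 - b - c := by linarith
    have e2 : a' = 1 - b' - c' := by linarith
    subst e1 e2
    rw [← sub_eq_zero] at he
    rw [← he]; module)
  refine ⟨?_, ?_, ?_⟩ <;> linarith [this.1, this.2]

theorem mem_triangle_iff : P ∈ convexHull ℝ {A, B, C} ↔
    ∃ a b c : ℝ, 0 ≤ a ∧ 0 ≤ b ∧ 0 ≤ c ∧ a + b + c = 1 ∧ P = a • A + b • B + c • C := by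
  rw [convexHull_insert (by simp), convexHull_pair, mem_convexJoin]
  constructor
  · rintro ⟨x, hx, y, hy, hP⟩
    rw [mem_singleton_iff] at hx
    subst hx
    obtain ⟨t, h0, h1, rfl⟩ := mem_segment_iff.1 hy
    obtain ⟨s, h2, h3, rfl⟩ := mem_segment_iff.1 hP
    exact ⟨1 - s, s * (1 - t), s * t, by linarith, mul_nonneg h2 (by linarith), by positivity,
      by ring, by module⟩
  · rintro ⟨a, b, c, ha, hb, hc, h, rfl⟩
    rcases (add_nonneg hb hc).eq_or_lt with h0 | h0
    · obtain rfl : b = 0 := by linarith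
      obtain rfl : c = 0 := by linarith
      obtain rfl : a = 1 := by linarith
      exact ⟨A, rfl, B, left_mem_segment ℝ _ _, by simpa using left_mem_segment ℝ A B⟩
    · refine ⟨A, rfl, (1 - c / (b + c)) • B + (c / (b + c)) • C, mem_segment_iff.2
        ⟨_, by positivity, (div_le_one h0).2 (by linarith), rfl⟩, mem_segment_iff.2 ⟨b + c, h0.le,
          by linarith, ?_⟩⟩
      have e1 : (b + c) * (c / (b + c)) = c := by field_simp
      have e2 : (b + c) * (1 - c / (b + c)) = b := by field_simp; ring
      rw [smul_add, smul_smul, smul_smul, e1, e2, add_assoc]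
      congr 2; linarith

/-- `P` lies in the relative interior of the triangle `ABC`. -/
def InTriangle (A B C P : Space) : Prop :=
  ∃ a b c : ℝ, 0 < a ∧ 0 < b ∧ 0 < c ∧ a + b + c = 1 ∧ P = a • A + b • B + c • C

theorem left_mem_triangle : A ∈ convexHull ℝ {A, B, C} := subset_convexHull ℝ _ (by simp)
theorem mid_mem_triangle : B ∈ convexHull ℝ {A, B, C} := subset_convexHull ℝ _ (by simp)
theorem right_mem_triangle : C ∈ convexHull ℝ {A, B, C} := subset_convexHull ℝ _ (by simp)

theorem InTriangle.mem (h : InTriangle A B C P) : P ∈ convexHull ℝ {A, B, C} := by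
  obtain ⟨a, b, c, ha, hb, hc, h, e⟩ := h
  exact mem_triangle_iff.2 ⟨a, b, c, ha.le, hb.le, hc.le, h, e⟩

theorem segment_subset_triangle {X Y : Space} (hX : X ∈ convexHull ℝ {A, B, C})
    (hY : Y ∈ convexHull ℝ {A, B, C}) : segment ℝ X Y ⊆ convexHull ℝ {A, B, C} :=
  (convex_convexHull ℝ _).segment_subset hX hY

theorem triangle_mono {X Y Z : Space} (hX : X ∈ convexHull ℝ {A, B, C})
    (hY : Y ∈ convexHull ℝ {A, B, C}) (hZ : Z ∈ convexHull ℝ {A, B, C}) :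
    convexHull ℝ {X, Y, Z} ⊆ convexHull ℝ {A, B, C} := by
  refine convexHull_min ?_ (convex_convexHull ℝ _)
  rintro x (rfl | rfl | rfl) <;> assumption

theorem InTriangle.notMem_segment₁ (h : AffineIndependent ℝ ![A, B, C]) (hP : InTriangle A B C P) :
    P ∉ segment ℝ A B := by
  obtain ⟨a, b, c, ha, hb, hc, h1, rfl⟩ := hP
  intro hm
  obtain ⟨t, -, -, e⟩ := mem_segment_iff.1 hm
  have := barycentric_unique h h1 (a' := 1 - t) (b' := t) (c' := 0) (by ring) (by rw [e]; simp)
  linarith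

theorem InTriangle.notMem_segment₂ (h : AffineIndependent ℝ ![A, B, C]) (hP : InTriangle A B C P) :
    P ∉ segment ℝ A C := by
  obtain ⟨a, b, c, ha, hb, hc, h1, rfl⟩ := hP
  intro hm
  obtain ⟨t, -, -, e⟩ := mem_segment_iff.1 hm
  have := barycentric_unique h h1 (a' := 1 - t) (b' := 0) (c' := t) (by ring) (by rw [e]; simp)
  linarith

theorem InTriangle.notMem_segment₃ (h : AffineIndependent ℝ ![A, B, C]) (hP : InTriangle A B C P) :
    P ∉ segment ℝ C B := by
  obtain ⟨a, b, c, ha, hb, hc, h1, rfl⟩ := hP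
  intro hm
  obtain ⟨t, -, -, e⟩ := mem_segment_iff.1 hm
  have := barycentric_unique h h1 (a' := 0) (b' := t) (c' := 1 - t) (by ring)
    (by rw [e]; simp [add_comm])
  linarith

theorem AffineIndependent.ne₁ (h : AffineIndependent ℝ ![A, B, C]) : A ≠ B := by
  rintro rfl
  simpa using affineIndependent_triple_iff.1 h 1 0 (by simp)

theorem AffineIndependent.ne₂ (h : AffineIndependent ℝ ![A, B, C]) : A ≠ C := by
  rintro rfl
  simpa using affineIndependent_triple_iff.1 h 0 1 (by simp)

theorem AffineIndependent.ne₃ (h : AffineIndependent ℝ ![A, B, C]) : C ≠ B := by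
  rintro rfl
  simpa using affineIndependent_triple_iff.1 h 1 (-1) (by simp)

theorem AffineIndependent.disjoint_edges (h : AffineIndependent ℝ ![A, B, C]) :
    Disjoint (halfOpenEdge (A, C)) (halfOpenEdge (C, B)) := by
  rw [Set.disjoint_left]
  intro P h1 h2
  obtain ⟨t, -, ht, rfl⟩ := mem_halfOpenEdge.1 h1
  obtain ⟨u, -, hu, e⟩ := mem_halfOpenEdge.1 h2
  have := barycentric_unique h (a := 1 - t) (b := 0) (c := t) (a' := 0) (b' := u) (c' := 1 - u)
    (by ring) (by ring) (by simp [e, add_comm])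
  linarith

theorem AffineIndependent.left_notMem (h : AffineIndependent ℝ ![A, B, C]) :
    A ∉ segment ℝ C B := by
  intro hm
  obtain ⟨t, -, -, e⟩ := mem_segment_iff.1 hm
  have := barycentric_unique h (a := 1) (b := 0) (c := 0) (a' := 0) (b' := t) (c' := 1 - t)
    (by ring) (by ring) (by simpa [add_comm] using e)
  linarith

theorem AffineIndependent.mid_notMem (h : AffineIndependent ℝ ![A, B, C]) :
    B ∉ segment ℝ A C := by
  intro hm
  obtain ⟨t, -, -, e⟩ := mem_segment_iff.1 hm
  have := barycentric_unique h (a := 0) (b := 1) (c := 0) (a' := 1 - t) (b' := 0) (c' := t)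
    (by ring) (by ring) (by simp [← e])
  linarith

end Triangles

section Steps

/-- The interior points of the triangle `ABC` on the path from `B` through `l` to `A`. -/
abbrev piercings (A B C : Space) (l : List Space) : Set Space :=
  {P | InTriangle A B C P ∧ P ∈ pathSupport (B :: (l ++ [A]))}

/-- The triangle `ABC` meets the path from `B` through `l` to `A` in `A`, `B` and finitely many
points inside the triangle, where the path crosses it. -/
structure Pierced (A B C : Space) (l : List Space) : Prop where
  ne_nil : l ≠ []
  indep : AffineIndependent ℝ ![A, B, C]
  simple : PathSimple (B :: (l ++ [A]))
  notMem : A ∉ halfPath (B :: (l ++ [A]))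
  inter : ∀ P ∈ convexHull ℝ {A, B, C}, P ∈ pathSupport (B :: (l ++ [A])) → P = A ∨ P = B ∨
    (InTriangle A B C P ∧ ∃ e ∈ pathEdges (B :: (l ++ [A])), P ∈ openSegment ℝ e.1 e.2)
  finite : (piercings A B C l).Finite

variable {A B C : Space} {l : List Space}

theorem Pierced.isPolygon (h : Pierced A B C l) : IsPolygon (A :: B :: l) := by
  refine isPolygon_cons_iff.2 ⟨h.ne_nil, h.simple, Set.disjoint_left.2 fun P hP hP' => ?_⟩
  have hs := halfOpenEdge_subset _ _ hP
  rcases h.inter P (segment_subset_triangle left_mem_triangle mid_mem_triangle hs)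
    (halfPath_subset _ hP') with rfl | rfl | h3
  · exact h.notMem hP'
  · exact right_notMem_halfOpenEdge (AffineIndependent.ne₁ h.indep) hP
  · exact h3.1.notMem_segment₁ h.indep hs

theorem Pierced.isPolygon_insert (h : Pierced A B C l) : IsPolygon (A :: C :: B :: l) := by
  refine isPolygon_insert_iff.2 ⟨h.simple, AffineIndependent.disjoint_edges h.indep,
    disjoint_union_left.2 ⟨Set.disjoint_left.2 fun P hP hP' => ?_,
    Set.disjoint_left.2 fun P hP hP' => ?_⟩⟩
  · have hs := halfOpenEdge_subset _ _ hP
    rcases h.inter P (segment_subset_triangle left_mem_triangle right_mem_triangle hs)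
      (halfPath_subset _ hP') with rfl | rfl | h3
    · exact h.notMem hP'
    · exact AffineIndependent.mid_notMem h.indep hs
    · exact h3.1.notMem_segment₂ h.indep hs
  · have hs := halfOpenEdge_subset _ _ hP
    rcases h.inter P (segment_subset_triangle right_mem_triangle mid_mem_triangle hs)
      (halfPath_subset _ hP') with rfl | rfl | h3
    · exact h.notMem hP'
    · exact right_notMem_halfOpenEdge (AffineIndependent.ne₃ h.indep) hP
    · exact h3.1.notMem_segment₃ h.indep hs

theorem Pierced.inter_support (h : Pierced A B C l) :
    convexHull ℝ {A, B, C} ∩ polygonSupport (A :: B :: l) =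
      segment ℝ A B ∪ piercings A B C l := by
  rw [polygonSupport_cons_cons]
  apply Subset.antisymm
  · rintro P ⟨hT, hP | hP⟩
    · exact Or.inl hP
    · rcases h.inter P hT hP with rfl | rfl | h3
      · exact Or.inl (left_mem_segment ℝ _ _)
      · exact Or.inl (right_mem_segment ℝ _ _)
      · exact Or.inr ⟨h3.1, hP⟩
  · rintro P (hP | hP)
    · exact ⟨segment_subset_triangle left_mem_triangle mid_mem_triangle hP, Or.inl hP⟩
    · exact ⟨hP.1.mem, Or.inr hP.2⟩

theorem Pierced.triangleMove (h : Pierced A B C l)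
    (h0 : piercings A B C l = ∅) :
    TriangleMove (knotOf _ h.isPolygon) (knotOf _ h.isPolygon_insert) := by
  refine ⟨A, B, C, ⟨l, .refl _, .refl _⟩, ?_⟩
  have := h.inter_support
  rwa [h0, union_empty] at this

theorem Pierced.crossingChange (h : Pierced A B C l) {P : Space}
    (h0 : piercings A B C l = {P}) :
    CrossingChange (knotOf _ h.isPolygon) (knotOf _ h.isPolygon_insert) := by
  have hP : InTriangle A B C P ∧ P ∈ pathSupport (B :: (l ++ [A])) := by
    have : P ∈ ({P} : Set Space) := rfl
    rwa [← h0] at this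
  refine ⟨A, B, C, P, ⟨l, .refl _, .refl _⟩, h.indep, ?_, hP.1, ?_⟩
  · have := h.inter_support
    rwa [h0] at this
  · rcases h.inter P hP.1.mem hP.2 with rfl | rfl | h3
    · exact absurd (left_mem_segment ℝ _ _) (hP.1.notMem_segment₁ h.indep)
    · exact absurd (right_mem_segment ℝ _ _) (hP.1.notMem_segment₁ h.indep)
    · obtain ⟨e, he, hPe⟩ := h3.2
      refine ⟨e, ?_, hPe⟩
      change e ∈ polygonEdges (A :: B :: l)
      rw [polygonEdges_cons]
      exact List.mem_cons_of_mem _ he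

/-- A polygon with vertices in `G` whatever path inside the triangle replaces the edge `AB`. -/
def StaysIn (G : Set KnotType) (A B C : Space) (l : List Space) : Prop :=
  ∀ q : List Space, (∀ x ∈ q, x ∈ convexHull ℝ {A, B, C}) →
    ∀ h : IsPolygon (A :: (q ++ B :: l)), (knotOf _ h).knotType ∈ G

theorem exists_between_avoiding {s t : ℝ} (h : s < t) {F : Set ℝ} (hF : F.Finite) :
    ∃ u, s < u ∧ u < t ∧ u ∉ F := by
  obtain ⟨u, hu, hu'⟩ := ((Ioo_infinite h).sdiff hF).nonempty
  exact ⟨u, hu.1, hu.2, hu'⟩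

theorem Pierced.split_left (h : Pierced A B C l) {t : ℝ} (h0 : 0 < t) (h1 : t < 1)
    (ht : ∀ a b c : ℝ, 0 < a → 0 < b → 0 < c → a + b + c = 1 →
      a • A + b • B + c • C ∈ pathSupport (B :: (l ++ [A])) → c ≠ t * (b + c)) :
    Pierced A B ((1 - t) • B + t • C) l ∧ Pierced A ((1 - t) • B + t • C) C (B :: l) ∧
      (∀ R ∈ piercings A B ((1 - t) • B + t • C) l, R ∈ piercings A B C l ∧ ∀ a b c : ℝ,
        a + b + c = 1 → R = a • A + b • B + c • C → c < t * (b + c)) ∧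
      ∀ R ∈ piercings A ((1 - t) • B + t • C) C (B :: l), R ∈ piercings A B C l ∧ ∀ a b c : ℝ,
        a + b + c = 1 → R = a • A + b • B + c • C → t * (b + c) < c := by
  set D := (1 - t) • B + t • C with hD
  have h1t : 0 < 1 - t := by linarith
  have hDT : D ∈ convexHull ℝ {A, B, C} :=
    segment_subset_triangle mid_mem_triangle right_mem_triangle
      (mem_segment_iff.2 ⟨t, h0.le, h1.le, rfl⟩)
  have hi := affineIndependent_triple_iff.1 h.indep
  have hin : ∀ P, InTriangle A B C P → P ∈ pathSupport (B :: (l ++ [A])) → ∃ a b c : ℝ, 0 < a ∧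
      0 < b ∧ 0 < c ∧ a + b + c = 1 ∧ P = a • A + b • B + c • C ∧ c ≠ t * (b + c) := by
    rintro P ⟨a, b, c, ha, hb, hc, hs, rfl⟩ hP
    exact ⟨a, b, c, ha, hb, hc, hs, rfl, ht a b c ha hb hc hs hP⟩
  have hDB : segment ℝ D B ⊆ convexHull ℝ {A, B, C} := segment_subset_triangle hDT mid_mem_triangle
  have hDB' : segment ℝ D B ⊆ segment ℝ C B := (convex_segment _ _).segment_subset
    (segment_symm ℝ B C ▸ mem_segment_iff.2 ⟨t, h0.le, h1.le, rfl⟩) (right_mem_segment ℝ _ _)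
  have hDneB : D ≠ B := by
    intro e
    have : t • (C - B) = 0 := by rw [← sub_eq_zero] at e; rw [← e, hD]; module
    rcases smul_eq_zero.1 this with h2 | h2
    · exact h0.ne' h2
    · exact AffineIndependent.ne₃ h.indep (sub_eq_zero.1 h2)
  have s1 : ∀ R ∈ piercings A B D l, R ∈ piercings A B C l ∧ ∀ a b c : ℝ,
      a + b + c = 1 → R = a • A + b • B + c • C → c < t * (b + c) := by
    rintro R ⟨⟨x, y, z, hx, hy, hz, hxyz, rfl⟩, hR⟩
    refine ⟨⟨⟨x, y + z * (1 - t), z * t, hx, by positivity, by positivity, by linarith,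
      by rw [hD]; module⟩, hR⟩, fun a b c hs e => ?_⟩
    obtain ⟨rfl, rfl, rfl⟩ := barycentric_unique h.indep hs (a' := x) (b' := y + z * (1 - t))
      (c' := z * t) (by linarith) (by rw [← e, hD]; module)
    nlinarith
  have s2 : ∀ R ∈ piercings A D C (B :: l), R ∈ piercings A B C l ∧ ∀ a b c : ℝ,
      a + b + c = 1 → R = a • A + b • B + c • C → t * (b + c) < c := by
    rintro R ⟨⟨x, y, z, hx, hy, hz, hxyz, rfl⟩, hR⟩
    have h2 : InTriangle A B C (x • A + y • D + z • C) := ⟨x, y * (1 - t), z + y * t, hx,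
      by positivity, by positivity, by linarith, by rw [hD]; module⟩
    refine ⟨⟨h2, ?_⟩, fun a b c hs e => ?_⟩
    · rw [List.cons_append, pathSupport_cons_cons] at hR
      exact hR.resolve_left fun h3 => h2.notMem_segment₃ h.indep (hDB' h3)
    · obtain ⟨rfl, rfl, rfl⟩ := barycentric_unique h.indep hs (a' := x) (b' := y * (1 - t))
        (c' := z + y * t) (by linarith) (by rw [← e, hD]; module)
      nlinarith
  refine ⟨?_, ?_, s1, s2⟩
  · refine ⟨h.ne_nil, affineIndependent_triple_iff.2 fun x y hxy => ?_, h.simple, h.notMem,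
      fun P hP hP' => ?_, h.finite.subset fun P hP => (s1 P hP).1⟩
    · have := hi (x + y * (1 - t)) (y * t) (by rw [← hxy, hD]; module)
      have hy : y = 0 := by simpa [h0.ne'] using this.2
      subst hy
      simpa using this.1
    · rcases h.inter P (triangle_mono left_mem_triangle mid_mem_triangle hDT hP) hP' with
        h2 | h2 | ⟨h2, h3⟩
      · exact Or.inl h2
      · exact Or.inr (Or.inl h2)
      · refine Or.inr (Or.inr ⟨?_, h3⟩)
        obtain ⟨a, b, c, ha, hb, hc, hs, e, hne⟩ := hin P h2 hP'
        obtain ⟨α, β, γ, hα, hβ, hγ, hs', e'⟩ := mem_triangle_iff.1 hP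
        obtain ⟨rfl, rfl, rfl⟩ := barycentric_unique h.indep hs (a' := α) (b' := β + γ * (1 - t))
          (c' := γ * t) (by linarith) (by rw [← e, e', hD]; module)
        refine ⟨_, β, γ, ha, hβ.lt_of_ne ?_, hγ.lt_of_ne ?_, hs', e'⟩
        · rintro rfl; apply hne; ring
        · rintro rfl; simp at hc
  · have hA : A ∉ halfPath (D :: (B :: l ++ [A])) := by
      rw [List.cons_append, halfPath_cons_cons]
      rintro (h2 | h2)
      · exact AffineIndependent.left_notMem h.indep (hDB' (halfOpenEdge_subset _ _ h2))
      · exact h.notMem h2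
    refine ⟨by simp, affineIndependent_triple_iff.2 fun x y hxy => ?_, ?_, hA,
      fun P hP hP' => ?_, h.finite.subset fun P hP => (s2 P hP).1⟩
    · have := hi (x * (1 - t)) (y + x * t) (by rw [← hxy, hD]; module)
      have hx : x = 0 := by simpa [h1t.ne'] using this.1
      subst hx
      simpa using this.2
    · rw [List.cons_append, pathSimple_cons_cons]
      refine ⟨h.simple, Set.disjoint_left.2 fun P hP hP' => ?_⟩
      have hs := halfOpenEdge_subset _ _ hP
      rcases h.inter P (hDB hs) (halfPath_subset _ hP') with rfl | rfl | h3
      · exact h.notMem hP'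
      · exact right_notMem_halfOpenEdge hDneB hP
      · exact h3.1.notMem_segment₃ h.indep (hDB' hs)
    · rw [List.cons_append, pathSupport_cons_cons] at hP'
      obtain ⟨α, β, γ, hα, hβ, hγ, hs', e'⟩ := mem_triangle_iff.1 hP
      have e2 : P = α • A + (β * (1 - t)) • B + (γ + β * t) • C := by rw [e', hD]; module
      rcases hP' with hP' | hP'
      · right; left
        obtain ⟨s, hs0, hs1, e⟩ := mem_segment_iff.1 hP'
        have e3 : P = (0 : ℝ) • A + ((1 - s) * (1 - t) + s) • B + ((1 - s) * t) • C := by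
          rw [e, hD]; module
        have := barycentric_unique h.indep (by linarith) (by ring) (e2.symm.trans e3)
        have : s = 0 := by nlinarith
        subst this
        rw [e]; module
      · rcases h.inter P (triangle_mono left_mem_triangle hDT right_mem_triangle hP) hP' with
          h2 | h2 | ⟨h2, h3⟩
        · exact Or.inl h2
        · exfalso
          have := barycentric_unique h.indep (a := 0) (b := 1) (c := 0) (by linarith)
            (by linarith) ((by simp [h2] : _ = P).trans e2)
          nlinarith
        · refine Or.inr (Or.inr ⟨?_, ?_⟩)
          · obtain ⟨a, b, c, ha, hb, hc, hs, e, hne⟩ := hin P h2 hP'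
            obtain ⟨rfl, rfl, rfl⟩ := barycentric_unique h.indep hs (by linarith) (e.symm.trans e2)
            refine ⟨_, β, γ, ha, hβ.lt_of_ne ?_, hγ.lt_of_ne ?_, hs', e'⟩
            · rintro rfl; simp at hb
            · rintro rfl; apply hne; ring
          · obtain ⟨e, he, hPe⟩ := h3
            exact ⟨e, by rw [List.cons_append, pathEdges_cons_cons]; exact List.mem_cons_of_mem _ he,
              hPe⟩

theorem Pierced.split_right (h : Pierced A B C l) {t : ℝ} (h0 : 0 < t) (h1 : t < 1)
    (ht : ∀ a b c : ℝ, 0 < a → 0 < b → 0 < c → a + b + c = 1 →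
      a • A + b • B + c • C ∈ pathSupport (B :: (l ++ [A])) → c ≠ t * (a + c)) :
    Pierced A B ((1 - t) • A + t • C) l ∧ Pierced ((1 - t) • A + t • C) B C (l ++ [A]) ∧
      (∀ R ∈ piercings A B ((1 - t) • A + t • C) l, R ∈ piercings A B C l ∧ ∀ a b c : ℝ,
        a + b + c = 1 → R = a • A + b • B + c • C → c < t * (a + c)) ∧
      ∀ R ∈ piercings ((1 - t) • A + t • C) B C (l ++ [A]), R ∈ piercings A B C l ∧ ∀ a b c : ℝ,
        a + b + c = 1 → R = a • A + b • B + c • C → t * (a + c) < c := by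
  set D := (1 - t) • A + t • C with hD
  have h1t : 0 < 1 - t := by linarith
  have hDT : D ∈ convexHull ℝ {A, B, C} :=
    segment_subset_triangle left_mem_triangle right_mem_triangle
      (mem_segment_iff.2 ⟨t, h0.le, h1.le, rfl⟩)
  have hi := affineIndependent_triple_iff.1 h.indep
  have hin : ∀ P, InTriangle A B C P → P ∈ pathSupport (B :: (l ++ [A])) → ∃ a b c : ℝ, 0 < a ∧
      0 < b ∧ 0 < c ∧ a + b + c = 1 ∧ P = a • A + b • B + c • C ∧ c ≠ t * (a + c) := by
    rintro P ⟨a, b, c, ha, hb, hc, hs, rfl⟩ hP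
    exact ⟨a, b, c, ha, hb, hc, hs, rfl, ht a b c ha hb hc hs hP⟩
  have hAD : segment ℝ A D ⊆ convexHull ℝ {A, B, C} := segment_subset_triangle left_mem_triangle hDT
  have hAD' : segment ℝ A D ⊆ segment ℝ A C := (convex_segment _ _).segment_subset
    (left_mem_segment ℝ _ _) (mem_segment_iff.2 ⟨t, h0.le, h1.le, rfl⟩)
  have hDneA : A ≠ D := by
    intro e
    have : t • (C - A) = 0 := by rw [← sub_eq_zero] at e; rw [← neg_eq_zero, ← e, hD]; module
    rcases smul_eq_zero.1 this with h2 | h2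
    · exact h0.ne' h2
    · exact AffineIndependent.ne₂ h.indep (sub_eq_zero.1 h2).symm
  have hsup : ∀ P, P ∈ pathSupport (B :: ((l ++ [A]) ++ [D])) ↔
      P ∈ pathSupport (B :: (l ++ [A])) ∨ P ∈ segment ℝ A D := by
    intro P
    have e : B :: ((l ++ [A]) ++ [D]) = (B :: l) ++ A :: [D] := by simp
    rw [e, pathSupport_append]
    simp
  have s1 : ∀ R ∈ piercings A B D l, R ∈ piercings A B C l ∧ ∀ a b c : ℝ,
      a + b + c = 1 → R = a • A + b • B + c • C → c < t * (a + c) := by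
    rintro R ⟨⟨x, y, z, hx, hy, hz, hxyz, rfl⟩, hR⟩
    refine ⟨⟨⟨x + z * (1 - t), y, z * t, by positivity, hy, by positivity, by linarith,
      by rw [hD]; module⟩, hR⟩, fun a b c hs e => ?_⟩
    obtain ⟨rfl, rfl, rfl⟩ := barycentric_unique h.indep hs (a' := x + z * (1 - t)) (b' := y)
      (c' := z * t) (by linarith) (by rw [← e, hD]; module)
    nlinarith
  have s2 : ∀ R ∈ piercings D B C (l ++ [A]), R ∈ piercings A B C l ∧ ∀ a b c : ℝ,
      a + b + c = 1 → R = a • A + b • B + c • C → t * (a + c) < c := by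
    rintro R ⟨⟨x, y, z, hx, hy, hz, hxyz, rfl⟩, hR⟩
    have h2 : InTriangle A B C (x • D + y • B + z • C) := ⟨x * (1 - t), y, z + x * t,
      by positivity, hy, by positivity, by linarith, by rw [hD]; module⟩
    refine ⟨⟨h2, ((hsup _).1 hR).resolve_right fun h3 => h2.notMem_segment₂ h.indep (hAD' h3)⟩,
      fun a b c hs e => ?_⟩
    obtain ⟨rfl, rfl, rfl⟩ := barycentric_unique h.indep hs (a' := x * (1 - t)) (b' := y)
      (c' := z + x * t) (by linarith) (by rw [← e, hD]; module)
    nlinarith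
  refine ⟨?_, ?_, s1, s2⟩
  · refine ⟨h.ne_nil, affineIndependent_triple_iff.2 fun x y hxy => ?_, h.simple, h.notMem,
      fun P hP hP' => ?_, h.finite.subset fun P hP => (s1 P hP).1⟩
    · have := hi x (y * t) (by rw [← hxy, hD]; module)
      exact ⟨this.1, by simpa [h0.ne'] using this.2⟩
    · rcases h.inter P (triangle_mono left_mem_triangle mid_mem_triangle hDT hP) hP' with
        h2 | h2 | ⟨h2, h3⟩
      · exact Or.inl h2
      · exact Or.inr (Or.inl h2)
      · refine Or.inr (Or.inr ⟨?_, h3⟩)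
        obtain ⟨a, b, c, ha, hb, hc, hs, e, hne⟩ := hin P h2 hP'
        obtain ⟨α, β, γ, hα, hβ, hγ, hs', e'⟩ := mem_triangle_iff.1 hP
        obtain ⟨rfl, rfl, rfl⟩ := barycentric_unique h.indep hs (a' := α + γ * (1 - t)) (b' := β)
          (c' := γ * t) (by linarith) (by rw [← e, e', hD]; module)
        refine ⟨α, _, γ, hα.lt_of_ne ?_, hb, hγ.lt_of_ne ?_, hs', e'⟩
        · rintro rfl; apply hne; ring
        · rintro rfl; simp at hc
  · have hpath : B :: ((l ++ [A]) ++ [D]) = (B :: l) ++ A :: [D] := by simp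
    refine ⟨by simp, affineIndependent_triple_iff.2 fun x y hxy => ?_, ?_, ?_,
      fun P hP hP' => ?_, h.finite.subset fun P hP => (s2 P hP).1⟩
    · have := hi x (y - (x + y) * t) (by rw [← hxy, hD]; module)
      obtain ⟨rfl, h2⟩ := this
      have : y * (1 - t) = 0 := by linarith
      exact ⟨rfl, by simpa [h1t.ne'] using this⟩
    · rw [hpath, pathSimple_append]
      refine ⟨h.simple, by simp [PathSimple], Set.disjoint_left.2 fun P hP hP' => ?_⟩
      simp only [halfPath_cons_cons, halfPath_singleton, union_empty] at hP'
      have hs := halfOpenEdge_subset _ _ hP'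
      rcases h.inter P (hAD hs) (halfPath_subset _ hP) with rfl | rfl | h3
      · exact h.notMem hP
      · exact AffineIndependent.mid_notMem h.indep (hAD' hs)
      · exact h3.1.notMem_segment₂ h.indep (hAD' hs)
    · rw [hpath, halfPath_append]
      simp only [halfPath_cons_cons, halfPath_singleton, union_empty]
      rintro (hP | hP)
      · have hs := right_mem_segment ℝ A D
        rcases h.inter D hDT (halfPath_subset _ hP) with h3 | h3 | h3
        · exact hDneA h3.symm
        · exact AffineIndependent.mid_notMem h.indep (h3 ▸ hAD' hs)
        · exact h3.1.notMem_segment₂ h.indep (hAD' hs)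
      · exact right_notMem_halfOpenEdge hDneA hP
    · obtain ⟨α, β, γ, hα, hβ, hγ, hs', e'⟩ := mem_triangle_iff.1 hP
      have e2 : P = (α * (1 - t)) • A + β • B + (γ + α * t) • C := by rw [e', hD]; module
      rcases (hsup P).1 hP' with hP' | hP'
      · rcases h.inter P (triangle_mono hDT mid_mem_triangle right_mem_triangle hP) hP' with
          h2 | h2 | ⟨h2, h3⟩
        · exfalso
          have := barycentric_unique h.indep (a := 1) (b := 0) (c := 0) (by linarith)
            (by linarith) ((by simp [h2] : _ = P).trans e2)
          nlinarith
        · exact Or.inr (Or.inl h2)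
        · refine Or.inr (Or.inr ⟨?_, ?_⟩)
          · obtain ⟨a, b, c, ha, hb, hc, hs, e, hne⟩ := hin P h2 hP'
            obtain ⟨rfl, rfl, rfl⟩ := barycentric_unique h.indep hs (by linarith) (e.symm.trans e2)
            refine ⟨α, _, γ, hα.lt_of_ne ?_, hb, hγ.lt_of_ne ?_, hs', e'⟩
            · rintro rfl; simp at ha
            · rintro rfl; apply hne; ring
          · obtain ⟨e, he, hPe⟩ := h3
            refine ⟨e, ?_, hPe⟩
            rw [hpath, pathEdges_append]
            exact List.mem_append_left _ he
      · left
        obtain ⟨s, hs0, hs1, e⟩ := mem_segment_iff.1 hP'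
        have e3 : P = ((1 - s) + s * (1 - t)) • A + (0 : ℝ) • B + (s * t) • C := by
          rw [e, hD]; module
        have := barycentric_unique h.indep (by linarith) (by ring) (e2.symm.trans e3)
        have : s = 1 := by nlinarith
        subst this
        rw [e]; module

end Steps

section Linking
variable {A B C : Space} {l : List Space}

theorem knotType_subdivide {A B C : Space} {l k k' : List Space} (hC : C ∈ openSegment ℝ A B)
    (hk : k ~r (A :: B :: l)) (hk' : k' ~r (A :: C :: B :: l)) (h : IsPolygon k)
    (h' : IsPolygon k') : (knotOf k h).knotType = (knotOf k' h').knotType :=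
  knotType_eq_of_triangleMove (triangleMove_subdivide (K := knotOf k h) (K' := knotOf k' h')
    hk hk' hC)

theorem knotType_rotate {k k' : List Space} (hk : k ~r k') (h : IsPolygon k) (h' : IsPolygon k') :
    (knotOf k h).knotType = (knotOf k' h').knotType :=
  knotType_eq_of_isRotated (K := knotOf k h) (K' := knotOf k' h') hk

theorem ncard_le_of_notMem {α : Type*} {s t : Set α} {n : ℕ} {x : α} (ht : t.Finite)
    (hn : t.ncard ≤ n + 1) (hx : x ∈ t) (h : s ⊆ t) (hx' : x ∉ s) : s.ncard ≤ n :=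
  Nat.lt_succ_iff.1 (lt_of_lt_of_le (ncard_lt_ncard ⟨h, fun h' => hx' (h' hx)⟩ ht) hn)

theorem Pierced.linked_of_card (G : Set KnotType) (n : ℕ) : ∀ {A B C : Space} {l : List Space}
    (h : Pierced A B C l) (_ : (piercings A B C l).ncard ≤ n)
    (_ : StaysIn G A B C l),
    Linked G (knotOf _ h.isPolygon).knotType (knotOf _ h.isPolygon_insert).knotType := by
  induction n with
  | zero =>
    intro A B C l h hn hG
    have h0 := (ncard_eq_zero h.finite).1 (Nat.le_zero.1 hn)
    rw [knotType_eq_of_triangleMove (h.triangleMove h0)]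
    exact .refl (hG [C] (by simpa using right_mem_triangle) h.isPolygon_insert)
  | succ n ih =>
    intro A B C l h hn hG
    have hG0 := hG [] (by simp) h.isPolygon
    have hG1 := hG [C] (by simpa using right_mem_triangle) h.isPolygon_insert
    rcases Nat.lt_or_ge 1 (piercings A B C l).ncard
      with h2 | h2
    swap
    · rcases Nat.le_one_iff_eq_zero_or_eq_one.1 h2 with h2 | h2
      · rw [knotType_eq_of_triangleMove (h.triangleMove ((ncard_eq_zero h.finite).1 h2))]
        exact .refl hG1
      · obtain ⟨P, hP⟩ := ncard_eq_one.1 h2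
        exact .of_crossingChange (h.crossingChange hP) hG0 hG1
    have hco : ∀ R, R ∈ piercings A B C l →
      ∃ a b c : ℝ, 0 < a ∧ 0 < b ∧ 0 < c ∧ a + b + c = 1 ∧ R = a • A + b • B + c • C :=
      fun R hR => hR.1
    choose! a b c ha hb hc hs he using hco
    have hfin : ∀ τ : Space → ℝ,
        (τ '' piercings A B C l).Finite :=
      fun τ => h.finite.image τ
    have huniq : ∀ {x y z : ℝ}, 0 < x → 0 < y → 0 < z → x + y + z = 1 →
        x • A + y • B + z • C ∈ pathSupport (B :: (l ++ [A])) → ∃ R,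
          R ∈ piercings A B C l ∧ x = a R ∧ y = b R ∧
          z = c R := by
      intro x y z hx hy hz hxyz hR
      have hR' : (x • A + y • B + z • C) ∈
        piercings A B C l :=
          ⟨⟨x, y, z, hx, hy, hz, hxyz, rfl⟩, hR⟩
      exact ⟨_, hR', barycentric_unique h.indep hxyz (hs _ hR') (he _ hR')⟩
    obtain ⟨P, Q, hP, hQ, hd⟩ : ∃ P Q, P ∈ piercings A B C l ∧ Q ∈ piercings A B C l ∧
        (c P / (b P + c P) < c Q / (b Q + c Q) ∨ c P / (a P + c P) < c Q / (a Q + c Q)) := by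
      obtain ⟨P, Q, hP, hQ, hPQ⟩ := (one_lt_ncard_iff h.finite).1 h2
      by_contra! hcon
      have e1 := (hcon Q P hQ hP).1.antisymm (hcon P Q hP hQ).1
      have e2 := (hcon Q P hQ hP).2.antisymm (hcon P Q hP hQ).2
      have p1 := ha P hP; have p2 := hb P hP; have p3 := hc P hP
      have q1 := ha Q hQ; have q2 := hb Q hQ; have q3 := hc Q hQ
      rw [div_eq_div_iff (by positivity) (by positivity)] at e1 e2
      have s1 := hs P hP
      have s2 := hs Q hQ
      have e3 : c P = c Q := by
        have : c P * (a Q + b Q + c Q) = c Q * (a P + b P + c P) := by linarith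
        rw [s1, s2] at this; linarith
      rw [e3] at e1 e2
      have e4 : b Q = b P := by
        have := mul_left_cancel₀ q3.ne' (by linarith : c Q * b Q = c Q * b P); exact this
      have e5 : a Q = a P := by
        have := mul_left_cancel₀ q3.ne' (by linarith : c Q * a Q = c Q * a P); exact this
      exact hPQ (by rw [he P hP, he Q hQ, e3, e4, e5])
    rcases hd with hd | hd
    · obtain ⟨t, htP, htQ, htF⟩ := exists_between_avoiding hd (hfin fun R => c R / (b R + c R))
      have p2 := hb P hP; have p3 := hc P hP; have q2 := hb Q hQ; have q3 := hc Q hQ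
      have h0 : 0 < t := lt_trans (by positivity) htP
      have h1 : t < 1 := htQ.trans ((div_lt_one (by positivity)).2 (by linarith))
      have h1t : 0 < 1 - t := by linarith
      obtain ⟨hl, hr, s1, s2⟩ := h.split_left h0 h1 (by
        intro x y z hx hy hz hxyz hR e
        obtain ⟨R, hRF, rfl, rfl, rfl⟩ := huniq hx hy hz hxyz hR
        have r1 := ha R hRF; have r2 := hb R hRF; have r3 := hc R hRF
        exact htF ⟨R, hRF, by change _ / _ = t; rw [div_eq_iff (by positivity)]; exact e⟩)
      set D := (1 - t) • B + t • C with hD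
      have hDT : D ∈ convexHull ℝ {A, B, C} :=
        segment_subset_triangle mid_mem_triangle right_mem_triangle
          (mem_segment_iff.2 ⟨t, h0.le, h1.le, rfl⟩)
      have L1 := ih hl (ncard_le_of_notMem h.finite hn hQ (fun R hR => (s1 R hR).1) (fun hcon => by
          have := (s1 Q hcon).2 _ _ _ (hs Q hQ) (he Q hQ)
          rw [lt_div_iff₀ (by positivity)] at htQ
          linarith))
        (fun q hq hp => hG q (fun x hx => triangle_mono left_mem_triangle mid_mem_triangle hDT
          (hq x hx)) hp)
      have L2 := ih hr (ncard_le_of_notMem h.finite hn hP (fun R hR => (s2 R hR).1) (fun hcon => by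
          have := (s2 P hcon).2 _ _ _ (hs P hP) (he P hP)
          rw [div_lt_iff₀ (by positivity)] at htP
          linarith))
        (fun q hq hp => by
          have e : A :: (q ++ D :: B :: l) = A :: ((q ++ [D]) ++ B :: l) := by simp
          have hp' := hp
          rw [e] at hp'
          have := hG (q ++ [D]) (fun x hx => by
            rcases List.mem_append.1 hx with hx | hx
            · exact triangle_mono left_mem_triangle hDT right_mem_triangle (hq x hx)
            · rw [List.mem_singleton.1 hx]; exact hDT) hp'
          rwa [knotType_rotate (e ▸ .refl _) hp hp'])
      have e := knotType_subdivide (A := C) (B := B) (C := D) (l := l ++ [A])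
        (openSegment_symm ℝ B C ▸ mem_openSegment_iff.2 ⟨t, h0, h1, rfl⟩)
        (k := A :: C :: B :: l) (k' := A :: C :: D :: B :: l) ⟨1, by simp⟩ ⟨1, by simp⟩
        h.isPolygon_insert hr.isPolygon_insert
      rw [e]
      exact L1.trans L2
    · obtain ⟨t, htP, htQ, htF⟩ := exists_between_avoiding hd (hfin fun R => c R / (a R + c R))
      have p2 := ha P hP; have p3 := hc P hP; have q2 := ha Q hQ; have q3 := hc Q hQ
      have h0 : 0 < t := lt_trans (by positivity) htP
      have h1 : t < 1 := htQ.trans ((div_lt_one (by positivity)).2 (by linarith))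
      have h1t : 0 < 1 - t := by linarith
      obtain ⟨hl, hr, s1, s2⟩ := h.split_right h0 h1 (by
        intro x y z hx hy hz hxyz hR e
        obtain ⟨R, hRF, rfl, rfl, rfl⟩ := huniq hx hy hz hxyz hR
        have r1 := ha R hRF; have r2 := hb R hRF; have r3 := hc R hRF
        exact htF ⟨R, hRF, by change _ / _ = t; rw [div_eq_iff (by positivity)]; exact e⟩)
      set D := (1 - t) • A + t • C with hD
      have hDT : D ∈ convexHull ℝ {A, B, C} :=
        segment_subset_triangle left_mem_triangle right_mem_triangle
          (mem_segment_iff.2 ⟨t, h0.le, h1.le, rfl⟩)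
      have L1 := ih hl (ncard_le_of_notMem h.finite hn hQ (fun R hR => (s1 R hR).1) (fun hcon => by
          have := (s1 Q hcon).2 _ _ _ (hs Q hQ) (he Q hQ)
          rw [lt_div_iff₀ (by positivity)] at htQ
          linarith))
        (fun q hq hp => hG q (fun x hx => triangle_mono left_mem_triangle mid_mem_triangle hDT
          (hq x hx)) hp)
      have L2 := ih hr (ncard_le_of_notMem h.finite hn hP (fun R hR => (s2 R hR).1) (fun hcon => by
          have := (s2 P hcon).2 _ _ _ (hs P hP) (he P hP)
          rw [div_lt_iff₀ (by positivity)] at htP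
          linarith))
        (fun q hq hp => by
          have hr' : (D :: (q ++ B :: (l ++ [A]))) ~r (A :: ((D :: q) ++ B :: l)) :=
            List.IsRotated.symm ⟨1, by simp⟩
          rw [knotType_rotate hr' hp (hp.isRotated hr')]
          exact hG (D :: q) (fun x hx => by
            rcases List.mem_cons.1 hx with rfl | hx
            · exact hDT
            · exact triangle_mono hDT mid_mem_triangle right_mem_triangle (hq x hx)) _)
      have e1 := knotType_rotate (k := D :: B :: (l ++ [A])) (k' := A :: D :: B :: l)
        (List.IsRotated.symm ⟨1, by simp⟩) hr.isPolygon hl.isPolygon_insert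
      have e2 := knotType_subdivide (A := A) (B := C) (C := D) (l := B :: l)
        (mem_openSegment_iff.2 ⟨t, h0, h1, rfl⟩)
        (k := A :: C :: B :: l) (k' := D :: C :: B :: (l ++ [A])) (.refl _)
        (List.IsRotated.symm ⟨1, by simp⟩) h.isPolygon_insert hr.isPolygon_insert
      rw [e2]
      rw [e1] at L2
      exact L1.trans L2

/-- Pushing an edge across a triangle that the rest of the knot pierces finitely often is a
sequence of isotopies and crossing changes. -/
theorem Pierced.linked {G : Set KnotType} (h : Pierced A B C l) (hG : StaysIn G A B C l) :
    Linked G (knotOf _ h.isPolygon).knotType (knotOf _ h.isPolygon_insert).knotType :=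
  Pierced.linked_of_card G _ h le_rfl hG

end Linking

section Frames

theorem exists_frame {u v : Space} (h : ∀ x y : ℝ, x • u + y • v = 0 → x = 0 ∧ y = 0) :
    ∃ (w : Space) (L : Space ≃L[ℝ] Space), ∀ x, L x = x 0 • u + x 1 • v + x 2 • w := by
  set w := crossProduct u v with hw
  have hw0 : w ≠ 0 := by
    rw [hw, crossProduct_ne_zero_iff_linearIndependent, LinearIndependent.pair_iff]
    exact h
  set f : Space →ₗ[ℝ] Space :=
    (LinearMap.proj 0).smulRight u + (LinearMap.proj 1).smulRight v + (LinearMap.proj 2).smulRight w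
  have hf : ∀ x, f x = x 0 • u + x 1 • v + x 2 • w := fun x => by simp [f]
  have hinj : Function.Injective f := by
    rw [injective_iff_map_eq_zero]
    intro x hx
    rw [hf] at hx
    have h2 : x 2 * (w ⬝ᵥ w) = 0 := by
      have := congrArg (fun y => w ⬝ᵥ y) hx
      simp only [dotProduct_add, dotProduct_smul, dotProduct_zero, smul_eq_mul] at this
      rw [hw, dotProduct_comm _ u, dot_self_cross, dotProduct_comm _ v, dot_cross_self] at this
      simpa using this
    have h2' : x 2 = 0 := (mul_eq_zero.1 h2).resolve_right
      (fun h => hw0 (dotProduct_self_eq_zero.1 h))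
    rw [h2', zero_smul, add_zero] at hx
    obtain ⟨h0, h1⟩ := h _ _ hx
    ext i; fin_cases i <;> simp [h0, h1, h2']
  exact ⟨w, (LinearEquiv.ofInjectiveEndo f hinj).toContinuousLinearEquiv, hf⟩

/-- The affine homeomorphism `x ↦ M + L x`. -/
def affineHomeo (M : Space) (L : Space ≃L[ℝ] Space) : Space ≃ₜ Space :=
  L.toHomeomorph.trans (Homeomorph.addLeft M)

@[simp] theorem affineHomeo_apply (M : Space) (L : Space ≃L[ℝ] Space) (x : Space) :
    affineHomeo M L x = M + L x := rfl

end Frames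

section Tent

theorem max_min_inverse {f g f' g' : ℝ → ℝ} (hf : Monotone f') (hg : Monotone g')
    (h1 : ∀ y, f' (f y) = y) (h2 : ∀ y, g' (g y) = y) (y : ℝ) :
    max (f' (min (f y) (g y))) (g' (min (f y) (g y))) = y := by
  rcases le_total (f y) (g y) with h | h
  · rw [min_eq_left h, h1]
    exact max_eq_left ((hg h).trans (h2 y).le)
  · rw [min_eq_right h, h2]
    exact max_eq_right ((hf h).trans (h1 y).le)

theorem min_max_inverse {f g f' g' : ℝ → ℝ} (hf : Monotone f') (hg : Monotone g')
    (h1 : ∀ y, f' (f y) = y) (h2 : ∀ y, g' (g y) = y) (y : ℝ) :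
    min (f' (max (f y) (g y))) (g' (max (f y) (g y))) = y := by
  rcases le_total (f y) (g y) with h | h
  · rw [max_eq_right h, h2]
    exact min_eq_right ((h1 y).symm.le.trans (hf h))
  · rw [max_eq_left h, h1]
    exact min_eq_left ((h2 y).symm.le.trans (hg h))

/-- The height of the tent over the point `p`. -/
noncomputable def tentHeight (k : ℝ) (p : Space) : ℝ := 1 - |p 0| - k * |p 2|

noncomputable def tentUp (k : ℝ) (p : Space) : ℝ :=
  max (p 1) (min (tentHeight k p + p 1 / (k + 1)) (tentHeight k p + (k + 1) * p 1))

noncomputable def tentDown (k : ℝ) (p : Space) : ℝ :=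
  min (p 1) (max ((k + 1) * (p 1 - tentHeight k p)) ((p 1 - tentHeight k p) / (k + 1)))

theorem continuous_tentHeight (k : ℝ) : Continuous (tentHeight k) := by
  unfold tentHeight; fun_prop

/-- The homeomorphism of space that pushes the segment from `(-1, 0, 0)` to `(1, 0, 0)` to the
segments through `(0, 1, 0)`; it is supported near the triangle if `k` is large. -/
noncomputable def tentHomeo (k : ℝ) (hk : 0 < k) : Space ≃ₜ Space where
  toFun p := ![p 0, tentUp k p, p 2]
  invFun p := ![p 0, tentDown k p, p 2]
  left_inv p := by
    have hk1 : 0 < k + 1 := by linarith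
    have key : tentDown k ![p 0, tentUp k p, p 2] = p 1 := by
      have hh : tentHeight k ![p 0, tentUp k p, p 2] = tentHeight k p := rfl
      unfold tentDown
      rw [hh]
      set b := tentHeight k p
      have := fun y => max_min_inverse (f := fun y => b + y / (k + 1)) (g := fun y => b + (k + 1) * y)
        (f' := fun q => (k + 1) * (q - b)) (g' := fun q => (q - b) / (k + 1))
        (fun x y h => mul_le_mul_of_nonneg_left (by linarith) hk1.le)
        (fun x y h => div_le_div_of_nonneg_right (by linarith) hk1.le)
        (fun y => by field_simp; ring) (fun y => by field_simp; ring) y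
      refine min_max_inverse (f := fun y => y)
        (g := fun y => min (b + y / (k + 1)) (b + (k + 1) * y)) (f' := fun y => y)
        (g' := fun q => max ((k + 1) * (q - b)) ((q - b) / (k + 1))) monotone_id ?_ (fun _ => rfl)
        this (p 1)
      exact Monotone.max (fun x y h => mul_le_mul_of_nonneg_left (by linarith) hk1.le)
        (fun x y h => div_le_div_of_nonneg_right (by linarith) hk1.le)
    ext i; fin_cases i
    · rfl
    · exact key
    · rfl
  right_inv p := by
    have hk1 : 0 < k + 1 := by linarith
    have key : tentUp k ![p 0, tentDown k p, p 2] = p 1 := by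
      have hh : tentHeight k ![p 0, tentDown k p, p 2] = tentHeight k p := rfl
      unfold tentUp
      rw [hh]
      set b := tentHeight k p
      have := fun y => min_max_inverse (f' := fun y => b + y / (k + 1))
        (g' := fun y => b + (k + 1) * y)
        (f := fun q => (k + 1) * (q - b)) (g := fun q => (q - b) / (k + 1))
        (fun x y h => add_le_add le_rfl (div_le_div_of_nonneg_right h hk1.le))
        (fun x y h => add_le_add le_rfl (mul_le_mul_of_nonneg_left h hk1.le))
        (fun y => by field_simp; ring) (fun y => by field_simp; ring) y
      refine max_min_inverse (f' := fun y => y)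
        (g' := fun y => min (b + y / (k + 1)) (b + (k + 1) * y)) (f := fun y => y)
        (g := fun q => max ((k + 1) * (q - b)) ((q - b) / (k + 1))) monotone_id ?_ (fun _ => rfl)
        this (p 1)
      exact Monotone.min (fun x y h => add_le_add le_rfl (div_le_div_of_nonneg_right h hk1.le))
        (fun x y h => add_le_add le_rfl (mul_le_mul_of_nonneg_left h hk1.le))
    ext i; fin_cases i
    · rfl
    · exact key
    · rfl
  continuous_toFun := by
    have := continuous_tentHeight k
    refine continuous_pi fun i => ?_
    fin_cases i
    · exact continuous_apply 0
    · change Continuous (tentUp k); unfold tentUp; fun_prop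
    · exact continuous_apply 2
  continuous_invFun := by
    have := continuous_tentHeight k
    refine continuous_pi fun i => ?_
    fin_cases i
    · exact continuous_apply 0
    · change Continuous (tentDown k); unfold tentDown; fun_prop
    · exact continuous_apply 2

/-- The set of points moved by `tentHomeo k`. -/
def tentRegion (k : ℝ) : Set Space :=
  {p | p 1 < tentHeight k p + p 1 / (k + 1) ∧ p 1 < tentHeight k p + (k + 1) * p 1}

theorem tentHomeo_apply_of_notMem {k : ℝ} (hk : 0 < k) {p : Space} (hp : p ∉ tentRegion k) :
    tentHomeo k hk p = p := by
  have : tentUp k p = p 1 := by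
    unfold tentUp
    refine max_eq_left ?_
    by_contra! h
    exact hp (lt_min_iff.1 h)
  change ![p 0, tentUp k p, p 2] = p
  rw [this]
  ext i; fin_cases i <;> rfl

theorem tentHomeo_apply_base {k : ℝ} (hk : 0 < k) {x : ℝ} (hx : |x| ≤ 1) :
    tentHomeo k hk ![x, 0, 0] = ![x, 1 - |x|, 0] := by
  change ![x, tentUp k ![x, 0, 0], 0] = _
  have : tentUp k ![x, 0, 0] = 1 - |x| := by
    simp [tentUp, tentHeight, hx]
  rw [this]

theorem tentRegion_anti {k k' : ℝ} (hk : 0 < k) (h : k ≤ k') : tentRegion k' ⊆ tentRegion k := by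
  rintro p ⟨h1, h2⟩
  have hk1 : 0 < k + 1 := by linarith
  have hk2 : 0 < k' + 1 := by linarith
  have hb : tentHeight k' p ≤ tentHeight k p := by
    unfold tentHeight
    nlinarith [abs_nonneg (p 2)]
  rcases le_total 0 (p 1) with h0 | h0
  · have e1 : p 1 / (k' + 1) ≤ p 1 / (k + 1) := div_le_div_of_nonneg_left h0 hk1 (by linarith)
    have e2 : p 1 / (k + 1) ≤ p 1 := div_le_self h0 (by linarith)
    exact ⟨by linarith, by nlinarith⟩
  · have e2 : p 1 ≤ p 1 / (k + 1) := by
      rw [le_div_iff₀ hk1]; nlinarith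
    refine ⟨by nlinarith, by nlinarith⟩

/-- The triangle with vertices `(-1, 0, 0)`, `(1, 0, 0)`, `(0, 1, 0)`. -/
def tentTriangle : Set Space := {p | p 2 = 0 ∧ 0 ≤ p 1 ∧ |p 0| + p 1 ≤ 1}

theorem exists_lt_of_notMem_tentTriangle {p : Space} (hp : p ∉ tentTriangle) : ∃ k > 0,
    tentHeight k p + p 1 / (k + 1) < p 1 ∨ tentHeight k p + (k + 1) * p 1 < p 1 := by
  have a0 := abs_nonneg (p 0)
  have a2 := abs_nonneg (p 2)
  by_cases h2 : p 2 = 0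
  · rcases lt_or_ge (p 1) 0 with h1 | h1
    · refine ⟨2 / -p 1, div_pos two_pos (by linarith), Or.inr ?_⟩
      have : 2 / -p 1 * p 1 = -2 := by have := h1.ne; field_simp
      simp only [tentHeight, h2, abs_zero, mul_zero]
      linarith
    · have h3 : 1 < |p 0| + p 1 := by
        by_contra! h; exact hp ⟨h2, h1, h⟩
      have hd : 0 < |p 0| + p 1 - 1 := by linarith
      set k := (p 1 + 1) / (|p 0| + p 1 - 1) with hk
      have hkp : 0 < k := by positivity
      refine ⟨k, hkp, Or.inl ?_⟩
      have : p 1 / (k + 1) < |p 0| + p 1 - 1 := by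
        rw [div_lt_iff₀ (by linarith)]
        have : k * (|p 0| + p 1 - 1) = p 1 + 1 := by rw [hk]; field_simp
        nlinarith
      simp only [tentHeight, h2, abs_zero, mul_zero]
      linarith
  · have h2' : 0 < |p 2| := abs_pos.2 h2
    refine ⟨2 / |p 2|, by positivity, ?_⟩
    have : 2 / |p 2| * |p 2| = 2 := by field_simp
    simp only [tentHeight, this]
    have hk : 0 < 2 / |p 2| := by positivity
    rcases lt_or_ge (p 1) 0 with h1 | h1
    · right; nlinarith
    · left
      have := div_le_self h1 (by linarith : 1 ≤ 2 / |p 2| + 1)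
      linarith

theorem eventually_avoids_of_compact {S : Set Space} (hS : IsCompact S)
    (h : Disjoint S tentTriangle) : ∀ᶠ k in atTop, ∀ p ∈ S, p ∉ tentRegion k := by
  refine hS.induction_on (p := fun S => ∀ᶠ k in atTop, ∀ p ∈ S, p ∉ tentRegion k) (by simp)
    (fun s t hst ht => ht.mono fun k hk p hp => hk p (hst hp))
    (fun s t hs ht => (hs.and ht).mono fun k hk p hp => hp.elim (hk.1 p) (hk.2 p)) ?_
  intro x hx
  obtain ⟨k, hk, hlt⟩ := exists_lt_of_notMem_tentTriangle (Set.disjoint_left.1 h hx)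
  have hc := continuous_tentHeight k
  have hev : ∀ᶠ p in 𝓝 x,
      tentHeight k p + p 1 / (k + 1) < p 1 ∨ tentHeight k p + (k + 1) * p 1 < p 1 := by
    rcases hlt with hlt | hlt
    · exact ((isOpen_lt (by fun_prop) (continuous_apply 1)).eventually_mem hlt).mono
        fun p => Or.inl
    · exact ((isOpen_lt (by fun_prop) (continuous_apply 1)).eventually_mem hlt).mono
        fun p => Or.inr
  refine ⟨_, mem_nhdsWithin_of_mem_nhds hev, ?_⟩
  filter_upwards [eventually_ge_atTop k] with k' hk' p hp hpr
  have := tentRegion_anti hk hk' hpr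
  rcases hp with hp | hp
  · exact hp.not_gt this.1
  · exact hp.not_gt this.2

/-- A segment starting at a base vertex of the triangle (`s = 1` or `s = -1`) and otherwise
disjoint from it. -/
theorem eventually_avoids_of_ray {s : ℝ} (hs : s = 1 ∨ s = -1) {v : Space}
    (h : ∀ t : ℝ, 0 < t → t < 1 → ![s, 0, 0] + t • v ∉ tentTriangle) :
    ∀ᶠ k in atTop, ∀ t : ℝ, 0 ≤ t → ![s, 0, 0] + t • v ∉ tentRegion k := by
  have key : ∃ k > 0, 0 ≤ s * v 0 + k * |v 2| + (v 1 - v 1 / (k + 1)) ∨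
      0 ≤ s * v 0 + k * |v 2| - k * v 1 := by
    by_cases h2 : v 2 = 0
    · simp only [h2, abs_zero, mul_zero, add_zero]
      rcases lt_or_ge (v 1) 0 with h1 | h1
      · refine ⟨(|v 0| + 1) / -v 1, div_pos (by positivity) (by linarith), Or.inr ?_⟩
        have : (|v 0| + 1) / -v 1 * v 1 = -(|v 0| + 1) := by have := h1.ne; field_simp
        have := neg_abs_le (v 0)
        have := le_abs_self (v 0)
        rcases hs with rfl | rfl <;> linarith
      · have h3 : 0 ≤ s * v 0 + v 1 ∧ (0 < s * v 0 + v 1 ∨ v 1 = 0) := by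
          by_contra hcon
          have hle : s * v 0 + v 1 ≤ 0 := by
            by_contra! h'; exact hcon ⟨h'.le, Or.inl h'⟩
          have hex : ∃ t : ℝ, 0 < t ∧ t < 1 ∧ t * (2 * |v 0| + v 1) ≤ 1 := by
            refine ⟨1 / (2 * |v 0| + v 1 + 2), by positivity,
              (div_lt_one (by positivity)).2 (by linarith [abs_nonneg (v 0)]), ?_⟩
            rw [one_div, inv_mul_le_iff₀ (by positivity)]; linarith
          obtain ⟨t, ht0, ht1, ht⟩ := hex
          refine h t ht0 ht1 ⟨by simp [h2], by simp; positivity, ?_⟩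
          simp only [Pi.add_apply, Matrix.cons_val_zero, Pi.smul_apply, smul_eq_mul,
            Matrix.cons_val_one, zero_add]
          have e1 : |s + t * v 0| ≤ 1 - t * v 1 := by
            have n1 := neg_abs_le (v 0)
            have n2 := le_abs_self (v 0)
            rw [abs_le]
            rcases hs with rfl | rfl
            · constructor <;> nlinarith
            · constructor <;> nlinarith
          linarith
        rcases h3.2 with h3' | h3'
        · refine ⟨(v 1 + 1) / (s * v 0 + v 1), by positivity, Or.inl ?_⟩
          set k := (v 1 + 1) / (s * v 0 + v 1) with hk
          have hkp : 0 < k := by positivity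
          have : v 1 / (k + 1) ≤ s * v 0 + v 1 := by
            rw [div_le_iff₀ (by linarith)]
            have : k * (s * v 0 + v 1) = v 1 + 1 := by rw [hk]; field_simp
            nlinarith
          linarith
        · refine ⟨1, one_pos, Or.inl ?_⟩
          rw [h3'] at h3 ⊢
          simpa using h3.1
    · have h2' : 0 < |v 2| := abs_pos.2 h2
      refine ⟨(|v 0| + 1) / |v 2|, by positivity, ?_⟩
      have : (|v 0| + 1) / |v 2| * |v 2| = |v 0| + 1 := by field_simp
      rw [this]
      have hk : 0 < (|v 0| + 1) / |v 2| := by positivity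
      have n1 := neg_abs_le (v 0)
      have n2 := le_abs_self (v 0)
      rcases lt_or_ge (v 1) 0 with h1 | h1
      · right; rcases hs with rfl | rfl <;> nlinarith
      · left
        have := div_le_self h1 (by linarith : 1 ≤ (|v 0| + 1) / |v 2| + 1)
        rcases hs with rfl | rfl <;> linarith
  obtain ⟨k, hk, hkey⟩ := key
  filter_upwards [eventually_ge_atTop k] with k' hk' t ht hpr
  obtain ⟨h1, h2⟩ := tentRegion_anti hk hk' hpr
  simp only [tentHeight, Pi.add_apply, Matrix.cons_val_zero, Pi.smul_apply, smul_eq_mul,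
    Matrix.cons_val_one, zero_add, Matrix.cons_val, abs_mul, abs_of_nonneg ht] at h1 h2
  have habs : 1 + t * (s * v 0) ≤ |s + t * v 0| := by
    rcases hs with rfl | rfl
    · linarith [le_abs_self (1 + t * v 0)]
    · linarith [neg_abs_le (-1 + t * v 0)]
  rcases hkey with hkey | hkey
  · have e : t * v 1 / (k + 1) = t * (v 1 / (k + 1)) := by ring
    rw [e] at h1
    nlinarith
  · nlinarith

end Tent

section TriangleHomeo

theorem pathEdges_ne {a : Space} {p : List Space} (h : PathSimple (p ++ [a]))
    (ha : a ∉ halfPath (p ++ [a])) {e : Space × Space} (he : e ∈ pathEdges (p ++ [a])) :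
    e.1 ≠ e.2 := by
  induction p with
  | nil => simp at he
  | cons b p ih =>
    cases p with
    | nil =>
      simp at he; subst he
      rintro (rfl : b = a)
      exact ha (mem_halfPath_of_mem (by simp))
    | cons c p =>
      simp only [List.cons_append, pathEdges_cons_cons, List.mem_cons, halfPath_cons_cons] at he ha h
      rw [pathSimple_cons_cons] at h
      rcases he with rfl | he
      · rintro (rfl : b = c)
        exact Set.disjoint_left.1 h.2 (left_mem_halfOpenEdge _ _)
          (mem_halfPath_of_mem (p := b :: p) (by simp))
      · exact ih h.1 (fun h' => ha (Or.inr h')) he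

/-- What remains of a polygon after removal of the edge `AB`. -/
theorem IsPolygon.inter_rest {A B P : Space} {l : List Space} (h : IsPolygon (A :: B :: l))
    (h1 : P ∈ segment ℝ A B) (h2 : P ∈ pathSupport (B :: (l ++ [A]))) : P = A ∨ P = B := by
  rw [← halfOpenEdge_union_right] at h1
  rcases h1 with h1 | h1
  · rcases pathSupport_subset_halfPath (B :: l) A h2 with h2 | h2
    · exact absurd h2 (Set.disjoint_left.1 (isPolygon_cons_iff.1 h).2.2 h1)
    · exact Or.inl h2
  · exact Or.inr h1

theorem IsPolygon.left_notMem {A B : Space} {l : List Space} (h : IsPolygon (A :: B :: l)) :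
    A ∉ halfPath (B :: (l ++ [A])) :=
  Set.disjoint_left.1 (isPolygon_cons_iff.1 h).2.2 (left_mem_halfOpenEdge _ _)

theorem right_mem_edge {B : Space} {p : List Space} (h : PathSimple (B :: p))
    {e : Space × Space} (he : e ∈ pathEdges (B :: p)) (hB : B ∈ segment ℝ e.1 e.2) :
    B = e.1 ∨ B = e.2 := by
  cases p with
  | nil => simp at he
  | cons c p =>
    rw [pathEdges_cons_cons, List.mem_cons] at he
    rcases he with rfl | he
    · exact Or.inl rfl
    · rw [← halfOpenEdge_union_right] at hB
      rcases hB with hB | hB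
      · exact absurd (mem_halfPath.2 ⟨e, he, hB⟩) (Set.disjoint_left.1
          ((pathSimple_cons_cons _ _ _).1 h).2 (left_mem_halfOpenEdge _ _))
      · exact Or.inr hB

theorem left_mem_edge {A : Space} {p : List Space} (hA : A ∉ halfPath (p ++ [A]))
    {e : Space × Space} (he : e ∈ pathEdges (p ++ [A])) (h : A ∈ segment ℝ e.1 e.2) : A = e.2 := by
  rw [← halfOpenEdge_union_right] at h
  rcases h with h | h
  · exact absurd (mem_halfPath.2 ⟨e, he, h⟩) hA
  · exact h

theorem isCompact_segment {E : Type*} [NormedAddCommGroup E] [NormedSpace ℝ E] (A B : E) :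
    IsCompact (segment ℝ A B) := by
  rw [← convexHull_pair (𝕜 := ℝ)]; exact (Set.toFinite {A, B}).isCompact_convexHull ℝ

/-- A nondegenerate triangle move is induced by a homeomorphism of space. -/
theorem exists_homeomorph_of_triangle {A B C : Space} {l : List Space}
    (hp : IsPolygon (A :: B :: l)) (hi : AffineIndependent ℝ ![A, B, C])
    (hT : convexHull ℝ {A, B, C} ∩ polygonSupport (A :: B :: l) = segment ℝ A B) :
    ∃ H : Space ≃ₜ Space, H '' polygonSupport (A :: B :: l) = polygonSupport (A :: C :: B :: l) := by
  set M : Space := (1 / 2 : ℝ) • (A + B) with hM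
  set u : Space := (1 / 2 : ℝ) • (B - A) with hu
  set v : Space := C - M with hv
  obtain ⟨w, L, hL⟩ := exists_frame (u := u) (v := v) (by
    intro x y hxy
    have := affineIndependent_triple_iff.1 hi ((x - y) / 2) y (by
      rw [← hxy, hu, hv, hM]; module)
    exact ⟨by linarith [this.1, this.2], this.2⟩)
  set Ψ := affineHomeo M L
  have hΨ : ∀ p : Space, Ψ p = M + (p 0 • u + p 1 • v + p 2 • w) := fun p => by
    rw [← hL]; rfl
  have hΨA : Ψ ![-1, 0, 0] = A := by
    rw [hΨ, hM, hu]; simp; module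
  have hΨB : Ψ ![1, 0, 0] = B := by
    rw [hΨ, hM, hu]; simp; module
  have hΨT : ∀ p ∈ tentTriangle, Ψ p ∈ convexHull ℝ {A, B, C} := by
    rintro p ⟨h2, h1, h0⟩
    have := abs_le.1 (by linarith : |p 0| ≤ 1 - p 1)
    refine mem_triangle_iff.2 ⟨(1 - p 0 - p 1) / 2, (1 + p 0 - p 1) / 2, p 1, by linarith,
      by linarith, h1, by ring, ?_⟩
    rw [hΨ, h2, hv, hu, hM]; module
  have hps := (isPolygon_cons_iff.1 hp).2.1
  have hAn := hp.left_notMem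
  have hrest : ∀ P ∈ convexHull ℝ {A, B, C}, P ∈ pathSupport (B :: (l ++ [A])) → P = A ∨ P = B := by
    intro P h1 h2
    refine hp.inter_rest ?_ h2
    rw [← hT, polygonSupport_cons_cons]
    exact ⟨h1, Or.inr h2⟩
  have hray : ∀ (s : ℝ) (X Y : Space), Ψ ![s, 0, 0] = X → X ∈ convexHull ℝ {A, B, C} →
      (∀ P ∈ convexHull ℝ {A, B, C}, P ∈ segment ℝ X Y → P = A ∨ P = B) → X = A ∨ X = B → X ≠ Y →
      s = 1 ∨ s = -1 → ∀ᶠ k in atTop, ∀ p, Ψ p ∈ segment ℝ X Y → p ∉ tentRegion k := by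
    intro s X Y hX hXT hAB hXAB hXY hs
    have hline : ∀ t : ℝ, Ψ (![s, 0, 0] + t • L.symm (Y - X)) = (1 - t) • X + t • Y := by
      intro t
      have h1 : M + L ![s, 0, 0] = X := hX
      have : Ψ (![s, 0, 0] + t • L.symm (Y - X)) = M + L ![s, 0, 0] + t • (Y - X) := by
        simp only [Ψ, affineHomeo_apply, map_add, map_smul, ContinuousLinearEquiv.apply_symm_apply,
          add_assoc]
      rw [this, h1]; module
    have hne : ∀ t : ℝ, t ≠ 0 → (1 - t) • X + t • Y ≠ X := by
      intro t ht e
      have : t • (Y - X) = 0 := by rw [← sub_eq_zero] at e; rw [← e]; module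
      exact hXY (sub_eq_zero.1 ((smul_eq_zero.1 this).resolve_left ht)).symm
    refine (eventually_avoids_of_ray hs (v := L.symm (Y - X)) ?_).mono fun k hk p hp' => ?_
    · intro t ht0 ht1 htT
      have h1 := hΨT _ htT
      rw [hline] at h1
      have e1 := hAB _ h1 (mem_segment_iff.2 ⟨t, ht0.le, ht1.le, rfl⟩)
      have h2 : (1 - t / 2) • X + (t / 2) • Y ∈ convexHull ℝ {A, B, C} :=
        segment_subset_triangle hXT h1 (mem_segment_iff.2
          ⟨1 / 2, by norm_num, by norm_num, by module⟩)
      have e2 := hAB _ h2 (mem_segment_iff.2 ⟨t / 2, by linarith, by linarith, rfl⟩)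
      have n1 := hne t ht0.ne'
      have n2 := hne (t / 2) (by linarith)
      have e3 : (1 - t) • X + t • Y = (1 - t / 2) • X + (t / 2) • Y := by
        rcases hXAB with rfl | rfl
        · rw [e1.resolve_left n1, e2.resolve_left n2]
        · rw [e1.resolve_right n1, e2.resolve_right n2]
      have : (t / 2) • (Y - X) = 0 := by rw [← sub_eq_zero] at e3; rw [← e3]; module
      exact hXY (sub_eq_zero.1 ((smul_eq_zero.1 this).resolve_left (by linarith))).symm
    · obtain ⟨t, h0, h1, e⟩ := mem_segment_iff.1 hp'
      rw [← hline] at e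
      rw [Ψ.injective e]
      exact hk t h0
  have hev : ∀ e ∈ pathEdges (B :: (l ++ [A])), ∀ᶠ k in atTop, ∀ p, Ψ p ∈ segment ℝ e.1 e.2 →
      p ∉ tentRegion k := by
    intro e he
    have hsub : segment ℝ e.1 e.2 ⊆ pathSupport (B :: (l ++ [A])) :=
      fun P hP => mem_pathSupport.2 ⟨e, he, hP⟩
    have hne := pathEdges_ne (p := B :: l) hps hAn he
    by_cases hAe : A ∈ segment ℝ e.1 e.2
    · have e2 : A = e.2 := left_mem_edge (p := B :: l) hAn he hAe
      have := hray (-1) A e.1 hΨA left_mem_triangle (fun P h1 h2 => hrest P h1 (hsub (by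
        rw [segment_symm, ← e2]; exact h2))) (Or.inl rfl) (by rw [e2]; exact hne.symm)
        (Or.inr rfl)
      rwa [segment_symm, ← e2]
    by_cases hBe : B ∈ segment ℝ e.1 e.2
    · rcases right_mem_edge hps he hBe with e2 | e2
      · have := hray 1 B e.2 hΨB mid_mem_triangle (fun P h1 h2 => hrest P h1 (hsub (by
          rw [← e2]; exact h2))) (Or.inr rfl) (by rw [e2]; exact hne) (Or.inl rfl)
        rwa [← e2]
      · have := hray 1 B e.1 hΨB mid_mem_triangle (fun P h1 h2 => hrest P h1 (hsub (by
          rw [segment_symm, ← e2]; exact h2))) (Or.inr rfl) (by rw [e2]; exact hne.symm)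
          (Or.inl rfl)
        rwa [segment_symm, ← e2]
    · have hc : IsCompact (Ψ.symm '' segment ℝ e.1 e.2) :=
        (isCompact_segment _ _).image Ψ.symm.continuous
      refine (eventually_avoids_of_compact hc ?_).mono fun k hk p hp' =>
        hk p ⟨Ψ p, hp', by simp⟩
      rw [Set.disjoint_left]
      rintro _ ⟨P, hP, rfl⟩ hPT
      have := hΨT _ hPT
      rw [Homeomorph.apply_symm_apply] at this
      rcases hrest P this (hsub hP) with rfl | rfl
      · exact hAe hP
      · exact hBe hP
  obtain ⟨k, hk, hk0⟩ := ((((pathEdges (B :: (l ++ [A]))).finite_toSet.eventually_all (l := atTop)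
    (p := fun e k => ∀ p, Ψ p ∈ segment ℝ e.1 e.2 → p ∉ tentRegion k)).2 hev).and
    (eventually_gt_atTop (0 : ℝ))).exists
  set H := (Ψ.symm.trans (tentHomeo k hk0)).trans Ψ
  have hfix : ∀ P ∈ pathSupport (B :: (l ++ [A])), H P = P := by
    intro P hP
    obtain ⟨e, he, hPe⟩ := mem_pathSupport.1 hP
    have := hk e he (Ψ.symm P) (by simpa using hPe)
    change Ψ (tentHomeo k hk0 (Ψ.symm P)) = P
    rw [tentHomeo_apply_of_notMem hk0 this]; simp
  have hbase : ∀ x : ℝ, |x| ≤ 1 → H (M + x • u) = M + (x • u + (1 - |x|) • v) := by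
    intro x hx
    have e1 : M + x • u = Ψ ![x, 0, 0] := by rw [hΨ]; simp
    rw [e1]
    change Ψ (tentHomeo k hk0 (Ψ.symm _)) = _
    rw [Homeomorph.symm_apply_apply, tentHomeo_apply_base hk0 hx, hΨ]
    simp
  refine ⟨H, ?_⟩
  rw [polygonSupport_cons_cons, polygonSupport_cons_cons, List.cons_append, pathSupport_cons_cons,
    image_union, ← union_assoc]
  congr 1
  · apply Subset.antisymm
    · rintro _ ⟨P, hP, rfl⟩
      obtain ⟨t, h0, h1, rfl⟩ := mem_segment_iff.1 hP
      have e : (1 - t) • A + t • B = M + (2 * t - 1) • u := by rw [hM, hu]; module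
      rw [e, hbase _ (abs_le.2 ⟨by linarith, by linarith⟩)]
      rcases le_total (2 * t - 1) 0 with h | h
      · left
        rw [abs_of_nonpos h]
        exact mem_segment_iff.2 ⟨2 * t, by linarith, by linarith, by rw [hv, hu, hM]; module⟩
      · right
        rw [abs_of_nonneg h]
        exact mem_segment_iff.2 ⟨2 * t - 1, by linarith, by linarith, by rw [hv, hu, hM]; module⟩
    · rintro P (hP | hP) <;> obtain ⟨t, h0, h1, rfl⟩ := mem_segment_iff.1 hP
      · refine ⟨M + (t - 1) • u, mem_segment_iff.2 ⟨t / 2, by linarith, by linarith, by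
          rw [hM, hu]; module⟩, ?_⟩
        rw [hbase _ (abs_le.2 ⟨by linarith, by linarith⟩), abs_of_nonpos (by linarith), hv, hu, hM]
        module
      · refine ⟨M + t • u, mem_segment_iff.2 ⟨(1 + t) / 2, by linarith, by linarith, by
          rw [hM, hu]; module⟩, ?_⟩
        rw [hbase _ (abs_le.2 ⟨by linarith, by linarith⟩), abs_of_nonneg (by linarith), hv, hu, hM]
        module
  · apply Subset.antisymm
    · rintro _ ⟨P, hP, rfl⟩
      rw [hfix P hP]; exact hP
    · intro P hP
      exact ⟨P, hP, hfix P hP⟩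

theorem support_eq_of_degenerate {A B C : Space} {l : List Space}
    (hp : IsPolygon (A :: B :: l)) (hp' : IsPolygon (A :: C :: B :: l))
    (hi : ¬ AffineIndependent ℝ ![A, B, C]) :
    polygonSupport (A :: C :: B :: l) = polygonSupport (A :: B :: l) := by
  apply polygonSupport_subdivide
  rw [affineIndependent_triple_iff] at hi
  push Not at hi
  obtain ⟨x, y, hxy, hne⟩ := hi
  have hAB := hp.ne
  have hy : y ≠ 0 := by
    rintro rfl
    simp only [zero_smul, add_zero] at hxy
    exact hne ((smul_eq_zero.1 hxy).resolve_right fun h => hAB (sub_eq_zero.1 h).symm) rfl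
  have hC : C = (1 - -x / y) • A + (-x / y) • B := by
    have : C = A + y⁻¹ • (y • (C - A)) := by rw [smul_smul, inv_mul_cancel₀ hy]; module
    rw [this, eq_neg_of_add_eq_zero_right hxy]
    have e : -x / y = y⁻¹ * -x := by ring
    rw [e]; module
  set t := -x / y
  obtain ⟨-, h2, h3⟩ := isPolygon_insert_iff.1 hp'
  have hBm : B ∈ halfPath (B :: (l ++ [A])) := mem_halfPath_of_mem (p := B :: l) (by simp)
  have ht0 : 0 < t := by
    by_contra! h
    refine Set.disjoint_left.1 h2 (left_mem_halfOpenEdge A C) (mem_halfOpenEdge.2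
      ⟨-t / (1 - t), div_nonneg (by linarith) (by linarith),
        (div_lt_one (by linarith)).2 (by linarith), ?_⟩)
    have h1 : (1 : ℝ) - t ≠ 0 := by linarith
    have e1 : (1 - -t / (1 - t)) * (1 - t) = 1 := by field_simp; ring
    have e2 : (1 - -t / (1 - t)) * t + -t / (1 - t) = 0 := by field_simp; ring
    calc A = ((1 - -t / (1 - t)) * (1 - t)) • A + ((1 - -t / (1 - t)) * t + -t / (1 - t)) • B := by
          rw [e1, e2]; simp
      _ = _ := by rw [hC]; module
  have ht1 : t < 1 := by
    by_contra! h
    rcases h.eq_or_lt with h | h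
    · have : C = B := by rw [hC, ← h]; simp
      exact Set.disjoint_left.1 h3 (Or.inr (this ▸ left_mem_halfOpenEdge C B)) hBm
    · refine Set.disjoint_left.1 h3 (Or.inl (mem_halfOpenEdge.2 ⟨1 / t, by positivity,
        (div_lt_one ht0).2 h, ?_⟩)) hBm
      have e1 : (1 / t) * t = 1 := by field_simp
      calc B = (1 - (1 / t) * t) • A + ((1 / t) * t) • B := by rw [e1]; simp
        _ = _ := by rw [hC]; module
  exact mem_openSegment_iff.2 ⟨t, ht0, ht1, hC⟩

theorem exists_homeomorph_of_triangleMove {K K' : PolygonalKnot} (h : TriangleMove K K') :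
    ∃ H : Space ≃ₜ Space, H '' K.support = K'.support := by
  obtain ⟨A, B, C, ⟨l, hK, hK'⟩, hT⟩ := h
  have e : K.support = polygonSupport (A :: B :: l) := polygonSupport_isRotated hK
  have e' : K'.support = polygonSupport (A :: C :: B :: l) := polygonSupport_isRotated hK'
  rw [e] at hT
  rw [e, e']
  by_cases hi : AffineIndependent ℝ ![A, B, C]
  · exact exists_homeomorph_of_triangle (K.isPolygon.isRotated hK) hi hT
  · refine ⟨Homeomorph.refl _, ?_⟩
    rw [support_eq_of_degenerate (K.isPolygon.isRotated hK) (K'.isPolygon.isRotated hK') hi]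
    simp

theorem exists_homeomorph_of_knotType_eq {K K' : PolygonalKnot} (h : K.knotType = K'.knotType) :
    ∃ H : Space ≃ₜ Space, H '' K.support = K'.support := by
  have h' : Relation.EqvGen TriangleMove K K' := Quotient.exact h
  clear h
  induction h' with
  | rel _ _ h => exact exists_homeomorph_of_triangleMove h
  | refl => exact ⟨Homeomorph.refl _, by simp⟩
  | symm _ _ _ ih =>
    obtain ⟨H, hH⟩ := ih
    exact ⟨H.symm, by rw [← hH]; simp [image_image]⟩
  | trans _ _ _ _ _ ih ih' =>
    obtain ⟨H, hH⟩ := ih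
    obtain ⟨H', hH'⟩ := ih'
    exact ⟨H.trans H', by rw [← hH', ← hH, image_image]; rfl⟩

theorem colorable_of_knotType_eq {m : ℕ} {K K' : PolygonalKnot} (h : K.knotType = K'.knotType)
    (hK : Colorable m K.support) : Colorable m K'.support := by
  obtain ⟨H, hH⟩ := exists_homeomorph_of_knotType_eq h
  rw [← hH]
  exact hK.image H

end TriangleHomeo

section Generic

/-- The plane through three points (or the line or point they span). -/
def plane (A B C : Space) : AffineSubspace ℝ Space := affineSpan ℝ (Set.range ![A, B, C])

theorem plane_ne_top (A B C : Space) : plane A B C ≠ ⊤ := by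
  intro h
  have h1 := finrank_vectorSpan_range_le ℝ ![A, B, C] (n := 2) (by simp)
  rw [← direction_affineSpan] at h1
  change Module.finrank ℝ (plane A B C).direction ≤ 2 at h1
  rw [h, AffineSubspace.direction_top, finrank_top] at h1
  simp at h1

theorem mem_plane {A B C P : Space} {a b c : ℝ} (h : a + b + c = 1)
    (hP : P = a • A + b • B + c • C) : P ∈ plane A B C := by
  have hA : A ∈ plane A B C := mem_affineSpan ℝ ⟨0, rfl⟩
  have hB : B ∈ plane A B C := mem_affineSpan ℝ ⟨1, rfl⟩
  have hC : C ∈ plane A B C := mem_affineSpan ℝ ⟨2, rfl⟩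
  have h1 := AffineSubspace.smul_vsub_vadd_mem _ b hB hA hA
  have h2 := AffineSubspace.smul_vsub_vadd_mem _ c hC hA h1
  convert h2 using 1
  simp only [vsub_eq_sub, vadd_eq_add]
  rw [hP, show a = 1 - b - c by linarith]; module

theorem dense_avoiding {s : Set (AffineSubspace ℝ Space)} (hs : s.Finite) (h : ∀ p ∈ s, p ≠ ⊤) :
    Dense {x : Space | ∀ p ∈ s, x ∉ p} := by
  refine MeasureTheory.Measure.dense_of_ae (μ := MeasureTheory.volume) ?_
  rw [MeasureTheory.ae_ball_iff hs.countable]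
  intro p hp
  exact MeasureTheory.measure_eq_zero_iff_ae_notMem.1
    (MeasureTheory.Measure.addHaar_affineSubspace _ p (h p hp))

theorem dense_compl_of_planes {ι : Type*} [Finite ι] (p : ι → AffineSubspace ℝ Space)
    (hp : ∀ i, p i ≠ ⊤) {S : Set Space} (hS : ∀ x ∈ S, ∃ i, x ∈ p i) : Dense Sᶜ :=
  (dense_avoiding (Set.finite_range p) (by rintro _ ⟨i, rfl⟩; exact hp i)).mono
    fun x hx hxS => by
      obtain ⟨i, hi⟩ := hS x hxS
      exact hx _ ⟨i, rfl⟩ hi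

theorem segment_subset_plane (A B C : Space) : segment ℝ A B ⊆ plane A B C := fun P hP => by
  obtain ⟨t, -, -, rfl⟩ := mem_segment_iff.1 hP
  exact mem_plane (a := 1 - t) (b := t) (c := 0) (by ring) (by simp)

theorem independent_of_notMem_plane {u v : Space} (hu : u ≠ 0) (hv : v ∉ plane 0 u 0) :
    ∀ x y : ℝ, x • u + y • v = 0 → x = 0 ∧ y = 0 := by
  intro x y hxy
  have hy : y = 0 := by
    by_contra hy
    refine hv (mem_plane (a := 1 - -x / y) (b := -x / y) (c := 0) (by ring) ?_)
    have : v = y⁻¹ • (y • v) := by rw [smul_smul, inv_mul_cancel₀ hy, one_smul]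
    rw [this, eq_neg_of_add_eq_zero_right hxy]
    have e : -x / y = y⁻¹ * -x := by ring
    rw [e]; module
  subst hy
  simp only [zero_smul, add_zero] at hxy
  exact ⟨(smul_eq_zero.1 hxy).resolve_right hu, rfl⟩

theorem exists_independent {u : Space} (hu : u ≠ 0) :
    ∃ v : Space, ∀ x y : ℝ, x • u + y • v = 0 → x = 0 ∧ y = 0 := by
  obtain ⟨v, hv⟩ := (dense_compl_of_planes (fun _ : Unit => plane 0 u 0) (fun _ => plane_ne_top _ _ _)
    (S := plane 0 u 0) (fun x hx => ⟨(), hx⟩)).nonempty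
  exact ⟨v, independent_of_notMem_plane hu hv⟩

/-- Coordinates with respect to a basis that begins with `u` and `v`. -/
theorem exists_coordinates {u v : Space} (h : ∀ x y : ℝ, x • u + y • v = 0 → x = 0 ∧ y = 0) :
    ∃ (w : Space) (c : Fin 3 → Space →L[ℝ] ℝ), (∀ y, y = c 0 y • u + c 1 y • v + c 2 y • w) ∧
      (c 0 u = 1 ∧ c 1 u = 0 ∧ c 2 u = 0) ∧ (c 0 v = 0 ∧ c 1 v = 1 ∧ c 2 v = 0) ∧
      c 0 w = 0 ∧ c 1 w = 0 ∧ c 2 w = 1 := by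
  obtain ⟨w, L, hL⟩ := exists_frame h
  refine ⟨w, fun i => (ContinuousLinearMap.proj i).comp (L.symm : Space →L[ℝ] Space),
    fun y => by simpa using hL (L.symm y), ?_⟩
  have eu : L.symm u = ![1, 0, 0] := by rw [L.symm_apply_eq, hL]; simp
  have ev : L.symm v = ![0, 1, 0] := by rw [L.symm_apply_eq, hL]; simp
  have ew : L.symm w = ![0, 0, 1] := by rw [L.symm_apply_eq, hL]; simp
  simp [eu, ev, ew]

end Generic

section PolygonTopology

theorem isCompact_pathSupport (p : List Space) : IsCompact (pathSupport p) :=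
  (pathEdges p).finite_toSet.isCompact_biUnion fun _ _ => isCompact_segment _ _

theorem exists_append_of_mem_pathEdges {p : List Space} {e : Space × Space}
    (he : e ∈ pathEdges p) : ∃ q r, p = q ++ e.1 :: e.2 :: r := by
  induction p with
  | nil => simp at he
  | cons a p ih =>
    cases p with
    | nil => simp at he
    | cons b p =>
      rw [pathEdges_cons_cons, List.mem_cons] at he
      rcases he with rfl | he
      · exact ⟨[], p, rfl⟩
      · obtain ⟨q, r, h⟩ := ih he
        exact ⟨a :: q, r, by rw [h]; rfl⟩

theorem exists_isRotated_of_mem_polygonEdges {k : List Space} (hk : 2 ≤ k.length)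
    {e : Space × Space} (he : e ∈ polygonEdges k) : ∃ l, k ~r (e.1 :: e.2 :: l) := by
  cases k with
  | nil => simp at hk
  | cons a t =>
    rw [polygonEdges_cons] at he
    obtain ⟨q, r, h⟩ := exists_append_of_mem_pathEdges he
    rcases List.eq_nil_or_concat r with rfl | ⟨r, x, rfl⟩
    · have h' : (a :: t) ++ [a] = (q ++ [e.1]) ++ [e.2] := by simpa using h
      obtain ⟨h1, h2⟩ := List.append_inj' h' rfl
      obtain rfl : a = e.2 := by simpa using h2
      cases q with
      | nil => simp at h1; rw [h1.2] at hk; simp at hk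
      | cons b q =>
        simp only [List.cons_append, List.cons.injEq] at h1
        refine ⟨q, ?_⟩
        rw [h1.2, h1.1]
        exact (List.IsRotated.symm ⟨1, by simp⟩)
    · have h' : (a :: t) ++ [a] = (q ++ e.1 :: e.2 :: r) ++ [x] := by simpa using h
      obtain ⟨h1, -⟩ := List.append_inj' h' rfl
      rw [h1]
      exact ⟨r ++ q, by simpa using (List.isRotated_append (l := q) (l' := e.1 :: e.2 :: r))⟩

theorem isConnected_pathSupport {a b : Space} {p : List Space} :
    IsConnected (pathSupport (a :: b :: p)) := by
  induction p generalizing a b with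
  | nil =>
    simp only [pathSupport_cons_cons, pathSupport_singleton, union_empty]
    exact ((convex_segment a b).isPathConnected ⟨a, left_mem_segment ℝ _ _⟩).isConnected
  | cons c p ih =>
    rw [pathSupport_cons_cons]
    exact ((convex_segment a b).isPathConnected ⟨a, left_mem_segment ℝ _ _⟩).isConnected.union
      ⟨b, right_mem_segment ℝ _ _, mem_pathSupport_of_mem (by simp) (by simp)⟩ ih

variable (K : PolygonalKnot)

theorem PolygonalKnot.exists_vertices : ∃ A B C l, K.vertices = A :: B :: C :: l := by
  match h' : K.vertices with
  | A :: B :: C :: l => exact ⟨A, B, C, l, rfl⟩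
  | [] => exact absurd K.three_le_length (by simp [h'])
  | [a] => exact absurd K.three_le_length (by simp [h'])
  | [a, b] => exact absurd K.three_le_length (by simp [h'])

theorem PolygonalKnot.isCompact_support : IsCompact K.support := by
  change IsCompact (polygonSupport K.vertices)
  obtain ⟨A, B, C, l, h⟩ := K.exists_vertices
  rw [h, polygonSupport_cons]
  exact isCompact_pathSupport _

theorem PolygonalKnot.isConnected_support : IsConnected K.support := by
  change IsConnected (polygonSupport K.vertices)
  obtain ⟨A, B, C, l, h⟩ := K.exists_vertices
  rw [h, polygonSupport_cons]
  exact isConnected_pathSupport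

theorem PolygonalKnot.dense_compl : Dense K.supportᶜ := by
  have hf : Finite {e | e ∈ polygonEdges K.vertices} := (polygonEdges K.vertices).finite_toSet
  refine dense_compl_of_planes (fun e : {e | e ∈ polygonEdges K.vertices} => plane e.1.1 e.1.2 0)
    (fun _ => plane_ne_top _ _ _) fun x hx => ?_
  simp only [PolygonalKnot.support, mem_iUnion] at hx
  obtain ⟨e, he, hx⟩ := hx
  exact ⟨⟨e, he⟩, segment_subset_plane _ _ _ hx⟩

theorem IsPolygon.vertex_notMem {Z x B : Space} {l : List Space} (h : IsPolygon (Z :: x :: B :: l)) :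
    x ≠ B ∧ x ≠ Z ∧ x ∉ pathSupport (B :: (l ++ [Z])) := by
  obtain ⟨hsimp, hd1, hd2⟩ := isPolygon_insert_iff.1 h
  have hxB : x ≠ B := by
    rintro rfl
    exact Set.disjoint_left.1 hd2 (Or.inr (left_mem_halfOpenEdge _ _))
      (mem_halfPath_of_mem (p := x :: l) (by simp))
  have hxZ : x ≠ Z := by
    rintro rfl
    exact Set.disjoint_left.1 hd1 (left_mem_halfOpenEdge _ _) (left_mem_halfOpenEdge _ _)
  have hxp : x ∉ pathSupport (B :: (l ++ [Z])) := by
    intro hx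
    rcases pathSupport_subset_halfPath (B :: l) Z hx with hx | hx
    · exact Set.disjoint_left.1 hd2 (Or.inr (left_mem_halfOpenEdge x B)) hx
    · exact hxZ hx
  exact ⟨hxB, hxZ, hxp⟩

/-- A polygonal knot near a vertex. -/
theorem niceAt_vertex {Z x B : Space} {l : List Space} (h : IsPolygon (Z :: x :: B :: l)) :
    NiceAt (polygonSupport (Z :: x :: B :: l)) x := by
  obtain ⟨hxB, hxZ, hxp⟩ := h.vertex_notMem
  obtain ⟨hsimp, hd1, hd2⟩ := isPolygon_insert_iff.1 h
  have hsupp : ∀ y, y ∈ polygonSupport (Z :: x :: B :: l) ↔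
      y ∈ segment ℝ x Z ∨ y ∈ segment ℝ x B ∨ y ∈ pathSupport (B :: (l ++ [Z])) := by
    intro y
    rw [polygonSupport_cons_cons, List.cons_append, pathSupport_cons_cons, segment_symm ℝ Z x]
    rfl
  have hopen : IsOpen (pathSupport (B :: (l ++ [Z])))ᶜ := (isCompact_pathSupport _).isClosed.isOpen_compl
  have hseg : ∀ y Y : Space, y ∈ segment ℝ x Y ↔ ∃ t : ℝ, 0 ≤ t ∧ t ≤ 1 ∧ y - x = t • (Y - x) := by
    intro y Y
    rw [mem_segment_iff]
    refine exists_congr fun t => and_congr_right fun _ => and_congr_right fun _ => ?_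
    rw [sub_eq_iff_eq_add]
    constructor <;> rintro rfl <;> module
  by_cases hi : ∀ s t : ℝ, s • (B - x) + t • (Z - x) = 0 → s = 0 ∧ t = 0
  · obtain ⟨w, c, hy, ⟨b0, b1, b2⟩, ⟨z0, z1, z2⟩, w0, w1, w2⟩ := exists_coordinates hi
    have ho0 : IsOpen {y | c 0 (y - x) < 1} := isOpen_lt (by fun_prop) continuous_const
    have ho1 : IsOpen {y | c 1 (y - x) < 1} := isOpen_lt (by fun_prop) continuous_const
    have hN : IsOpen {y | (c 0 (y - x) < 1 ∧ c 1 (y - x) < 1) ∧ y ∉ pathSupport (B :: (l ++ [Z]))} :=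
      ((ho0.inter ho1).inter hopen :)
    obtain ⟨ρ, hρ, hsub⟩ := Metric.isOpen_iff.1 hN x ⟨by simp, hxp⟩
    refine (niceAt_bent b0 z0 w0 b1 z1 w1 b2 z2 w2).congr hρ ?_
    intro y hyb
    obtain ⟨⟨h0, h1⟩, h2⟩ := hsub hyb
    rw [hsupp, hseg, hseg]
    constructor
    · rintro ⟨hw, (⟨ha, hb⟩ | ⟨ha, hb⟩)⟩
      · refine Or.inr (Or.inl ⟨_, ha, h0.le, ?_⟩)
        have := hy (y - x)
        rwa [hw, hb, zero_smul, zero_smul, add_zero, add_zero] at this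
      · refine Or.inl ⟨_, hb, h1.le, ?_⟩
        have := hy (y - x)
        rwa [hw, ha, zero_smul, zero_smul, add_zero, zero_add] at this
    · rintro (⟨t, ht0, ht1, e⟩ | ⟨t, ht0, ht1, e⟩ | h3)
      · simp [-map_sub, bentLine, e, z0, z1, z2, ht0]
      · simp [-map_sub, bentLine, e, b0, b1, b2, ht0]
      · exact absurd h3 h2
  · have hu : B - x ≠ 0 := sub_ne_zero.2 hxB.symm
    push Not at hi
    obtain ⟨s, t, hst, hne⟩ := hi
    have ht : t ≠ 0 := by
      rintro rfl
      simp only [zero_smul, add_zero] at hst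
      exact hne ((smul_eq_zero.1 hst).resolve_right hu) rfl
    have hZ : Z - x = (-(s / t)) • (B - x) := by
      have : Z - x = t⁻¹ • (t • (Z - x)) := by rw [smul_smul, inv_mul_cancel₀ ht, one_smul]
      rw [this, eq_neg_of_add_eq_zero_right hst]
      have e : s / t = t⁻¹ * s := by ring
      rw [e]; module
    set d := s / t
    have hd : 0 < d := by
      rcases lt_trichotomy d 0 with h0 | h0 | h0
      · exfalso
        have h1d : 1 + -d ≠ 0 := by linarith
        set P := x + (-d / (1 + -d)) • (B - x) with hP
        suffices h1 : P ∈ halfOpenEdge (Z, x) ∧ P ∈ halfOpenEdge (x, B) from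
          Set.disjoint_left.1 hd1 h1.1 h1.2
        refine ⟨mem_halfOpenEdge.2 ⟨1 - 1 / (1 + -d), ?_, ?_, ?_⟩,
          mem_halfOpenEdge.2 ⟨-d / (1 + -d), ?_, ?_, ?_⟩⟩
        · rw [sub_nonneg]; exact (div_le_one (by linarith)).2 (by linarith)
        · have : 0 < 1 / (1 + -d) := one_div_pos.2 (by linarith)
          linarith
        · have e : Z = x + (-d) • (B - x) := by rw [← hZ]; module
          rw [e, hP]
          have e2 : -d / (1 + -d) = 1 / (1 + -d) * -d := by ring
          rw [e2]; module
        · exact div_nonneg (by linarith) (by linarith)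
        · exact (div_lt_one (by linarith)).2 (by linarith)
        · rw [hP]; module
      · exfalso
        rw [h0, neg_zero, zero_smul] at hZ
        exact hxZ (sub_eq_zero.1 hZ).symm
      · exact h0
    obtain ⟨v, hv⟩ := exists_independent hu
    obtain ⟨w, c, hy, ⟨-, b1, b2⟩, ⟨-, v1, v2⟩, -, w1, w2⟩ := exists_coordinates hv
    have ho0 : IsOpen {y | c 0 (y - x) < 1} := isOpen_lt (by fun_prop) continuous_const
    have ho1 : IsOpen {y | -d < c 0 (y - x)} := isOpen_lt continuous_const (by fun_prop)
    have hN : IsOpen {y | (c 0 (y - x) < 1 ∧ -d < c 0 (y - x)) ∧ y ∉ pathSupport (B :: (l ++ [Z]))} :=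
      ((ho0.inter ho1).inter hopen :)
    obtain ⟨ρ, hρ, hsub⟩ := Metric.isOpen_iff.1 hN x ⟨by simpa using hd, hxp⟩
    refine (niceAt_straight v1 w1 v2 w2).congr hρ ?_
    intro y hyb
    obtain ⟨⟨h0, h1⟩, h2⟩ := hsub hyb
    rw [hsupp, hseg, hseg]
    constructor
    · rintro ⟨hb, hw⟩
      have e := hy (y - x)
      rw [hw, hb, zero_smul, zero_smul, add_zero, add_zero] at e
      rcases le_total 0 (c 0 (y - x)) with h3 | h3
      · exact Or.inr (Or.inl ⟨_, h3, h0.le, e⟩)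
      · refine Or.inl ⟨-c 0 (y - x) / d, div_nonneg (by linarith) hd.le,
          (div_le_one hd).2 (by linarith), ?_⟩
        rw [hZ, smul_smul]
        have : -c 0 (y - x) / d * -d = c 0 (y - x) := by field_simp
        rwa [this]
    · rintro (⟨t, ht0, ht1, e⟩ | ⟨t, ht0, ht1, e⟩ | h3)
      · simp [-map_sub, e, hZ, b1, b2]
      · simp [-map_sub, e, b1, b2]
      · exact absurd h3 h2

theorem IsPolygon.niceAt {k : List Space} (h : IsPolygon k) {x : Space}
    (hx : x ∈ polygonSupport k) : NiceAt (polygonSupport k) x := by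
  have key : ∀ l B, k ~r (x :: B :: l) → NiceAt (polygonSupport k) x := by
    intro l B hr
    have h' := h.isRotated hr
    rcases List.eq_nil_or_concat l with rfl | ⟨l, Z, rfl⟩
    · exact absurd h'.1 (by simp)
    · have hr' : (x :: B :: (l ++ [Z])) ~r (Z :: x :: B :: l) :=
        List.IsRotated.symm ⟨1, by simp⟩
      rw [List.concat_eq_append] at hr h'
      rw [polygonSupport_isRotated (hr.trans hr')]
      exact niceAt_vertex (h'.isRotated hr')
  simp only [polygonSupport, mem_iUnion] at hx
  obtain ⟨e, he, hx⟩ := hx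
  obtain ⟨l, hr⟩ := exists_isRotated_of_mem_polygonEdges (by have := h.1; omega) he
  by_cases h1 : x = e.1
  · subst h1; exact key _ _ hr
  by_cases h2 : x = e.2
  · subst h2
    have h' := h.isRotated hr
    cases l with
    | nil => exact absurd h'.1 (by simp)
    | cons Y l => exact key (l ++ [e.1]) Y (hr.trans ⟨1, by simp⟩)
  have hxo : x ∈ openSegment ℝ e.1 e.2 :=
    mem_openSegment_of_ne_left_right (Ne.symm h1) (Ne.symm h2) hx
  have h' := h.isRotated hr
  have hl := (isPolygon_cons_iff.1 h').1
  have h3 := (isPolygon_subdivide_iff h'.ne hxo hl).2 h'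
  rw [polygonSupport_isRotated hr, ← polygonSupport_subdivide hxo]
  rcases List.exists_cons_of_ne_nil hl with ⟨Y, l', rfl⟩
  exact niceAt_vertex h3

end PolygonTopology

section IntegerMatrices

variable {σ τ : Type*} [Fintype σ] [Fintype τ] [DecidableEq σ] [DecidableEq τ]

theorem exists_mul_mul_eq_one {k : Type*} [Field k] (A : Matrix τ σ k) {r : ℕ} (hr : A.rank = r) :
    ∃ (U : Matrix (Fin r) τ k) (C : Matrix σ (Fin r) k), U * A * C = 1 := by
  set f := A.mulVecLin
  obtain ⟨s, hs⟩ := f.rangeRestrict.exists_rightInverse_of_surjective f.range_rangeRestrict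
  obtain ⟨t, ht⟩ := f.range.subtype.exists_leftInverse_of_injective f.range.ker_subtype
  have e : f.range ≃ₗ[k] (Fin r → k) := LinearEquiv.ofFinrankEq _ _ (by
    rw [Module.finrank_fin_fun]; exact hr)
  refine ⟨LinearMap.toMatrix' (e.toLinearMap.comp t), LinearMap.toMatrix' (s.comp e.symm.toLinearMap),
    ?_⟩
  have hA : A = LinearMap.toMatrix' f := (LinearMap.toMatrix'_toLin' A).symm
  rw [hA]
  rw [← LinearMap.toMatrix'_comp, ← LinearMap.toMatrix'_comp, ← LinearMap.toMatrix'_id]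
  congr 1
  ext1 i
  ext1
  have h1 : ∀ y, f (s y) = (y : τ → k) := fun y =>
    congrArg Subtype.val (LinearMap.congr_fun hs y)
  have h2 : ∀ y : f.range, t (y : τ → k) = y := fun y => LinearMap.congr_fun ht y
  simp [h1, h2]

/-- An integer matrix whose kernel modulo `2` has dimension at most `N` has this property modulo
almost every prime. -/
theorem exists_forall_finrank_ker_le (A : Matrix τ σ ℤ) {N : ℕ}
    (h : Module.finrank (ZMod 2) (A.map (Int.cast : ℤ → ZMod 2)).mulVecLin.ker ≤ N) :
    ∃ d : ℤ, d ≠ 0 ∧ ∀ (p : ℕ) [Fact p.Prime], ¬ (p : ℤ) ∣ d →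
      Module.finrank (ZMod p) (A.map (Int.cast : ℤ → ZMod p)).mulVecLin.ker ≤ N := by
  obtain ⟨r, hr⟩ : ∃ r, (A.map (Int.cast : ℤ → ZMod 2)).rank = r := ⟨_, rfl⟩
  obtain ⟨U, C, hUC⟩ := exists_mul_mul_eq_one _ hr
  set U' : Matrix (Fin r) τ ℤ := U.map fun x => (x.val : ℤ)
  set C' : Matrix σ (Fin r) ℤ := C.map fun x => (x.val : ℤ)
  have hcast : ∀ (p : ℕ), (((U' * A * C').det : ℤ) : ZMod p) =
      (U'.map (Int.cast : ℤ → ZMod p) * A.map (Int.cast : ℤ → ZMod p) *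
        C'.map (Int.cast : ℤ → ZMod p)).det := by
    intro p
    have := RingHom.map_det (Int.castRingHom (ZMod p)) (U' * A * C')
    rw [eq_intCast] at this
    rw [this, RingHom.mapMatrix_apply, Matrix.map_mul, Matrix.map_mul]
    rfl
  have hU : U'.map (Int.cast : ℤ → ZMod 2) = U := by ext i j; simp [U']
  have hC : C'.map (Int.cast : ℤ → ZMod 2) = C := by ext i j; simp [C']
  refine ⟨(U' * A * C').det, fun h0 => ?_, fun p _ hpd => ?_⟩
  · have := hcast 2
    rw [h0, hU, hC, hUC, Matrix.det_one] at this
    simp at this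
  · have hpd' : ((U' * A * C').det : ZMod p) ≠ 0 := fun h => hpd
      ((ZMod.intCast_zmod_eq_zero_iff_dvd _ _).1 h)
    rw [hcast] at hpd'
    have h1 := Matrix.rank_of_isUnit _ ((Matrix.isUnit_iff_isUnit_det _).2 (isUnit_iff_ne_zero.2 hpd'))
    have h2 := (Matrix.rank_mul_le_left _ _).trans' h1.ge |>.trans (Matrix.rank_mul_le_right _ _)
    rw [Fintype.card_fin] at h2
    have h3 := (A.map (Int.cast : ℤ → ZMod p)).mulVecLin.finrank_range_add_finrank_ker
    have h4 := (A.map (Int.cast : ℤ → ZMod 2)).mulVecLin.finrank_range_add_finrank_ker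
    rw [Module.finrank_pi] at h3 h4
    rw [Matrix.rank] at h2 hr
    omega

end IntegerMatrices

section Nerves

/-- A finite cover of `X` by nonempty convex open sets. -/
structure IsConvexCover {ι : Type} (V : ι → Set Space) (X : Set Space) : Prop where
  isOpen : ∀ i, IsOpen (V i)
  convex : ∀ i, Convex ℝ (V i)
  nonempty : ∀ i, (V i).Nonempty
  cover : X = ⋃ i, V i

variable {ι : Type} [Fintype ι] [DecidableEq ι] {V : ι → Set Space} {X : Set Space}

open Classical in
/-- The linear conditions on one-cochains of the nerve of `V` to be twisted cocycles. -/
noncomputable def cocycleMatrix (V : ι → Set Space) (ε : ι → ι → ℤˣ) :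
    Matrix ((ι × ι × ι) ⊕ (ι × ι)) (ι × ι) ℤ := fun i q => match i with
  | .inl (a, b, c) => if (V a ∩ V b ∩ V c).Nonempty then
      (if (a, b) = q then 1 else 0) + ε a b * (if (b, c) = q then 1 else 0) -
        (if (a, c) = q then 1 else 0) else 0
  | .inr (a, b) => if (V a ∩ V b).Nonempty then 0 else if (a, b) = q then 1 else 0

/-- The twisted one-cocycles of the nerve of `V` modulo `p`. -/
noncomputable def cocycles (V : ι → Set Space) (ε : ι → ι → ℤˣ) (p : ℕ) :
    Submodule (ZMod p) (ι × ι → ZMod p) :=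
  ((cocycleMatrix V ε).map (Int.cast : ℤ → ZMod p)).mulVecLin.ker

theorem mem_cocycles {ε : ι → ι → ℤˣ} {p : ℕ} {z : ι × ι → ZMod p} : z ∈ cocycles V ε p ↔
    (∀ a b c, (V a ∩ V b ∩ V c).Nonempty → z (a, c) = z (a, b) + ((ε a b : ℤˣ) : ℤ) * z (b, c)) ∧
    ∀ a b, ¬ (V a ∩ V b).Nonempty → z (a, b) = 0 := by
  classical
  have h1 : ∀ a b c, ((cocycleMatrix V ε).map (Int.cast : ℤ → ZMod p)).mulVec z (.inl (a, b, c)) =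
      if (V a ∩ V b ∩ V c).Nonempty then
        z (a, b) + ((ε a b : ℤˣ) : ℤ) * z (b, c) - z (a, c) else 0 := by
    intro a b c
    simp only [Matrix.mulVec, dotProduct, Matrix.map_apply, cocycleMatrix]
    split_ifs
    · simp [sub_mul, add_mul, Finset.sum_add_distrib, Finset.sum_sub_distrib]
    · simp
  have h2 : ∀ a b, ((cocycleMatrix V ε).map (Int.cast : ℤ → ZMod p)).mulVec z (.inr (a, b)) =
      if (V a ∩ V b).Nonempty then 0 else z (a, b) := by
    intro a b
    simp only [Matrix.mulVec, dotProduct, Matrix.map_apply, cocycleMatrix]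
    split_ifs
    · simp
    · simp
  rw [cocycles, LinearMap.mem_ker, Matrix.mulVecLin_apply, funext_iff, Sum.forall]
  refine and_congr ?_ ?_
  · rw [Prod.forall]
    refine forall_congr' fun a => ?_
    rw [Prod.forall]
    refine forall_congr' fun b => forall_congr' fun c => ?_
    rw [h1]
    split_ifs with h
    · simp only [Pi.zero_apply, h, forall_const]
      rw [sub_eq_zero]; exact eq_comm
    · simp [h]
  · rw [Prod.forall]
    refine forall_congr' fun a => forall_congr' fun b => ?_
    rw [h2]
    split_ifs with h <;> simp [h]

open Classical in
/-- The twisted coboundary of a zero-cochain. -/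
noncomputable def coboundary (V : ι → Set Space) (ε : ι → ι → ℤˣ) (p : ℕ) :
    (ι → ZMod p) →ₗ[ZMod p] (ι × ι → ZMod p) where
  toFun f q := if (V q.1 ∩ V q.2).Nonempty then f q.1 - ((ε q.1 q.2 : ℤˣ) : ℤ) * f q.2 else 0
  map_add' f g := by
    ext q; simp only [Pi.add_apply]; split_ifs <;> ring
  map_smul' c f := by
    ext q; simp only [Pi.smul_apply, smul_eq_mul, RingHom.id_apply]; split_ifs <;> ring

theorem coboundary_apply {ε : ι → ι → ℤˣ} {p : ℕ} {f : ι → ZMod p} {a b : ι}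
    (h : (V a ∩ V b).Nonempty) :
    coboundary V ε p f (a, b) = f a - ((ε a b : ℤˣ) : ℤ) * f b := if_pos h

theorem coboundary_mem_cocycles {ε : ι → ι → ℤˣ} {p : ℕ} (f : ι → ZMod p)
    (hε : ∀ a b c, (V a ∩ V b ∩ V c).Nonempty →
      (((ε a c : ℤˣ) : ℤ) : ZMod p) = ((ε a b : ℤˣ) : ℤ) * ((ε b c : ℤˣ) : ℤ)) :
    coboundary V ε p f ∈ cocycles V ε p := by
  refine mem_cocycles.2 ⟨fun a b c h => ?_, fun a b h => if_neg h⟩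
  obtain ⟨P, ⟨h1, h2⟩, h3⟩ := h
  rw [coboundary_apply ⟨P, h1, h3⟩, coboundary_apply ⟨P, h1, h2⟩, coboundary_apply ⟨P, h2, h3⟩,
    hε a b c ⟨P, ⟨h1, h2⟩, h3⟩]
  ring

theorem finrank_le_succ {k M : Type*} [Field k] [AddCommGroup M] [Module k M]
    [FiniteDimensional k M] {B Z : Submodule k M}
    (h : ∀ z ∈ Z, ∀ z' ∈ Z, z ∉ B → z' ∉ B → z + z' ∈ B) :
    Module.finrank k Z ≤ Module.finrank k B + 1 := by
  by_cases hz : ∃ z ∈ Z, z ∉ B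
  · obtain ⟨z, hz, hzB⟩ := hz
    have hle : Z ≤ B ⊔ Submodule.span k {z} := by
      intro y hy
      by_cases hyB : y ∈ B
      · exact Submodule.mem_sup_left hyB
      · have h1 := h z hz y hy hzB hyB
        have h2 : y = (z + y) + (-1 : k) • z := by module
        rw [h2]
        exact Submodule.add_mem_sup h1 (Submodule.smul_mem _ _ (Submodule.mem_span_singleton_self z))
    calc Module.finrank k Z ≤ Module.finrank k ↥(B ⊔ Submodule.span k {z}) :=
          Submodule.finrank_mono hle
      _ ≤ Module.finrank k B + Module.finrank k (Submodule.span k {z}) :=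
          Submodule.finrank_add_le_finrank_add_finrank _ _
      _ ≤ _ := by gcongr; exact finrank_span_le_card {z} |>.trans (by simp)
  · push Not at hz
    exact (Submodule.finrank_mono hz).trans (Nat.le_succ _)

theorem units_cast_zmod_two (e : ℤˣ) : (((e : ℤˣ) : ℤ) : ZMod 2) = 1 := by
  rcases Int.units_eq_one_or e with rfl | rfl <;> simp

variable (K : PolygonalKnot)

/-- A cocycle modulo `2` on the nerve of a cover of the complement of a knot is a local system. -/
theorem exists_system_of_cocycle (hV : IsConvexCover V K.supportᶜ) :
    ∃ s : (ι × ι → ZMod 2) → Space → Space → Multiplicative (ZMod 2),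
      (∀ z z' P Q, s (z + z') P Q = s z P Q * s z' P Q) ∧
      ∀ ε, ∀ z ∈ cocycles V ε 2, IsSystem (s z) K.supportᶜ K.supportᶜ ∧
        (IsTrivialOn (s z) K.supportᶜ K.supportᶜ → ∃ f, coboundary V ε 2 f = z) := by
  classical
  have hmem : ∀ P : Space, ∃ i, P ∈ K.supportᶜ → P ∈ V i := by
    intro P
    by_cases hP : P ∈ K.supportᶜ
    · have := hP
      rw [hV.cover, mem_iUnion] at this
      obtain ⟨i, hi⟩ := this
      exact ⟨i, fun _ => hi⟩
    · obtain ⟨Q, hQ⟩ := K.dense_compl.nonempty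
      rw [hV.cover, mem_iUnion] at hQ
      obtain ⟨i, -⟩ := hQ
      exact ⟨i, fun h => absurd h hP⟩
  choose i hi using hmem
  set s : (ι × ι → ZMod 2) → Space → Space → Multiplicative (ZMod 2) := fun z P Q =>
    if h : ∃ c, P ∈ V c ∧ Q ∈ V c then
      .ofAdd (-z (i P, h.choose) + z (i Q, h.choose)) else 1 with hs
  refine ⟨s, fun z z' P Q => ?_, fun ε z hz => ?_⟩
  · simp only [hs]
    split_ifs
    · rw [← ofAdd_add]; congr 1; simp only [Pi.add_apply]; ring
    · rfl
  have hVX : ∀ {c P}, P ∈ V c → P ∈ K.supportᶜ := fun {c P} h => by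
    rw [hV.cover]; exact mem_iUnion.2 ⟨c, h⟩
  have hco : ∀ a b c, (V a ∩ V b ∩ V c).Nonempty → z (a, c) = z (a, b) + z (b, c) := by
    intro a b c h
    have := (mem_cocycles.1 hz).1 a b c h
    rwa [units_cast_zmod_two, one_mul] at this
  have hpot : ∀ c, ∀ x ∈ V c, Pot (s z) K.supportᶜ x fun P => .ofAdd (z (i P, c)) := by
    intro c x hx
    refine pot_iff.2 ⟨V c, hV.isOpen c, hx, ?_⟩
    rintro P ⟨hP, hP'⟩ Q ⟨hQ, hQ'⟩
    have h : ∃ c, P ∈ V c ∧ Q ∈ V c := ⟨c, hP, hQ⟩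
    simp only [hs, dif_pos h]
    rw [← ofAdd_neg, ← ofAdd_add]
    congr 1
    have e1 := hco (i P) c h.choose ⟨P, ⟨hi P hP', hP⟩, h.choose_spec.1⟩
    have e2 := hco (i Q) c h.choose ⟨Q, ⟨hi Q hQ', hQ⟩, h.choose_spec.2⟩
    rw [e1, e2]; ring
  refine ⟨fun x hx => ⟨_, hpot _ x (hi x hx)⟩, ?_⟩
  rintro ⟨f, hf⟩
  have hrat : ∀ c, ∃ t : ZMod 2, ∀ P ∈ V c, z (i P, c) = (f P).toAdd + t := by
    intro c
    obtain ⟨t, ht⟩ := IsPreconnected.exists_ratio K.dense_compl (hV.convex c).isPreconnected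
      (hV.isOpen c) (hV.nonempty c) (hpot c) (fun x hx => hf x (hVX hx))
    refine ⟨t.toAdd, fun P hP => ?_⟩
    have := congrArg Multiplicative.toAdd (ht P hP (hVX hP))
    rw [toAdd_mul] at this
    rw [add_comm]; exact this
  choose t ht using hrat
  refine ⟨t, ?_⟩
  ext ⟨a, b⟩
  by_cases hab : (V a ∩ V b).Nonempty
  · rw [coboundary_apply hab, units_cast_zmod_two, one_mul]
    obtain ⟨P, ha, hb⟩ := hab
    have e1 := ht a P ha
    have e2 := ht b P hb
    have e3 := hco (i P) a b ⟨P, ⟨hi P (hVX ha), ha⟩, hb⟩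
    have e4 : ∀ u v : ZMod 2, u - v = v - u := by decide
    rw [e4]
    linear_combination (-1 : ZMod 2) * e2 + e1 + e3
  · rw [(mem_cocycles.1 hz).2 a b hab]
    exact if_neg hab

theorem finrank_cocycles_two_le (hV : IsConvexCover V K.supportᶜ) (ε : ι → ι → ℤˣ) :
    Module.finrank (ZMod 2) (cocycles V ε 2) ≤ Fintype.card ι := by
  obtain ⟨s, hadd, hs⟩ := exists_system_of_cocycle K hV
  have h1 : Module.finrank (ZMod 2) (cocycles V ε 2) ≤
      Module.finrank (ZMod 2) (coboundary V ε 2).range + 1 := by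
    refine finrank_le_succ fun z hz z' hz' hzB hzB' => ?_
    have := isTrivialOn_mul_of_not (by decide) K.dense_compl subset_rfl
      (fun x hx => K.isPolygon.niceAt hx) K.isConnected_support (hs ε z hz).1 (hs ε z' hz').1
      (fun h => hzB ((hs ε z hz).2 h)) (fun h => hzB' ((hs ε z' hz').2 h))
    simp only [← hadd] at this
    exact (hs ε (z + z') (add_mem hz hz')).2 this
  have h2 := (coboundary V ε 2).finrank_range_add_finrank_ker
  rw [Module.finrank_fintype_fun_eq_card] at h2
  have h3 : 0 < Module.finrank (ZMod 2) (coboundary V ε 2).ker := by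
    rw [Module.finrank_pos_iff_exists_ne_zero]
    refine ⟨⟨fun _ => 1, ?_⟩, fun h => ?_⟩
    · rw [LinearMap.mem_ker]
      ext ⟨a, b⟩
      by_cases hab : (V a ∩ V b).Nonempty
      · rw [coboundary_apply hab, units_cast_zmod_two]; simp
      · exact if_neg hab
    · obtain ⟨Q, hQ⟩ := K.dense_compl.nonempty
      rw [hV.cover, mem_iUnion] at hQ
      obtain ⟨i, -⟩ := hQ
      have := congrFun (congrArg Subtype.val h) i
      simp at this
  omega

end Nerves

section ConvexCovers

/-- `X` is the union of finitely many convex open sets. -/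
def IsFiniteConvexUnion (X : Set Space) : Prop :=
  ∃ s : Set (Set Space), s.Finite ∧ (∀ V ∈ s, IsOpen V ∧ Convex ℝ V) ∧ X = ⋃₀ s

theorem IsFiniteConvexUnion.inter {X Y : Set Space} (hX : IsFiniteConvexUnion X)
    (hY : IsFiniteConvexUnion Y) : IsFiniteConvexUnion (X ∩ Y) := by
  obtain ⟨s, hs, h, rfl⟩ := hX
  obtain ⟨t, ht, h', rfl⟩ := hY
  refine ⟨Set.image2 (· ∩ ·) s t, hs.image2 _ ht, ?_, ?_⟩
  · rintro _ ⟨V, hV, W, hW, rfl⟩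
    exact ⟨(h V hV).1.inter (h' W hW).1, (h V hV).2.inter (h' W hW).2⟩
  · ext x
    simp only [mem_inter_iff, mem_sUnion, mem_image2]
    constructor
    · rintro ⟨⟨V, hV, hx⟩, W, hW, hx'⟩
      exact ⟨_, ⟨V, hV, W, hW, rfl⟩, hx, hx'⟩
    · rintro ⟨_, ⟨V, hV, W, hW, rfl⟩, hx, hx'⟩
      exact ⟨⟨V, hV, hx⟩, W, hW, hx'⟩

theorem isFiniteConvexUnion_compl_segment {A B : Space} (h : A ≠ B) :
    IsFiniteConvexUnion (segment ℝ A B)ᶜ := by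
  obtain ⟨v, hv⟩ := exists_independent (sub_ne_zero.2 h.symm)
  obtain ⟨w, c, hy, ⟨u0, u1, u2⟩, -⟩ := exists_coordinates hv
  have hlt : ∀ (i : Fin 3) (r : ℝ), IsOpen {y | c i y < r} ∧ Convex ℝ {y | c i y < r} := fun i r =>
    ⟨isOpen_lt (by fun_prop) continuous_const, convex_halfSpace_lt (c i).isLinear r⟩
  have hgt : ∀ (i : Fin 3) (r : ℝ), IsOpen {y | r < c i y} ∧ Convex ℝ {y | r < c i y} := fun i r =>
    ⟨isOpen_lt continuous_const (by fun_prop), convex_halfSpace_gt (c i).isLinear r⟩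
  refine ⟨{{y | c 0 y < c 0 A}, {y | c 0 A + 1 < c 0 y}, {y | c 1 y < c 1 A}, {y | c 1 A < c 1 y},
    {y | c 2 y < c 2 A}, {y | c 2 A < c 2 y}}, Set.toFinite _, ?_, ?_⟩
  · rintro V (rfl | rfl | rfl | rfl | rfl | rfl) <;> simp only [hlt, hgt, and_self]
  · ext y
    have key : y ∈ segment ℝ A B ↔ (c 0 A ≤ c 0 y ∧ c 0 y ≤ c 0 A + 1) ∧ c 1 y = c 1 A ∧
        c 2 y = c 2 A := by
      rw [mem_segment_iff]
      constructor
      · rintro ⟨t, h0, h1, e⟩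
        have e' : y = A + t • (B - A) := by rw [e]; module
        rw [e']
        simp only [map_add, map_smul, u0, u1, u2]
        simp [h0, h1]
      · rintro ⟨⟨h0, h1⟩, h2, h3⟩
        refine ⟨c 0 y - c 0 A, by linarith, by linarith, ?_⟩
        have := hy (y - A)
        simp only [map_sub, h2, h3, sub_self, zero_smul, add_zero] at this
        rw [sub_eq_iff_eq_add] at this
        rw [this]
        simp only [map_add, map_smul, map_sub]
        have e1 : c 0 B - c 0 A = 1 := by rw [← map_sub, u0]
        simp only [smul_eq_mul, e1]; module
    simp only [mem_compl_iff, key, mem_sUnion, mem_insert_iff, mem_singleton_iff, exists_eq_or_imp,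
      exists_eq_left, Set.mem_ofPred_eq]
    rw [not_and_or, not_and_or, not_and_or, not_le, not_le, ← ne_eq, ← ne_eq, ne_iff_lt_or_gt,
      ne_iff_lt_or_gt]
    tauto

theorem PolygonalKnot.isFiniteConvexUnion_compl (K : PolygonalKnot) :
    IsFiniteConvexUnion K.supportᶜ := by
  have hne : ∀ e ∈ polygonEdges K.vertices, e.1 ≠ e.2 := by
    intro e he
    obtain ⟨l, hl⟩ := exists_isRotated_of_mem_polygonEdges
      (by have := K.three_le_length; omega) he
    exact (K.isPolygon.isRotated hl).ne
  have key : ∀ l : List (Space × Space), (∀ e ∈ l, e.1 ≠ e.2) →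
      IsFiniteConvexUnion (⋃ e ∈ l, segment ℝ e.1 e.2)ᶜ := by
    intro l
    induction l with
    | nil =>
      intro _
      exact ⟨{univ}, Set.toFinite _, by simp [convex_univ], by simp⟩
    | cons e l ih =>
      intro h
      have : (⋃ e' ∈ e :: l, segment ℝ e'.1 e'.2)ᶜ =
          (segment ℝ e.1 e.2)ᶜ ∩ (⋃ e ∈ l, segment ℝ e.1 e.2)ᶜ := by
        ext x; simp
      rw [this]
      exact (isFiniteConvexUnion_compl_segment (h e (by simp))).inter
        (ih fun e he => h e (by simp [he]))
  exact key _ hne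

theorem PolygonalKnot.exists_convexCover (K : PolygonalKnot) :
    ∃ (ι : Type) (_ : Fintype ι) (V : ι → Set Space), IsConvexCover V K.supportᶜ := by
  obtain ⟨s, hs, h, e⟩ := K.isFiniteConvexUnion_compl
  have : Finite {V | V ∈ s ∧ V.Nonempty} := hs.subset fun V hV => hV.1
  refine ⟨{V | V ∈ s ∧ V.Nonempty}, Fintype.ofFinite _, Subtype.val, fun V => (h V V.2.1).1,
    fun V => (h V V.2.1).2, fun V => V.2.2, ?_⟩
  rw [e]
  ext x
  simp only [mem_sUnion, mem_iUnion, Subtype.exists, Set.mem_ofPred_eq, exists_prop]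
  exact ⟨fun ⟨V, hV, hx⟩ => ⟨V, ⟨hV, x, hx⟩, hx⟩, fun ⟨V, hV, hx⟩ => ⟨V, hV.1, hx⟩⟩

end ConvexCovers

section Finiteness

/-- The complement of a knot is connected. -/
theorem PolygonalKnot.eq_of_locConst (K : PolygonalKnot) {α : Type*} {u : Space → α}
    {D : Set Space} (hD : Dense D) (hDK : D ⊆ K.supportᶜ)
    (hu : ∀ x ∈ K.supportᶜ, LocConst u D x) {P Q : Space} (hP : P ∈ D) (hQ : Q ∈ D) :
    u P = u Q := by
  refine LocConst.eq_of_isPreconnected hD isPreconnected_univ (fun x _ => ?_) trivial hP trivial hQ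
  by_cases hx : x ∈ K.support
  · obtain ⟨r, hr, -, U, W, hc, -⟩ := K.isPolygon.niceAt hx 1 one_pos
    refine locConst_iff.2 ⟨Metric.ball x r, Metric.isOpen_ball, Metric.mem_ball_self hr, ?_⟩
    intro a ha b hb
    exact LocConst.eq_of_isPreconnected hD hc.isPreconnected (fun z hz => hu z hz.2)
      ⟨ha.1, hDK ha.2⟩ ha.2 ⟨hb.1, hDK hb.2⟩ hb.2
  · exact hu x hx

/-- The sign of the representative of smallest absolute value. -/
def zmodSign {p : ℕ} (x : ZMod p) : ℤˣ := if 0 < x.valMinAbs then 1 else -1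

theorem zmodSign_mul {p : ℕ} [Fact p.Prime] (hp : p ≠ 2) {x : ZMod p} (hx : x ≠ 0) (e : ℤˣ) :
    zmodSign ((((e : ℤˣ) : ℤ) : ZMod p) * x) = e * zmodSign x := by
  rcases Int.units_eq_one_or e with rfl | rfl
  · simp
  · have h1 : (-x).valMinAbs = -x.valMinAbs := by
      refine ZMod.valMinAbs_neg_of_ne_half fun h => ?_
      exact hp (((Fact.out : p.Prime).eq_two_or_odd').resolve_right
        (fun ho => Nat.not_even_iff_odd.2 ho ⟨x.val, by omega⟩))
    have h2 : x.valMinAbs ≠ 0 := by rwa [ne_eq, ZMod.valMinAbs_eq_zero]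
    simp only [zmodSign, Units.val_neg, Units.val_one, Int.cast_neg, Int.cast_one, neg_mul, one_mul,
      h1]
    split_ifs <;> first | omega | rfl

theorem dihedralShift_mul {m : ℕ} (g g' : DihedralGroup m) : dihedralShift (g * g') =
    dihedralShift g + ((dihedralSign m g : ℤˣ) : ℤ) * dihedralShift g' := by
  have := dihedralAct_mul g g' 0
  simpa [dihedralAct] using this

variable {ι : Type} [Fintype ι] [DecidableEq ι] {V : ι → Set Space} (K : PolygonalKnot) {p : ℕ}

theorem coboundary_injective [Fact p.Prime] (hp : p ≠ 2) (hV : IsConvexCover V K.supportᶜ)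
    {D : Set Space} (hD : Dense D) (hDK : D ⊆ K.supportᶜ) {σ : Space → Space → ℤˣ}
    (hσ : ¬ IsTrivialOn σ D K.supportᶜ) {e : ι → Space → ℤˣ}
    (he : ∀ a, ∀ x ∈ V a, Pot σ D x (e a)) {ε : ι → ι → ℤˣ}
    (hε : ∀ a b, ∀ P ∈ V a ∩ V b, P ∈ D → e a P = ε a b * e b P) :
    Function.Injective (coboundary V ε p) := by
  rw [injective_iff_map_eq_zero]
  intro f hf
  have hfa : ∀ a b, (V a ∩ V b).Nonempty → f a = ((ε a b : ℤˣ) : ℤ) * f b := fun a b h => by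
    rw [← sub_eq_zero, ← coboundary_apply h, hf]; rfl
  have hmem : ∀ P : Space, ∃ i, P ∈ K.supportᶜ → P ∈ V i := by
    intro P
    by_cases hP : P ∈ K.supportᶜ
    · have := hP
      rw [hV.cover, mem_iUnion] at this
      exact this.imp fun i hi _ => hi
    · obtain ⟨Q, hQ⟩ := K.dense_compl.nonempty
      rw [hV.cover, mem_iUnion] at hQ
      exact hQ.imp fun i _ h => absurd h hP
  choose i hi using hmem
  have hVX : ∀ {c P}, P ∈ V c → P ∈ K.supportᶜ := fun {c P} h => by
    rw [hV.cover]; exact mem_iUnion.2 ⟨c, h⟩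
  have hzero : ∀ a b, (V a ∩ V b).Nonempty → (f a = 0 ↔ f b = 0) := fun a b h => by
    rw [hfa a b h]
    rcases Int.units_eq_one_or (ε a b) with h | h <;> simp [h]
  by_contra hne
  obtain ⟨a0, ha0⟩ := Function.ne_iff.1 hne
  have hall : ∀ P ∈ D, f (i P) ≠ 0 := by
    intro P hP h0
    obtain ⟨Q, hQ, hQD⟩ := hD.inter_open_nonempty _ (hV.isOpen a0) (hV.nonempty a0)
    have := K.eq_of_locConst (u := fun P => f (i P) = 0) hD hDK (fun x hx => by
      refine locConst_iff.2 ⟨V (i x), hV.isOpen _, hi x hx, fun a ha b hb => propext ?_⟩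
      rw [hzero (i a) (i x) ⟨a, hi a (hDK ha.2), ha.1⟩,
        hzero (i b) (i x) ⟨b, hi b (hDK hb.2), hb.1⟩]) hP hQD
    rw [eq_iff_iff] at this
    exact ha0 ((hzero (i Q) a0 ⟨Q, hi Q (hDK hQD), hQ⟩).1 (this.1 h0))
  refine hσ ⟨fun P => zmodSign (f (i P)) * e (i P) P, fun x hx => ?_⟩
  refine ((he (i x) x (hi x hx)).const_mul (zmodSign (f (i x)))).congr ?_
  filter_upwards [mem_nhdsWithin_of_mem_nhds ((hV.isOpen _).mem_nhds (hi x hx)),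
    self_mem_nhdsWithin] with P hP hPD
  have h1 : P ∈ V (i x) ∩ V (i P) := ⟨hP, hi P (hDK hPD)⟩
  rw [hfa _ _ ⟨P, h1⟩, zmodSign_mul hp (hall P hPD), hε _ _ P h1 hPD, mul_mul_mul_comm,
    Int.units_mul_self, one_mul]

theorem finrank_cocycles_of_colorable [Fact p.Prime] (hp : p ≠ 2)
    (hV : IsConvexCover V K.supportᶜ) (hK : Colorable p K.support) :
    ∃ ε, ¬ Module.finrank (ZMod p) (cocycles V ε p) ≤ Fintype.card ι := by
  classical
  obtain ⟨D, φ, hD, hDK, hφ⟩ := hK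
  have hVX : ∀ {c P}, P ∈ V c → P ∈ K.supportᶜ := fun {c P} h => by
    rw [hV.cover]; exact mem_iUnion.2 ⟨c, h⟩
  have hg : ∀ a, IsTrivialOn φ D (V a) := fun a => by
    obtain ⟨w, hw⟩ := hV.nonempty a
    exact (hφ.isSystem.mono (fun x hx => hVX hx) subset_rfl).isTrivialOn_of_starConvex hD
      (hV.isOpen a) hw ((hV.convex a).starConvex hw)
  choose g hg using hg
  have hT : ∀ a b, ∃ c, (∀ P ∈ V a ∩ V b, P ∈ D → g a P = c * g b P) ∧
      (¬ (V a ∩ V b).Nonempty → c = 1) := by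
    intro a b
    by_cases hab : (V a ∩ V b).Nonempty
    · obtain ⟨c, hc⟩ := IsPreconnected.exists_ratio hD
        ((hV.convex a).inter (hV.convex b)).isPreconnected ((hV.isOpen a).inter (hV.isOpen b)) hab
        (fun x hx => hg a x hx.1) (fun x hx => hg b x hx.2)
      exact ⟨c, hc, fun h => absurd hab h⟩
    · exact ⟨1, fun P hP => absurd ⟨P, hP⟩ hab, fun _ => rfl⟩
  choose T hT hT1 using hT
  set ε : ι → ι → ℤˣ := fun a b => dihedralSign p (T a b) with hε
  have hTco : ∀ a b c, (V a ∩ V b ∩ V c).Nonempty → T a c = T a b * T b c := by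
    intro a b c h
    obtain ⟨P, ⟨⟨h1, h2⟩, h3⟩, hPD⟩ := hD.inter_open_nonempty _
      (((hV.isOpen a).inter (hV.isOpen b)).inter (hV.isOpen c)) h
    have e1 := hT a c P ⟨h1, h3⟩ hPD
    rw [hT a b P ⟨h1, h2⟩ hPD, hT b c P ⟨h2, h3⟩ hPD, ← mul_assoc] at e1
    exact (mul_right_cancel e1).symm
  refine ⟨ε, fun hle => ?_⟩
  have hinj : Function.Injective (coboundary V ε p) := coboundary_injective K hp hV hD hDK hφ.sign
    (e := fun a P => dihedralSign p (g a P)) (fun a x hx => (hg a x hx).map _)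
    fun a b P hP hPD => by simp only [hε, ← map_mul, hT a b P hP hPD]
  have hrange : (coboundary V ε p).range ≤ cocycles V ε p := by
    rintro _ ⟨f, rfl⟩
    refine coboundary_mem_cocycles f fun a b c h => ?_
    simp only [hε, hTco a b c h, map_mul, Units.val_mul, Int.cast_mul]
  have heq : (coboundary V ε p).range = cocycles V ε p := by
    refine Submodule.eq_of_le_of_finrank_le hrange ?_
    rw [LinearMap.finrank_range_of_inj hinj, Module.finrank_fintype_fun_eq_card]
    exact hle
  obtain ⟨f, hf⟩ : (fun q : ι × ι => dihedralShift (T q.1 q.2)) ∈ (coboundary V ε p).range := by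
    rw [heq]
    refine mem_cocycles.2 ⟨fun a b c h => ?_, fun a b h => ?_⟩
    · simp only [hTco a b c h, dihedralShift_mul, hε]
    · simp only [hT1 a b h]; rfl
  have hfT : ∀ a b, (V a ∩ V b).Nonempty → f a = dihedralAct (T a b) (f b) := fun a b h => by
    have := congrFun hf (a, b)
    rw [coboundary_apply h] at this
    rw [dihedralAct, ← this]; ring
  have hmem : ∀ P : Space, ∃ i, P ∈ K.supportᶜ → P ∈ V i := by
    intro P
    by_cases hP : P ∈ K.supportᶜ
    · have := hP
      rw [hV.cover, mem_iUnion] at this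
      exact this.imp fun i hi _ => hi
    · obtain ⟨Q, hQ⟩ := K.dense_compl.nonempty
      rw [hV.cover, mem_iUnion] at hQ
      exact hQ.imp fun i _ h => absurd h hP
  choose i hi using hmem
  refine hφ.not_flat (fun P => dihedralAct (g (i P) P)⁻¹ (f (i P))) fun x hx => ?_
  obtain ⟨N, hN, hxN, h⟩ := pot_iff.1 (hg (i x) x (hi x hx))
  have hev : ∀ᶠ P in 𝓝[D] x, P ∈ N ∩ D ∧
      dihedralAct (g (i P) P)⁻¹ (f (i P)) = dihedralAct (g (i x) P)⁻¹ (f (i x)) := by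
    filter_upwards [mem_nhdsWithin_of_mem_nhds ((hV.isOpen _).mem_nhds (hi x hx)),
      mem_nhdsWithin_of_mem_nhds (hN.mem_nhds hxN), self_mem_nhdsWithin] with P hP hPN hPD
    have h1 : P ∈ V (i x) ∩ V (i P) := ⟨hP, hi P (hDK hPD)⟩
    refine ⟨⟨hPN, hPD⟩, ?_⟩
    rw [hfT _ _ ⟨P, h1⟩, ← dihedralAct_mul, hT _ _ P h1 hPD, mul_inv_rev, inv_mul_cancel_right]
  filter_upwards [hev.prod_mk hev] with q hq
  rw [hq.1.2, hq.2.2, h _ hq.1.1 _ hq.2.1, ← dihedralAct_mul, mul_inv_cancel_right]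

/-- A knot is colorable modulo finitely many primes only. -/
theorem PolygonalKnot.exists_bound_of_colorable :
    ∃ N, ∀ p, p.Prime → Colorable p K.support → p ≤ N := by
  classical
  obtain ⟨ι, _, V, hV⟩ := K.exists_convexCover
  have h := fun ε => exists_forall_finrank_ker_le (cocycleMatrix V ε)
    (finrank_cocycles_two_le K hV ε)
  choose d hd0 hd using h
  refine ⟨2 + ∑ ε, (d ε).natAbs, fun p hp hK => ?_⟩
  by_contra! hlt
  have : Fact p.Prime := ⟨hp⟩
  obtain ⟨ε, hε⟩ := finrank_cocycles_of_colorable K (by omega) hV hK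
  refine hε (hd ε p fun hdvd => ?_)
  have h1 := Int.le_of_dvd (by simpa using hd0 ε) ((dvd_abs _ _).2 hdvd)
  have h2 := Finset.single_le_sum (f := fun ε => (d ε).natAbs) (fun _ _ => Nat.zero_le _)
    (Finset.mem_univ ε)
  rw [Int.abs_eq_natAbs] at h1
  omega

end Finiteness

section HalfPlanes
variable {E : Type*} [NormedAddCommGroup E] [NormedSpace ℝ E] {b w : E →L[ℝ] ℝ} {x y : E}
  {D : Set E}

open Classical in
/-- The two-point function that is `-1` when `q` changes where `p` holds. -/
noncomputable def flipSign (p q : E → Prop) (P Q : E) : ℤˣ :=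
  if p P ∧ ¬(q P ↔ q Q) then -1 else 1

open Classical in
/-- The sign `1` where `q` holds and `-1` elsewhere. -/
noncomputable def sideSign (q : E → Prop) (P : E) : ℤˣ := if q P then 1 else -1

section
variable {p q : E → Prop} {P Q : E}

theorem flipSign_of_not (h : ¬p P) : flipSign p q P Q = 1 := if_neg fun h' => h h'.1

theorem flipSign_of_iff (h : q P ↔ q Q) : flipSign p q P Q = 1 := if_neg fun h' => h'.2 h

theorem flipSign_of_pos (h : p P) : flipSign p q P Q = (sideSign q P)⁻¹ * sideSign q Q := by
  by_cases h1 : q P <;> by_cases h2 : q Q <;> simp [flipSign, sideSign, h, h1, h2]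

theorem pot_flipSign_of_not (h : ∀ᶠ P in 𝓝 x, ¬p P) : Pot (flipSign p q) D x 1 := by
  have := eventually_nhdsWithin_of_eventually_nhds (s := D) h
  filter_upwards [Filter.Eventually.prod_mk this this] with r hr
  rw [flipSign_of_not hr.1]; simp

theorem pot_flipSign_of_iff (h : (∀ᶠ P in 𝓝 x, q P) ∨ ∀ᶠ P in 𝓝 x, ¬q P) :
    Pot (flipSign p q) D x 1 := by
  rcases h with h | h <;>
  · have := eventually_nhdsWithin_of_eventually_nhds (s := D) h
    filter_upwards [Filter.Eventually.prod_mk this this] with r hr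
    rw [flipSign_of_iff (by simp [hr.1, hr.2])]; simp

theorem pot_flipSign_of_pos (h : ∀ᶠ P in 𝓝 x, p P) : Pot (flipSign p q) D x (sideSign q) := by
  have := eventually_nhdsWithin_of_eventually_nhds (s := D) h
  filter_upwards [Filter.Eventually.prod_mk this this] with r hr using flipSign_of_pos hr.1

end

/-- The sign local system that changes sign along the half-plane `b > 0`, `w = 0` through `x`. -/
noncomputable def halfSign (b w : E →L[ℝ] ℝ) (x : E) : E → E → ℤˣ :=
  flipSign (fun P => 0 < b (P - x)) fun P => 0 < w (P - x)

theorem eventually_pos {c : E →L[ℝ] ℝ} (h : 0 < c (y - x)) : ∀ᶠ P in 𝓝 y, 0 < c (P - x) :=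
  (isOpen_lt continuous_const (by fun_prop) : IsOpen {P | 0 < c (P - x)}).eventually_mem h

theorem eventually_neg {c : E →L[ℝ] ℝ} (h : c (y - x) < 0) : ∀ᶠ P in 𝓝 y, ¬0 < c (P - x) :=
  ((isOpen_lt (by fun_prop) continuous_const : IsOpen {P | c (P - x) < 0}).eventually_mem h).mono
    fun _ h => not_lt.2 (le_of_lt h)

theorem not_meridianTrivial_halfSign {eb ew : E} (hbb : b eb = 1) (hbw : b ew = 0)
    (hwb : w eb = 0) (hww : w ew = 1) (hD : Dense D) :
    ¬ MeridianTrivial (halfSign b w x) D {p | b (p - x) = 0 ∧ w (p - x) = 0} x := by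
  classical
  rintro ⟨f, hf⟩
  obtain ⟨ρ, hρ, hsub⟩ := Metric.eventually_nhds_iff_ball.1 hf
  set s : E → ℤˣ := sideSign fun P => 0 < w (P - x)
  have hconv : ∀ (c : E →L[ℝ] ℝ) (i : Bool), IsOpen (Metric.ball x ρ ∩ {z | 0 < boolSign i * c (z - x)}) ∧
      Convex ℝ (Metric.ball x ρ ∩ {z | 0 < boolSign i * c (z - x)}) := fun c i => by
    refine ⟨Metric.isOpen_ball.inter (isOpen_lt continuous_const (by fun_prop)),
      (convex_ball x ρ).inter ?_⟩
    intro u hu v hv s t hs ht hst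
    simp only [Set.mem_ofPred_eq, map_sub, map_add, map_smul, smul_eq_mul] at hu hv ⊢
    have : boolSign i * (s * c u + t * c v - c x) =
      s * (boolSign i * (c u - c x)) + t * (boolSign i * (c v - c x)) := by
      rw [← sub_eq_zero]
      linear_combination (boolSign i * c x) * (hst)
    rw [this]
    rcases hs.eq_or_lt with rfl | hs
    · rw [zero_add] at hst; subst hst; simpa using hv
    · exact add_pos_of_pos_of_nonneg (mul_pos hs hu) (mul_nonneg ht hv.le)
  have hgen : ∀ (c : E →L[ℝ] ℝ) (i : Bool) (g : E → ℤˣ),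
      (∀ z, 0 < boolSign i * c (z - x) → ¬(b (z - x) = 0 ∧ w (z - x) = 0)) →
      (∀ z, 0 < boolSign i * c (z - x) → Pot (halfSign b w x) D z g) →
      ∃ a : ℤˣ, ∀ P ∈ Metric.ball x ρ, 0 < boolSign i * c (P - x) → P ∈ D → f P = a * g P := by
    intro c i g h1 h2
    by_cases hne : (Metric.ball x ρ ∩ {z | 0 < boolSign i * c (z - x)}).Nonempty
    · obtain ⟨a, ha⟩ := IsPreconnected.exists_ratio (φ := halfSign b w x) (f := f) (g := g) hD
        (hconv c i).2.isPreconnected (hconv c i).1 hne (fun z hz => hsub z hz.1 (h1 z hz.2))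
        (fun z hz => h2 z hz.2)
      exact ⟨a, fun P hP hP' => ha P ⟨hP, hP'⟩⟩
    · exact ⟨1, fun P hP hP' => absurd ⟨P, hP, hP'⟩ hne⟩
  have hpos : ∀ (c : E →L[ℝ] ℝ) z, 0 < boolSign true * c (z - x) → 0 < c (z - x) := by
    intro c z hz; rwa [boolSign, cond_true, one_mul] at hz
  have hneg : ∀ (c : E →L[ℝ] ℝ) z, 0 < boolSign false * c (z - x) → c (z - x) < 0 := by
    intro c z hz; rw [boolSign, cond_false] at hz; linarith
  obtain ⟨a1, ha1⟩ := hgen w true 1 (fun z hz h => by simp [h.2] at hz)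
    fun z hz => pot_flipSign_of_iff (Or.inl (eventually_pos (hpos w z hz)))
  obtain ⟨a2, ha2⟩ := hgen w false 1 (fun z hz h => by simp [h.2] at hz)
    fun z hz => pot_flipSign_of_iff (Or.inr (eventually_neg (hneg w z hz)))
  obtain ⟨a3, ha3⟩ := hgen b false 1 (fun z hz h => by simp [h.1] at hz)
    fun z hz => pot_flipSign_of_not (eventually_neg (hneg b z hz))
  obtain ⟨a4, ha4⟩ := hgen b true s (fun z hz h => by simp [h.1] at hz)
    fun z hz => pot_flipSign_of_pos (eventually_pos (hpos b z hz))
  have hex : ∀ i j : Bool, ∃ P ∈ Metric.ball x ρ, 0 < boolSign i * w (P - x) ∧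
      0 < boolSign j * b (P - x) ∧ P ∈ D := by
    intro i j
    have hne : (Metric.ball x ρ ∩ {z | 0 < boolSign i * w (z - x)} ∩
        {z | 0 < boolSign j * b (z - x)}).Nonempty := by
      set v : E := boolSign i • ew + boolSign j • eb with hv
      set r := ρ / (2 * (‖v‖ + 1)) with hr
      have hr0 : 0 < r := by positivity
      have hsq : ∀ i, boolSign i * boolSign i = 1 := by rintro (_ | _) <;> simp [boolSign]
      refine ⟨x + r • v, ⟨?_, ?_⟩, ?_⟩
      · rw [Metric.mem_ball, dist_eq_norm, add_sub_cancel_left, norm_smul, Real.norm_eq_abs,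
          abs_of_pos hr0, hr, div_mul_eq_mul_div, div_lt_iff₀ (by positivity)]
        nlinarith [norm_nonneg v]
      · simp only [Set.mem_ofPred_eq, add_sub_cancel_left, map_smul, hv, map_add, smul_eq_mul, hwb,
          hww]
        nlinarith [hsq i]
      · simp only [Set.mem_ofPred_eq, add_sub_cancel_left, map_smul, hv, map_add, smul_eq_mul, hbb,
          hbw]
        nlinarith [hsq j]
    obtain ⟨P, ⟨⟨h1, h2⟩, h3⟩, h4⟩ := hD.inter_open_nonempty _
      ((hconv w i).1.inter (isOpen_lt continuous_const (by fun_prop) :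
        IsOpen {z | 0 < boolSign j * b (z - x)})) hne
    exact ⟨P, h1, h2, h3, h4⟩
  obtain ⟨P1, h11, h12, h13, h14⟩ := hex true false
  obtain ⟨P2, h21, h22, h23, h24⟩ := hex false false
  obtain ⟨P3, h31, h32, h33, h34⟩ := hex true true
  obtain ⟨P4, h41, h42, h43, h44⟩ := hex false true
  have q1 := (ha1 P1 h11 h12 h14).symm.trans (ha3 P1 h11 h13 h14)
  have q2 := (ha2 P2 h21 h22 h24).symm.trans (ha3 P2 h21 h23 h24)
  have q3 := (ha1 P3 h31 h32 h34).symm.trans (ha4 P3 h31 h33 h34)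
  have q4 := (ha2 P4 h41 h42 h44).symm.trans (ha4 P4 h41 h43 h44)
  have s3 : s P3 = 1 := if_pos (hpos w _ h32)
  have s4 : s P4 = -1 := if_neg (not_lt.2 (hneg w _ h42).le)
  simp only [Pi.one_apply, mul_one, s3, s4] at q1 q2 q3 q4
  rw [q1, ← q2, q4] at q3
  exact absurd q3 (by rcases Int.units_eq_one_or a4 with rfl | rfl <;> decide)

end HalfPlanes

section Strips

/-- A two-point function that is a half-plane system near `x`. -/
theorem niceAt_of_halfPlane {E : Type*} [NormedAddCommGroup E] [NormedSpace ℝ E]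
    {p q : E → Prop} {K : Set E} {x : E} {b w : E →L[ℝ] ℝ} {eb ew : E}
    (hbb : b eb = 1) (hbw : b ew = 0) (hwb : w eb = 0) (hww : w ew = 1)
    (h : ∀ᶠ P in 𝓝 x, (p P ↔ 0 < b (P - x)) ∧ (q P ↔ 0 < w (P - x)) ∧
      (P ∈ K ↔ b (P - x) = 0 ∧ w (P - x) = 0)) :
    NiceAt K x ∧ ∀ D, Dense D → ¬ MeridianTrivial (flipSign p q) D K x := by
  classical
  constructor
  · obtain ⟨ρ, hρ, hsub⟩ := Metric.eventually_nhds_iff_ball.1 h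
    exact (niceAt_straight hbb hbw hwb hww).congr hρ fun y hy => (hsub y hy).2.2.symm
  · rintro D hD ⟨f, hf⟩
    refine not_meridianTrivial_halfSign (x := x) hbb hbw hwb hww hD ⟨f, ?_⟩
    filter_upwards [hf, h, h.eventually_nhds] with y h1 h2 h3 hy
    refine (h1 fun hyK => hy (h2.2.2.1 hyK)).congr_system ?_
    have h4 := eventually_nhdsWithin_of_eventually_nhds (s := D) h3
    filter_upwards [h4.prod_mk h4] with r hr
    simp only [halfSign, flipSign, hr.1.1, hr.1.2.1, hr.2.2.1]

/-- The open ray from `v` in direction `w`. -/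
def ray (v w : Space) : Set Space := {P | ∃ r : ℝ, 0 < r ∧ P = v + r • w}

theorem eventually_notMem_ray {v w x : Space} (hw : w ≠ 0) (hx : x ∉ ray v w) (hxv : x ≠ v) :
    ∀ᶠ y in 𝓝 x, y ∉ ray v w := by
  have hc : IsClosed ((fun r : ℝ => v + r • w) '' Ici 0) :=
    ((Homeomorph.addLeft v).isClosedEmbedding.comp
      (isClosedEmbedding_smul_left (𝕜 := ℝ) hw)).isClosedMap _ isClosed_Ici
  have hx' : x ∉ (fun r : ℝ => v + r • w) '' Ici 0 := by
    rintro ⟨r, hr, rfl⟩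
    rcases (show (0 : ℝ) ≤ r from hr).eq_or_lt with rfl | hr
    · simp at hxv
    · exact hx ⟨r, hr, rfl⟩
  filter_upwards [hc.isOpen_compl.mem_nhds hx'] with y hy
  rintro ⟨r, hr, rfl⟩
  exact hy ⟨r, hr.le, rfl⟩

/-- The sign system of the strip over an edge. -/
theorem exists_strip {a e w : Space}
    (h : ∀ x y : ℝ, x • (e - a) + y • w = 0 → x = 0 ∧ y = 0) :
    ∃ σ : Space → Space → ℤˣ,
      (∀ D x, x ∉ segment ℝ a e → x ∉ ray a w → x ∉ ray e w → ∃ f, Pot σ D x f) ∧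
      (∀ v, v = a ∨ v = e → ∀ x ∈ ray v w, NiceAt (ray v w) x ∧
        ∀ D, Dense D → ¬ MeridianTrivial σ D (ray v w) x) ∧
      ∀ x ∈ openSegment ℝ a e, ∀ D, Dense D → ¬ MeridianTrivial σ D (segment ℝ a e) x := by
  obtain ⟨n, c, hy, ⟨hu0, hu1, hu2⟩, ⟨hw0, hw1, hw2⟩, hn0, hn1, hn2⟩ := exists_coordinates h
  have hraya : ∀ x, x ∈ ray a w ↔ c 0 (x - a) = 0 ∧ 0 < c 1 (x - a) ∧ c 2 (x - a) = 0 := by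
    intro x
    constructor
    · rintro ⟨r, hr, rfl⟩
      simp [hw0, hw1, hw2, hr]
    · rintro ⟨h0, h1, h2⟩
      refine ⟨_, h1, ?_⟩
      have := hy (x - a)
      rw [h0, h2, zero_smul, zero_smul, zero_add, add_zero] at this
      rw [← this]; module
  have hraye : ∀ x, x ∈ ray e w ↔ c 0 (x - a) = 1 ∧ 0 < c 1 (x - a) ∧ c 2 (x - a) = 0 := by
    intro x
    constructor
    · rintro ⟨r, hr, rfl⟩
      have : e + r • w - a = (e - a) + r • w := by module
      rw [this]
      simp only [map_add, map_smul, hu0, hu1, hu2, hw0, hw1, hw2]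
      simpa using hr
    · rintro ⟨h0, h1, h2⟩
      refine ⟨_, h1, ?_⟩
      have := hy (x - a)
      rw [h0, h2, zero_smul, one_smul, add_zero] at this
      rw [sub_eq_iff_eq_add] at this
      nth_rw 1 [this]; module
  have hseg : ∀ x, x ∈ segment ℝ a e ↔
      (0 ≤ c 0 (x - a) ∧ c 0 (x - a) ≤ 1) ∧ c 1 (x - a) = 0 ∧ c 2 (x - a) = 0 := by
    intro x
    rw [mem_segment_iff]
    constructor
    · rintro ⟨t, h0, h1, rfl⟩
      have : (1 - t) • a + t • e - a = t • (e - a) := by module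
      rw [this]
      simp only [map_smul, hu0, hu1, hu2]
      simp [h0, h1]
    · rintro ⟨⟨h0, h1⟩, h2, h3⟩
      refine ⟨_, h0, h1, ?_⟩
      have := hy (x - a)
      rw [h2, h3, zero_smul, zero_smul, add_zero, add_zero, sub_eq_iff_eq_add] at this
      nth_rw 1 [this]; module
  have hlt : ∀ (i : Fin 3) (r : ℝ) {x}, c i (x - a) < r → ∀ᶠ P in 𝓝 x, c i (P - a) < r :=
    fun i r x hx => (isOpen_lt (by fun_prop) continuous_const :
      IsOpen {P | c i (P - a) < r}).eventually_mem hx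
  have hgt : ∀ (i : Fin 3) (r : ℝ) {x}, r < c i (x - a) → ∀ᶠ P in 𝓝 x, r < c i (P - a) :=
    fun i r x hx => (isOpen_lt continuous_const (by fun_prop) :
      IsOpen {P | r < c i (P - a)}).eventually_mem hx
  have hsub : ∀ (i : Fin 3) (P x : Space), c i (P - x) = c i (P - a) - c i (x - a) := by
    intro i P x; rw [← map_sub]; congr 1; abel
  refine ⟨flipSign (fun P => 0 < c 0 (P - a) ∧ c 0 (P - a) < 1 ∧ 0 < c 1 (P - a))
    fun P => 0 < c 2 (P - a), fun D x h1 h2 h3 => ?_, ?_, fun x hx => ?_⟩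
  · rcases lt_trichotomy (c 2 (x - a)) 0 with hz | hz | hz
    · exact ⟨_, pot_flipSign_of_iff (Or.inr ((hlt 2 0 hz).mono fun _ h => not_lt.2 h.le))⟩
    · rcases lt_or_ge (c 0 (x - a)) 0 with h4 | h4
      · exact ⟨_, pot_flipSign_of_not ((hlt 0 0 h4).mono fun _ h h' => (lt_asymm h h'.1).elim)⟩
      rcases lt_or_ge 1 (c 0 (x - a)) with h5 | h5
      · exact ⟨_, pot_flipSign_of_not ((hgt 0 1 h5).mono fun _ h h' => (lt_asymm h h'.2.1).elim)⟩
      rcases lt_trichotomy (c 1 (x - a)) 0 with h6 | h6 | h6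
      · exact ⟨_, pot_flipSign_of_not ((hlt 1 0 h6).mono fun _ h h' => (lt_asymm h h'.2.2).elim)⟩
      · exact absurd ((hseg x).2 ⟨⟨h4, h5⟩, h6, hz⟩) h1
      · have h7 : 0 < c 0 (x - a) := h4.lt_of_ne fun h => h2 ((hraya x).2 ⟨h.symm, h6, hz⟩)
        have h8 : c 0 (x - a) < 1 := h5.lt_of_ne fun h => h3 ((hraye x).2 ⟨h, h6, hz⟩)
        exact ⟨_, pot_flipSign_of_pos ((hgt 0 0 h7).and ((hlt 0 1 h8).and (hgt 1 0 h6)))⟩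
    · exact ⟨_, pot_flipSign_of_iff (Or.inl (hgt 2 0 hz))⟩
  · rintro v (rfl | rfl) x hx
    · obtain ⟨h0, h1, h2⟩ := (hraya x).1 hx
      refine niceAt_of_halfPlane (b := c 0) (w := c 2) hu0 hn0 hu2 hn2 ?_
      filter_upwards [hgt 1 0 h1, hlt 0 1 (by rw [h0]; exact one_pos)] with P h3 h4
      rw [hsub 0 P x, hsub 2 P x, h0, h2, sub_zero, sub_zero, hraya]
      tauto
    · obtain ⟨h0, h1, h2⟩ := (hraye x).1 hx
      refine niceAt_of_halfPlane (b := -c 0) (w := c 2) (eb := -(v - a)) (ew := n) (by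
          rw [neg_apply, map_neg, hu0, neg_neg]) (by simp [hn0]) (by rw [map_neg, hu2, neg_zero]) hn2 ?_
      filter_upwards [hgt 1 0 h1, hgt 0 0 (by rw [h0]; exact one_pos)] with P h3 h4
      rw [neg_apply, hsub 0 P x, hsub 2 P x, h0, h2, sub_zero, hraye,
        neg_sub, sub_pos, sub_eq_zero, eq_comm (a := (1 : ℝ))]
      tauto
  · obtain ⟨t, ht0, ht1, hxt⟩ := mem_openSegment_iff.1 hx
    have hxa : x - a = t • (e - a) := by rw [hxt]; module
    have h0 : c 0 (x - a) = t := by rw [hxa, map_smul, hu0, smul_eq_mul, mul_one]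
    have h1 : c 1 (x - a) = 0 := by rw [hxa, map_smul, hu1, smul_zero]
    have h2 : c 2 (x - a) = 0 := by rw [hxa, map_smul, hu2, smul_zero]
    refine (niceAt_of_halfPlane (b := c 1) (w := c 2) hw1 hn1 hw2 hn2 ?_).2
    filter_upwards [hgt 0 0 (by rw [h0]; exact ht0), hlt 0 1 (by rw [h0]; exact ht1)] with P h3 h4
    rw [hsub 1 P x, hsub 2 P x, h1, h2, sub_zero, sub_zero, hseg]
    exact ⟨⟨fun h => h.2.2, fun h => ⟨h3, h4, h⟩⟩, Iff.rfl, ⟨fun h => h.2, fun h => ⟨⟨h3.le, h4.le⟩, h⟩⟩⟩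

end Strips

section SignSystem

theorem exists_pot_prod {E : Type*} [TopologicalSpace E] {ι : Type*} {s : ι → E → E → ℤˣ}
    {D : Set E} {x : E} {l : List ι} (h : ∀ i ∈ l, ∃ f, Pot (s i) D x f) :
    ∃ f, Pot (fun P Q => (l.map fun i => s i P Q).prod) D x f := by
  induction l with
  | nil => exact ⟨1, by simp [Pot]⟩
  | cons i l ih =>
    obtain ⟨f, hf⟩ := h i (by simp)
    obtain ⟨g, hg⟩ := ih fun i hi => h i (by simp [hi])
    exact ⟨_, by simpa using hf.mul hg⟩

theorem exists_isRotated_of_mem {k : List Space} (hk : 3 ≤ k.length) {v : Space} (hv : v ∈ k) :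
    ∃ Z B l, k ~r (Z :: v :: B :: l) := by
  obtain ⟨s, t, rfl⟩ := List.append_of_mem hv
  have h1 : (s ++ v :: t) ~r (v :: (t ++ s)) := by
    simpa using (List.isRotated_append (l := s) (l' := v :: t))
  have hlen : 2 ≤ (t ++ s).length := by simp at hk ⊢; omega
  match h : t ++ s, hlen with
  | B :: Y :: r, _ =>
    rw [h] at h1
    rcases List.eq_nil_or_concat (Y :: r) with h2 | ⟨l, Z, h2⟩
    · simp at h2
    · rw [h2, List.concat_eq_append] at h1
      exact ⟨Z, B, l, h1.trans (List.IsRotated.symm ⟨1, by simp⟩)⟩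

/-- The complement of a polygonal knot has a nontrivial local system of signs. -/
theorem IsPolygon.exists_signSystem {k : List Space} (h : IsPolygon k) :
    ∃ (D : Set Space) (σ : Space → Space → ℤˣ), Dense D ∧ D ⊆ (polygonSupport k)ᶜ ∧
      IsSystem σ D (polygonSupport k)ᶜ ∧ ¬ IsTrivialOn σ D (polygonSupport k)ᶜ := by
  classical
  obtain ⟨w, hw⟩ : ∃ w : Space, ∀ u ∈ k, ∀ v ∈ k, u ≠ v →
      ∀ x y : ℝ, x • (v - u) + y • w = 0 → x = 0 ∧ y = 0 := by
    have hf : ((fun p : Space × Space => plane 0 (p.2 - p.1) 0) '' {p | p.1 ∈ k ∧ p.2 ∈ k}).Finite :=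
      (k.finite_toSet.prod k.finite_toSet).image _
    obtain ⟨w, hw⟩ := (dense_avoiding hf (by rintro _ ⟨p, -, rfl⟩; exact plane_ne_top _ _ _)).nonempty
    exact ⟨w, fun u hu v hv huv => independent_of_notMem_plane (sub_ne_zero.2 huv.symm)
      (hw _ ⟨(u, v), ⟨hu, hv⟩, rfl⟩)⟩
  have hw0 : w ≠ 0 := by
    rintro rfl
    match k, h.1 with
    | A :: B :: C :: l, _ => simpa using hw A (by simp) B (by simp) h.ne 0 1 (by simp)
  set K := polygonSupport k
  set R : Set Space := ⋃ v ∈ k, ray v w with hR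
  have hsep : ∀ u ∈ k, ∀ v ∈ k, u ≠ v → ∀ x ∈ ray v w, x ≠ u ∧ x ∉ ray u w := by
    rintro u hu v hv huv _ ⟨r, hr, rfl⟩
    constructor
    · intro hx
      have := hw u hu v hv huv 1 r (by rw [← hx]; module)
      linarith [this.1]
    · rintro ⟨r', hr', e⟩
      have := hw u hu v hv huv 1 (r - r') (by
        have : v - u = (r' - r) • w := by
          rw [sub_eq_iff_eq_add]; rw [← sub_eq_zero] at e ⊢; rw [← e]; module
        rw [this]; module)
      linarith [this.1]
  have hfar : ∀ v ∈ k, ∀ x ∈ ray v w, ∀ᶠ y in 𝓝 x, ∀ u ∈ k, u ≠ v → y ∉ ray u w := by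
    refine fun v hv x hx => (k.finite_toSet.eventually_all).2 fun u hu => ?_
    by_cases huv : u = v
    · exact Eventually.of_forall fun _ h => absurd huv h
    · filter_upwards [eventually_notMem_ray hw0 (hsep u hu v hv huv x hx).2
        (hsep u hu v hv huv x hx).1] with y hy _ using hy
  have hedge : ∀ e ∈ polygonEdges k, e.1 ∈ k ∧ e.2 ∈ k ∧ e.1 ≠ e.2 := by
    intro e he
    obtain ⟨l, hl⟩ := exists_isRotated_of_mem_polygonEdges (by have := h.1; omega) he
    exact ⟨hl.mem_iff.2 (by simp), hl.mem_iff.2 (by simp), (h.isRotated hl).ne⟩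
  have hs := fun e : Space × Space => show ∃ σ : Space → Space → ℤˣ, e ∈ polygonEdges k → _ from by
    by_cases he : e ∈ polygonEdges k
    · exact (exists_strip (hw _ (hedge e he).1 _ (hedge e he).2.1 (hedge e he).2.2)).imp
        fun σ hσ _ => hσ
    · exact ⟨1, fun h => absurd h he⟩
  choose s hs using hs
  set S : Space → Space → ℤˣ := fun P Q => ((polygonEdges k).map fun e => s e P Q).prod with hS
  have hSrot : ∀ {k'}, k ~r k' → S = fun P Q => ((polygonEdges k').map fun e => s e P Q).prod :=
    fun hr => by
      funext P Q
      exact ((polygonEdges_isRotated hr).map _).prod_eq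
  have hoff : ∀ D, ∀ x ∉ R, ∀ l : List (Space × Space), (∀ e ∈ l, e ∈ polygonEdges k) →
      (∀ e ∈ l, x ∉ segment ℝ e.1 e.2) →
      ∃ f, Pot (fun P Q => (l.map fun e => s e P Q).prod) D x f := by
    intro D x hx l hl hxl
    refine exists_pot_prod fun e he => (hs e (hl e he)).1 D x (hxl e he) ?_ ?_
    · exact fun h => hx (mem_biUnion (hedge e (hl e he)).1 h)
    · exact fun h => hx (mem_biUnion (hedge e (hl e he)).2.1 h)
  have hnR : ∀ x ∈ R, NiceAt R x := by
    intro x hx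
    simp only [hR, mem_iUnion] at hx
    obtain ⟨v, hv, hx⟩ := hx
    obtain ⟨Z, B, l, hr⟩ := exists_isRotated_of_mem h.1 hv
    have hn := ((hs (Z, v) ((polygonEdges_isRotated hr).mem_iff.2 (by
      rw [polygonEdges_cons]; simp))).2.1 v (Or.inr rfl) x hx).1
    obtain ⟨ρ, hρ, hsub⟩ := Metric.eventually_nhds_iff_ball.1 (hfar v hv x hx)
    refine hn.congr hρ fun y hy => ⟨fun h => mem_biUnion hv h, fun h => ?_⟩
    simp only [hR, mem_iUnion] at h
    obtain ⟨u, hu, h⟩ := h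
    by_contra hne
    exact hsub y hy u hu (by rintro rfl; exact hne h) h
  set D : Set Space := (K ∪ R)ᶜ with hD'
  have hDK : D ⊆ Kᶜ := compl_subset_compl.2 subset_union_left
  have hDR : D ⊆ Rᶜ := compl_subset_compl.2 subset_union_right
  have hD : Dense D := by
    have hf : ((fun e : Space × Space => plane e.1 e.2 0) '' {e | e ∈ polygonEdges k} ∪
        (fun v => plane v (v + w) 0) '' {v | v ∈ k}).Finite :=
      ((polygonEdges k).finite_toSet.image _).union (k.finite_toSet.image _)
    refine (dense_avoiding hf ?_).mono fun x hx hxKR => ?_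
    · rintro _ (⟨p, -, rfl⟩ | ⟨p, -, rfl⟩) <;> exact plane_ne_top _ _ _
    · rcases hxKR with hxK | hxR
      · simp only [K, polygonSupport, mem_iUnion] at hxK
        obtain ⟨e, he, hxe⟩ := hxK
        exact hx _ (Or.inl ⟨e, he, rfl⟩) (segment_subset_plane _ _ _ hxe)
      · simp only [hR, mem_iUnion] at hxR
        obtain ⟨v, hv, r, hr, rfl⟩ := hxR
        exact hx _ (Or.inr ⟨v, hv, rfl⟩) (mem_plane (a := 1 - r) (b := r) (c := 0) (by ring)
          (by module))
  have hKc : IsOpen Kᶜ := ((knotOf k h).isCompact_support.isClosed.isOpen_compl :)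
  have hG := isPotentialSheaf_compl (φ := S) hD hDR hnR
  have hY : ∀ x ∈ Kᶜ, ∃ f, ∀ᶠ y in 𝓝 x, y ∉ R → Pot S D y f := fun x hxK => by
    by_cases hx : x ∈ R
    · simp only [hR, mem_iUnion] at hx
      obtain ⟨v, hv, hx⟩ := hx
      obtain ⟨Z, B, l, hr⟩ := exists_isRotated_of_mem h.1 hv
      have hed : polygonEdges (Z :: v :: B :: l) =
        (Z, v) :: (v, B) :: pathEdges (B :: (l ++ [Z])) := by rw [polygonEdges_cons]; rfl
      have hin : ∀ e ∈ (Z, v) :: (v, B) :: pathEdges (B :: (l ++ [Z])), e ∈ polygonEdges k := by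
        intro e he
        rw [← hed] at he
        exact (polygonEdges_isRotated hr).mem_iff.2 he
      have hp := h.isRotated hr
      have hsegK : ∀ e ∈ polygonEdges k, ∀ y ∉ K, y ∉ segment ℝ e.1 e.2 := fun e he y hy hye =>
        hy (mem_biUnion he hye)
      have hlk : ∀ u ∈ B :: (l ++ [Z]), u ∈ k ∧ u ≠ v := by
        intro u hu
        refine ⟨hr.mem_iff.2 ?_, ?_⟩
        · simp only [List.mem_cons, List.mem_append, List.not_mem_nil, or_false] at hu ⊢; tauto
        · rintro rfl
          exact hp.vertex_notMem.2.2 (mem_pathSupport_of_mem (by simp) hu)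
      set N : Set Space := {y | y ∉ K ∧ ∀ u ∈ k, u ≠ v → y ∉ ray u w}
      have hN : N ∈ 𝓝 x := (hKc.eventually_mem hxK).and (hfar v hv x hx)
      have hsys : ∀ e ∈ [(Z, v), (v, B)], IsSystem (s e) D (N \ ray v w) := by
        intro e he y hy
        have he' : e ∈ polygonEdges k := hin e (by simp at he; simp; tauto)
        have hray : ∀ u ∈ k, y ∉ ray u w := fun u hu => by
          by_cases huv : u = v
          · rw [huv]; exact hy.2
          · exact hy.1.2 u hu huv
        exact (hs e he').1 D y (hsegK e he' y hy.1.1) (hray _ (hedge e he').1)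
          (hray _ (hedge e he').2.1)
      have m1 := (hs (Z, v) (hin _ (by simp))).2.1 v (Or.inr rfl) x hx
      have m2 := (hs (v, B) (hin _ (by simp))).2.1 v (Or.inl rfl) x hx
      obtain ⟨f, hf⟩ := m1.1.meridianTrivial_mul (fun a b => units_int_mul_eq_one) hD hN
        (hsys _ (by simp)) (hsys _ (by simp)) (m1.2 D hD) (m2.2 D hD)
      obtain ⟨g, hg⟩ := exists_pot_prod (s := s) (D := D) (x := x)
        (l := pathEdges (B :: (l ++ [Z]))) fun e he => by
        have he' := hin e (by simp [he])
        obtain ⟨h1, h2⟩ := mem_of_mem_pathEdges he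
        exact (hs e he').1 D x (hsegK e he' x hxK)
          (hsep _ (hlk _ h1).1 v hv (hlk _ h1).2 x hx).2
          (hsep _ (hlk _ h2).1 v hv (hlk _ h2).2 x hx).2
      refine ⟨fun y => f y * g y, ?_⟩
      filter_upwards [hf, hg.eventually] with y h1 h2 hyR
      rw [hSrot hr, hed]
      have := (h1 fun hy => hyR (mem_biUnion hv hy)).mul h2
      simpa [mul_assoc] using this
    · obtain ⟨f, hf⟩ := hoff D x hx (polygonEdges k) (fun _ => id)
        fun e he hxe => hxK (mem_biUnion he hxe)
      exact ⟨f, hf.eventually.mono fun y hy _ => hy⟩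
  obtain ⟨φ, hφ⟩ := hG.exists_system hD hY
  refine ⟨D, φ, hD, hDK, fun x hx => (hY x hx).imp fun f hf => (hφ x hx f).1 hf, ?_⟩
  rintro ⟨f, hf⟩
  obtain ⟨A, B, C, l, hk⟩ := (knotOf k h).exists_vertices
  change k = A :: B :: C :: l at hk
  have hp : IsPolygon (A :: B :: C :: l) := hk ▸ h
  have hed : polygonEdges k = (A, B) :: pathEdges (B :: ((C :: l) ++ [A])) := by
    rw [hk, polygonEdges_cons]; rfl
  have hAB : (A, B) ∈ polygonEdges k := by simp [hed]
  obtain ⟨m, hm, hmR⟩ : ∃ m ∈ openSegment ℝ A B, m ∉ R := by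
    have hfin : {t : ℝ | (1 - t) • A + t • B ∈ R}.Finite := by
      have : {t : ℝ | (1 - t) • A + t • B ∈ R} ⊆
          ⋃ v ∈ {v | v ∈ k}, {t : ℝ | (1 - t) • A + t • B ∈ ray v w} := by
        intro t ht
        simpa [hR] using ht
      refine (k.finite_toSet.biUnion fun v _ => Set.Subsingleton.finite ?_).subset this
      rintro t ⟨r, -, e⟩ t' ⟨r', -, e'⟩
      have := hw A (hedge _ hAB).1 B (hedge _ hAB).2.1 (hedge _ hAB).2.2 (t - t') (r' - r) (by
        rw [← sub_eq_zero] at e e'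
        have : (t - t') • (B - A) + (r' - r) • w = ((1 - t) • A + t • B - (v + r • w)) -
          ((1 - t') • A + t' • B - (v + r' • w)) := by module
        rw [this, e, e', sub_zero])
      linarith [this.1]
    obtain ⟨t, ht, htR⟩ := (Set.Ioo_infinite (zero_lt_one (α := ℝ))).exists_notMem_finite hfin
    exact ⟨_, mem_openSegment_iff.2 ⟨t, ht.1, ht.2, rfl⟩, htR⟩
  have hrest : m ∉ pathSupport (B :: ((C :: l) ++ [A])) := fun hm' => by
    rcases hp.inter_rest (openSegment_subset_segment _ _ _ hm) hm' with rfl | rfl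
    · exact hp.ne (left_mem_openSegment_iff.1 hm)
    · exact hp.ne (right_mem_openSegment_iff.1 hm)
  obtain ⟨g, hg⟩ := hoff D m hmR (pathEdges (B :: ((C :: l) ++ [A])))
    (fun e he => by rw [hed]; exact List.mem_cons_of_mem _ he) fun e he hme => hrest (mem_pathSupport.2 ⟨e, he, hme⟩)
  have hRo : ∀ᶠ y in 𝓝 m, y ∉ R := by
    have : ∀ᶠ y in 𝓝 m, ∀ v ∈ k, y ∉ ray v w := (k.finite_toSet.eventually_all).2 fun v hv =>
      eventually_notMem_ray hw0 (fun h => hmR (mem_biUnion hv h)) (by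
        rintro rfl
        refine hrest (mem_pathSupport_of_mem (by simp) ?_)
        have hv' : m ∈ k := hv
        rw [hk] at hv'
        simp only [List.mem_cons, List.mem_append, List.not_mem_nil, or_false] at hv' ⊢
        tauto)
    filter_upwards [this] with y hy
    simpa [hR] using hy
  refine (hs (A, B) hAB).2.2 m hm D hD ⟨fun y => f y * g y, ?_⟩
  filter_upwards [hRo.eventually_nhds, hRo, hg.eventually,
    (isCompact_pathSupport (B :: ((C :: l) ++ [A]))).isClosed.isOpen_compl.eventually_mem hrest]
    with y h1 h2 h3 h4 hy
  have hyK : y ∈ Kᶜ := by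
    simp only [K]
    rw [hk, polygonSupport_cons_cons]
    exact fun h => h.elim hy h4
  have h5 := (((hφ y hyK f).2 (hf y hyK)).self_of_nhds h2).mul h3
  refine h5.congr_system (Eventually.of_forall fun r => ?_)
  simp only [S, hed, List.map_cons, List.prod_cons]
  rw [mul_assoc, Int.units_mul_self, mul_one]

end SignSystem

section Interpolation

/-- Linear interpolation of a function on the integers. -/
noncomputable def interp (f : ℤ → ℝ) (x : ℝ) : ℝ := f ⌊x⌋ + (x - ⌊x⌋) * (f (⌊x⌋ + 1) - f ⌊x⌋)

theorem interp_eq (f : ℤ → ℝ) {j : ℤ} {x : ℝ} (h0 : (j : ℝ) ≤ x) (h1 : x ≤ j + 1) :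
    interp f x = f j + (x - j) * (f (j + 1) - f j) := by
  rcases h1.eq_or_lt with rfl | h1
  · have : ⌊(j : ℝ) + 1⌋ = j + 1 := by rw [Int.floor_add_one, Int.floor_intCast]
    rw [interp, this]; push_cast; ring
  · rw [interp, Int.floor_eq_iff.2 ⟨h0, h1⟩]

theorem continuous_interp (f : ℤ → ℝ) : Continuous (interp f) := by
  have h : ∀ j : ℤ, ContinuousOn (interp f) (Icc (j : ℝ) (j + 1)) := fun j => by
    refine ContinuousOn.congr (f := fun x => f j + (x - j) * (f (j + 1) - f j)) (by fun_prop) ?_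
    exact fun x hx => interp_eq f hx.1 hx.2
  rw [continuous_iff_continuousAt]
  intro x
  have h1 := (h (⌊x⌋ - 1)).union_of_isClosed (h ⌊x⌋) isClosed_Icc isClosed_Icc
  push_cast at h1
  rw [sub_add_cancel, Icc_union_Icc_eq_Icc (by linarith) (by linarith)] at h1
  exact h1.continuousAt (Icc_mem_nhds (by linarith [Int.floor_le x]) (Int.lt_floor_add_one x))

theorem interp_mem {f : ℤ → ℝ} {s : Set ℝ} (hs : Convex ℝ s) {x : ℝ}
    (h : ∀ j : ℤ, (j : ℝ) ≤ x → x ≤ j + 1 → f j ∈ s ∧ f (j + 1) ∈ s) : interp f x ∈ s := by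
  obtain ⟨h1, h2⟩ := h ⌊x⌋ (Int.floor_le x) (Int.lt_floor_add_one x).le
  have := hs h1 h2 (a := 1 - (x - ⌊x⌋)) (b := x - ⌊x⌋) (by linarith [Int.lt_floor_add_one x])
    (by linarith [Int.floor_le x]) (by ring)
  convert this using 1
  simp only [interp, smul_eq_mul]; ring

theorem interp_of_le {f : ℤ → ℝ} {x y : ℝ} {a : ℤ} (h : x ≤ a) (hf : ∀ j ≤ a, f j = y) :
    interp f x = y := by
  have h1 := Int.ceil_lt_add_one x
  have h2 : ⌈x⌉ ≤ a := Int.ceil_le.2 h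
  rw [interp_eq f (j := ⌈x⌉ - 1) (by push_cast; linarith) (by push_cast; linarith [Int.le_ceil x]),
    hf _ (by omega), hf _ (by omega)]
  ring

theorem interp_of_ge {f : ℤ → ℝ} {x y : ℝ} {a : ℤ} (h : (a : ℝ) ≤ x) (hf : ∀ j ≥ a, f j = y) :
    interp f x = y := by
  have h2 : a ≤ ⌊x⌋ := Int.le_floor.2 h
  rw [interp, hf _ h2, hf _ (by omega)]
  ring

end Interpolation

section Tangle
variable (n : ℕ)

/-- The second coordinates of the vertices of the winding strand. -/
def windY (j : ℤ) : ℝ :=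
  if j < 0 then -2 else if j < 4 * n then (if j % 4 = 0 ∨ j % 4 = 3 then -1 else 1)
  else if j < 4 * n + 4 then (if j % 4 = 0 ∨ j % 4 = 3 then -1 else -3) else 0

/-- The third coordinates of the vertices of the winding strand. -/
def windZ (j : ℤ) : ℝ :=
  if j < 0 ∨ 4 * n + 4 ≤ j then 0 else if j % 4 < 2 then 1 else -1

/-- The second coordinates of the vertices of the returning strand. -/
def backY (j : ℤ) : ℝ := if j ≤ 4 * n + 4 then -2 else 0

/-- The twisted clasp: an axis, a strand winding around it and clasping a third strand. -/
def tangle : Set Space :=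
  {P | P 1 = 0 ∧ P 2 = 0 ∧ (P 0 ≤ 4 * n + 4 ∨ 4 * n + 5 ≤ P 0)} ∪
  {P | (-1 ≤ P 0 ∧ P 0 ≤ 4 * n + 4) ∧ P 1 = interp (windY n) (P 0) ∧ P 2 = interp (windZ n) (P 0)} ∪
  {P | -1 ≤ P 0 ∧ P 1 = interp (backY n) (P 0) ∧ P 2 = 0}

/-- The number of the half twist at a point. -/
noncomputable def slab (x : ℝ) : ℤ := max 0 (min ⌊(2 * x + 1) / 4⌋ (2 * n + 1))

variable {n}

theorem slab_eventually {x : ℝ} (h : ∀ k : ℤ, 1 ≤ k → k ≤ 2 * n + 1 → x ≠ 2 * k - 1 / 2) :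
    ∀ᶠ y in 𝓝 x, slab n y = slab n x := by
  set k := ⌊(2 * x + 1) / 4⌋ with hk
  have h1 : (k : ℝ) ≤ (2 * x + 1) / 4 := Int.floor_le _
  have h2 : (2 * x + 1) / 4 < k + 1 := Int.lt_floor_add_one _
  rcases h1.eq_or_lt with h1 | h1
  · have hk' : k ≤ 0 ∨ 2 * (n : ℤ) + 2 ≤ k := by
      by_contra! hc
      exact h k (by omega) (by omega) (by rw [h1]; ring)
    filter_upwards [Ioo_mem_nhds (show x - 1 < x by linarith) (show x < x + 1 by linarith)] with y hy
    have h3 : ⌊(2 * y + 1) / 4⌋ = k ∨ ⌊(2 * y + 1) / 4⌋ = k - 1 := by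
      rcases le_or_gt (k : ℝ) ((2 * y + 1) / 4) with h4 | h4
      · exact Or.inl (Int.floor_eq_iff.2 ⟨h4, by linarith [hy.2]⟩)
      · exact Or.inr (Int.floor_eq_iff.2 ⟨by push_cast; linarith [hy.1], by push_cast; linarith⟩)
    unfold slab
    omega
  · filter_upwards [Ioo_mem_nhds (show 2 * (k : ℝ) - 1 / 2 < x by linarith)
      (show x < 2 * (k : ℝ) + 3 / 2 by linarith)] with y hy
    have : ⌊(2 * y + 1) / 4⌋ = k := Int.floor_eq_iff.2 ⟨by linarith [hy.1], by linarith [hy.2]⟩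
    rw [slab, slab, this]

theorem slab_eventually_boundary {k : ℤ} (h0 : 1 ≤ k) (h1 : k ≤ 2 * n + 1) :
    ∀ᶠ y in 𝓝 (2 * (k : ℝ) - 1 / 2), slab n y = k ∨ slab n y = k - 1 := by
  filter_upwards [Ioo_mem_nhds (show 2 * (k : ℝ) - 1 / 2 - 1 < 2 * (k : ℝ) - 1 / 2 by linarith)
    (show 2 * (k : ℝ) - 1 / 2 < 2 * (k : ℝ) - 1 / 2 + 1 by linarith)] with y hy
  have h3 : ⌊(2 * y + 1) / 4⌋ = k ∨ ⌊(2 * y + 1) / 4⌋ = k - 1 := by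
    rcases le_or_gt (k : ℝ) ((2 * y + 1) / 4) with h4 | h4
    · exact Or.inl (Int.floor_eq_iff.2 ⟨h4, by linarith [hy.2]⟩)
    · exact Or.inr (Int.floor_eq_iff.2 ⟨by push_cast; linarith [hy.1], by push_cast; linarith⟩)
  unfold slab
  omega

theorem slab_of_le {x : ℝ} (h : x < 3 / 2) : slab n x = 0 := by
  have : ⌊(2 * x + 1) / 4⌋ < 1 := by rw [Int.floor_lt]; push_cast; linarith
  unfold slab; omega

theorem slab_of_ge {x : ℝ} (h : 4 * n + 2 ≤ x) : slab n x = 2 * n + 1 := by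
  have : 2 * (n : ℤ) + 1 ≤ ⌊(2 * x + 1) / 4⌋ := by rw [Int.le_floor]; push_cast; linarith
  unfold slab; omega

theorem wind_of_le {x : ℝ} (h : x ≤ -1) : interp (windY n) x = -2 ∧ interp (windZ n) x = 0 :=
  ⟨interp_of_le (a := -1) (by exact_mod_cast h) fun j hj => if_pos (by omega),
    interp_of_le (a := -1) (by exact_mod_cast h) fun j hj => if_pos (by omega)⟩

theorem wind_of_ge {x : ℝ} (h : 4 * n + 4 ≤ x) :
    interp (windY n) x = 0 ∧ interp (windZ n) x = 0 :=
  ⟨interp_of_ge (a := 4 * n + 4) (by exact_mod_cast h) fun j hj => by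
      rw [windY, if_neg (by omega), if_neg (by omega), if_neg (by omega)],
    interp_of_ge (a := 4 * n + 4) (by exact_mod_cast h) fun j hj => if_pos (by omega)⟩

theorem backY_of_le {x : ℝ} (h : x ≤ 4 * n + 4) : interp (backY n) x = -2 :=
  interp_of_le (a := 4 * n + 4) (by exact_mod_cast h) fun j hj => if_pos hj

theorem backY_of_ge {x : ℝ} (h : 4 * n + 5 ≤ x) : interp (backY n) x = 0 :=
  interp_of_ge (a := 4 * n + 5) (by exact_mod_cast h) fun j hj => if_neg (by omega)

theorem backY_mid {x : ℝ} (h : 4 * n + 4 ≤ x) (h' : x ≤ 4 * n + 5) :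
    interp (backY n) x = 2 * (x - (4 * n + 5)) := by
  rw [interp_eq _ (j := 4 * n + 4) (by push_cast; linarith) (by push_cast; linarith), backY, backY,
    if_pos le_rfl, if_neg (by omega)]
  push_cast; ring

theorem backY_lt {x : ℝ} (h : x < 4 * n + 5) : interp (backY n) x < 0 := by
  rcases le_or_gt x (4 * n + 4) with h' | h'
  · rw [backY_of_le h']; norm_num
  · rw [backY_mid h'.le h.le]; linarith

theorem backY_bounds (x : ℝ) : -2 ≤ interp (backY n) x ∧ interp (backY n) x ≤ 0 :=
  interp_mem (convex_Icc (-2 : ℝ) 0) fun j _ _ => by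
    simp only [backY]; constructor <;> split_ifs <;> norm_num

theorem windY_bounds (x : ℝ) : -3 ≤ interp (windY n) x ∧ interp (windY n) x ≤ 1 :=
  interp_mem (convex_Icc (-3 : ℝ) 1) fun j _ _ => by
    simp only [windY]; constructor <;> split_ifs <;> norm_num

theorem windZ_bounds (x : ℝ) : -1 ≤ interp (windZ n) x ∧ interp (windZ n) x ≤ 1 :=
  interp_mem (convex_Icc (-1 : ℝ) 1) fun j _ _ => by
    simp only [windZ]; constructor <;> split_ifs <;> norm_num

/-- The side of the axis on which the winding strand runs in a slab. -/
def slabSign (k : ℤ) : ℝ := if Even k then 1 else -1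

theorem windZ_slab {k : ℤ} (h0 : 0 ≤ k) (h1 : k ≤ 2 * n + 1) :
    windZ n (2 * k) = slabSign k ∧ windZ n (2 * k + 1) = slabSign k := by
  unfold windZ slabSign
  rcases Int.even_or_odd k with hk | hk
  · have h2 : k % 2 = 0 := Int.even_iff.1 hk
    rw [if_pos hk, if_neg (by omega), if_pos (by omega), if_neg (by omega), if_pos (by omega)]
    exact ⟨rfl, rfl⟩
  · have h2 : k % 2 = 1 := Int.odd_iff.1 hk
    rw [if_neg (Int.not_even_iff_odd.2 hk), if_neg (by omega), if_neg (by omega), if_neg (by omega),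
      if_neg (by omega)]
    exact ⟨rfl, rfl⟩

theorem windZ_before {k : ℤ} (h0 : 0 ≤ k) (h1 : k ≤ 2 * n + 1) :
    windZ n (2 * k - 1) = if k = 0 then 0 else -slabSign k := by
  unfold windZ slabSign
  rcases Int.even_or_odd k with hk | hk
  · have h2 : k % 2 = 0 := Int.even_iff.1 hk
    rw [if_pos hk]
    split_ifs <;> first | omega | norm_num
  · have h2 : k % 2 = 1 := Int.odd_iff.1 hk
    rw [if_neg (Int.not_even_iff_odd.2 hk)]
    split_ifs <;> first | omega | norm_num

theorem windZ_after {k : ℤ} (h0 : 0 ≤ k) (h1 : k ≤ 2 * n + 1) :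
    windZ n (2 * k + 1 + 1) = if k = 2 * n + 1 then 0 else -slabSign k := by
  unfold windZ slabSign
  rcases Int.even_or_odd k with hk | hk
  · have h2 : k % 2 = 0 := Int.even_iff.1 hk
    rw [if_pos hk]
    split_ifs <;> first | omega | norm_num
  · have h2 : k % 2 = 1 := Int.odd_iff.1 hk
    rw [if_neg (Int.not_even_iff_odd.2 hk)]
    split_ifs <;> first | omega | norm_num

theorem slabSign_mul_windZ (x : ℝ) : 0 ≤ slabSign (slab n x) * interp (windZ n) x := by
  have hsq : ∀ k, slabSign k * slabSign k = 1 := fun k => by unfold slabSign; split_ifs <;> norm_num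
  set k := ⌊(2 * x + 1) / 4⌋ with hk
  have h1 : (k : ℝ) ≤ (2 * x + 1) / 4 := Int.floor_le _
  have h2 : (2 * x + 1) / 4 < k + 1 := Int.lt_floor_add_one _
  rcases lt_or_ge k 0 with h3 | h3
  · have h4 : x < -1 / 2 := by
      have : (k : ℝ) ≤ -1 := by exact_mod_cast Int.le_sub_one_of_lt h3
      linarith
    rw [slab_of_le (by linarith)]
    rcases le_or_gt x (-1) with h5 | h5
    · rw [(wind_of_le h5).2, mul_zero]
    · rw [interp_eq _ (j := -1) (by push_cast; linarith) (by push_cast; linarith)]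
      have e1 : windZ n (-1) = 0 := if_pos (by omega)
      have e2 : windZ n (-1 + 1) = slabSign 0 := (windZ_slab (n := n) le_rfl (by omega)).1
      rw [e1, e2]
      push_cast
      have := hsq 0
      nlinarith
  rcases lt_or_ge (2 * (n : ℤ) + 1) k with h4 | h4
  · have h5 : (2 * (n : ℝ) + 2) ≤ k := by exact_mod_cast h4
    rw [slab_of_ge (by linarith)]
    rcases le_or_gt (4 * (n : ℝ) + 4) x with h6 | h6
    · rw [(wind_of_ge h6).2, mul_zero]
    · rw [interp_eq _ (j := 2 * (2 * n + 1) + 1) (by push_cast; linarith) (by push_cast; linarith),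
        windZ_after (by omega) le_rfl, (windZ_slab (by omega) le_rfl).2, if_pos rfl]
      push_cast
      nlinarith [hsq (2 * n + 1)]
  have hs : slab n x = k := by unfold slab; omega
  rw [hs]
  have hz := windZ_slab h3 h4
  rcases le_or_gt x (2 * k) with h5 | h5
  · rw [interp_eq _ (j := 2 * k - 1) (by push_cast; linarith) (by push_cast; linarith),
      windZ_before h3 h4, sub_add_cancel, hz.1]
    push_cast
    split_ifs <;> nlinarith [hsq k]
  rcases le_or_gt x (2 * k + 1) with h6 | h6
  · rw [interp_eq _ (j := 2 * k) (by push_cast; linarith) (by push_cast; linarith), hz.1, hz.2]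
    nlinarith [hsq k]
  · rw [interp_eq _ (j := 2 * k + 1) (by push_cast; linarith) (by push_cast; linarith),
      windZ_after h3 h4, hz.2]
    push_cast
    split_ifs <;> nlinarith [hsq k]

theorem even_of_windZ_pos {x : ℝ} (h : 0 < interp (windZ n) x) : Even (slab n x) := by
  by_contra hc
  have := slabSign_mul_windZ (n := n) x
  rw [slabSign, if_neg hc] at this
  linarith

theorem not_even_of_windZ_neg {x : ℝ} (h : interp (windZ n) x < 0) : ¬Even (slab n x) := by
  intro hc
  have := slabSign_mul_windZ (n := n) x
  rw [slabSign, if_pos hc] at this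
  linarith

/-- The strand at the boundary of two slabs. -/
theorem wind_boundary {k : ℤ} (h0 : 1 ≤ k) (h1 : k ≤ 2 * n + 1) :
    interp (windZ n) (2 * k - 1 / 2) = 0 ∧ interp (windY n) (2 * k - 1 / 2) =
      if k = 2 * n + 1 then -3 else if Even k then -1 else 1 := by
  rw [interp_eq _ (j := 2 * k - 1) (by push_cast; linarith) (by push_cast; linarith),
    interp_eq _ (j := 2 * k - 1) (by push_cast; linarith) (by push_cast; linarith),
    windZ_before (by omega) h1, sub_add_cancel, (windZ_slab (by omega) h1).1, if_neg (by omega)]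
  push_cast
  refine ⟨by ring, ?_⟩
  have key : ∀ a b : ℝ, a = b → a + (2 * (k : ℝ) - 1 / 2 - (2 * k - 1)) * (b - a) = a := by
    rintro a _ rfl; ring
  rcases Int.even_or_odd k with hk | hk
  · have h2 : k % 2 = 0 := Int.even_iff.1 hk
    have e1 : windY n (2 * k - 1) = -1 := by unfold windY; split_ifs <;> first | omega | rfl
    have e2 : windY n (2 * k) = -1 := by unfold windY; split_ifs <;> first | omega | rfl
    rw [key _ _ (e1.trans e2.symm), e1, if_neg (by omega), if_pos hk]
  · have h2 : k % 2 = 1 := Int.odd_iff.1 hk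
    rw [if_neg (Int.not_even_iff_odd.2 hk)]
    split_ifs with h3
    · have e1 : windY n (2 * k - 1) = -3 := by unfold windY; split_ifs <;> first | omega | rfl
      have e2 : windY n (2 * k) = -3 := by unfold windY; split_ifs <;> first | omega | rfl
      rw [key _ _ (e1.trans e2.symm), e1]
    · have e1 : windY n (2 * k - 1) = 1 := by unfold windY; split_ifs <;> first | omega | rfl
      have e2 : windY n (2 * k) = 1 := by unfold windY; split_ifs <;> first | omega | rfl
      rw [key _ _ (e1.trans e2.symm), e1]

end Tangle

section TangleLabels
variable (n : ℕ)

/-- The reflections of the dihedral group. -/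
def reflection (k : ℤ) : DihedralGroup (4 * n + 1) := .sr (-(k : ZMod (4 * n + 1)))

/-- The label of the winding strand in a slab. -/
noncomputable def windLabel (c : ℤ) : DihedralGroup (4 * n + 1) :=
  reflection n (if Even c then c + 1 else if c < 2 * n + 1 then c else 2 * n)

/-- The label of the region below the axis in a slab. -/
noncomputable def axisLabel (c : ℤ) : DihedralGroup (4 * n + 1) :=
  reflection n (if Even c then c else if c < 2 * n + 1 then c + 1 else 2 * n)

/-- The label of the region below the returning strand in a slab. -/
noncomputable def backLabel (c : ℤ) : DihedralGroup (4 * n + 1) :=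
  if Even c then windLabel n c * .sr 0 else .sr 0 * windLabel n c

/-- The label of the regions of the sheet containing the axis and the returning strand. -/
noncomputable def sheetLabel (c : ℤ) (e a : Bool) : DihedralGroup (4 * n + 1) :=
  bif e then (bif a then backLabel n c else axisLabel n c) else 1

/-- The label of a point below the sheet of the winding strand (`h`) or the sheet of the axis (`z`),
where `o`, `e` and `a` say whether it projects below the winding strand, the axis and the returning
strand. -/
noncomputable def tangleLabel (c : ℤ) (o e a h z : Bool) : DihedralGroup (4 * n + 1) :=
  if Even c then (bif h && o then windLabel n c else 1) * (bif z then sheetLabel n c e a else 1)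
  else (bif z then sheetLabel n c e a else 1) * (bif h && o then windLabel n c else 1)

variable {n}

theorem reflection_mul (a b : ℤ) :
    reflection n a * reflection n b = .r ((a - b : ℤ) : ZMod (4 * n + 1)) := by
  rw [reflection, reflection, DihedralGroup.sr_mul_sr]; congr 1; push_cast; ring

theorem reflection_zero : reflection n 0 = .sr 0 := by simp [reflection]

theorem reflection_mul_self (a : ℤ) : reflection n a * reflection n a = 1 := by
  rw [reflection_mul, sub_self, Int.cast_zero]; rfl

theorem windLabel_mul_self (c : ℤ) : windLabel n c * windLabel n c = 1 := reflection_mul_self _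

theorem tangleLabel_top (c : ℤ) (o e a : Bool) : tangleLabel n c o e a false false = 1 := by
  simp [tangleLabel]

theorem tangleLabel_none (c : ℤ) (h z : Bool) : tangleLabel n c false false false h z = 1 := by
  simp [tangleLabel, sheetLabel]

theorem tangleLabel_all (c : ℤ) : tangleLabel n c true true true true true = .sr 0 := by
  unfold tangleLabel
  split_ifs with h
  · simp only [Bool.and_self, cond_true, sheetLabel, backLabel, if_pos h, ← mul_assoc,
      windLabel_mul_self, one_mul]
  · simp only [Bool.and_self, cond_true, sheetLabel, backLabel, if_neg h, mul_assoc,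
      windLabel_mul_self, mul_one]

theorem windLabel_mul_axisLabel {c : ℤ} (h : Even c) :
    windLabel n c * axisLabel n c = .r 1 := by
  rw [windLabel, axisLabel, if_pos h, if_pos h, reflection_mul]; simp

theorem axisLabel_mul_windLabel {c : ℤ} (h : ¬Even c) :
    axisLabel n c * windLabel n c = .r (if c < 2 * n + 1 then 1 else 0) := by
  rw [windLabel, axisLabel, if_neg h, if_neg h, reflection_mul]
  split_ifs <;> simp

/-- The labels below both sheets agree at the boundary of two slabs. -/
theorem tangleLabel_boundary {k : ℤ} (h0 : 1 ≤ k) (h1 : k ≤ 2 * n + 1) {Y : ℝ} {o e a : Bool}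
    (ho : o = decide (Y < if k = 2 * n + 1 then -3 else if Even k then -1 else 1))
    (he : e = decide (Y < 0)) (ha : a = decide (Y < -2)) :
    tangleLabel n (k - 1) o e a true true = tangleLabel n k o e a true true := by
  have hcast : ((4 * n + 1 : ℕ) : ZMod (4 * n + 1)) = 0 := ZMod.natCast_self _
  push_cast at hcast
  have hae : a = true → e = true := by
    rw [ha, he, decide_eq_true_iff, decide_eq_true_iff]; intro h; linarith
  rcases Int.even_or_odd k with hk | hk
  · have hk2 : k % 2 = 0 := Int.even_iff.1 hk
    have hk' : ¬Even (k - 1) := by rw [Int.even_iff]; omega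
    rw [if_neg (by omega), if_pos hk] at ho
    have hao : a = true → o = true := by
      rw [ha, ho, decide_eq_true_iff, decide_eq_true_iff]; intro h; linarith
    have hoe : o = true → e = true := by
      rw [he, ho, decide_eq_true_iff, decide_eq_true_iff]; intro h; linarith
    have h3 : axisLabel n (k - 1) * windLabel n (k - 1) = .r 1 := by
      rw [axisLabel_mul_windLabel hk', if_pos (by omega)]
    have h4 : axisLabel n (k - 1) = axisLabel n k := by
      rw [axisLabel, axisLabel, if_neg hk', if_pos (by omega), if_pos hk, sub_add_cancel]
    cases a
    · cases o <;> cases e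
      · rw [tangleLabel_none, tangleLabel_none]
      · simp [tangleLabel, sheetLabel, h4]
      · simp at hoe
      · simp only [tangleLabel, if_pos hk, if_neg hk', sheetLabel, Bool.and_self, cond_true,
          cond_false, h3, windLabel_mul_axisLabel hk]
    · obtain rfl := hao rfl
      obtain rfl := hae rfl
      rw [tangleLabel_all, tangleLabel_all]
  · have hk2 : k % 2 = 1 := Int.odd_iff.1 hk
    have hk' : ¬Even k := Int.not_even_iff_odd.2 hk
    have hk1 : Even (k - 1) := by rw [Int.even_iff]; omega
    rw [if_neg hk'] at ho
    rcases h1.lt_or_eq with h1 | rfl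
    · rw [if_neg (by omega)] at ho
      have heo : e = true → o = true := by
        rw [he, ho, decide_eq_true_iff, decide_eq_true_iff]; intro h; linarith
      have h3 : axisLabel n k * windLabel n k = .r 1 := by
        rw [axisLabel_mul_windLabel hk', if_pos (by omega)]
      have h4 : windLabel n (k - 1) = windLabel n k := by
        rw [windLabel, windLabel, if_neg hk', if_pos hk1, if_pos h1, sub_add_cancel]
      cases a
      · cases o <;> cases e
        · rw [tangleLabel_none, tangleLabel_none]
        · simp at heo
        · simp [tangleLabel, sheetLabel, h4]
        · simp only [tangleLabel, if_pos hk1, if_neg hk', sheetLabel, Bool.and_self, cond_true,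
            cond_false, h3, windLabel_mul_axisLabel hk1]
      · obtain rfl := hae rfl
        obtain rfl := heo rfl
        rw [tangleLabel_all, tangleLabel_all]
    · rw [if_pos rfl] at ho
      have hoa : o = true → a = true := by
        rw [ha, ho, decide_eq_true_iff, decide_eq_true_iff]; intro h; linarith
      have h4 : axisLabel n (2 * n + 1 - 1) = axisLabel n (2 * n + 1) := by
        rw [axisLabel, axisLabel, if_neg hk', if_neg (lt_irrefl _), if_pos hk1, add_sub_cancel_right]
      have h5 : backLabel n (2 * n + 1 - 1) = backLabel n (2 * n + 1) := by
        rw [backLabel, backLabel, if_neg hk', if_pos hk1, windLabel, windLabel, if_neg hk',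
          if_pos hk1, if_neg (lt_irrefl _), ← reflection_zero, reflection_mul, reflection_mul]
        congr 1
        push_cast
        linear_combination hcast
      cases a
      · cases o
        · cases e
          · rw [tangleLabel_none, tangleLabel_none]
          · simp only [tangleLabel, if_pos hk1, if_neg hk', sheetLabel, cond_true, cond_false,
              Bool.and_false, one_mul, mul_one, h4]
        · simp at hoa
      · obtain rfl := hae rfl
        cases o
        · simp only [tangleLabel, if_pos hk1, if_neg hk', sheetLabel, cond_true, cond_false,
              Bool.and_false, one_mul, mul_one, h5]
        · rw [tangleLabel_all, tangleLabel_all]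

end TangleLabels

section TangleSystem
variable (n : ℕ)

/-- The position of a point of space relative to the projections of the three strands. -/
noncomputable def belowWind (P : Space) : Bool := decide (P 1 < interp (windY n) (P 0))
noncomputable def belowAxis (P : Space) : Bool := decide (P 1 < 0)
noncomputable def belowBack (P : Space) : Bool :=
  decide (P 1 < interp (backY n) (P 0))

/-- The position of a point relative to the sheets. -/
noncomputable def underWind (P : Space) : Bool :=
  decide (P 2 < if -7 / 2 < P 1 then interp (windZ n) (P 0) else 0)
noncomputable def underAxis (P : Space) : Bool := decide (P 2 < 0)

/-- The label of a point with the planar position of another point. -/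
noncomputable def labelAt (x P : Space) : DihedralGroup (4 * n + 1) :=
  tangleLabel n (slab n (P 0)) (belowWind n x) (belowAxis x) (belowBack n x) (underWind n P)
    (underAxis P)

open Classical in
/-- The dihedral local system on the complement of the tangle. -/
noncomputable def tangleSystem (P Q : Space) : DihedralGroup (4 * n + 1) :=
  if underWind n P = underWind n Q ∧ underAxis P = underAxis Q then 1
  else (labelAt n P P)⁻¹ * labelAt n P Q

variable {n}

theorem eventually_decide_lt (i : Fin 3) {G : Space → ℝ} (hG : Continuous G) {x : Space}
    (h : x i ≠ G x) : ∀ᶠ y in 𝓝 x, decide (y i < G y) = decide (x i < G x) := by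
  rcases lt_or_gt_of_ne h with h | h
  · filter_upwards [(isOpen_lt (continuous_apply i) hG).eventually_mem h] with y hy
    rw [decide_eq_true h, decide_eq_true (show y i < G y from hy)]
  · filter_upwards [(isOpen_lt hG (continuous_apply i)).eventually_mem h] with y hy
    rw [decide_eq_false h.le.not_gt, decide_eq_false (show G y < y i from hy).le.not_gt]

theorem continuous_interp_coord (f : ℤ → ℝ) : Continuous fun P : Space => interp f (P 0) :=
  (continuous_interp f).comp (continuous_apply 0)

/-- Where the projection meets no strand the labels are a potential. -/
theorem pot_labelAt {x : Space} {D : Set Space} (h1 : x 1 ≠ interp (windY n) (x 0)) (h2 : x 1 ≠ 0)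
    (h3 : x 1 ≠ interp (backY n) (x 0)) : Pot (tangleSystem n) D x (labelAt n x) := by
  classical
  have hc : ∀ᶠ P in 𝓝 x, ∀ o e a, belowWind n x = o → belowAxis x = e → belowBack n x = a →
      ((slab n (P 0) = slab n (x 0) ∧ ∀ k : ℤ, 1 ≤ k → k ≤ 2 * n + 1 → x 0 ≠ 2 * k - 1 / 2) ∨
      ∃ k : ℤ, (slab n (P 0) = k ∨ slab n (P 0) = k - 1) ∧ x 0 = 2 * k - 1 / 2 ∧ 1 ≤ k ∧
        k ≤ 2 * n + 1) := by
    by_cases hb : ∀ k : ℤ, 1 ≤ k → k ≤ 2 * n + 1 → x 0 ≠ 2 * k - 1 / 2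
    · filter_upwards [(continuous_apply (0 : Fin 3)).continuousAt.eventually (slab_eventually hb)]
        with P hP _ _ _ _ _ _ using Or.inl ⟨hP, hb⟩
    · push Not at hb
      obtain ⟨k, hk0, hk1, hk⟩ := hb
      have := slab_eventually_boundary hk0 hk1
      rw [← hk] at this
      filter_upwards [(continuous_apply (0 : Fin 3)).continuousAt.eventually this]
        with P hP _ _ _ _ _ _ using Or.inr ⟨k, hP, hk, hk0, hk1⟩
  have hpar : ∀ P : Space, underWind n P = true → underAxis P = false → Even (slab n (P 0)) := by
    intro P h4 h5
    rw [underWind, decide_eq_true_iff] at h4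
    rw [underAxis, decide_eq_false_iff_not] at h5
    split_ifs at h4
    · exact even_of_windZ_pos (by linarith)
    · exact absurd h4 h5
  have hpar' : ∀ P : Space, underWind n P = false → underAxis P = true → ¬Even (slab n (P 0)) := by
    intro P h4 h5
    rw [underWind, decide_eq_false_iff_not] at h4
    rw [underAxis, decide_eq_true_iff] at h5
    split_ifs at h4
    · exact not_even_of_windZ_neg (by linarith)
    · exact absurd h5 h4
  have hnear : ∀ᶠ P in 𝓝 x, belowWind n P = belowWind n x ∧ belowAxis P = belowAxis x ∧
      belowBack n P = belowBack n x :=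
    (eventually_decide_lt 1 (continuous_interp_coord _) h1).and
      ((eventually_decide_lt 1 continuous_const h2).and
        (eventually_decide_lt 1 (continuous_interp_coord _) h3))
  have hev := eventually_nhdsWithin_of_eventually_nhds (s := D) (hc.and hnear)
  filter_upwards [hev.prod_mk hev] with r hr
  obtain ⟨⟨hP, hP1, hP2, hP3⟩, hQ, -⟩ := hr
  have e0 : ∀ Q, labelAt n r.1 Q = labelAt n x Q := fun Q => by
    rw [labelAt, labelAt, hP1, hP2, hP3]
  rw [tangleSystem, e0, e0]
  split_ifs with hbits
  · suffices h : labelAt n x r.1 = labelAt n x r.2 by rw [h, inv_mul_cancel]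
    have hP' := hP _ _ _ rfl rfl rfl
    have hQ' := hQ _ _ _ rfl rfl rfl
    have hslab : slab n (r.1 0) = slab n (r.2 0) → labelAt n x r.1 = labelAt n x r.2 := fun h => by
      rw [labelAt, labelAt, h, hbits.1, hbits.2]
    rcases hP' with ⟨hP', hb⟩ | ⟨k, hP', hk, hk0, hk1⟩
    · rcases hQ' with ⟨hQ', -⟩ | ⟨k, -, hk, hk0, hk1⟩
      · exact hslab (hP'.trans hQ'.symm)
      · exact absurd hk (hb k hk0 hk1)
    · rcases hQ' with ⟨-, hb⟩ | ⟨k', hQ', hk', -⟩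
      · exact absurd hk (hb k hk0 hk1)
      · have hkk : (k' : ℝ) = k := by linarith
        obtain rfl : k' = k := by exact_mod_cast hkk
        rcases hz1 : underWind n r.2 with _ | _ <;> rcases hz2 : underAxis r.2 with _ | _
        · rw [labelAt, labelAt, hbits.1, hbits.2, hz1, hz2, tangleLabel_top, tangleLabel_top]
        · refine hslab ?_
          have p1 := hpar' r.1 (hbits.1.trans hz1) (hbits.2.trans hz2)
          have p2 := hpar' r.2 hz1 hz2
          rw [Int.even_iff] at p1 p2
          omega
        · refine hslab ?_
          have p1 := hpar r.1 (hbits.1.trans hz1) (hbits.2.trans hz2)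
          have p2 := hpar r.2 hz1 hz2
          rw [Int.even_iff] at p1 p2
          omega
        · have hbd := wind_boundary hk0 hk1
          have := tangleLabel_boundary hk0 hk1 (Y := x 1) (o := belowWind n x) (e := belowAxis x)
            (a := belowBack n x) (by rw [belowWind, hk, hbd.2]) rfl (by
              have : (k' : ℝ) ≤ 2 * n + 1 := by exact_mod_cast hk1
              rw [belowBack, hk, backY_of_le (by linarith)])
          rw [labelAt, labelAt, hbits.1, hbits.2, hz1, hz2]
          rcases hP' with e1 | e1 <;> rcases hQ' with e2 | e2 <;> rw [e1, e2] <;>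
            first | rfl | exact this | exact this.symm
  · rfl

theorem slab_eventually_of_ne {x : ℝ} (h : interp (windZ n) x ≠ 0) :
    ∀ᶠ y in 𝓝 x, slab n y = slab n x :=
  slab_eventually fun k h0 h1 e => h (by rw [e]; exact (wind_boundary h0 h1).1)

/-- The tangle system is a local system off the tangle. -/
theorem isSystem_tangleSystem (D : Set Space) : IsSystem (tangleSystem n) D (tangle n)ᶜ := by
  classical
  intro x hx
  have ha : ¬(x 1 = 0 ∧ x 2 = 0 ∧ (x 0 ≤ 4 * n + 4 ∨ 4 * n + 5 ≤ x 0)) :=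
    fun h => hx (Or.inl (Or.inl h))
  have hw : ¬((-1 ≤ x 0 ∧ x 0 ≤ 4 * n + 4) ∧ x 1 = interp (windY n) (x 0) ∧
    x 2 = interp (windZ n) (x 0)) := fun h => hx (Or.inl (Or.inr h))
  have hr : ¬(-1 ≤ x 0 ∧ x 1 = interp (backY n) (x 0) ∧ x 2 = 0) := fun h => hx (Or.inr h)
  by_cases hgen : x 1 ≠ interp (windY n) (x 0) ∧ x 1 ≠ 0 ∧ x 1 ≠ interp (backY n) (x 0)
  · exact ⟨_, pot_labelAt hgen.1 hgen.2.1 hgen.2.2⟩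
  have hY : -7 / 2 < x 1 := by
    by_contra hY
    refine hgen ⟨fun h => ?_, fun h => ?_, fun h => ?_⟩
    · linarith [(windY_bounds (n := n) (x 0)).1]
    · linarith
    · linarith [(backY_bounds (n := n) (x 0)).1]
  have hYev : ∀ᶠ P in 𝓝 x, underWind n P = decide (P 2 < interp (windZ n) (P 0)) := by
    filter_upwards [(isOpen_lt continuous_const (continuous_apply 1) :
      IsOpen {P : Space | -7 / 2 < P 1}).eventually_mem hY] with P hP
    rw [underWind, if_pos (show -7 / 2 < P 1 from hP)]
  have hx1 : underWind n x = decide (x 2 < interp (windZ n) (x 0)) := hYev.self_of_nhds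
  have hwc : x 2 ≠ interp (windZ n) (x 0) → ∀ᶠ P in 𝓝 x, underWind n P = underWind n x := fun h => by
    filter_upwards [hYev, eventually_decide_lt 2 (continuous_interp_coord _) h]
      with P h1 h2
    rw [h1, h2, hx1]
  have hac : x 2 ≠ 0 → ∀ᶠ P in 𝓝 x, underAxis P = underAxis x :=
    fun h => eventually_decide_lt 2 continuous_const h
  have hrange : interp (windZ n) (x 0) ≠ 0 → -1 ≤ x 0 ∧ x 0 ≤ 4 * n + 4 := fun h => by
    by_contra hc
    rw [not_and_or, not_le, not_le] at hc
    rcases hc with hc | hc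
    · exact h (wind_of_le hc.le).2
    · exact h (wind_of_ge hc.le).2
  have hslab : interp (windZ n) (x 0) ≠ 0 → ∀ᶠ P in 𝓝 x, slab n (P 0) = slab n (x 0) := fun h =>
    (continuous_apply (0 : Fin 3)).continuousAt.eventually (slab_eventually_of_ne h)
  have mk : ∀ (p : Space → Prop) (f : Space → DihedralGroup (4 * n + 1)), (∀ᶠ P in 𝓝 x, p P) →
      (∀ P Q, p P → p Q → tangleSystem n P Q = (f P)⁻¹ * f Q) → ∃ f, Pot (tangleSystem n) D x f := by
    intro p f hp hf
    have hev := eventually_nhdsWithin_of_eventually_nhds (s := D) hp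
    refine ⟨f, ?_⟩
    filter_upwards [hev.prod_mk hev] with r hr using hf _ _ hr.1 hr.2
  by_cases hz : x 2 = 0
  · by_cases hh : interp (windZ n) (x 0) = 0
    · -- the strand bounding no crossing
      have hout : x 0 < -1 ∨ 4 * n + 4 < x 0 := by
        by_contra! hc
        refine hgen ⟨fun h => hw ⟨hc, h, by rw [hz, hh]⟩, fun h => ha ⟨h, hz, Or.inl hc.2⟩,
          fun h => hr ⟨hc.1, h, hz⟩⟩
      rcases hout with hout | hout
      · have hY2 : x 1 = -2 := by
          by_contra hne
          refine hgen ⟨?_, fun h => ha ⟨h, hz, Or.inl (by linarith [n.cast_nonneg (α := ℝ)])⟩, ?_⟩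
          · rwa [(wind_of_le hout.le).1]
          · rwa [backY_of_le (by linarith [n.cast_nonneg (α := ℝ)])]
        refine mk (fun P => (P 0 < -1 ∧ P 1 < 0) ∧ underWind n P = decide (P 2 < interp (windZ n) (P 0)))
          (fun P => bif underAxis P then .sr 0 else 1) (Eventually.and ?_ hYev) ?_
        · exact ((isOpen_lt (continuous_apply 0) continuous_const : IsOpen {P : Space | P 0 < -1}).eventually_mem
            hout).and ((isOpen_lt (continuous_apply 1) continuous_const :
              IsOpen {P : Space | P 1 < 0}).eventually_mem (by
                rw [mem_ofPred_eq, hY2]; norm_num))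
        · have key : ∀ P, ((P 0 < -1 ∧ P 1 < 0) ∧
              underWind n P = decide (P 2 < interp (windZ n) (P 0))) →
              underWind n P = underAxis P ∧ slab n (P 0) = 0 ∧ belowAxis P = true ∧
              belowWind n P = belowBack n P := by
            rintro P ⟨⟨h1, h2⟩, h3⟩
            refine ⟨by rw [h3, (wind_of_le h1.le).2]; rfl, slab_of_le (by linarith),
              decide_eq_true h2, ?_⟩
            rw [belowWind, belowBack, (wind_of_le h1.le).1,
              backY_of_le (by linarith [n.cast_nonneg (α := ℝ)])]
          have hax : tangleLabel n 0 false true false true true = .sr 0 := by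
            simp [tangleLabel, sheetLabel, axisLabel, reflection_zero]
          intro P Q hP hQ
          obtain ⟨p1, p2, p3, p4⟩ := key P hP
          obtain ⟨q1, q2, q3, q4⟩ := key Q hQ
          rw [tangleSystem, labelAt, labelAt, p1, p2, p3, p4, q1, q2]
          rcases belowBack n P with _ | _ <;> rcases underAxis P with _ | _ <;>
            rcases underAxis Q with _ | _ <;> simp [tangleLabel_top, tangleLabel_all, hax]
      · have hY0 : x 1 = 0 := by
          by_contra hne
          refine hgen ⟨?_, hne, fun h => hr ⟨by linarith [n.cast_nonneg (α := ℝ)], h, hz⟩⟩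
          rwa [(wind_of_ge hout.le).1]
        have hx5 : x 0 < 4 * n + 5 := by
          by_contra! hc
          exact ha ⟨hY0, hz, Or.inr hc⟩
        have hnb : x 1 ≠ interp (backY n) (x 0) := by rw [hY0]; exact (backY_lt hx5).ne'
        have hfb : belowBack n x = false :=
          decide_eq_false (by rw [hY0]; exact (backY_lt hx5).le.not_gt)
        refine mk (fun P => (4 * (n : ℝ) + 4 < P 0 ∧ belowBack n P = false) ∧
          underWind n P = decide (P 2 < interp (windZ n) (P 0))) 1 (Eventually.and ?_ hYev) ?_
        · refine ((isOpen_lt continuous_const (continuous_apply 0) :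
            IsOpen {P : Space | 4 * (n : ℝ) + 4 < P 0}).eventually_mem hout).and ?_
          rw [← hfb]
          exact eventually_decide_lt 1 (continuous_interp_coord _) hnb
        · have key : ∀ P, ((4 * (n : ℝ) + 4 < P 0 ∧ belowBack n P = false) ∧
              underWind n P = decide (P 2 < interp (windZ n) (P 0))) →
              underWind n P = underAxis P ∧ slab n (P 0) = 2 * n + 1 ∧
              belowWind n P = belowAxis P := by
            rintro P ⟨⟨h1, h2⟩, h3⟩
            exact ⟨by rw [h3, (wind_of_ge h1.le).2]; rfl, slab_of_ge (by linarith),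
              by rw [belowWind, belowAxis, (wind_of_ge h1.le).1]⟩
          have hodd : ¬Even (2 * (n : ℤ) + 1) := by rw [Int.even_iff]; omega
          have hax : tangleLabel n (2 * n + 1) true true false true true = 1 := by
            simp only [tangleLabel, if_neg hodd, sheetLabel, cond_true, cond_false, Bool.and_self,
              axisLabel_mul_windLabel hodd, if_neg (lt_irrefl _)]
            rfl
          intro P Q hP hQ
          obtain ⟨p1, p2, p4⟩ := key P hP
          obtain ⟨q1, q2, q4⟩ := key Q hQ
          rw [tangleSystem, labelAt, labelAt, p1, p2, p4, q1, q2, hP.1.2]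
          rcases belowAxis P with _ | _ <;> rcases underAxis P with _ | _ <;>
            rcases underAxis Q with _ | _ <;> simp [tangleLabel_top, tangleLabel_none, hax]
    · have hR := hrange hh
      have hY0 : x 1 ≠ 0 := fun h => ha ⟨h, hz, Or.inl hR.2⟩
      have hYb : x 1 ≠ interp (backY n) (x 0) := fun h => hr ⟨hR.1, h, hz⟩
      refine mk (fun P => (underWind n P = underWind n x ∧ slab n (P 0) = slab n (x 0)) ∧
        belowAxis P = belowAxis x ∧ belowBack n P = belowBack n x)
        (fun P => bif underAxis P then sheetLabel n (slab n (x 0)) (belowAxis x) (belowBack n x) else 1)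
        (((hwc (by rw [hz]; exact Ne.symm hh)).and (hslab hh)).and
          ((eventually_decide_lt 1 continuous_const hY0).and
          (eventually_decide_lt 1 (continuous_interp_coord _) hYb))) ?_
      rintro P Q ⟨⟨p1, p2⟩, p3, p4⟩ ⟨⟨q1, q2⟩, -⟩
      rw [tangleSystem, labelAt, labelAt, p1, p2, p3, p4, q1, q2]
      simp only [true_and, tangleLabel]
      by_cases hE : Even (slab n (x 0))
      · simp only [if_pos hE]
        rcases underAxis P with _ | _ <;> rcases underAxis Q with _ | _ <;> simp
      · simp only [if_neg hE]
        have hf : underWind n x = false := by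
          rw [hx1, hz]
          exact decide_eq_false fun h => hE (even_of_windZ_pos h)
        rw [hf]
        rcases underAxis P with _ | _ <;> rcases underAxis Q with _ | _ <;> simp
  · by_cases hzh : x 2 = interp (windZ n) (x 0)
    · have hh : interp (windZ n) (x 0) ≠ 0 := hzh ▸ hz
      have hYw : x 1 ≠ interp (windY n) (x 0) := fun h => hw ⟨hrange hh, h, hzh⟩
      refine mk (fun P => (underAxis P = underAxis x ∧ slab n (P 0) = slab n (x 0)) ∧
        belowWind n P = belowWind n x)
        (fun P => bif underWind n P && belowWind n x then windLabel n (slab n (x 0)) else 1)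
        (((hac hz).and (hslab hh)).and
          (eventually_decide_lt 1 (continuous_interp_coord _) hYw)) ?_
      rintro P Q ⟨⟨p1, p2⟩, p3⟩ ⟨⟨q1, q2⟩, -⟩
      rw [tangleSystem, labelAt, labelAt, p1, p2, p3, q1, q2]
      simp only [and_true, tangleLabel]
      by_cases hE : Even (slab n (x 0))
      · simp only [if_pos hE]
        have hf : underAxis x = false := by
          rw [underAxis, hzh]
          exact decide_eq_false fun h => not_even_of_windZ_neg h hE
        rw [hf]
        rcases underWind n P with _ | _ <;> rcases underWind n Q with _ | _ <;> simp
      · simp only [if_neg hE]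
        rcases underWind n P with _ | _ <;> rcases underWind n Q with _ | _ <;> simp
    · refine mk (fun P => underAxis P = underAxis x ∧ underWind n P = underWind n x) 1
        ((hac hz).and (hwc hzh)) ?_
      rintro P Q ⟨p1, p2⟩ ⟨q1, q2⟩
      rw [tangleSystem, if_pos ⟨p2.trans q2.symm, p1.trans q1.symm⟩]
      simp

end TangleSystem

section Shell
variable (n : ℕ)

/-- A gauge whose sublevel sets are boxes around the tangle. -/
noncomputable def boxGauge (P : Space) : ℝ :=
  max (max (|P 0 - (2 * n + 2)| - (2 * n + 3)) (|P 1 + 1| - 2)) (|P 2| - 1)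

/-- The inclusion of the signs into the dihedral group. -/
noncomputable def signLift (m : ℕ) : ℤˣ →* DihedralGroup m where
  toFun u := if u = 1 then 1 else .sr 0
  map_one' := if_pos rfl
  map_mul' a b := by
    rcases Int.units_eq_one_or a with rfl | rfl <;> rcases Int.units_eq_one_or b with rfl | rfl <;>
      simp

/-- An open box. -/
def openBox (a b : Space) : Set Space :=
  {P | (a 0 < P 0 ∧ P 0 < b 0) ∧ (a 1 < P 1 ∧ P 1 < b 1) ∧ a 2 < P 2 ∧ P 2 < b 2}

variable {n}

theorem convex_openBox (a b : Space) : Convex ℝ (openBox a b) := by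
  rintro P ⟨⟨h1, h2⟩, ⟨h3, h4⟩, h5, h6⟩ Q ⟨⟨k1, k2⟩, ⟨k3, k4⟩, k5, k6⟩ s t hs ht hst
  have key : ∀ {u v w : ℝ}, u < v → u < w → u < s * v + t * w := fun {u v w} h k => by
    have := (convex_Ioi u) h k hs ht hst
    simpa using this
  have key' : ∀ {u v w : ℝ}, v < u → w < u → s * v + t * w < u := fun {u v w} h k => by
    have := (convex_Iio u) h k hs ht hst
    simpa using this
  exact ⟨⟨key h1 k1, key' h2 k2⟩, ⟨key h3 k3, key' h4 k4⟩, key h5 k5, key' h6 k6⟩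

theorem boxGauge_lt_iff {P : Space} {t : ℝ} : boxGauge n P < t ↔
    P ∈ openBox ![-1 - t, -3 - t, -1 - t] ![4 * n + 5 + t, 1 + t, 1 + t] := by
  simp only [boxGauge, max_lt_iff, sub_lt_iff_lt_add, abs_lt, openBox, mem_ofPred_eq,
    Matrix.cons_val]
  constructor
  · rintro ⟨⟨⟨h1, h2⟩, h3, h4⟩, h5, h6⟩
    exact ⟨⟨by linarith, by linarith⟩, ⟨by linarith, by linarith⟩, by linarith, by linarith⟩
  · rintro ⟨⟨h1, h2⟩, ⟨h3, h4⟩, h5, h6⟩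
    exact ⟨⟨⟨by linarith, by linarith⟩, by linarith, by linarith⟩, by linarith, by linarith⟩

theorem continuous_boxGauge : Continuous (boxGauge n) := by
  unfold boxGauge; fun_prop

theorem dihedralSign_signLift (m : ℕ) (u : ℤˣ) : dihedralSign m (signLift m u) = u := by
  rcases Int.units_eq_one_or u with rfl | rfl
  · simp
  · change dihedralSign m (if (-1 : ℤˣ) = 1 then 1 else .sr 0) = -1
    rw [if_neg (by decide)]; rfl

/-- The sign system of the axis. -/
noncomputable abbrev axisSign : Space → Space → ℤˣ := flipSign (fun P => P 1 < 0) fun P => P 2 < 0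

theorem labelAt_lateral {P Q : Space}
    (hPQ : (P 0 < -3 / 2 ∧ Q 0 < -3 / 2) ∨ 4 * (n : ℝ) + 11 / 2 < P 0 ∨ P 1 < -7 / 2)
    (hQ : underWind n Q = underAxis Q) :
    labelAt n P Q = bif belowAxis P && underAxis Q then .sr 0 else 1 := by
  have hn := n.cast_nonneg (α := ℝ)
  have hall : ∀ b c, tangleLabel n c b b b (underAxis Q) (underAxis Q) =
      bif b && underAxis Q then .sr 0 else 1 := by
    intro b c
    cases b
    · rw [tangleLabel_none]; rfl
    · cases underAxis Q
      · rw [tangleLabel_top]; rfl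
      · rw [tangleLabel_all]; rfl
  rw [labelAt, hQ]
  rcases hPQ with ⟨h, hq⟩ | h | h
  · have e1 : belowWind n P = belowBack n P := by
      rw [belowWind, belowBack, (wind_of_le (by linarith)).1, backY_of_le (by linarith)]
    rw [e1, slab_of_le (by linarith)]
    rcases hb : belowBack n P with _ | _ <;> rcases he : belowAxis P with _ | _
    · exact hall _ _
    · cases underAxis Q
      · rw [tangleLabel_top]; rfl
      · simp [tangleLabel, sheetLabel, axisLabel, reflection_zero]
    · rw [belowBack, decide_eq_true_iff] at hb
      rw [belowAxis, decide_eq_false_iff_not] at he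
      linarith [(backY_bounds (n := n) (P 0)).2]
    · exact hall _ _
  · have e1 : belowWind n P = belowAxis P := by
      rw [belowWind, (wind_of_ge (by linarith)).1, belowAxis]
    have e2 : belowBack n P = belowAxis P := by
      rw [belowBack, backY_of_ge (by linarith), belowAxis]
    rw [e1, e2]; exact hall _ _
  · have e1 : belowWind n P = true :=
      decide_eq_true (by linarith [(windY_bounds (n := n) (P 0)).1])
    have e2 : belowBack n P = true :=
      decide_eq_true (by linarith [(backY_bounds (n := n) (P 0)).1])
    have e3 : belowAxis P = true := decide_eq_true (by linarith)
    rw [e1, e2, e3]; exact hall _ _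

theorem tangleSystem_of_label {P Q : Space} (hP : underWind n P = underAxis P)
    (hQ : underWind n Q = underAxis Q)
    (h : ∀ R, R = P ∨ R = Q → labelAt n P R = bif belowAxis P && underAxis R then .sr 0 else 1) :
    tangleSystem n P Q = signLift _ (axisSign P Q) := by
  have e1 : (P 1 < 0) = (belowAxis P = true) := by rw [belowAxis, decide_eq_true_iff]
  have e2 : ∀ P : Space, (P 2 < 0) = (underAxis P = true) := fun P => by
    rw [underAxis, decide_eq_true_iff]
  rw [tangleSystem, h _ (Or.inl rfl), h _ (Or.inr rfl), axisSign, flipSign, e1, e2, e2, hP, hQ]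
  rcases belowAxis P with _ | _ <;> rcases underAxis P with _ | _ <;>
    rcases underAxis Q with _ | _ <;> simp [signLift]

theorem labelAt_upper {P Q : Space} (h : 3 / 2 < P 1) : labelAt n P Q = 1 := by
  have e1 : belowWind n P = false :=
    decide_eq_false (by linarith [(windY_bounds (n := n) (P 0)).2])
  have e2 : belowBack n P = false :=
    decide_eq_false (by linarith [(backY_bounds (n := n) (P 0)).2])
  have e3 : belowAxis P = false := decide_eq_false (by linarith)
  rw [labelAt, e1, e2, e3, tangleLabel_none]

theorem under_of_high {P : Space} (h : 3 / 2 < P 2) :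
    underWind n P = false ∧ underAxis P = false :=
  ⟨decide_eq_false (by split_ifs <;> linarith [(windZ_bounds (n := n) (P 0)).2]),
    decide_eq_false (by linarith)⟩

theorem under_of_low {P : Space} (h : P 2 < -3 / 2) :
    underWind n P = true ∧ underAxis P = true :=
  ⟨decide_eq_true (by split_ifs <;> linarith [(windZ_bounds (n := n) (P 0)).1]),
    decide_eq_true (by linarith)⟩

/-- In the shell of the box the tangle system is the sign system of the axis. -/
theorem tangleSystem_shell {x : Space} (hx : 1 / 2 < boxGauge n x) :
    ∀ᶠ r in 𝓝 x ×ˢ 𝓝 x, tangleSystem n r.1 r.2 = signLift _ (axisSign r.1 r.2) := by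
  have mk : ∀ U : Set Space, IsOpen U → x ∈ U → (∀ P ∈ U, ∀ Q ∈ U, tangleSystem n P Q =
      signLift _ (axisSign P Q)) → ∀ᶠ r in 𝓝 x ×ˢ 𝓝 x, tangleSystem n r.1 r.2 =
      signLift _ (axisSign r.1 r.2) := by
    intro U hU hxU h
    have := hU.eventually_mem hxU
    filter_upwards [this.prod_mk this] with r hr using h _ hr.1 _ hr.2
  have lo : ∀ (i : Fin 3) (c : ℝ), IsOpen {P : Space | P i < c} := fun i c =>
    isOpen_lt (continuous_apply i) continuous_const
  have hi : ∀ (i : Fin 3) (c : ℝ), IsOpen {P : Space | c < P i} := fun i c =>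
    isOpen_lt continuous_const (continuous_apply i)
  have hz : ∀ P Q : Space, (3 / 2 < P 2 ∧ 3 / 2 < Q 2) ∨ (P 2 < -3 / 2 ∧ Q 2 < -3 / 2) →
      tangleSystem n P Q = signLift _ (axisSign P Q) := by
    rintro P Q (⟨h, k⟩ | ⟨h, k⟩)
    · rw [axisSign, flipSign_of_iff (iff_of_false (by linarith) (by linarith)), tangleSystem,
        if_pos ⟨(under_of_high h).1.trans (under_of_high k).1.symm, (under_of_high (n := n) h).2.trans (under_of_high (n := n) k).2.symm⟩, map_one]
    · rw [axisSign, flipSign_of_iff (iff_of_true (by linarith) (by linarith)), tangleSystem,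
        if_pos ⟨(under_of_low h).1.trans (under_of_low k).1.symm, (under_of_low (n := n) h).2.trans (under_of_low (n := n) k).2.symm⟩, map_one]
  simp only [boxGauge, lt_max_iff, lt_sub_iff_add_lt, lt_abs] at hx
  by_cases h1 : 3 / 2 < x 1
  · refine mk _ (hi 1 (3 / 2)) h1 fun P hP Q hQ => ?_
    rw [tangleSystem, labelAt_upper hP, labelAt_upper hP, axisSign,
      flipSign_of_not (by rw [not_lt]; linarith [show 3 / 2 < P 1 from hP])]
    simp
  rcases hx with ((hx | hx) | hx | hx) | hx | hx
  · exact mk _ (hi 0 (4 * n + 11 / 2)) (by rw [mem_ofPred_eq]; linarith) fun P hP Q hQ => by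
      have e : ∀ P : Space, 4 * (n : ℝ) + 11 / 2 < P 0 → underWind n P = underAxis P := fun P h => by
        rw [underWind, underAxis, (wind_of_ge (by linarith)).2, ite_self]
      exact tangleSystem_of_label (e P hP) (e Q hQ) (by
        rintro R (rfl | rfl)
        exacts [labelAt_lateral (Or.inr (Or.inl hP)) (e _ hP),
          labelAt_lateral (Or.inr (Or.inl hP)) (e _ hQ)])
  · exact mk _ (lo 0 (-3 / 2)) (by rw [mem_ofPred_eq]; linarith) fun P hP Q hQ => by
      have e : ∀ P : Space, P 0 < -3 / 2 → underWind n P = underAxis P := fun P h => by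
        rw [underWind, underAxis, (wind_of_le (by linarith)).2, ite_self]
      exact tangleSystem_of_label (e P hP) (e Q hQ) (by
        rintro R (rfl | rfl)
        exacts [labelAt_lateral (Or.inl ⟨hP, hP⟩) (e _ hP),
          labelAt_lateral (Or.inl ⟨hP, hQ⟩) (e _ hQ)])
  · linarith
  · exact mk _ (lo 1 (-7 / 2)) (by rw [mem_ofPred_eq]; linarith) fun P hP Q hQ => by
      have e : ∀ P : Space, P 1 < -7 / 2 → underWind n P = underAxis P := fun P h => by
        rw [underWind, underAxis, if_neg (not_lt.2 h.le)]
      exact tangleSystem_of_label (e P hP) (e Q hQ) (by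
        rintro R (rfl | rfl)
        exacts [labelAt_lateral (Or.inr (Or.inr hP)) (e _ hP),
          labelAt_lateral (Or.inr (Or.inr hP)) (e _ hQ)])
  · exact mk _ (hi 2 (3 / 2)) (by rw [mem_ofPred_eq]; linarith) fun P hP Q hQ =>
      hz P Q (Or.inl ⟨hP, hQ⟩)
  · exact mk _ (lo 2 (-3 / 2)) (by rw [mem_ofPred_eq]; linarith) fun P hP Q hQ =>
      hz P Q (Or.inr ⟨hP, hQ⟩)

end Shell

theorem IsTrivialOn.of_dense_subset {E Γ : Type*} [TopologicalSpace E] [Group Γ] {φ : E → E → Γ}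
    {D D' Y : Set E} (hφ : IsSystem φ D Y) (hD' : Dense D') (hDD' : D' ⊆ D)
    (h : IsTrivialOn φ D' Y) : IsTrivialOn φ D Y := by
  classical
  obtain ⟨f, hf⟩ := h
  refine ⟨fun P => if h : ∃ v, ∀ᶠ Q in 𝓝[D'] P, f Q * φ Q P = v then h.choose else 1,
    fun x hx => ?_⟩
  obtain ⟨g, hg⟩ := hφ x hx
  obtain ⟨N, hN, hxN, hNc⟩ := locConst_iff.1 ((hg.mono hDD').locConst (hf x hx))
  obtain ⟨M, hM, hxM, hMc⟩ := pot_iff.1 hg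
  obtain ⟨Z, hZ, hZD⟩ := hD'.exists_mem_open hN ⟨x, hxN⟩
  refine (hg.const_mul (f Z * (g Z)⁻¹)).congr (mem_nhdsWithin.2
    ⟨N ∩ M, hN.inter hM, ⟨hxN, hxM⟩, ?_⟩)
  rintro P ⟨⟨hPN, hPM⟩, hPD⟩
  have hne : (𝓝[D'] P).NeBot := mem_closure_iff_nhdsWithin_neBot.1 (hD' P)
  have hev : ∀ᶠ Q in 𝓝[D'] P, f Q * φ Q P = f Z * (g Z)⁻¹ * g P := by
    refine mem_nhdsWithin.2 ⟨N ∩ M, hN.inter hM, ⟨hPN, hPM⟩, ?_⟩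
    rintro Q ⟨⟨hQN, hQM⟩, hQD⟩
    rw [mem_ofPred_eq, hMc Q ⟨hQM, hDD' hQD⟩ P ⟨hPM, hPD⟩, ← mul_assoc]
    congr 1
    exact hNc Q ⟨hQN, hQD⟩ Z ⟨hZD, hZ⟩
  have hex : ∃ v, ∀ᶠ Q in 𝓝[D'] P, f Q * φ Q P = v := ⟨_, hev⟩
  rw [mem_ofPred_eq, dif_pos hex]
  obtain ⟨Q, h1, h2⟩ := (hex.choose_spec.and hev).exists
  exact h2.symm.trans h1

section Gluing
variable {n : ℕ}

theorem isOpen_boxGauge_lt (t : ℝ) : IsOpen {P | boxGauge n P < t} :=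
  isOpen_lt continuous_boxGauge continuous_const

/-- The axis and its sign system. -/
theorem niceAt_axis {x : Space} (hx : x 1 = 0 ∧ x 2 = 0) :
    NiceAt {P : Space | P 1 = 0 ∧ P 2 = 0} x ∧ ∀ D, Dense D →
      ¬MeridianTrivial axisSign D {P : Space | P 1 = 0 ∧ P 2 = 0} x := by
  refine niceAt_of_halfPlane (b := -ContinuousLinearMap.proj (R := ℝ) (1 : Fin 3))
    (w := -ContinuousLinearMap.proj (R := ℝ) (2 : Fin 3)) (eb := ![0, -1, 0]) (ew := ![0, 0, -1])
    (by simp) (by simp) (by simp) (by simp) (Eventually.of_forall fun P => ?_)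
  simp [hx.1, hx.2]

theorem isSystem_axisSign (D : Set Space) :
    IsSystem axisSign D {P : Space | P 1 = 0 ∧ P 2 = 0}ᶜ := by
  intro x hx
  have lo : ∀ (i : Fin 3), IsOpen {P : Space | P i < 0} := fun i =>
    isOpen_lt (continuous_apply i) continuous_const
  have hi : ∀ (i : Fin 3), IsOpen {P : Space | 0 < P i} := fun i =>
    isOpen_lt continuous_const (continuous_apply i)
  rcases lt_trichotomy (x 1) 0 with h | h | h
  · exact ⟨_, pot_flipSign_of_pos ((lo 1).eventually_mem h)⟩
  · rcases lt_or_gt_of_ne (fun h2 => hx ⟨h, h2⟩) with h2 | h2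
    · exact ⟨_, pot_flipSign_of_iff (Or.inl ((lo 2).eventually_mem h2))⟩
    · exact ⟨_, pot_flipSign_of_iff (Or.inr (((hi 2).eventually_mem h2).mono
        fun P hP => not_lt.2 (le_of_lt hP)))⟩
  · exact ⟨_, pot_flipSign_of_not (((hi 1).eventually_mem h).mono fun P hP => not_lt.2 (le_of_lt hP))⟩

/-- A sign system that is nontrivial around the axis of the box differs from the sign system of the
axis by a gauge transformation. -/
theorem exists_gauge {K : Set Space} {D : Set Space} {σ : Space → Space → ℤˣ} (hD : Dense D)
    (hDK : D ⊆ Kᶜ) (hσ : IsSystem σ D Kᶜ) (hσ' : ¬IsTrivialOn σ D Kᶜ)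
    (hn : ∀ x ∈ K, NiceAt K x) (hK : IsPreconnected K)
    (hbox : ∀ x, boxGauge n x < 2 → (x ∈ K ↔ x 1 = 0 ∧ x 2 = 0)) :
    ∃ u : Space → ℤˣ, ∀ x, boxGauge n x < 2 → x ∉ K →
      Pot (fun a b => axisSign a b * σ a b) D x u := by
  have hnice := isPotentialSheaf_compl (φ := fun a b => axisSign a b * σ a b) hD hDK hn
  have hc : (![0, -1, 0] : Space) ∈ {P : Space | boxGauge n P < 2} := by
    rw [mem_ofPred_eq, boxGauge_lt_iff]
    have := n.cast_nonneg (α := ℝ)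
    simp [openBox]
    norm_num; positivity
  suffices hall : ∀ x ∈ {P : Space | boxGauge n P < 2}, ∃ f, ∀ᶠ y in 𝓝 x, y ∉ K →
      Pot (fun a b => axisSign a b * σ a b) D y f by
    obtain ⟨u, hu⟩ := hnice.exists_global hD (isOpen_boxGauge_lt (n := n) 2) hc
      (by simp only [boxGauge_lt_iff] at hc ⊢; exact (convex_openBox _ _).starConvex hc) hall
    exact ⟨u, fun x hx hxK => (hu x hx).self_of_nhds hxK⟩
  intro x hx
  have hN := (isOpen_boxGauge_lt (n := n) 2).mem_nhds hx
  have hax : ∀ y, boxGauge n y < 2 → y ∉ K → y ∈ {P : Space | P 1 = 0 ∧ P 2 = 0}ᶜ :=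
    fun y hy hyK h => hyK ((hbox y hy).2 h)
  by_cases hxK : x ∈ K
  · refine (hn x hxK).meridianTrivial_mul (fun a b => units_int_mul_eq_one) hD hN
      ((isSystem_axisSign D).mono (fun y hy => hax y hy.1 hy.2) subset_rfl)
      (hσ.mono (fun y hy => hy.2) subset_rfl) ?_
      fun h => hσ' (h.isTrivialOn_compl hD hDK hσ hn hK hxK)
    rintro ⟨f, hf⟩
    refine (niceAt_axis ((hbox x hx).1 hxK)).2 D hD ⟨f, ?_⟩
    filter_upwards [hf, hN] with y h1 h2 h3 using h1 fun h => h3 ((hbox y h2).1 h)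
  · obtain ⟨f, hf⟩ := isSystem_axisSign D x (hax x hx hxK)
    obtain ⟨g, hg⟩ := hσ x hxK
    exact ⟨_, (hf.mul hg).eventually.mono fun y h _ => h⟩

open Classical in
/-- The tangle system glued into a sign system. -/
noncomputable def gluedSystem (n : ℕ) (σ : Space → Space → ℤˣ) (u : Space → ℤˣ) (P Q : Space) :
    DihedralGroup (4 * n + 1) :=
  if boxGauge n P < 1 ∧ boxGauge n Q < 1 then
    signLift _ (u P) * tangleSystem n P Q * signLift _ (u Q)
  else signLift _ (σ P Q)

theorem gluedSystem_inside {σ : Space → Space → ℤˣ} {u : Space → ℤˣ} {x : Space}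
    (hx : boxGauge n x < 1) : ∀ᶠ r in 𝓝 x ×ˢ 𝓝 x, gluedSystem n σ u r.1 r.2 =
      signLift _ (u r.1) * tangleSystem n r.1 r.2 * signLift _ (u r.2) := by
  have := (isOpen_boxGauge_lt (n := n) 1).eventually_mem hx
  filter_upwards [this.prod_mk this] with r hr
  rw [gluedSystem, if_pos hr]

theorem gluedSystem_outside {K D : Set Space} {σ : Space → Space → ℤˣ} {u : Space → ℤˣ}
    (hu : ∀ x, boxGauge n x < 2 → x ∉ K → Pot (fun a b => axisSign a b * σ a b) D x u)
    {x : Space} (hxK : x ∉ K) (hx : 1 / 2 < boxGauge n x) :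
    ∀ᶠ r in 𝓝[D] x ×ˢ 𝓝[D] x, gluedSystem n σ u r.1 r.2 = signLift _ (σ r.1 r.2) := by
  rcases lt_or_ge (boxGauge n x) 2 with h2 | h2
  · filter_upwards [hu x h2 hxK, (tangleSystem_shell hx).filter_mono
      (Filter.prod_mono nhdsWithin_le_nhds nhdsWithin_le_nhds)] with r h3 h4
    rw [gluedSystem]
    split_ifs
    · rw [h4, ← map_mul, ← map_mul]
      congr 1
      rcases Int.units_eq_one_or (u r.1) with h5 | h5 <;>
      rcases Int.units_eq_one_or (u r.2) with h6 | h6 <;>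
      rcases Int.units_eq_one_or (axisSign r.1 r.2) with h7 | h7 <;>
      rcases Int.units_eq_one_or (σ r.1 r.2) with h8 | h8 <;>
      rw [h5, h6, h7, h8] at h3 <;> rw [h5, h6, h7, h8] <;> revert h3 <;> decide
    · rfl
  · have := ((isOpen_lt continuous_const continuous_boxGauge :
      IsOpen {P | 1 < boxGauge n P}).eventually_mem (show 1 < boxGauge n x by linarith))
    have := eventually_nhdsWithin_of_eventually_nhds (s := D) this
    filter_upwards [this.prod_mk this] with r hr
    rw [gluedSystem, if_neg fun h => (not_lt_of_gt h.1) hr.1]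

theorem mem_tangle {P : Space} (h : P ∈ tangle n) :
    (P 1 = 0 ∨ P 1 = interp (windY n) (P 0) ∨ P 1 = interp (backY n) (P 0)) ∧
      (P 2 = 0 ∨ P 2 = interp (windZ n) (P 0)) := by
  rcases h with (h | h) | h
  · exact ⟨Or.inl h.1, Or.inl h.2.1⟩
  · exact ⟨Or.inr (Or.inl h.2.1), Or.inr h.2.2⟩
  · exact ⟨Or.inr (Or.inr h.2.1), Or.inl h.2.2⟩

theorem IsFlat.act_eq {m : ℕ} {E : Type*} [NormedAddCommGroup E] [NormedSpace ℝ E]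
    {φ : E → E → DihedralGroup m} {D Y O : Set E} {h : E → ZMod m}
    {f : E → DihedralGroup m} (hh : IsFlat φ D Y h) (hD : Dense D) (hO : Convex ℝ O) (hOY : O ⊆ Y)
    (hf : ∀ x ∈ O, Pot φ D x f) {P Q : E} (hP : P ∈ O) (hPD : P ∈ D) (hQ : Q ∈ O) (hQD : Q ∈ D) :
    dihedralAct (f P) (h P) = dihedralAct (f Q) (h Q) := by
  refine LocConst.eq_of_isPreconnected (u := fun P => dihedralAct (f P) (h P)) hD hO.isPreconnected
    (fun x hx => ?_) hP hPD hQ hQD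
  have h1 := hf x hx
  unfold Pot at h1
  unfold LocConst
  filter_upwards [h1, hh x (hOY hx)] with r h1 h2
  rw [h2, h1, ← dihedralAct_mul, mul_inv_cancel_left]

theorem pot_tangleSystem_of_far {x : Space} {D : Set Space} (h : 3 / 2 < x 2 ∨ x 2 < -3 / 2) :
    Pot (tangleSystem n) D x 1 := by
  have key : ∀ U : Set Space, IsOpen U → x ∈ U → (∀ P ∈ U, ∀ Q ∈ U,
      underWind n P = underWind n Q ∧ underAxis P = underAxis Q) → Pot (tangleSystem n) D x 1 := by
    intro U hU hx h
    have := eventually_nhdsWithin_of_eventually_nhds (s := D) (hU.eventually_mem hx)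
    filter_upwards [this.prod_mk this] with r hr
    rw [tangleSystem, if_pos (h _ hr.1 _ hr.2)]; simp
  rcases h with h | h
  · refine key {P | 3 / 2 < P 2} (isOpen_lt continuous_const (continuous_apply 2)) h
      fun P hP Q hQ => ?_
    rw [(under_of_high hP).1, (under_of_high (n := n) hP).2, (under_of_high hQ).1, (under_of_high (n := n) hQ).2]
    exact ⟨rfl, rfl⟩
  · refine key {P | P 2 < -3 / 2} (isOpen_lt (continuous_apply 2) continuous_const) h
      fun P hP Q hQ => ?_
    rw [(under_of_low hP).1, (under_of_low (n := n) hP).2, (under_of_low hQ).1, (under_of_low (n := n) hQ).2]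
    exact ⟨rfl, rfl⟩

theorem isOpen_openBox (a b : Space) : IsOpen (openBox a b) := by
  have lo : ∀ i : Fin 3, IsOpen {P : Space | P i < b i} := fun i =>
    isOpen_lt (continuous_apply i) continuous_const
  have hi : ∀ i : Fin 3, IsOpen {P : Space | a i < P i} := fun i =>
    isOpen_lt continuous_const (continuous_apply i)
  exact ((hi 0).inter (lo 0)).inter (((hi 1).inter (lo 1)).inter ((hi 2).inter (lo 2)))

/-- The tangle system has no flat section. -/
theorem not_isFlat_tangleSystem (hn : 1 ≤ n) {D : Set Space} (hD : Dense D)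
    (h : Space → ZMod (4 * n + 1)) :
    ¬IsFlat (tangleSystem n) D {x | boxGauge n x < 1 ∧ x ∉ tangle n} h := by
  intro hf
  have hn' : (1 : ℝ) ≤ n := by exact_mod_cast hn
  have pick : ∀ y1 y2 z1 z2 : ℝ, y1 < y2 → z1 < z2 →
      ∃ P ∈ D, P ∈ openBox ![0, y1, z1] ![1 / 2, y2, z2] := by
    intro y1 y2 z1 z2 hy hz
    obtain ⟨P, h1, h2⟩ := hD.exists_mem_open (isOpen_openBox ![0, y1, z1] ![1 / 2, y2, z2])
      ⟨![1 / 4, (y1 + y2) / 2, (z1 + z2) / 2], by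
        simp only [openBox, mem_ofPred_eq, Matrix.cons_val]
        exact ⟨⟨by norm_num, by norm_num⟩, ⟨by linarith, by linarith⟩, by linarith, by linarith⟩⟩
    exact ⟨P, h1, h2⟩
  have box : ∀ {P : Space} {y1 y2 z1 z2 : ℝ}, P ∈ openBox ![0, y1, z1] ![1 / 2, y2, z2] ↔
      (0 < P 0 ∧ P 0 < 1 / 2) ∧ (y1 < P 1 ∧ P 1 < y2) ∧ z1 < P 2 ∧ P 2 < z2 := fun {P _ _ _ _} => by
    simp only [openBox, mem_ofPred_eq, Matrix.cons_val]
  have big : ∀ P : Space, (0 < P 0 ∧ P 0 < 1 / 2) → (-4 < P 1 ∧ P 1 < 2) → (-2 < P 2 ∧ P 2 < 2) →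
      boxGauge n P < 1 := by
    rintro P ⟨h1, h2⟩ ⟨h3, h4⟩ ⟨h5, h6⟩
    rw [boxGauge_lt_iff]
    simp only [openBox, mem_ofPred_eq, Matrix.cons_val]
    exact ⟨⟨by linarith, by linarith⟩, ⟨by linarith, by linarith⟩, by linarith, by linarith⟩
  have flat : ∀ z1 z2 : ℝ, -2 ≤ z1 → z2 ≤ 2 → (3 / 2 ≤ z1 ∨ z2 ≤ -3 / 2) → ∀ P Q : Space, P ∈ D →
      Q ∈ D → P ∈ openBox ![0, -4, z1] ![1 / 2, 2, z2] → Q ∈ openBox ![0, -4, z1] ![1 / 2, 2, z2] →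
      h P = h Q := by
    intro z1 z2 h1 h2 h3 P Q hP hQ hP' hQ'
    have := hf.act_eq (O := openBox ![0, -4, z1] ![1 / 2, 2, z2]) (f := 1) hD (convex_openBox _ _)
      (fun x hx => ?_) (fun x hx => pot_tangleSystem_of_far ?_) hP' hP hQ' hQ
    · simpa [dihedralAct_one] using this
    · obtain ⟨h4, h5, h6, h7⟩ := box.1 hx
      refine ⟨big x h4 h5 ⟨by linarith, by linarith⟩, fun h8 => ?_⟩
      have := windZ_bounds (n := n) (x 0)
      rcases (mem_tangle h8).2 with h9 | h9 <;> rcases h3 with h3 | h3 <;> linarith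
    · obtain ⟨h4, h5, h6, h7⟩ := box.1 hx
      rcases h3 with h3 | h3
      · exact Or.inl (by linarith)
      · exact Or.inr (by linarith)
  have column : ∀ (y1 y2 : ℝ) (lab : Space → DihedralGroup (4 * n + 1)), -4 ≤ y1 → y2 ≤ 2 →
      (∀ P : Space, (0 < P 0 ∧ P 0 < 1 / 2) → (y1 < P 1 ∧ P 1 < y2) → P 1 ≠ interp (windY n) (P 0) ∧
        P 1 ≠ 0 ∧ P 1 ≠ interp (backY n) (P 0) ∧ ∀ Q : Space, (0 < Q 0 ∧ Q 0 < 1 / 2) →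
        labelAt n P Q = lab Q) →
      ∀ P Q : Space, P ∈ D → Q ∈ D → P ∈ openBox ![0, y1, -2] ![1 / 2, y2, 2] →
      Q ∈ openBox ![0, y1, -2] ![1 / 2, y2, 2] →
      dihedralAct (lab P) (h P) = dihedralAct (lab Q) (h Q) := by
    intro y1 y2 lab h1 h2 h3 P Q hP hQ hP' hQ'
    refine hf.act_eq (O := openBox ![0, y1, -2] ![1 / 2, y2, 2]) hD (convex_openBox _ _)
      (fun x hx => ?_) (fun x hx => ?_) hP' hP hQ' hQ
    · obtain ⟨h4, h5, h6⟩ := box.1 hx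
      refine ⟨big x h4 ⟨by linarith, by linarith⟩ h6, fun h8 => ?_⟩
      obtain ⟨k1, k2, k3, -⟩ := h3 x h4 h5
      rcases (mem_tangle h8).1 with h9 | h9 | h9
      exacts [k2 h9, k1 h9, k3 h9]
    · obtain ⟨h4, h5, h6⟩ := box.1 hx
      obtain ⟨k1, k2, k3, k4⟩ := h3 x h4 h5
      refine (pot_labelAt k1 k2 k3).congr (eventually_nhdsWithin_of_eventually_nhds ?_)
      filter_upwards [(isOpen_openBox ![0, y1, -2] ![1 / 2, y2, 2]).eventually_mem hx] with Q hQ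
        using k4 Q (box.1 hQ).1
  obtain ⟨P1, hP1, hP1'⟩ := pick (3 / 2) 2 (3 / 2) 2 (by norm_num) (by norm_num)
  obtain ⟨Q1, hQ1, hQ1'⟩ := pick (3 / 2) 2 (-2) (-3 / 2) (by norm_num) (by norm_num)
  obtain ⟨P2, hP2, hP2'⟩ := pick (-2) (-1) (3 / 2) 2 (by norm_num) (by norm_num)
  obtain ⟨Q2, hQ2, hQ2'⟩ := pick (-2) (-1) (-2) (-3 / 2) (by norm_num) (by norm_num)
  rw [box] at hP1' hQ1' hP2' hQ2'
  have e1 := flat (3 / 2) 2 (by norm_num) le_rfl (Or.inl le_rfl) P1 P2 hP1 hP2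
    (box.2 ⟨hP1'.1, ⟨by linarith, by linarith⟩, hP1'.2.2⟩)
    (box.2 ⟨hP2'.1, ⟨by linarith, by linarith⟩, hP2'.2.2⟩)
  have e2 := flat (-2) (-3 / 2) le_rfl (by norm_num) (Or.inr le_rfl) Q1 Q2 hQ1 hQ2
    (box.2 ⟨hQ1'.1, ⟨by linarith, by linarith⟩, hQ1'.2.2⟩)
    (box.2 ⟨hQ2'.1, ⟨by linarith, by linarith⟩, hQ2'.2.2⟩)
  have e3 := column (3 / 2) 2 1 (by norm_num) le_rfl (fun P _ hP => by
      have := windY_bounds (n := n) (P 0)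
      have := backY_bounds (n := n) (P 0)
      exact ⟨by linarith, by linarith, by linarith, fun Q _ => labelAt_upper hP.1⟩) P1 Q1 hP1 hQ1
    (box.2 ⟨hP1'.1, hP1'.2.1, by linarith, by linarith⟩)
    (box.2 ⟨hQ1'.1, hQ1'.2.1, by linarith, by linarith⟩)
  have hlow : ∀ P : Space, (0 < P 0 ∧ P 0 < 1 / 2) → interp (windY n) (P 0) = -1 + 2 * P 0 := by
    intro P hP
    have w0 : windY n 0 = -1 := by unfold windY; rw [if_neg, if_pos, if_pos] <;> omega
    have w1 : windY n (0 + 1) = 1 := by unfold windY; rw [if_neg, if_pos, if_neg] <;> omega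
    rw [interp_eq _ (j := 0) (by push_cast; linarith) (by push_cast; linarith), w0, w1]
    push_cast; ring
  have e4 := column (-2) (-1) (fun Q => tangleLabel n 0 true true false (underWind n Q) (underAxis Q))
    (by norm_num) (by norm_num) (fun P hP hP' => by
      have h5 := hlow P hP
      have h6 : interp (backY n) (P 0) = -2 := backY_of_le (by linarith)
      refine ⟨by linarith, by linarith, by linarith, fun Q hQ => ?_⟩
      rw [labelAt, slab_of_le (by linarith), belowWind, belowAxis, belowBack,
        decide_eq_true (by linarith), decide_eq_true (by linarith), decide_eq_false (by linarith)])
    P2 Q2 hP2 hQ2 (box.2 ⟨hP2'.1, hP2'.2.1, by linarith, by linarith⟩)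
    (box.2 ⟨hQ2'.1, hQ2'.2.1, by linarith, by linarith⟩)
  have hlab : tangleLabel n 0 true true false true true = .r 1 := by
    simp only [tangleLabel, if_pos Even.zero, sheetLabel, Bool.and_self, cond_true, cond_false,
      windLabel_mul_axisLabel Even.zero]
  rw [(under_of_high hP2'.2.2.1).1, (under_of_high (n := n) hP2'.2.2.1).2, (under_of_low hQ2'.2.2.2).1,
    (under_of_low (n := n) hQ2'.2.2.2).2, hlab, tangleLabel_top, dihedralAct_one] at e4
  simp only [Pi.one_apply, dihedralAct_one] at e3
  rw [← e1, e3, e2] at e4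
  simp only [dihedralAct, dihedralShift, dihedralSign_r] at e4
  have : Fact (1 < 4 * n + 1) := ⟨by omega⟩
  simp at e4

/-- A knot that contains the tangle in a box, and that continues outside as a knot containing the
axis of the box, has a dihedral coloring. -/
theorem colorable_of_tangle (hn : 1 ≤ n) {K K' D : Set Space} {σ : Space → Space → ℤˣ}
    (hD : Dense D) (hDK : D ⊆ Kᶜ) (hσ : IsSystem σ D Kᶜ) (hσ' : ¬IsTrivialOn σ D Kᶜ)
    (hK : ∀ x ∈ K, NiceAt K x) (hKc : IsPreconnected K)
    (hbox : ∀ x, boxGauge n x < 2 → (x ∈ K ↔ x 1 = 0 ∧ x 2 = 0))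
    (hK' : IsClosed K') (hK'd : Dense K'ᶜ)
    (hin : ∀ x, boxGauge n x < 1 → (x ∈ K' ↔ x ∈ tangle n))
    (hout : ∀ x, 1 / 2 < boxGauge n x → (x ∈ K' ↔ x ∈ K)) : Colorable (4 * n + 1) K' := by
  obtain ⟨u, hu⟩ := exists_gauge hD hDK hσ hσ' hK hKc hbox
  have hD' : Dense (D ∩ K'ᶜ) := hD.inter_of_isOpen_right hK'd hK'.isOpen_compl
  have hout' : ∀ x ∉ K, 1 / 2 < boxGauge n x → ∀ᶠ r in 𝓝[D ∩ K'ᶜ] x ×ˢ 𝓝[D ∩ K'ᶜ] x,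
      gluedSystem n σ u r.1 r.2 = signLift _ (σ r.1 r.2) := fun x hxK hx =>
    (gluedSystem_outside hu hxK hx).filter_mono (Filter.prod_mono
      (nhdsWithin_mono _ inter_subset_left) (nhdsWithin_mono _ inter_subset_left))
  have hsq : ∀ v : ℤˣ, signLift (4 * n + 1) v * signLift (4 * n + 1) v = 1 := fun v => by
    rw [← map_mul, Int.units_mul_self, map_one]
  have hinv : ∀ v : ℤˣ, (signLift (4 * n + 1) v)⁻¹ = signLift (4 * n + 1) v := fun v =>
    inv_eq_of_mul_eq_one_left (hsq v)
  refine ⟨D ∩ K'ᶜ, gluedSystem n σ u, hD', inter_subset_right, ⟨fun x hx => ?_, ?_, ?_⟩⟩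
  · rcases le_or_gt (boxGauge n x) (1 / 2) with h | h
    · have h1 : boxGauge n x < 1 := by linarith
      obtain ⟨f, hf⟩ := isSystem_tangleSystem (D ∩ K'ᶜ) x fun h2 => hx ((hin x h1).2 h2)
      refine ⟨fun P => f P * signLift _ (u P), ?_⟩
      unfold Pot at hf ⊢
      filter_upwards [hf, (gluedSystem_inside (σ := σ) (u := u) h1).filter_mono
        (Filter.prod_mono nhdsWithin_le_nhds nhdsWithin_le_nhds)] with r h2 h3
      rw [h3, h2, mul_inv_rev, hinv]; group
    · have hxK : x ∉ K := fun h1 => hx ((hout x h).2 h1)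
      obtain ⟨f, hf⟩ := hσ x hxK
      refine ⟨_, ((hf.mono inter_subset_left).map (signLift (4 * n + 1))).congr_system ?_⟩
      filter_upwards [hout' x hxK h] with r hr using hr.symm
  · rintro ⟨f, hf⟩
    have hc : boxGauge n ![-2, 0, 0] = 1 := by
      have : |(-2 : ℝ) - (2 * n + 2)| = 2 * n + 4 := by
        rw [abs_of_nonpos (by linarith [n.cast_nonneg (α := ℝ)])]; ring
      simp only [boxGauge, Matrix.cons_val, this]
      norm_num
    have hcK : (![-2, 0, 0] : Space) ∈ K := (hbox _ (by rw [hc]; norm_num)).2 ⟨rfl, rfl⟩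
    refine hσ' (.of_dense_subset hσ hD' inter_subset_left (MeridianTrivial.isTrivialOn_compl hD'
      (inter_subset_left.trans hDK) (hσ.mono subset_rfl inter_subset_left) hK hKc hcK ⟨f, ?_⟩))
    filter_upwards [(isOpen_lt continuous_const continuous_boxGauge :
      IsOpen {P | 1 / 2 < boxGauge n P}).eventually_mem (show 1 / 2 < boxGauge n ![-2, 0, 0] by rw [hc]; norm_num)]
      with y hy hyK
    refine (hf y fun h => hyK ((hout y hy).1 h)).congr_system ?_
    filter_upwards [hout' y hyK hy] with r hr
    rw [hr, dihedralSign_signLift]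
  · intro h hh
    refine not_isFlat_tangleSystem hn hD' (fun P => dihedralAct (signLift _ (u P)) (h P))
      fun x hx => ?_
    filter_upwards [hh x fun h1 => hx.2 ((hin x hx.1).1 h1),
      (gluedSystem_inside (σ := σ) (u := u) hx.1).filter_mono
        (Filter.prod_mono nhdsWithin_le_nhds nhdsWithin_le_nhds)] with r h2 h3
    rw [h2, h3, ← dihedralAct_mul, ← dihedralAct_mul, ← mul_assoc, ← mul_assoc, hsq, one_mul]

end Gluing

section TangleVertices
variable {n : ℕ}

theorem mem_segment_iff_of_lt {X Y P : Space} (h : X 0 < Y 0) : P ∈ segment ℝ X Y ↔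
    (X 0 ≤ P 0 ∧ P 0 ≤ Y 0) ∧ (Y 0 - X 0) * (P 1 - X 1) = (P 0 - X 0) * (Y 1 - X 1) ∧
      (Y 0 - X 0) * (P 2 - X 2) = (P 0 - X 0) * (Y 2 - X 2) := by
  rw [mem_segment_iff]
  constructor
  · rintro ⟨t, h0, h1, rfl⟩
    simp only [Pi.add_apply, Pi.smul_apply, smul_eq_mul]
    exact ⟨⟨by nlinarith, by nlinarith⟩, by ring, by ring⟩
  · rintro ⟨⟨h0, h1⟩, h2, h3⟩
    have hd : 0 < Y 0 - X 0 := sub_pos.2 h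
    refine ⟨(P 0 - X 0) / (Y 0 - X 0), div_nonneg (by linarith) hd.le,
      (div_le_one hd).2 (by linarith), funext fun i => ?_⟩
    have key : ∀ i, (Y 0 - X 0) * (P i - X i) = (P 0 - X 0) * (Y i - X i) → P i =
        ((1 - (P 0 - X 0) / (Y 0 - X 0)) • X + ((P 0 - X 0) / (Y 0 - X 0)) • Y) i := fun i hi => by
      simp only [Pi.add_apply, Pi.smul_apply, smul_eq_mul]
      field_simp
      linear_combination hi
    fin_cases i
    exacts [key 0 (by ring), key 1 h2, key 2 h3]

/-- The vertices of the tangle strand, in the order in which they are introduced. -/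
noncomputable def tangleVertex (n : ℕ) : ℕ → Space
  | 0 => ![4 * n + 5, 0, 0]
  | 1 => ![4 * n + 4, -2, 0]
  | k + 2 => ![(k : ℝ) - 1, windY n (k - 1), windZ n (k - 1)]

/-- The first `k` vertices of the tangle strand, in reverse order. -/
noncomputable def tangleTail (n : ℕ) : ℕ → List Space
  | 0 => []
  | k + 1 => tangleVertex n k :: tangleTail n k

/-- The vertex at which the strand branches off the axis. -/
noncomputable def tangleTip (n : ℕ) : Space := ![4 * n + 4, 0, 0]

theorem mem_tanglePath {k : ℕ} {P : Space} {B : Space} {m : List Space} :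
    P ∈ pathSupport (tangleVertex n k :: (tangleTail n k ++ B :: m)) ↔
      (∃ i < k, P ∈ segment ℝ (tangleVertex n (i + 1)) (tangleVertex n i)) ∨
      P ∈ pathSupport (tangleVertex n 0 :: B :: m) := by
  induction k with
  | zero => simp [tangleTail]
  | succ k ih =>
    rw [tangleTail, List.cons_append, pathSupport_cons_cons, mem_union, ih, ← or_assoc]
    refine or_congr_left ⟨?_, ?_⟩
    · rintro (h | ⟨i, hi, h⟩)
      exacts [⟨k, by omega, h⟩, ⟨i, by omega, h⟩]
    · rintro ⟨i, hi, h⟩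
      rcases Nat.lt_succ_iff_lt_or_eq.1 hi with hi | rfl
      exacts [Or.inr ⟨i, hi, h⟩, Or.inl h]

theorem mem_tangleEdges {k i : ℕ} (hi : i < k) (m : List Space) :
    (tangleVertex n (i + 1), tangleVertex n i) ∈
      pathEdges (tangleVertex n k :: (tangleTail n k ++ m)) := by
  induction k with
  | zero => omega
  | succ k ih =>
    rw [tangleTail, List.cons_append, pathEdges_cons_cons]
    rcases Nat.lt_succ_iff_lt_or_eq.1 hi with hi | rfl
    exacts [List.mem_cons_of_mem _ (ih hi), List.mem_cons_self]

theorem wind_start : windY n (-1) = -2 ∧ windZ n (-1) = 0 ∧ windY n 0 = -1 ∧ windZ n 0 = 1 := by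
  refine ⟨if_pos (by omega), if_pos (by omega), ?_, ?_⟩
  · unfold windY; split_ifs <;> first | omega | rfl
  · unfold windZ; split_ifs <;> first | omega | rfl

theorem wind_pair {j : ℤ} (h0 : 0 < j) (h1 : j ≤ 4 * n + 3) :
    (windZ n j = 1 ∨ windZ n j = -1) ∧ (windZ n (j - 1) = windZ n j ∨
      (windZ n (j - 1) = -windZ n j ∧ windY n (j - 1) = windY n j ∧
        (windY n j = 1 ∨ windY n j = -1 ∨ (windY n j = -3 ∧ j = 4 * n + 2)))) := by
  have ez : ∀ i : ℤ, 0 ≤ i → i ≤ 4 * n + 3 → windZ n i = if i % 4 < 2 then 1 else -1 :=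
    fun i _ _ => if_neg (by omega)
  have ey : ∀ i : ℤ, 0 ≤ i → i ≤ 4 * n + 3 → windY n i = if i % 4 = 0 ∨ i % 4 = 3 then -1 else
      if i < 4 * n then 1 else -3 := fun i _ _ => by
    rw [windY, if_neg (by omega)]
    split_ifs <;> first | omega | rfl
  rw [ez j h0.le h1, ez (j - 1) (by omega) (by omega), ey j h0.le h1, ey (j - 1) (by omega)
    (by omega)]
  refine ⟨by split_ifs <;> simp, ?_⟩
  have h : j % 4 = 1 ∨ j % 4 = 3 ∨ j % 4 = 0 ∨ j % 4 = 2 := by omega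
  rcases h with h | h | h | h
  · left; rw [if_pos (by omega), if_pos (by omega)]
  · left; rw [if_neg (by omega), if_neg (by omega)]
  · right; rw [if_neg (by omega), if_pos (by omega), if_pos (by omega), if_pos (by omega)]
    simp
  · right
    split_ifs <;> first | omega | norm_num
    omega

variable {k i : ℕ} {a b c : ℝ}

/-- The triangles swept by the strand are pierced by the earlier part of the strand only once. -/
theorem tangle_triangle (hk : k ≤ 4 * n + 5) (hi : i < k) (ha : 0 ≤ a) (hb : 0 ≤ b) (hc : 0 ≤ c)
    (hs : a + b + c = 1) (hP : a • tangleTip n + b • tangleVertex n k + c • tangleVertex n (k + 1) ∈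
      segment ℝ (tangleVertex n (i + 1)) (tangleVertex n i)) :
    (a = 0 ∧ c = 0) ∨ (k = 4 * n + 4 ∧ i = 1 ∧ a = 1 / 3 ∧ b = 1 / 3 ∧ c = 1 / 3) := by
  have hn := n.cast_nonneg (α := ℝ)
  match k, i with
  | 1, 0 =>
    rw [mem_segment_iff_of_lt (by simp [tangleVertex]; norm_num)] at hP
    simp only [tangleVertex, tangleTip, Pi.add_apply, Pi.smul_apply, smul_eq_mul, Matrix.cons_val,
      zero_sub, CharP.cast_eq_zero, wind_start.1, wind_start.2.1] at hP
    obtain ⟨⟨h1, -⟩, h2, -⟩ := hP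
    have : c = 0 := by nlinarith
    subst this
    exact Or.inl ⟨by nlinarith, rfl⟩
  | k + 2, i =>
    have hk' : (k : ℝ) ≤ 4 * n + 3 := by exact_mod_cast (show k ≤ 4 * n + 3 by omega)
    have hk0 := k.cast_nonneg (α := ℝ)
    match i with
    | 0 =>
      exfalso
      rw [mem_segment_iff_of_lt (by simp [tangleVertex]; norm_num)] at hP
      simp only [tangleVertex, tangleTip, Pi.add_apply, Pi.smul_apply, smul_eq_mul,
        Matrix.cons_val, Nat.cast_add, Nat.cast_one, add_sub_cancel_right] at hP
      obtain ⟨⟨h1, -⟩, h2, -⟩ := hP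
      have hbc : b + c = 0 := by nlinarith
      obtain rfl : b = 0 := by linarith
      obtain rfl : c = 0 := by linarith
      obtain rfl : a = 1 := by linarith
      norm_num at h2
    | 1 =>
      rw [mem_segment_iff_of_lt (by simp [tangleVertex]; linarith)] at hP
      simp only [tangleVertex, tangleTip, Pi.add_apply, Pi.smul_apply, smul_eq_mul,
        Matrix.cons_val, Nat.cast_add, Nat.cast_one, add_sub_cancel_right, zero_sub,
        CharP.cast_eq_zero, wind_start.1, wind_start.2.1] at hP
      obtain ⟨-, h2, h3⟩ := hP
      have h4 : 4 * (n : ℝ) + 4 - -1 ≠ 0 := by linarith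
      have hy : b * windY n (k - 1) + c * windY n k = -2 := by
        apply mul_left_cancel₀ h4; linear_combination h2
      have hz : b * windZ n (k - 1) + c * windZ n k = 0 := by
        apply mul_left_cancel₀ h4; linear_combination h3
      rcases Nat.eq_zero_or_pos k with rfl | hkp
      · rw [CharP.cast_eq_zero, zero_sub, wind_start.1, wind_start.2.2.1] at hy
        rw [CharP.cast_eq_zero, zero_sub, wind_start.2.1, wind_start.2.2.2] at hz
        have : c = 0 := by linarith
        exact Or.inl ⟨by linarith, this⟩
      · obtain ⟨p1, p2⟩ := wind_pair (n := n) (j := k) (by omega) (by omega)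
        rcases p2 with p2 | ⟨p2, p3, p4⟩
        · exfalso
          rw [p2] at hz
          have : b + c = 0 := by rcases p1 with p1 | p1 <;> rw [p1] at hz <;> linarith
          have hb' : b = 0 := by linarith
          have hc' : c = 0 := by linarith
          rw [hb', hc'] at hy; norm_num at hy
        · rw [p2] at hz
          have hbc : b = c := by rcases p1 with p1 | p1 <;> rw [p1] at hz <;> linarith
          rw [p3, hbc] at hy
          rcases p4 with p4 | p4 | ⟨p4, p5⟩ <;> rw [p4] at hy
          · linarith
          · linarith
          · exact Or.inr ⟨by omega, rfl, by linarith, by linarith, by linarith⟩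
    | i + 2 =>
      have hik : (i : ℝ) + 1 ≤ k := by exact_mod_cast (show i + 1 ≤ k by omega)
      rw [segment_symm, mem_segment_iff_of_lt (by simp [tangleVertex])] at hP
      simp only [tangleVertex, tangleTip, Pi.add_apply, Pi.smul_apply, smul_eq_mul,
        Matrix.cons_val, Nat.cast_add, Nat.cast_one, add_sub_cancel_right] at hP
      obtain ⟨⟨-, h1⟩, -⟩ := hP
      have h5 : a * (4 * n + 5 - k) + c ≤ 0 := by
        have : a * (4 * n + 4) + b * (k - 1) + c * k ≤ k - 1 := by linarith
        have hb' : b = 1 - a - c := by linarith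
        rw [hb'] at this
        nlinarith
      have h6 : 0 ≤ a * (4 * n + 5 - k - 1) := mul_nonneg ha (by linarith)
      exact Or.inl ⟨by linarith, by linarith⟩

theorem tangle_axis (hk : k ≤ 4 * n + 5) (ha : 0 ≤ a) (hb : 0 ≤ b) (hc : 0 ≤ c)
    (hs : a + b + c = 1) {P : Space}
    (hP : P = a • tangleTip n + b • tangleVertex n k + c • tangleVertex n (k + 1))
    (h1 : P 1 = 0) (h2 : P 2 = 0) (h0 : P 0 ≤ 4 * n + 4 ∨ 4 * n + 5 ≤ P 0) :
    (b = 0 ∧ c = 0) ∨ (a = 0 ∧ c = 0) := by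
  match k with
  | 0 =>
    simp only [hP, tangleVertex, tangleTip, Pi.add_apply, Pi.smul_apply, smul_eq_mul,
      Matrix.cons_val] at h0 h1
    have hc' : c = 0 := by linarith
    subst hc'
    rcases h0 with h0 | h0
    · left; exact ⟨by nlinarith, rfl⟩
    · right; exact ⟨by nlinarith, rfl⟩
  | 1 =>
    simp only [hP, tangleVertex, tangleTip, Pi.add_apply, Pi.smul_apply, smul_eq_mul,
      Matrix.cons_val, CharP.cast_eq_zero, zero_sub, wind_start.1] at h1
    exact Or.inl ⟨by linarith, by linarith⟩
  | k + 2 =>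
    simp only [hP, tangleVertex, tangleTip, Pi.add_apply, Pi.smul_apply, smul_eq_mul,
      Matrix.cons_val, Nat.cast_add, Nat.cast_one, add_sub_cancel_right] at h1 h2
    left
    rcases Nat.eq_zero_or_pos k with rfl | hkp
    · rw [CharP.cast_eq_zero, zero_sub, wind_start.1, wind_start.2.2.1] at h1
      exact ⟨by linarith, by linarith⟩
    · obtain ⟨p1, p2⟩ := wind_pair (n := n) (j := k) (by omega) (by omega)
      rcases p2 with p2 | ⟨p2, p3, p4⟩ <;> rw [p2] at h2
      · rcases p1 with p1 | p1 <;> rw [p1] at h2 <;> exact ⟨by linarith, by linarith⟩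
      · have hbc : b = c := by rcases p1 with p1 | p1 <;> rw [p1] at h2 <;> linarith
        rw [p3, hbc] at h1
        rcases p4 with p4 | p4 | ⟨p4, -⟩ <;> rw [p4] at h1 <;> exact ⟨by linarith, by linarith⟩

theorem tangle_independent (hk : k ≤ 4 * n + 5) :
    AffineIndependent ℝ ![tangleTip n, tangleVertex n k, tangleVertex n (k + 1)] := by
  rw [affineIndependent_triple_iff]
  intro x y h
  have h0 := congrFun h 0
  have h1 := congrFun h 1
  have h2 := congrFun h 2
  have hn := n.cast_nonneg (α := ℝ)
  match k with
  | 0 =>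
    simp only [tangleVertex, tangleTip, Pi.add_apply, Pi.sub_apply, Pi.smul_apply, smul_eq_mul,
      Matrix.cons_val, Pi.zero_apply] at h0 h1
    exact ⟨by linarith, by linarith⟩
  | 1 =>
    simp only [tangleVertex, tangleTip, Pi.add_apply, Pi.sub_apply, Pi.smul_apply, smul_eq_mul,
      Matrix.cons_val, Pi.zero_apply, CharP.cast_eq_zero, zero_sub, wind_start.1] at h0 h1
    have : y = 0 := by
      have : y * (4 * n + 5) = 0 := by linarith
      rcases mul_eq_zero.1 this with h | h <;> linarith
    exact ⟨by linarith, this⟩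
  | k + 2 =>
    simp only [tangleVertex, tangleTip, Pi.add_apply, Pi.sub_apply, Pi.smul_apply, smul_eq_mul,
      Matrix.cons_val, Pi.zero_apply, Nat.cast_add, Nat.cast_one, add_sub_cancel_right] at h0 h1 h2
    rcases Nat.eq_zero_or_pos k with rfl | hkp
    · rw [CharP.cast_eq_zero, zero_sub, wind_start.1, wind_start.2.2.1] at h1
      rw [CharP.cast_eq_zero, zero_sub, wind_start.2.1, wind_start.2.2.2] at h2
      exact ⟨by linarith, by linarith⟩
    · obtain ⟨p1, p2⟩ := wind_pair (n := n) (j := k) (by omega) (by omega)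
      rcases p2 with p2 | ⟨p2, p3, p4⟩ <;> rw [p2] at h2
      · have hxy : y = -x := by rcases p1 with p1 | p1 <;> rw [p1] at h2 <;> linarith
        rw [hxy] at h0
        exact ⟨by linarith, by linarith⟩
      · have hbc : x = y := by rcases p1 with p1 | p1 <;> rw [p1] at h2 <;> linarith
        rw [p3, hbc] at h1
        rcases p4 with p4 | p4 | ⟨p4, -⟩ <;> rw [p4] at h1 <;> exact ⟨by linarith, by linarith⟩

theorem boxGauge_tip : boxGauge n (tangleTip n) < 1 / 2 := by
  have hn := n.cast_nonneg (α := ℝ)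
  rw [boxGauge_lt_iff]
  simp only [openBox, tangleTip, mem_ofPred_eq, Matrix.cons_val]
  refine ⟨⟨?_, ?_⟩, ⟨?_, ?_⟩, ?_, ?_⟩ <;> linarith

theorem boxGauge_vertex (hk : k ≤ 4 * n + 6) : boxGauge n (tangleVertex n k) < 1 / 2 := by
  have hn := n.cast_nonneg (α := ℝ)
  rw [boxGauge_lt_iff]
  simp only [openBox, mem_ofPred_eq, Matrix.cons_val]
  match k with
  | 0 | 1 =>
    simp only [tangleVertex, Matrix.cons_val]
    refine ⟨⟨?_, ?_⟩, ⟨?_, ?_⟩, ?_, ?_⟩ <;> linarith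
  | k + 2 =>
    have hk' : (k : ℝ) ≤ 4 * n + 4 := by exact_mod_cast (show k ≤ 4 * n + 4 by omega)
    have hk0 := k.cast_nonneg (α := ℝ)
    have hy : -3 ≤ windY n (k - 1) ∧ windY n (k - 1) ≤ 1 := by
      unfold windY; constructor <;> split_ifs <;> norm_num
    have hz : -1 ≤ windZ n (k - 1) ∧ windZ n (k - 1) ≤ 1 := by
      unfold windZ; constructor <;> split_ifs <;> norm_num
    simp only [tangleVertex, Matrix.cons_val]
    refine ⟨⟨?_, ?_⟩, ⟨?_, ?_⟩, ?_, ?_⟩ <;> linarith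

end TangleVertices

theorem Pierced.linked_of_subsingleton {A B C : Space} {l : List Space} {G : Set KnotType}
    (h : Pierced A B C l)
    (hs : {P | InTriangle A B C P ∧ P ∈ pathSupport (B :: (l ++ [A]))}.Subsingleton)
    (h1 : (knotOf _ h.isPolygon).knotType ∈ G) (h2 : (knotOf _ h.isPolygon_insert).knotType ∈ G) :
    Linked G (knotOf _ h.isPolygon).knotType (knotOf _ h.isPolygon_insert).knotType := by
  rcases hs.eq_empty_or_singleton with h0 | ⟨P, h0⟩
  · rw [← knotType_eq_of_triangleMove (h.triangleMove h0)]
    exact .refl h1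
  · exact .of_crossingChange (h.crossingChange h0) h1 h2

section TangleMoves
variable {n : ℕ} {A B : Space} {l : List Space}

/-- Two points on the axis on either side of a box. -/
structure AxisEnds (n : ℕ) (A B : Space) : Prop where
  left : A 0 ≤ -3 ∧ A 1 = 0 ∧ A 2 = 0
  right : 4 * n + 7 ≤ B 0 ∧ B 1 = 0 ∧ B 2 = 0

/-- A polygon one of whose edges is the only part inside a box, and lies on the axis of the box. -/
structure AxisFrame (n : ℕ) (A B : Space) (l : List Space) : Prop extends AxisEnds n A B where
  isPolygon : IsPolygon (A :: B :: l)
  far : ∀ P ∈ pathSupport (B :: (l ++ [A])), 2 ≤ boxGauge n P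

/-- The polygon with the first `k + 1` vertices of the tangle strand inserted. -/
noncomputable def tanglePolygon (n : ℕ) (A B : Space) (l : List Space) (k : ℕ) : List Space :=
  tangleTip n :: tangleVertex n k :: (tangleTail n k ++ B :: (l ++ [A]))

theorem convex_boxGauge_lt (t : ℝ) : Convex ℝ {P | boxGauge n P < t} := by
  simp only [boxGauge_lt_iff]; exact convex_openBox _ _

theorem AxisEnds.mem_left (h : AxisEnds n A B) {P : Space} :
    P ∈ segment ℝ A (tangleTip n) ↔ (A 0 ≤ P 0 ∧ P 0 ≤ 4 * n + 4) ∧ P 1 = 0 ∧ P 2 = 0 := by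
  have hn := n.cast_nonneg (α := ℝ)
  obtain ⟨h0, h1, h2⟩ := h.left
  have e : tangleTip n 0 = 4 * n + 4 ∧ tangleTip n 1 = 0 ∧ tangleTip n 2 = 0 := ⟨rfl, rfl, rfl⟩
  rw [mem_segment_iff_of_lt (by rw [e.1]; linarith), e.1, e.2.1, e.2.2, h1, h2]
  have : 4 * (n : ℝ) + 4 - A 0 ≠ 0 := by linarith
  simp [this]

theorem AxisEnds.mem_right (h : AxisEnds n A B) {P : Space} :
    P ∈ segment ℝ (tangleVertex n 0) B ↔ (4 * n + 5 ≤ P 0 ∧ P 0 ≤ B 0) ∧ P 1 = 0 ∧ P 2 = 0 := by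
  have hn := n.cast_nonneg (α := ℝ)
  obtain ⟨h0, h1, h2⟩ := h.right
  have e : tangleVertex n 0 0 = 4 * n + 5 ∧ tangleVertex n 0 1 = 0 ∧ tangleVertex n 0 2 = 0 :=
    ⟨rfl, rfl, rfl⟩
  rw [mem_segment_iff_of_lt (by rw [e.1]; linarith), e.1, e.2.1, e.2.2, h1, h2]
  have : B 0 - (4 * n + 5) ≠ 0 := by linarith
  simp [this]

theorem AxisEnds.mem_axis (h : AxisEnds n A B) {P : Space} :
    P ∈ segment ℝ A B ↔ (A 0 ≤ P 0 ∧ P 0 ≤ B 0) ∧ P 1 = 0 ∧ P 2 = 0 := by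
  have hn := n.cast_nonneg (α := ℝ)
  obtain ⟨h0, h1, h2⟩ := h.right
  obtain ⟨k0, k1, k2⟩ := h.left
  rw [mem_segment_iff_of_lt (by linarith), h1, h2, k1, k2]
  have : B 0 - A 0 ≠ 0 := by linarith
  simp [this]

theorem mem_tanglePolygon_rest {k : ℕ} {P : Space} :
    P ∈ pathSupport (tangleVertex n k :: ((tangleTail n k ++ B :: (l ++ [A])) ++ [tangleTip n])) ↔
      (∃ i < k, P ∈ segment ℝ (tangleVertex n (i + 1)) (tangleVertex n i)) ∨
      P ∈ segment ℝ (tangleVertex n 0) B ∨ P ∈ pathSupport (B :: (l ++ [A])) ∨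
      P ∈ segment ℝ A (tangleTip n) := by
  have e : tangleTail n k ++ B :: (l ++ [A]) ++ [tangleTip n] =
      tangleTail n k ++ B :: (l ++ A :: [tangleTip n]) := by simp
  rw [e, mem_tanglePath, pathSupport_cons_cons, ← List.cons_append, pathSupport_append]
  simp

theorem AxisFrame.base (h : AxisFrame n A B l) : ∃ h0 : IsPolygon (tanglePolygon n A B l 0),
    (knotOf _ h0).knotType = (knotOf _ h.isPolygon).knotType := by
  have hn := n.cast_nonneg (α := ℝ)
  obtain ⟨h0, h1, h2⟩ := h.right
  obtain ⟨k0, k1, k2⟩ := h.left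
  have op : ∀ {X Y Z : Space}, Z ∈ segment ℝ X Y → X 0 < Z 0 → Z 0 < Y 0 → Z ∈ openSegment ℝ X Y :=
    fun hZ hX hY => mem_openSegment_of_ne_left_right (fun e => by rw [e] at hX; exact hX.false)
      (fun e => by rw [e] at hY; exact hY.false) hZ
  have e0 : tangleTip n 0 = 4 * n + 4 := rfl
  have e1 : tangleVertex n 0 0 = 4 * n + 5 := rfl
  have hN : tangleTip n ∈ openSegment ℝ A B :=
    op (h.mem_axis.2 ⟨⟨by rw [e0]; linarith, by rw [e0]; linarith⟩, rfl, rfl⟩)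
      (by rw [e0]; linarith) (by rw [e0]; linarith)
  have hF : tangleVertex n 0 ∈ openSegment ℝ (tangleTip n) B := by
    refine op ((mem_segment_iff_of_lt (by rw [e0]; linarith)).2 ⟨⟨by rw [e0, e1]; linarith,
      by rw [e1]; linarith⟩, ?_, ?_⟩) (by rw [e0, e1]; linarith) (by rw [e1]; linarith)
    · rw [h1]; simp [tangleTip, tangleVertex]
    · rw [h2]; simp [tangleTip, tangleVertex]
  have hl : l ≠ [] := (isPolygon_cons_iff.1 h.isPolygon).1
  have p1 : IsPolygon (A :: tangleTip n :: B :: l) :=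
    (isPolygon_subdivide_iff h.isPolygon.ne hN hl).2 h.isPolygon
  have r1 : (A :: tangleTip n :: B :: l) ~r (tangleTip n :: B :: (l ++ [A])) :=
    ⟨1, by simp⟩
  have p2 := p1.isRotated r1
  have p3 : IsPolygon (tanglePolygon n A B l 0) :=
    (isPolygon_subdivide_iff p2.ne hF (by simp)).2 p2
  exact ⟨p3, ((knotType_subdivide hN (.refl _) (.refl _) h.isPolygon p1).trans
    ((knotType_rotate r1 p1 p2).trans (knotType_subdivide hF (.refl _) (.refl _) p2 p3))).symm⟩

theorem AxisFrame.sweep (h : AxisFrame n A B l) {k : ℕ} (hk : k ≤ 4 * n + 5) {a b c : ℝ}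
    (ha : 0 ≤ a) (hb : 0 ≤ b) (hc : 0 ≤ c) (hs : a + b + c = 1) {P : Space}
    (hP : P = a • tangleTip n + b • tangleVertex n k + c • tangleVertex n (k + 1))
    (hr : P ∈ pathSupport
      (tangleVertex n k :: ((tangleTail n k ++ B :: (l ++ [A])) ++ [tangleTip n]))) :
    (b = 0 ∧ c = 0) ∨ (a = 0 ∧ c = 0) ∨ (k = 4 * n + 4 ∧
      P ∈ segment ℝ (tangleVertex n 2) (tangleVertex n 1) ∧ a = 1 / 3 ∧ b = 1 / 3 ∧ c = 1 / 3) := by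
  rcases mem_tanglePolygon_rest.1 hr with ⟨i, hi, hr⟩ | hr | hr | hr
  · rcases tangle_triangle hk hi ha hb hc hs (hP ▸ hr) with h1 | ⟨h1, rfl, h2⟩
    exacts [Or.inr (Or.inl h1), Or.inr (Or.inr ⟨h1, hr, h2⟩)]
  · obtain ⟨⟨h0, -⟩, h1, h2⟩ := h.mem_right.1 hr
    rcases tangle_axis hk ha hb hc hs hP h1 h2 (Or.inr h0) with h3 | h3
    exacts [Or.inl h3, Or.inr (Or.inl h3)]
  · exfalso
    have hT : P ∈ convexHull ℝ {tangleTip n, tangleVertex n k, tangleVertex n (k + 1)} :=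
      mem_triangle_iff.2 ⟨a, b, c, ha, hb, hc, hs, hP⟩
    have : P ∈ {P | boxGauge n P < 1 / 2} := convexHull_min (by
      rintro x (rfl | rfl | rfl)
      exacts [boxGauge_tip, boxGauge_vertex (by omega), boxGauge_vertex (by omega)])
      (convex_boxGauge_lt _) hT
    rw [mem_ofPred_eq] at this
    linarith [h.far P hr]
  · obtain ⟨⟨-, h0⟩, h1, h2⟩ := h.mem_left.1 hr
    rcases tangle_axis hk ha hb hc hs hP h1 h2 (Or.inl h0) with h3 | h3
    exacts [Or.inl h3, Or.inr (Or.inl h3)]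

theorem AxisFrame.crossing (h : AxisFrame n A B l) {k : ℕ} (hk : k ≤ 4 * n + 5) {P : Space}
    (hP : P ∈ {P | InTriangle (tangleTip n) (tangleVertex n k) (tangleVertex n (k + 1)) P ∧
      P ∈ pathSupport
        (tangleVertex n k :: ((tangleTail n k ++ B :: (l ++ [A])) ++ [tangleTip n]))}) :
    k = 4 * n + 4 ∧ P = (1 / 3 : ℝ) • tangleTip n + (1 / 3 : ℝ) • tangleVertex n k +
      (1 / 3 : ℝ) • tangleVertex n (k + 1) := by
  obtain ⟨⟨a, b, c, ha, hb, hc, hs, hP⟩, hr⟩ := hP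
  rcases h.sweep hk ha.le hb.le hc.le hs hP hr with h1 | h1 | ⟨h1, -, rfl, rfl, rfl⟩
  · exact absurd h1.1 hb.ne'
  · exact absurd h1.1 ha.ne'
  · exact ⟨h1, hP⟩

theorem AxisFrame.pierced (h : AxisFrame n A B l) {k : ℕ} (hk : k ≤ 4 * n + 5)
    (hp : IsPolygon (tanglePolygon n A B l k)) :
    Pierced (tangleTip n) (tangleVertex n k) (tangleVertex n (k + 1))
      (tangleTail n k ++ B :: (l ++ [A])) where
  ne_nil := by simp
  indep := tangle_independent hk
  simple := (isPolygon_cons_iff.1 hp).2.1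
  notMem := hp.left_notMem
  finite := (finite_singleton _).subset fun P hP => (h.crossing hk hP).2
  inter P hT hr := by
    obtain ⟨a, b, c, ha, hb, hc, hs, hP⟩ := mem_triangle_iff.1 hT
    rcases h.sweep hk ha hb hc hs hP hr with ⟨rfl, rfl⟩ | ⟨rfl, rfl⟩ | ⟨rfl, h2, rfl, rfl, rfl⟩
    · obtain rfl : a = 1 := by linarith
      left; rw [hP]; simp
    · obtain rfl : b = 1 := by linarith
      right; left; rw [hP]; simp
    · refine Or.inr (Or.inr ⟨⟨_, _, _, by norm_num, by norm_num, by norm_num, hs, hP⟩,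
        (tangleVertex n 2, tangleVertex n 1), ?_, ?_⟩)
      · rw [List.append_assoc]; exact mem_tangleEdges (by omega) _
      · have e : P 0 = (12 * n + 7) / 3 := by
          rw [hP]
          simp only [tangleVertex, tangleTip, Pi.add_apply, Pi.smul_apply, smul_eq_mul,
            Matrix.cons_val]
          push_cast; ring
        have hn := n.cast_nonneg (α := ℝ)
        refine mem_openSegment_of_ne_left_right (fun e2 => ?_) (fun e2 => ?_) h2 <;>
        · rw [← e2] at e
          simp only [tangleVertex, Matrix.cons_val] at e
          push_cast at e
          linarith

/-- The tangle is inserted by isotopies and at most one crossing change. -/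
theorem AxisFrame.exists_linked (h : AxisFrame n A B l) :
    ∃ h' : IsPolygon (tanglePolygon n A B l (4 * n + 6)), ∀ G : Set KnotType,
      (knotOf _ h.isPolygon).knotType ∈ G → (knotOf _ h').knotType ∈ G →
      Linked G (knotOf _ h.isPolygon).knotType (knotOf _ h').knotType := by
  have step : ∀ {k} (hk : k ≤ 4 * n + 5) (hk' : k ≠ 4 * n + 4)
      (hp : IsPolygon (tanglePolygon n A B l k)), ∃ hp' : IsPolygon (tanglePolygon n A B l (k + 1)),
      (knotOf _ hp').knotType = (knotOf _ hp).knotType := fun hk hk' hp =>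
    ⟨(h.pierced hk hp).isPolygon_insert, (knotType_eq_of_triangleMove
      ((h.pierced hk hp).triangleMove (eq_empty_of_forall_notMem
        fun P hP => hk' (h.crossing hk hP).1))).symm⟩
  have low : ∀ k ≤ 4 * n + 4, ∃ hp : IsPolygon (tanglePolygon n A B l k),
      (knotOf _ hp).knotType = (knotOf _ h.isPolygon).knotType := by
    intro k
    induction k with
    | zero => exact fun _ => h.base
    | succ k ih =>
      intro hk
      obtain ⟨hp, e⟩ := ih (by omega)
      obtain ⟨hp', e'⟩ := step (by omega) (by omega) hp
      exact ⟨hp', e'.trans e⟩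
  obtain ⟨hp, e⟩ := low _ le_rfl
  have hc := h.pierced (by omega) hp
  obtain ⟨hp', e'⟩ := step le_rfl (by omega) hc.isPolygon_insert
  refine ⟨hp', fun G h1 h2 => ?_⟩
  rw [← e] at h1 ⊢
  rw [e'] at h2 ⊢
  refine hc.linked_of_subsingleton (fun P hP Q hQ => ?_) h1 h2
  rw [(h.crossing (by omega) hP).2, (h.crossing (by omega) hQ).2]

end TangleMoves

section TangleSupport
variable {n : ℕ} {A B : Space} {l : List Space}

theorem tangleTip_eq : tangleTip n = tangleVertex n (4 * n + 7) := by
  have h1 : windY n (4 * n + 4) = 0 := by unfold windY; split_ifs <;> first | omega | rfl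
  have h2 : windZ n (4 * n + 4) = 0 := if_pos (by omega)
  have e : ((4 * n + 5 : ℕ) : ℤ) - 1 = 4 * n + 4 := by push_cast; ring
  rw [tangleVertex, e, h1, h2, tangleTip]
  push_cast
  congr 1
  ring

theorem mem_windSegment {j : ℕ} {P : Space} :
    P ∈ segment ℝ (tangleVertex n (j + 3)) (tangleVertex n (j + 2)) ↔
      ((j : ℝ) - 1 ≤ P 0 ∧ P 0 ≤ j) ∧ P 1 = interp (windY n) (P 0) ∧
        P 2 = interp (windZ n) (P 0) := by
  rw [segment_symm, mem_segment_iff_of_lt (by simp [tangleVertex])]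
  simp only [tangleVertex, Matrix.cons_val]
  push_cast
  rw [add_sub_cancel_right, add_sub_cancel_right]
  refine and_congr_right fun ⟨h0, h1⟩ => ?_
  rw [interp_eq (windY n) (j := (j : ℤ) - 1) (by push_cast; linarith) (by push_cast; linarith),
    interp_eq (windZ n) (j := (j : ℤ) - 1) (by push_cast; linarith) (by push_cast; linarith),
    sub_add_cancel]
  push_cast
  constructor <;> rintro ⟨h2, h3⟩ <;> exact ⟨by linarith, by linarith⟩

theorem mem_claspSegment {P : Space} :
    (P ∈ segment ℝ (tangleVertex n 1) (tangleVertex n 0) ∨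
      P ∈ segment ℝ (tangleVertex n 2) (tangleVertex n 1)) ↔
      (-1 ≤ P 0 ∧ P 0 ≤ 4 * n + 5) ∧ P 1 = interp (backY n) (P 0) ∧ P 2 = 0 := by
  have hn := n.cast_nonneg (α := ℝ)
  rw [mem_segment_iff_of_lt (by simp [tangleVertex]; norm_num),
    mem_segment_iff_of_lt (by simp [tangleVertex]; linarith)]
  simp only [tangleVertex, Matrix.cons_val]
  simp only [CharP.cast_eq_zero, zero_sub, wind_start.1, wind_start.2.1]
  have hne : 4 * (n : ℝ) + 4 - -1 ≠ 0 := by linarith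
  constructor
  · rintro (⟨⟨h0, h1⟩, h2, h3⟩ | ⟨⟨h0, h1⟩, h2, h3⟩)
    · rw [backY_mid h0 h1]
      exact ⟨⟨by linarith, h1⟩, by linarith, by linarith⟩
    · rw [backY_of_le h1]
      refine ⟨⟨h0, by linarith⟩, ?_, ?_⟩ <;> apply mul_left_cancel₀ hne <;> linarith
  · rintro ⟨⟨h0, h1⟩, h2, h3⟩
    rcases le_or_gt (P 0) (4 * n + 4) with h4 | h4
    · rw [backY_of_le h4] at h2
      exact Or.inr ⟨⟨h0, h4⟩, by rw [h2]; ring, by rw [h3]; ring⟩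
    · rw [backY_mid h4.le h1] at h2
      exact Or.inl ⟨⟨h4.le, h1⟩, by rw [h2]; ring, by rw [h3]; ring⟩

theorem mem_tanglePolygon {P : Space} :
    P ∈ polygonSupport (tanglePolygon n A B l (4 * n + 6)) ↔
      (∃ i < 4 * n + 7, P ∈ segment ℝ (tangleVertex n (i + 1)) (tangleVertex n i)) ∨
      P ∈ segment ℝ (tangleVertex n 0) B ∨ P ∈ pathSupport (B :: (l ++ [A])) ∨
      P ∈ segment ℝ A (tangleTip n) := by
  rw [tanglePolygon, polygonSupport_cons_cons, mem_union, mem_tanglePolygon_rest, ← or_assoc]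
  refine or_congr_left ⟨?_, ?_⟩
  · rintro (h | ⟨i, hi, h⟩)
    · exact ⟨4 * n + 6, by omega, by rwa [← tangleTip_eq]⟩
    · exact ⟨i, by omega, h⟩
  · rintro ⟨i, hi, h⟩
    rcases Nat.lt_succ_iff_lt_or_eq.1 hi with hi | rfl
    · exact Or.inr ⟨i, hi, h⟩
    · left; rwa [tangleTip_eq]

theorem AxisFrame.mem_polygon (h : AxisFrame n A B l) {P : Space} (hP : boxGauge n P < 2) :
    P ∈ polygonSupport (A :: B :: l) ↔ P 1 = 0 ∧ P 2 = 0 := by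
  rw [polygonSupport_cons_cons, mem_union, h.mem_axis]
  obtain ⟨h0, -⟩ := h.left
  obtain ⟨k0, -⟩ := h.right
  constructor
  · rintro (h1 | h1)
    exacts [h1.2, absurd (h.far P h1) (not_le.2 hP)]
  · rw [boxGauge_lt_iff] at hP
    obtain ⟨⟨h1, h2⟩, -⟩ := hP
    simp only [Matrix.cons_val] at h1 h2
    exact fun h3 => Or.inl ⟨⟨by linarith, by linarith⟩, h3⟩

theorem AxisFrame.mem_inside (h : AxisFrame n A B l) {P : Space} (hP : boxGauge n P < 1) :
    P ∈ polygonSupport (tanglePolygon n A B l (4 * n + 6)) ↔ P ∈ tangle n := by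
  have hn := n.cast_nonneg (α := ℝ)
  obtain ⟨h0, -⟩ := h.left
  obtain ⟨k0, -⟩ := h.right
  have hP' := hP
  rw [boxGauge_lt_iff] at hP'
  obtain ⟨⟨g1, g2⟩, -⟩ := hP'
  simp only [Matrix.cons_val] at g1 g2
  rw [mem_tanglePolygon, h.mem_left, h.mem_right]
  constructor
  · rintro (⟨i, hi, h1⟩ | ⟨⟨h1, -⟩, h2, h3⟩ | h1 | ⟨⟨-, h1⟩, h2, h3⟩)
    · match i with
      | 0 => exact Or.inr ⟨(mem_claspSegment.1 (Or.inl h1)).1.1, (mem_claspSegment.1 (Or.inl h1)).2⟩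
      | 1 => exact Or.inr ⟨(mem_claspSegment.1 (Or.inr h1)).1.1, (mem_claspSegment.1 (Or.inr h1)).2⟩
      | j + 2 =>
        obtain ⟨⟨h2, h3⟩, h4⟩ := mem_windSegment.1 h1
        have hj : (j : ℝ) ≤ 4 * n + 4 := by exact_mod_cast (show j ≤ 4 * n + 4 by omega)
        exact Or.inl (Or.inr ⟨⟨by linarith [j.cast_nonneg (α := ℝ)], by linarith⟩, h4⟩)
    · exact Or.inl (Or.inl ⟨h2, h3, Or.inr h1⟩)
    · linarith [h.far P h1]
    · exact Or.inl (Or.inl ⟨h2, h3, Or.inl h1⟩)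
  · rintro ((⟨h1, h2, h3 | h3⟩ | ⟨⟨h1, h2⟩, h3⟩) | ⟨h1, h2, h3⟩)
    · exact Or.inr (Or.inr (Or.inr ⟨⟨by linarith, h3⟩, h1, h2⟩))
    · exact Or.inr (Or.inl ⟨⟨h3, by linarith⟩, h1, h2⟩)
    · have hj : ⌈P 0⌉₊ ≤ 4 * n + 4 := Nat.ceil_le.2 (by push_cast; exact h2)
      refine Or.inl ⟨⌈P 0⌉₊ + 2, by omega, mem_windSegment.2 ⟨⟨?_, Nat.le_ceil _⟩, h3⟩⟩
      rcases le_or_gt 0 (P 0) with h4 | h4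
      · linarith [Nat.ceil_lt_add_one h4]
      · rw [Nat.ceil_eq_zero.2 h4.le]; push_cast; linarith
    · rcases le_or_gt (P 0) (4 * n + 5) with h4 | h4
      · rcases mem_claspSegment.2 ⟨⟨h1, h4⟩, h2, h3⟩ with h5 | h5
        exacts [Or.inl ⟨0, by omega, h5⟩, Or.inl ⟨1, by omega, h5⟩]
      · rw [backY_of_ge h4.le] at h2
        exact Or.inr (Or.inl ⟨⟨h4.le, by linarith⟩, h2, h3⟩)

theorem boxGauge_axis {P : Space} (h1 : 4 * n + 4 ≤ P 0) (h2 : P 0 ≤ 4 * n + 5)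
    (h3 : P 1 = 0 ∧ P 2 = 0) : boxGauge n P < 1 / 2 := by
  have hn := n.cast_nonneg (α := ℝ)
  rw [boxGauge_lt_iff]
  simp only [openBox, mem_ofPred_eq, Matrix.cons_val, h3.1, h3.2]
  refine ⟨⟨?_, ?_⟩, ⟨?_, ?_⟩, ?_, ?_⟩ <;> linarith

theorem boxGauge_vertex' {k : ℕ} (hk : k ≤ 4 * n + 7) :
    boxGauge n (tangleVertex n k) < 1 / 2 := by
  rcases hk.lt_or_eq with hk | rfl
  · exact boxGauge_vertex (by omega)
  · rw [← tangleTip_eq]; exact boxGauge_tip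

theorem AxisFrame.mem_outside (h : AxisFrame n A B l) {P : Space} (hP : 1 / 2 < boxGauge n P) :
    P ∈ polygonSupport (tanglePolygon n A B l (4 * n + 6)) ↔ P ∈ polygonSupport (A :: B :: l) := by
  have hn := n.cast_nonneg (α := ℝ)
  obtain ⟨h0, -⟩ := h.left
  obtain ⟨k0, -⟩ := h.right
  rw [mem_tanglePolygon, polygonSupport_cons_cons, mem_union, h.mem_left, h.mem_right, h.mem_axis]
  constructor
  · rintro (⟨i, hi, h1⟩ | ⟨⟨h1, h2⟩, h3⟩ | h1 | ⟨⟨h1, h2⟩, h3⟩)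
    · have := (convex_boxGauge_lt (n := n) (1 / 2)).segment_subset
        (boxGauge_vertex' (k := i + 1) (by omega)) (boxGauge_vertex' (k := i) (by omega)) h1
      exact absurd this (not_lt.2 hP.le)
    · exact Or.inl ⟨⟨by linarith, h2⟩, h3⟩
    · exact Or.inr h1
    · exact Or.inl ⟨⟨h1, by linarith⟩, h3⟩
  · rintro (⟨⟨h1, h2⟩, h3⟩ | h1)
    · rcases le_or_gt (P 0) (4 * n + 4) with h4 | h4
      · exact Or.inr (Or.inr (Or.inr ⟨⟨h1, h4⟩, h3⟩))
      rcases le_or_gt (4 * (n : ℝ) + 5) (P 0) with h5 | h5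
      · exact Or.inr (Or.inl ⟨⟨h5, h2⟩, h3⟩)
      exact absurd (boxGauge_axis h4.le h5.le h3) (not_lt.2 hP.le)
    · exact Or.inr (Or.inr (Or.inl h1))

/-- The knot with the tangle inserted has a dihedral coloring. -/
theorem AxisFrame.colorable (h : AxisFrame n A B l) (hn : 1 ≤ n)
    (h' : IsPolygon (tanglePolygon n A B l (4 * n + 6))) :
    Colorable (4 * n + 1) (polygonSupport (tanglePolygon n A B l (4 * n + 6))) := by
  obtain ⟨D, σ, hD, hDK, hσ, hσ'⟩ := h.isPolygon.exists_signSystem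
  exact colorable_of_tangle hn hD hDK hσ hσ' (fun x hx => h.isPolygon.niceAt hx)
    (knotOf _ h.isPolygon).isConnected_support.isPreconnected (fun x => h.mem_polygon)
    (knotOf _ h').isCompact_support.isClosed (knotOf _ h').dense_compl (fun x => h.mem_inside)
    fun x => h.mem_outside

end TangleSupport

section AffineMaps
variable (Φ : Space ≃ᵃ[ℝ] Space)

theorem polygonEdges_map (l : List Space) :
    polygonEdges (l.map Φ) = (polygonEdges l).map (Prod.map Φ Φ) := by
  rw [polygonEdges, polygonEdges, ← List.map_rotate, List.zip_map]

theorem halfOpenEdge_map (e : Space × Space) :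
    halfOpenEdge (Prod.map Φ Φ e) = Φ '' halfOpenEdge e := by
  simp [halfOpenEdge, image_image, AffineEquiv.apply_lineMap]

theorem IsPolygon.map {l : List Space} (h : IsPolygon l) : IsPolygon (l.map Φ) := by
  refine ⟨by simpa using h.1, ?_⟩
  rw [polygonEdges_map, List.pairwise_map]
  refine h.2.imp fun {e f} hef => ?_
  rw [halfOpenEdge_map, halfOpenEdge_map]
  exact (disjoint_image_iff Φ.injective).2 hef

theorem segment_map (X Y : Space) : Φ '' segment ℝ X Y = segment ℝ (Φ X) (Φ Y) :=
  image_segment ℝ Φ.toAffineMap X Y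

theorem polygonSupport_map (l : List Space) :
    polygonSupport (l.map Φ) = Φ '' polygonSupport l := by
  simp only [polygonSupport, polygonEdges_map, image_iUnion, segment_map]
  ext P
  simp

/-- The image of a knot under an affine map. -/
def PolygonalKnot.map (K : PolygonalKnot) : PolygonalKnot := knotOf _ (K.isPolygon.map Φ)

variable {Φ}

theorem PolygonalKnot.support_map (K : PolygonalKnot) : (K.map Φ).support = Φ '' K.support :=
  polygonSupport_map Φ _

theorem ReplacesEdge.map {K K' : PolygonalKnot} {A B C : Space} (h : ReplacesEdge K K' A B C) :
    ReplacesEdge (K.map Φ) (K'.map Φ) (Φ A) (Φ B) (Φ C) := by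
  obtain ⟨l, h1, h2⟩ := h
  exact ⟨l.map Φ, h1.map Φ, h2.map Φ⟩

theorem triangle_map (A B C : Space) :
    convexHull ℝ {Φ A, Φ B, Φ C} = Φ '' convexHull ℝ {A, B, C} := by
  have := Φ.toAffineMap.image_convexHull {A, B, C}
  rw [image_insert_eq, image_insert_eq, image_singleton] at this
  exact this.symm

theorem TriangleMove.map {K K' : PolygonalKnot} (h : TriangleMove K K') :
    TriangleMove (K.map Φ) (K'.map Φ) := by
  obtain ⟨A, B, C, h1, h2⟩ := h
  refine ⟨_, _, _, h1.map, ?_⟩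
  rw [triangle_map, PolygonalKnot.support_map, ← image_inter Φ.injective, h2, segment_map]

theorem CrossingChange.map {K K' : PolygonalKnot} (h : CrossingChange K K') :
    CrossingChange (K.map Φ) (K'.map Φ) := by
  obtain ⟨A, B, C, P, h1, h2, h3, ⟨a, b, c, ha, hb, hc, hs, hP⟩, e, he, heP⟩ := h
  refine ⟨_, _, _, Φ P, h1.map, ?_, ?_, ⟨a, b, c, ha, hb, hc, hs, ?_⟩, Prod.map Φ Φ e, ?_, ?_⟩
  · have := h2.map' Φ.toAffineMap Φ.injective
    convert this using 1
    ext i; fin_cases i <;> rfl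
  · rw [triangle_map, PolygonalKnot.support_map, ← image_inter Φ.injective, h3, image_union,
      segment_map, image_singleton]
  · have e1 : ∀ x, Φ x = Φ.linear x + Φ 0 := fun x => by
      have := Φ.map_vadd 0 x
      simpa using this
    rw [e1, hP, e1 A, e1 B, e1 C, map_add, map_add, map_smul, map_smul, map_smul]
    obtain rfl : a = 1 - b - c := by linarith
    module
  · change _ ∈ polygonEdges (K.vertices.map Φ)
    rw [polygonEdges_map]
    exact List.mem_map_of_mem he
  · have := image_openSegment ℝ Φ.toAffineMap e.1 e.2
    exact this ▸ mem_image_of_mem _ heP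

theorem knotType_map_eq {K K' : PolygonalKnot} (h : K.knotType = K'.knotType) :
    (K.map Φ).knotType = (K'.map Φ).knotType := by
  have h' := Quotient.exact h
  clear h
  induction h' with
  | rel _ _ h => exact knotType_eq_of_triangleMove h.map
  | refl => rfl
  | symm _ _ _ ih => exact ih.symm
  | trans _ _ _ _ _ ih ih' => exact ih.trans ih'

variable (Φ) in
/-- The action of affine maps on knot types. -/
def KnotType.map (κ : KnotType) : KnotType :=
  Quotient.lift (fun K : PolygonalKnot => (K.map Φ).knotType)
    (fun _ _ h => knotType_map_eq (Quotient.sound h)) κ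

theorem Linked.map {G G' : Set KnotType} {κ κ' : KnotType} (h : Linked G κ κ')
    (hG : ∀ κ ∈ G, κ.map Φ ∈ G') : Linked G' (κ.map Φ) (κ'.map Φ) := by
  obtain ⟨h1, h2, ⟨w⟩⟩ := h
  have key : ∀ {a b : G} (_ : (gordianGraph.induce G).Walk a b),
      Linked G' (a.1.map Φ) (b.1.map Φ) := by
    intro a b w
    induction w with
    | nil => exact .refl (hG _ (Subtype.property _))
    | @cons u v _ hadj _ ih =>
      refine .trans ?_ ih
      have hadj := (SimpleGraph.fromRel_adj _ _ _).1 (SimpleGraph.comap_adj.1 hadj)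
      have hu := hG _ u.2
      have hv := hG _ v.2
      rcases hadj.2 with ⟨K, K', e, e', hc⟩ | ⟨K, K', e, e', hc⟩
      · change K.knotType = u.1 at e
        change K'.knotType = v.1 at e'
        rw [← e] at hu ⊢
        rw [← e'] at hv ⊢
        exact .of_crossingChange hc.map hu hv
      · change K.knotType = v.1 at e
        change K'.knotType = u.1 at e'
        rw [← e'] at hu ⊢
        rw [← e] at hv ⊢
        exact (Linked.of_crossingChange hc.map hv hu).symm
  exact key w

theorem PolygonalKnot.colorable_map {m : ℕ} {K : PolygonalKnot} (h : Colorable m K.support) :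
    Colorable m (K.map Φ).support := by
  rw [PolygonalKnot.support_map]
  exact h.image (AffineEquiv.toContinuousAffineEquiv Φ).toHomeomorph

end AffineMaps

section GenericTriangles
variable {W X C Y Z P u v w : Space} {a b c : ℝ}

theorem false_of_comb (hW : W ∉ plane u v w) (ha : a ≠ 0) {x y z : ℝ}
    (h : a • W = x • u + y • v + z • w) (hs : a = x + y + z) : False := by
  refine hW (mem_plane (a := a⁻¹ * x) (b := a⁻¹ * y) (c := a⁻¹ * z) ?_ ?_)
  · rw [← mul_add, ← mul_add, ← hs, inv_mul_cancel₀ ha]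
  · rw [← inv_smul_smul₀ ha W, h]; module

theorem independent_of_generic (hW : ∀ v, v = X ∨ v = C → W ∉ plane X C v) (h : X ≠ C) :
    AffineIndependent ℝ ![W, X, C] := by
  rw [affineIndependent_triple_iff]
  intro x y hxy
  have e : (x + y) • W = x • X + y • C + (0 : ℝ) • C := by
    rw [← sub_eq_zero, ← neg_eq_zero, ← hxy]; module
  by_cases hs : x + y = 0
  · obtain rfl : y = -x := by linarith
    have : x • (X - C) = 0 := by rw [← hxy]; module
    have hx := (smul_eq_zero.1 this).resolve_right (sub_ne_zero.2 h)
    simp [hx]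
  · exact (false_of_comb (hW C (Or.inr rfl)) hs e (by ring)).elim

theorem generic_edge (hY : W ∉ plane X C Y) (hZ : W ∉ plane X C Z) (hX : W ∉ plane X Y Z)
    (hC : W ∉ plane C Y Z) (hXC : P ∈ segment ℝ X C → P ∈ segment ℝ Y Z → P = X) (ha : 0 ≤ a)
    (hb : 0 ≤ b) (hc : 0 ≤ c) (hs : a + b + c = 1) (hP : P = a • W + b • X + c • C)
    (h : P ∈ segment ℝ Y Z) : P = X ∨ (InTriangle W X C P ∧ P ∈ openSegment ℝ Y Z) := by
  obtain ⟨t, h0, h1, ht⟩ := mem_segment_iff.1 h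
  rcases ha.eq_or_lt with rfl | ha
  · exact Or.inl (hXC ⟨b, c, hb, hc, by linarith, by rw [hP]; module⟩ h)
  have e : a • W = (1 - t) • Y + t • Z - b • X - c • C := by rw [← ht, hP]; module
  have hb' : b ≠ 0 := by
    rintro rfl
    exact false_of_comb hC ha.ne' (x := -c) (y := 1 - t) (z := t) (by rw [e]; module) (by linarith)
  have hc' : c ≠ 0 := by
    rintro rfl
    exact false_of_comb hX ha.ne' (x := -b) (y := 1 - t) (z := t) (by rw [e]; module) (by linarith)
  have ht0 : t ≠ 0 := by
    rintro rfl
    exact false_of_comb hY ha.ne' (x := -b) (y := -c) (z := 1) (by rw [e]; module) (by linarith)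
  have ht1 : t ≠ 1 := by
    rintro rfl
    exact false_of_comb hZ ha.ne' (x := -b) (y := -c) (z := 1) (by rw [e]; module) (by linarith)
  exact Or.inr ⟨⟨a, b, c, ha, hb.lt_of_ne' hb', hc.lt_of_ne' hc', hs, hP⟩, mem_openSegment_iff.2
    ⟨t, h0.lt_of_ne' ht0, h1.lt_of_ne ht1, ht⟩⟩

theorem generic_edge_finite (hY : W ∉ plane X C Y) (hZ : W ∉ plane X C Z) :
    {P | InTriangle W X C P ∧ P ∈ segment ℝ Y Z}.Finite := by
  refine Subsingleton.finite ?_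
  rintro P ⟨⟨a, b, c, ha, -, -, hs, hP⟩, hPe⟩ Q ⟨⟨a', b', c', -, -, -, hs', hQ⟩, hQe⟩
  obtain ⟨t, -, -, ht⟩ := mem_segment_iff.1 hPe
  obtain ⟨s, -, -, hs1⟩ := mem_segment_iff.1 hQe
  have h1 : s * a - t * a' = 0 := by
    by_contra hne
    refine false_of_comb hY hne (x := t * b' - s * b) (y := t * c' - s * c) (z := s - t) ?_ ?_
    · have e : (s - t) • Y = s • P - t • Q := by rw [ht, hs1]; module
      rw [e, hP, hQ]; module
    · linear_combination s * hs - t * hs'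
  have h2 : (1 - t) * a' - (1 - s) * a = 0 := by
    by_contra hne
    refine false_of_comb hZ hne (x := (1 - s) * b - (1 - t) * b')
      (y := (1 - s) * c - (1 - t) * c') (z := s - t) ?_ ?_
    · have e : (s - t) • Z = (1 - t) • Q - (1 - s) • P := by rw [ht, hs1]; module
      rw [e, hP, hQ]; module
    · linear_combination (1 - t) * hs' - (1 - s) * hs
  have h3 : a = a' := by linarith
  subst h3
  have h4 : (s - t) * a = 0 := by linarith
  have h5 : s = t := by linarith [(mul_eq_zero.1 h4).resolve_right ha.ne']
  rw [ht, hs1, h5]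

theorem finite_of_edges {S : Space → Prop} {p : List Space}
    (h : ∀ e ∈ pathEdges p, {P | S P ∧ P ∈ segment ℝ e.1 e.2}.Finite) :
    {P | S P ∧ P ∈ pathSupport p}.Finite := by
  refine ((pathEdges p).finite_toSet.biUnion h).subset ?_
  rintro P ⟨h1, h2⟩
  obtain ⟨e, he, hP⟩ := mem_pathSupport.1 h2
  exact mem_biUnion (show e ∈ {e | e ∈ pathEdges p} from he) ⟨h1, hP⟩

end GenericTriangles

section Tangled
variable {n : ℕ} {A B : Space} {r : List Space}

/-- The strand of the tangle. -/
noncomputable def tangleStrand (n : ℕ) : List Space :=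
  tangleTip n :: tangleVertex n (4 * n + 6) :: tangleTail n (4 * n + 6)

/-- The closed polygon that runs through the tangle and then through the vertices in `r`. -/
noncomputable def tangled (n : ℕ) (A B : Space) (r : List Space) : List Space :=
  B :: (r ++ A :: tangleStrand n)

theorem tangled_isRotated : tanglePolygon n A B r (4 * n + 6) ~r tangled n A B r := by
  have e1 : tanglePolygon n A B r (4 * n + 6) = tangleStrand n ++ B :: (r ++ [A]) := rfl
  have e2 : tangled n A B r = B :: (r ++ [A]) ++ tangleStrand n := by simp [tangled]
  rw [e1, e2]
  exact List.isRotated_append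

theorem AxisEnds.strand (h : AxisEnds n A B) {P : Space}
    (hP : P ∈ pathSupport (A :: (tangleStrand n ++ [B]))) :
    boxGauge n P < 2 ∨ P ∈ segment ℝ A B := by
  have hn := n.cast_nonneg (α := ℝ)
  obtain ⟨h0, -⟩ := h.left
  obtain ⟨k0, -⟩ := h.right
  rw [tangleStrand, List.cons_append, pathSupport_cons_cons, List.cons_append,
    pathSupport_cons_cons] at hP
  have box : ∀ {X Y : Space}, boxGauge n X < 1 / 2 → boxGauge n Y < 1 / 2 → P ∈ segment ℝ X Y →
      boxGauge n P < 2 := fun hX hY hP => by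
    have := (convex_boxGauge_lt (n := n) (1 / 2)).segment_subset hX hY hP
    exact this.trans (by norm_num)
  rcases hP with hP | hP | hP
  · obtain ⟨⟨h1, h2⟩, h3⟩ := h.mem_left.1 hP
    exact Or.inr (h.mem_axis.2 ⟨⟨h1, by linarith⟩, h3⟩)
  · exact Or.inl (box boxGauge_tip (boxGauge_vertex le_rfl) hP)
  · rcases mem_tanglePath.1 hP with ⟨i, hi, hP⟩ | hP
    · exact Or.inl (box (boxGauge_vertex (by omega)) (boxGauge_vertex (by omega)) hP)
    · rw [pathSupport_cons_cons, pathSupport_singleton, union_empty] at hP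
      obtain ⟨⟨h1, h2⟩, h3⟩ := h.mem_right.1 hP
      exact Or.inr (h.mem_axis.2 ⟨⟨by linarith, h2⟩, h3⟩)

theorem mem_tangleEdges_last (k : ℕ) (m : List Space) : (tangleVertex n 0, B) ∈
    pathEdges (tangleVertex n k :: (tangleTail n k ++ B :: m)) := by
  induction k with
  | zero => simp [tangleTail]
  | succ k ih => exact List.mem_cons_of_mem _ ih

/-- Undoing the tangle in a simple polygon leaves a simple polygon. -/
theorem AxisEnds.isPolygon_of_tangled (h : AxisEnds n A B) (hr : r ≠ [])
    (far : ∀ P ∈ pathSupport (B :: (r ++ [A])), 2 ≤ boxGauge n P)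
    (hp : IsPolygon (tangled n A B r)) : IsPolygon (A :: B :: r) := by
  have hn := n.cast_nonneg (α := ℝ)
  obtain ⟨h0, -⟩ := h.left
  obtain ⟨k0, -⟩ := h.right
  have hs : PathSimple ((B :: r) ++ A :: (tangleStrand n ++ [B])) := by
    have := hp.2
    rw [tangled, polygonEdges_cons] at this
    simpa [PathSimple] using this
  obtain ⟨s1, -, s3⟩ := (pathSimple_append _ _ _).1 hs
  refine isPolygon_cons_iff.2 ⟨hr, s1, Set.disjoint_left.2 fun P hP hP' => ?_⟩
  have hg := far P (halfPath_subset _ hP')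
  obtain ⟨⟨h1, h2⟩, h3⟩ := h.mem_axis.1 (halfOpenEdge_subset _ _ hP)
  refine Set.disjoint_left.1 s3 hP' ?_
  have open' : ∀ {X Y : Space}, P ∈ segment ℝ X Y → P ≠ Y → P ∈ halfOpenEdge (X, Y) :=
    fun {X Y} hXY hY => by
      rw [← halfOpenEdge_union_right] at hXY
      exact hXY.resolve_right hY
  rcases le_or_gt (P 0) (4 * n + 4) with h4 | h4
  · refine mem_halfPath.2 ⟨(A, tangleTip n), List.mem_cons_self, open' (h.mem_left.2
      ⟨⟨h1, h4⟩, h3⟩) ?_⟩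
    rintro rfl
    linarith [boxGauge_tip (n := n)]
  rcases le_or_gt (P 0) (4 * n + 5) with h5 | h5
  · linarith [boxGauge_axis h4.le h5 h3]
  · refine mem_halfPath.2 ⟨(tangleVertex n 0, B), List.mem_cons_of_mem _ (List.mem_cons_of_mem _
      (mem_tangleEdges_last (n := n) (B := B) (4 * n + 6) [])), open' (h.mem_right.2 ⟨⟨h5.le, h2⟩, h3⟩) ?_⟩
    rintro rfl
    refine right_notMem_halfOpenEdge (fun e => ?_) hP
    rw [e] at h0
    linarith

theorem AxisEnds.mem_of_tangled (h : AxisEnds n A B) (hn : 1 ≤ n) (hr : r ≠ [])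
    (far : ∀ P ∈ pathSupport (B :: (r ++ [A])), 2 ≤ boxGauge n P) {G : Set KnotType}
    (hG : ∀ K : PolygonalKnot, Colorable (4 * n + 1) K.support → K.knotType ∈ G)
    {k : List Space} (hk : k ~r tangled n A B r) (hp : IsPolygon k) :
    (knotOf k hp).knotType ∈ G := by
  have h1 := hp.isRotated hk
  have hk' := hk.trans (tangled_isRotated (n := n) (A := A) (B := B) (r := r)).symm
  have h2 := hp.isRotated hk'
  rw [knotType_rotate hk' hp h2]
  exact hG _ (AxisFrame.colorable ⟨h, h.isPolygon_of_tangled hr far h1, far⟩ hn h2)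

end Tangled

section Cone
variable {n : ℕ} {A B W : Space} {c : List Space}

/-- A polygon `c` in general position with respect to a point `W`, whose cone from `W` avoids a box
and meets the segment `AB` only in its ends. -/
structure ConeFrame (n : ℕ) (A B W : Space) (c : List Space) : Prop extends AxisEnds n A B where
  isPolygon : IsPolygon (A :: B :: c)
  far : ∀ X ∈ c, ∀ Y, Y ∈ c ∨ Y = A ∨ Y = B → ∀ P ∈ convexHull ℝ {W, X, Y}, 2 ≤ boxGauge n P
  generic : ∀ u ∈ A :: B :: c, ∀ v ∈ A :: B :: c, ∀ w ∈ A :: B :: c, W ∉ plane u v w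
  above : ∃ g : Space →ᵃ[ℝ] ℝ, g A = 0 ∧ g B = 0 ∧ g W < 0 ∧ ∀ X ∈ c, g X < 0

theorem ConeFrame.far_path (h : ConeFrame n A B W c) : ∀ q : List Space, (∀ x ∈ q, x ∈ c) →
    ∀ P ∈ pathSupport (q ++ [A]), 2 ≤ boxGauge n P
  | [], _, P, hP => by simp at hP
  | [x], hq, P, hP => by
    rw [List.singleton_append, pathSupport_cons_cons, pathSupport_singleton, union_empty] at hP
    exact h.far x (hq x (by simp)) A (Or.inr (Or.inl rfl)) P
      (segment_subset_triangle mid_mem_triangle right_mem_triangle hP)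
  | x :: y :: q, hq, P, hP => by
    rw [List.cons_append, List.cons_append, pathSupport_cons_cons] at hP
    rcases hP with hP | hP
    · exact h.far x (hq x (by simp)) y (Or.inl (hq y (by simp))) P
        (segment_subset_triangle mid_mem_triangle right_mem_triangle hP)
    · exact h.far_path (y :: q) (fun z hz => hq z (List.mem_cons_of_mem _ hz)) P hP

theorem pathSupport_subset_of_convex {S : Set Space} (hS : Convex ℝ S) {p : List Space}
    (hp : ∀ x ∈ p, x ∈ S) : pathSupport p ⊆ S :=
  pathSupport_subset_convexHull.trans (convexHull_min hp hS)

/-- Points of the strand that lie low are on the axis. -/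
theorem ConeFrame.eq_of_strand (h : ConeFrame n A B W c) {X C P : Space} {a b d : ℝ} (ha : 0 ≤ a) (hb : 0 ≤ b) (hd : 0 ≤ d)
    (hs : a + b + d = 1) (hP : P = a • W + b • X + d • C) (hX : X ∈ c)
    (hC : C ∈ c ∨ C = A ∨ C = B) (hr : P ∈ pathSupport (A :: (tangleStrand n ++ [B]))) :
    a = 0 ∧ b = 0 := by
  have hT : P ∈ convexHull ℝ {W, X, C} := mem_triangle_iff.2 ⟨a, b, d, ha, hb, hd, hs, hP⟩
  have hAB := (h.strand hr).resolve_left (not_lt.2 (h.far X hX C hC P hT))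
  obtain ⟨g, gA, gB, gW, gc⟩ := h.above
  have comb : ∀ {x y z : ℝ} {U V T : Space}, x + y + z = 1 →
      g (x • U + y • V + z • T) = x * g U + y * g V + z * g T := by
    intro x y z U V T hxyz
    have e1 : ∀ x, g x = g.linear x + g 0 := fun x => by simpa using g.map_vadd 0 x
    rw [e1, e1 U, e1 V, e1 T, map_add, map_add, map_smul, map_smul, map_smul]
    simp only [smul_eq_mul]
    linear_combination -g 0 * hxyz
  have h0 : g P = 0 := by
    obtain ⟨t, -, -, ht⟩ := mem_segment_iff.1 hAB
    have := comb (U := A) (V := B) (T := B) (show (1 - t) + t + 0 = 1 by ring)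
    rw [zero_smul, add_zero, ← ht, gA, gB] at this
    simpa using this
  rw [hP, comb hs] at h0
  have gX := gc X hX
  have gC : g C ≤ 0 := by
    rcases hC with hC | rfl | rfl
    exacts [(gc C hC).le, gA.le, gB.le]
  have h1 := mul_nonpos_of_nonneg_of_nonpos ha gW.le
  have h2 := mul_nonpos_of_nonneg_of_nonpos hb gX.le
  have h3 := mul_nonpos_of_nonneg_of_nonpos hd gC
  exact ⟨(mul_eq_zero.1 (by linarith)).resolve_right gW.ne,
    (mul_eq_zero.1 (by linarith)).resolve_right gX.ne⟩

theorem ConeFrame.edge_mem (h : ConeFrame n A B W c) {p q : List Space} (hc : c = p ++ q)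
    {e : Space × Space} (he : e ∈ pathEdges (q ++ [A])) {v : Space} (hv : v = e.1 ∨ v = e.2) :
    v ∈ A :: B :: c := by
  have h1 := mem_of_mem_pathEdges he
  subst hc
  simp only [List.mem_append, List.mem_singleton] at h1
  grind

theorem ConeFrame.notMem_path (h : ConeFrame n A B W c) : B ∉ pathSupport (c ++ [A]) := by
  obtain ⟨x, c', rfl⟩ := List.exists_cons_of_ne_nil (isPolygon_cons_iff.1 h.isPolygon).1
  exact (IsPolygon.vertex_notMem (Z := A) (x := B) (B := x) (l := c') h.isPolygon).2.2

/-- The first step of the cone construction. -/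
theorem ConeFrame.first (h : ConeFrame n A B W c) (hn : 1 ≤ n) {G : Set KnotType}
    (hG : ∀ K : PolygonalKnot, Colorable (4 * n + 1) K.support → K.knotType ∈ G)
    (hp : IsPolygon (tangled n A B c)) : ∃ hp' : IsPolygon (tangled n A B (W :: c)),
      Linked G (knotOf _ hp).knotType (knotOf _ hp').knotType := by
  obtain ⟨x, c', rfl⟩ := List.exists_cons_of_ne_nil (isPolygon_cons_iff.1 h.isPolygon).1
  have hB := h.notMem_path
  have hpath : pathSupport (x :: ((c' ++ A :: tangleStrand n) ++ [B])) =
      pathSupport ((x :: c') ++ [A]) ∪ pathSupport (A :: (tangleStrand n ++ [B])) := by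
    rw [← pathSupport_append]; simp
  have hedge : ∀ e ∈ pathEdges ((x :: c') ++ [A]),
      e ∈ pathEdges (x :: ((c' ++ A :: tangleStrand n) ++ [B])) := by
    intro e he
    rw [show x :: ((c' ++ A :: tangleStrand n) ++ [B]) =
      (x :: c') ++ A :: (tangleStrand n ++ [B]) by simp, pathEdges_append]
    exact List.mem_append_left _ he
  have hgen := fun {u v w} hu hv hw => h.generic u hu v hv w hw
  have hv := fun {e v} he => h.edge_mem (p := []) (q := x :: c') (e := e) (v := v) rfl he
  have mB : B ∈ A :: B :: x :: c' := by simp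
  have mx : x ∈ A :: B :: x :: c' := by simp
  have hperm : ∀ P, InTriangle B x W P ↔ InTriangle W x B P := by
    refine fun P => ⟨?_, ?_⟩ <;> rintro ⟨a, b, d, ha, hb, hd, hs, hP⟩ <;>
      exact ⟨d, b, a, hd, hb, ha, by linarith, by rw [hP]; module⟩
  have hset : convexHull ℝ {B, x, W} = convexHull ℝ {W, x, B} := by
    congr 1; ext; simp; tauto
  have hP : Pierced B x W (c' ++ A :: tangleStrand n) := by
    refine ⟨by simp, ?_, (isPolygon_cons_iff.1 hp).2.1, hp.left_notMem, fun P hT hr => ?_, ?_⟩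
    · have := independent_of_generic (W := W) (X := B) (C := x)
        (fun v hv => hgen mB mx (by rcases hv with rfl | rfl <;> assumption))
        (IsPolygon.vertex_notMem (x := B) (B := x) h.isPolygon).1
      rw [← affineIndependent_equiv (finRotate 3)] at this
      convert this using 1
      ext i; fin_cases i <;> rfl
    · rw [hset] at hT
      obtain ⟨a, b, d, ha, hb, hd, hs, hPe⟩ := mem_triangle_iff.1 hT
      rw [hpath] at hr
      rcases hr with hr | hr
      · obtain ⟨e, he, hPs⟩ := mem_pathSupport.1 hr
        have hXC : P ∈ segment ℝ x B → P ∈ segment ℝ e.1 e.2 → P = x := fun h1 _ => by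
          refine (IsPolygon.inter_rest (A := B) (B := x) (l := c' ++ [A]) (h.isPolygon.isRotated
            ⟨1, by simp⟩) (segment_symm ℝ x B ▸ h1) ?_).resolve_left fun e => hB (e ▸ hr)
          rw [show x :: (c' ++ [A] ++ [B]) = (x :: c') ++ A :: [B] by simp, pathSupport_append]
          exact Or.inl hr
        rcases generic_edge (hgen mx mB (hv he (.inl rfl))) (hgen mx mB (hv he (.inr rfl)))
          (hgen mx (hv he (.inl rfl)) (hv he (.inr rfl)))
          (hgen mB (hv he (.inl rfl)) (hv he (.inr rfl))) hXC ha hb hd hs hPe hPs with h1 | h1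
        · exact Or.inr (Or.inl h1)
        · exact Or.inr (Or.inr ⟨(hperm P).2 h1.1, e, hedge e he, h1.2⟩)
      · obtain ⟨rfl, rfl⟩ := h.eq_of_strand ha hb hd hs hPe (by simp) (Or.inr (Or.inr rfl)) hr
        obtain rfl : d = 1 := by linarith
        left; rw [hPe]; simp
    · rw [piercings, hpath]
      have hf : {P | InTriangle B x W P ∧ P ∈ pathSupport ((x :: c') ++ [A])}.Finite :=
        finite_of_edges fun e he => by
          simp only [hperm]
          exact generic_edge_finite (hgen mx mB (hv he (.inl rfl))) (hgen mx mB (hv he (.inr rfl)))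
      refine hf.subset ?_
      rintro P ⟨h1, h2 | h2⟩
      · exact ⟨h1, h2⟩
      · obtain ⟨a, b, d, ha, hb, hd, hs, hPe⟩ := (hperm P).1 h1
        exact absurd (h.eq_of_strand ha.le hb.le hd.le hs hPe (by simp) (Or.inr (Or.inr rfl)) h2).1
          ha.ne'
  refine ⟨hP.isPolygon_insert, hP.linked fun q hq hpq => h.mem_of_tangled (r := q ++ x :: c') hn
    (by simp) (fun P hr => ?_) hG (by unfold tangled; rw [List.append_assoc, List.cons_append]) hpq⟩
  rw [show B :: (q ++ x :: c' ++ [A]) = (B :: q) ++ x :: (c' ++ [A]) by simp,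
    pathSupport_append] at hr
  rcases hr with hr | hr
  · refine h.far x (by simp) B (Or.inr (Or.inr rfl)) P (hset ▸ pathSupport_subset_of_convex
      (convex_convexHull ℝ {B, x, W}) (fun y hy => ?_) hr)
    simp only [List.cons_append, List.mem_cons, List.mem_append, List.not_mem_nil, or_false] at hy
    rcases hy with rfl | hy | rfl
    exacts [left_mem_triangle, hq y hy, mid_mem_triangle]
  · exact h.far_path (x :: c') (fun _ hx => hx) P hr

/-- A further step of the cone construction. -/
theorem ConeFrame.step (h : ConeFrame n A B W c) (hn : 1 ≤ n) {G : Set KnotType}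
    (hG : ∀ K : PolygonalKnot, Colorable (4 * n + 1) K.support → K.knotType ∈ G) {p q : List Space}
    {C : Space} (hc : c = p ++ C :: q) (hp : IsPolygon (tangled n A B (W :: C :: q))) :
    ∃ hp' : IsPolygon (tangled n A B (W :: q)),
      Linked G (knotOf _ hp).knotType (knotOf _ hp').knotType := by
  obtain ⟨X, m, hX⟩ : ∃ X m, q ++ [A] = X :: m := List.exists_cons_of_ne_nil (by simp)
  have happ : ∀ s : List Space, X :: (m ++ s) = q ++ A :: s := fun s => by
    rw [← List.cons_append, ← hX]; simp
  set rest := m ++ (tangleStrand n ++ [B]) with hrest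
  have hrot : ∀ s, (W :: (s ++ X :: rest)) ~r tangled n A B (W :: (s ++ q)) := fun s => by
    rw [hrest, happ, tangled, show W :: (s ++ (q ++ A :: (tangleStrand n ++ [B]))) =
      (W :: (s ++ q) ++ A :: tangleStrand n) ++ [B] by simp]
    exact List.isRotated_append
  have hpi : IsPolygon (W :: C :: X :: rest) := hp.isRotated (hrot [C]).symm
  have hpath : pathSupport (X :: (rest ++ [W])) = pathSupport (q ++ [A]) ∪
      (pathSupport (A :: (tangleStrand n ++ [B])) ∪ segment ℝ B W) := by
    have e : X :: (rest ++ [W]) = q ++ A :: (tangleStrand n ++ B :: [W]) := by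
      rw [← happ]; simp [hrest]
    rw [e, pathSupport_append, show A :: (tangleStrand n ++ B :: [W]) = (A :: tangleStrand n) ++ B :: [W]
      by simp, pathSupport_append (A :: tangleStrand n), pathSupport_cons_cons, pathSupport_singleton, union_empty]
    rfl
  have hedge : ∀ e ∈ pathEdges (q ++ [A]), e ∈ pathEdges (X :: (rest ++ [W])) := by
    intro e he
    rw [hrest, List.append_assoc, happ, pathEdges_append]
    exact List.mem_append_left _ he
  have hgen := fun {u v w} hu hv hw => h.generic u hu v hv w hw
  have hv := fun {e v} he => h.edge_mem (p := p ++ [C]) (q := q) (e := e) (v := v) (by simp [hc]) he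
  have mC' : C ∈ c := by simp [hc]
  have mC : C ∈ A :: B :: c := by simp [mC']
  have mB : B ∈ A :: B :: c := by simp
  have hX' : X ∈ c ∨ X = A ∨ X = B := by
    have : X ∈ q ++ [A] := by simp [hX]
    simp only [List.mem_append, List.mem_singleton] at this
    rcases this with h1 | h1
    exacts [Or.inl (by simp [hc, h1]), Or.inr (Or.inl h1)]
  have mX : X ∈ A :: B :: c := by simp; tauto
  have hCX : (C, X) ∈ pathEdges (c ++ [A]) := by
    rw [hc, List.append_assoc, List.cons_append, hX, pathEdges_append]
    exact List.mem_append_right _ (by simp)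
  have hAn := h.isPolygon.left_notMem
  obtain ⟨x, c', hcx⟩ := List.exists_cons_of_ne_nil (isPolygon_cons_iff.1 h.isPolygon).1
  have hCX' : (C, X) ∈ pathEdges (B :: (c ++ [A])) := by
    rw [hcx] at hCX ⊢
    exact List.mem_cons_of_mem _ hCX
  have hne : X ≠ C :=
    (pathEdges_ne (p := B :: c) (isPolygon_cons_iff.1 h.isPolygon).2.1 hAn hCX').symm
  have hXC : ∀ P ∈ pathSupport (q ++ [A]), P ∈ segment ℝ X C → P = X := by
    intro P hr hP
    have hs := (isPolygon_cons_iff.1 h.isPolygon).2.1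
    rw [show B :: (c ++ [A]) = (B :: p) ++ C :: (q ++ [A]) by simp [hc], hX,
      pathSimple_append, pathSimple_cons_cons, ← hX] at hs
    rw [segment_symm, ← halfOpenEdge_union_right] at hP
    refine hP.resolve_left fun h1 => ?_
    rcases pathSupport_subset_halfPath q A hr with h2 | rfl
    · exact Set.disjoint_left.1 hs.2.1.2 h1 h2
    · exact hAn (mem_halfPath.2 ⟨_, hCX', h1⟩)
  have hBW : ∀ {P : Space} {a b d : ℝ}, 0 ≤ b → 0 ≤ d → a + b + d = 1 → P = a • W + b • X + d • C →
      P ∈ segment ℝ B W → b = 0 ∧ d = 0 := by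
    intro P a b d hb hd hs hPe hPs
    obtain ⟨t, h0, h1, ht⟩ := mem_segment_iff.1 hPs
    have hat : a = t := sub_eq_zero.1 <| by_contra fun hne => false_of_comb (hgen mB mX mC) hne
      (x := 1 - t) (y := -b) (z := -d) (by linear_combination (norm := module) hPe.symm.trans ht) (by linarith)
    rcases h1.eq_or_lt with rfl | h1
    · constructor <;> linarith
    · refine (h.notMem_path (mem_pathSupport.2 ⟨_, hCX, ?_⟩)).elim
      have h2 : (1 - t) ≠ 0 := by linarith
      refine mem_segment_iff.2 ⟨b / (1 - t), div_nonneg hb (by linarith), ?_, ?_⟩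
      · rw [div_le_one (by linarith)]; linarith
      · have e : (1 - t) • B = d • C + b • X := by
          subst hat; linear_combination (norm := module) ht.symm.trans hPe
        have e2 : 1 - b / (1 - t) = (1 - t)⁻¹ * d := by field_simp; linarith
        rw [e2, ← inv_smul_smul₀ h2 B, e, div_eq_inv_mul]; module
  have hfar := h.far C mC' X hX'
  have hP : Pierced W X C rest := by
    refine ⟨by simp [hrest], independent_of_generic (fun v hv => hgen mX mC (by
      rcases hv with rfl | rfl <;> assumption)) hne, (isPolygon_insert_iff.1 hpi).1, fun h1 =>
      hpi.left_notMem ?_, fun P hT hr => ?_, ?_⟩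
    · rw [List.cons_append, halfPath_cons_cons]
      exact Or.inr h1
    · obtain ⟨a, b, d, ha, hb, hd, hs, hPe⟩ := mem_triangle_iff.1 hT
      rw [hpath] at hr
      rcases hr with hr | hr | hr
      · obtain ⟨e, he, hPs⟩ := mem_pathSupport.1 hr
        rcases generic_edge (hgen mX mC (hv he (.inl rfl))) (hgen mX mC (hv he (.inr rfl)))
          (hgen mX (hv he (.inl rfl)) (hv he (.inr rfl)))
          (hgen mC (hv he (.inl rfl)) (hv he (.inr rfl))) (fun h1 _ => hXC P hr h1)
          ha hb hd hs hPe hPs with h1 | h1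
        · exact Or.inr (Or.inl h1)
        · exact Or.inr (Or.inr ⟨h1.1, e, hedge e he, h1.2⟩)
      · obtain ⟨rfl, rfl⟩ := h.eq_of_strand (X := C) (C := X) ha hd hb (by linarith)
          (by rw [hPe]; module) mC' hX' hr
        obtain rfl : b = 1 := by linarith
        right; left; rw [hPe]; simp
      · obtain ⟨rfl, rfl⟩ := hBW hb hd hs hPe hr
        obtain rfl : a = 1 := by linarith
        left; rw [hPe]; simp
    · rw [piercings, hpath]
      have hf : {P | InTriangle W X C P ∧ P ∈ pathSupport (q ++ [A])}.Finite :=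
        finite_of_edges fun e he =>
          generic_edge_finite (hgen mX mC (hv he (.inl rfl))) (hgen mX mC (hv he (.inr rfl)))
      refine hf.subset ?_
      rintro P ⟨h1, h2 | h2⟩
      · exact ⟨h1, h2⟩
      obtain ⟨a, b, d, ha, hb, hd, hs, hPe⟩ := h1
      rcases h2 with h2 | h2
      · exact absurd (h.eq_of_strand (X := C) (C := X) ha.le hd.le hb.le (by linarith)
          (by rw [hPe]; module) mC' hX' h2).1 ha.ne'
      · exact absurd (hBW hb.le hd.le hs hPe h2).1 hb.ne'
  have hl := hP.linked (G := G) fun s hs hps => h.mem_of_tangled (r := W :: (s ++ q)) hn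
    (by simp) (fun P hr => ?_) hG (hrot s) hps
  · have r0 := hrot []
    have r1 := hrot [C]
    have p0 := hP.isPolygon.isRotated r0
    refine ⟨p0, ?_⟩
    have e1 := knotType_rotate r1 hpi hp
    have e0 := knotType_rotate r0 hP.isPolygon p0
    simp only [List.nil_append] at e0
    exact e1 ▸ e0 ▸ hl.symm
  · have e : B :: (W :: (s ++ q) ++ [A]) = B :: W :: (s ++ X :: m) := by rw [← hX]; simp
    rw [e, pathSupport_cons_cons, ← List.cons_append, pathSupport_append, ← hX] at hr
    rcases hr with hr | hr | hr
    · exact h.far C mC' B (Or.inr (Or.inr rfl)) P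
        (segment_subset_triangle right_mem_triangle left_mem_triangle hr)
    · rw [show ({W, C, X} : Set Space) = {W, X, C} by ext; simp; tauto] at hfar
      refine hfar P (pathSupport_subset_of_convex (convex_convexHull ℝ _) (fun y hy => ?_) hr)
      simp only [List.cons_append, List.mem_cons, List.mem_append, List.not_mem_nil, or_false] at hy
      rcases hy with rfl | hy | rfl
      exacts [left_mem_triangle, hs y hy, mid_mem_triangle]
    · exact h.far_path q (fun y hy => by simp [hc, hy]) P hr

/-- A knot in a cone frame is linked to the tangle closed up by the apex of the cone. -/
theorem ConeFrame.linked (h : ConeFrame n A B W c) (hn : 1 ≤ n) {G : Set KnotType}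
    (hG : ∀ K : PolygonalKnot, Colorable (4 * n + 1) K.support → K.knotType ∈ G)
    (h0 : (knotOf _ h.isPolygon).knotType ∈ G) : ∃ h' : IsPolygon (tangled n A B [W]),
      Linked G (knotOf _ h.isPolygon).knotType (knotOf _ h').knotType := by
  have hne : c ≠ [] := (isPolygon_cons_iff.1 h.isPolygon).1
  have far : ∀ P ∈ pathSupport (B :: (c ++ [A])), 2 ≤ boxGauge n P := by
    obtain ⟨x, c', hc⟩ := List.exists_cons_of_ne_nil hne
    intro P hP
    rw [hc, List.cons_append, pathSupport_cons_cons, ← List.cons_append, ← hc] at hP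
    rcases hP with hP | hP
    · exact h.far x (by simp [hc]) B (Or.inr (Or.inr rfl)) P
        (segment_subset_triangle right_mem_triangle mid_mem_triangle hP)
    · exact h.far_path c (fun _ hx => hx) P hP
  obtain ⟨p1, l1⟩ := AxisFrame.exists_linked ⟨h.toAxisEnds, h.isPolygon, far⟩
  have p2 := p1.isRotated tangled_isRotated
  have e2 := knotType_rotate tangled_isRotated p1 p2
  obtain ⟨p3, l3⟩ := h.first hn hG p2
  have l4 := (l1 G h0 (h.toAxisEnds.mem_of_tangled hn hne far hG tangled_isRotated p1)).trans
    (e2 ▸ l3)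
  have key : ∀ q p, c = p ++ q → ∀ hp : IsPolygon (tangled n A B (W :: q)),
      (knotOf _ hp).knotType ∈ G → ∃ h' : IsPolygon (tangled n A B [W]),
        Linked G (knotOf _ hp).knotType (knotOf _ h').knotType := by
    intro q
    induction q with
    | nil => exact fun p _ hp h => ⟨hp, .refl h⟩
    | cons C q ih =>
      intro p hc hp hk
      obtain ⟨p5, l5⟩ := h.step hn hG hc hp
      obtain ⟨p6, l6⟩ := ih (p ++ [C]) (by simp [hc]) p5 l5.2.1
      exact ⟨p6, l5.trans l6⟩
  obtain ⟨p7, l7⟩ := key c [] (by simp) p3 l4.2.1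
  exact ⟨p7, l4.trans l7⟩

end Cone

section Finger
variable {A B C : Space} {l : List Space}

theorem IsPolygon.exists_insert (h : IsPolygon (A :: B :: l)) (hl : l ≠ []) (hC : C ∉ plane A B B)
    (hd : ∀ a b d : ℝ, 0 ≤ a → 0 ≤ b → 0 < d → a + b + d = 1 →
      a • A + b • B + d • C ∉ pathSupport (B :: (l ++ [A]))) :
    ∃ h' : IsPolygon (A :: C :: B :: l), (knotOf _ h).knotType = (knotOf _ h').knotType := by
  have hp : Pierced A B C l := by
    refine ⟨hl, ?_, (isPolygon_cons_iff.1 h).2.1, h.left_notMem, fun P hP hP' => ?_, ?_⟩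
    · rw [affineIndependent_triple_iff]
      intro x y hxy
      have hy : y = 0 := by
        by_contra hy
        exact false_of_comb hC hy (x := x + y) (y := -x) (z := 0)
          (by linear_combination (norm := module) hxy) (by ring)
      subst hy
      have : x • (B - A) = 0 := by rw [← hxy]; module
      exact ⟨(smul_eq_zero.1 this).resolve_right (sub_ne_zero.2 h.ne.symm), rfl⟩
    · obtain ⟨a, b, d, ha, hb, hd', hs, rfl⟩ := mem_triangle_iff.1 hP
      rcases hd'.eq_or_lt with rfl | hd'
      · exact (h.inter_rest ⟨a, b, ha, hb, by linarith, by module⟩ hP').imp id Or.inl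
      · exact (hd a b d ha hb hd' hs hP').elim
    · refine finite_empty.subset ?_
      rintro P ⟨⟨a, b, d, ha, hb, hd', hs, rfl⟩, hP'⟩
      exact hd a b d ha.le hb.le hd' hs hP'
  refine ⟨hp.isPolygon_insert, knotType_eq_of_triangleMove (hp.triangleMove ?_)⟩
  refine eq_empty_iff_forall_notMem.2 ?_
  rintro P ⟨⟨a, b, d, ha, hb, hd', hs, rfl⟩, hP'⟩
  exact hd a b d ha.le hb.le hd' hs hP'

theorem exists_of_mem_plane {P : Space} (h : P ∈ plane A B C) :
    ∃ a b c : ℝ, a + b + c = 1 ∧ P = a • A + b • B + c • C := by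
  obtain ⟨w, hw, rfl⟩ := eq_affineCombination_of_mem_affineSpan_of_fintype h
  refine ⟨w 0, w 1, w 2, by rw [← hw, Fin.sum_univ_three], ?_⟩
  rw [Finset.affineCombination_eq_linear_combination _ _ w hw, Fin.sum_univ_three]
  rfl

variable {ℓ : Space →ₗ[ℝ] ℝ}

theorem le_of_mem_pathSupport {t : ℝ} {P : Space} (h : ∀ x ∈ l, ℓ x ≤ t)
    (hP : P ∈ pathSupport l) :
    ℓ P ≤ t :=
  pathSupport_subset_of_convex (S := {x | ℓ x ≤ t}) (convex_halfSpace_le ℓ.isLinear t) h hP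

/-- A finger from the top vertex of a knot to an edge `AB` above the knot. -/
theorem PolygonalKnot.exists_finger (K : PolygonalKnot) (hℓ : InjOn ℓ {x | x ∈ K.vertices}) :
    ∃ c Z V X, ∀ d ≠ 0, ℓ d = 0 → ∀ B, (∀ x ∈ c, ℓ x < ℓ B) → B ∉ plane Z V X →
      B ∉ plane V X (V + d) →
      ∃ hp : IsPolygon ((B + d) :: B :: c), (knotOf _ hp).knotType = K.knotType := by
  obtain ⟨V, hV, hmax⟩ := K.vertices.toFinset.exists_max_image ℓ (by
    obtain ⟨A, _, _, _, h⟩ := K.exists_vertices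
    exact ⟨A, by simp [h]⟩)
  simp only [List.mem_toFinset] at hV hmax
  obtain ⟨Z, U, m, hr⟩ := exists_isRotated_of_mem K.three_le_length hV
  have h0 := K.isPolygon.isRotated hr
  have hlt : ∀ y ∈ U :: (m ++ [Z]), ℓ y < ℓ V := by
    intro y hy
    have hyV : y ≠ V := by
      rintro rfl
      exact (IsPolygon.vertex_notMem h0).2.2 (mem_pathSupport_of_mem (by simp) hy)
    have hyK : y ∈ K.vertices := hr.mem_iff.2 (by simp at hy ⊢; tauto)
    exact (hmax y hyK).lt_of_ne fun e => hyV (hℓ hyK hV e)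
  obtain ⟨t, ht0, ht1, ht⟩ : ∃ t : ℝ, 0 < t ∧ t < 1 ∧
      ∀ y ∈ U :: (m ++ [Z]), ℓ y < (1 - t) * ℓ V + t * ℓ U := by
    have e1 : ∀ᶠ t in 𝓝[>] (0 : ℝ), ∀ y ∈ {y | y ∈ U :: (m ++ [Z])},
        ℓ y < (1 - t) * ℓ V + t * ℓ U := by
      refine ((List.finite_toSet _).eventually_all).2 fun y hy => nhdsWithin_le_nhds ?_
      refine ContinuousAt.eventually_lt (by fun_prop) (by fun_prop) ?_
      simpa using hlt y hy
    have e2 : ∀ᶠ t in 𝓝[>] (0 : ℝ), t < 1 := nhdsWithin_le_nhds (eventually_lt_nhds one_pos)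
    obtain ⟨t, h1, h2, h3⟩ := (eventually_mem_nhdsWithin.and (e2.and e1)).exists
    exact ⟨t, h1, h2, h3⟩
  set X := (1 - t) • V + t • U with hX
  have ℓX : ℓ X = (1 - t) * ℓ V + t * ℓ U := by simp [hX]
  have hXV : ℓ X < ℓ V := by
    have := hlt U (by simp)
    rw [ℓX]; nlinarith
  have hr1 : (Z :: V :: U :: m) ~r (V :: U :: (m ++ [Z])) := ⟨1, by simp⟩
  have h1 := h0.isRotated hr1
  have hXm : X ∈ openSegment ℝ V U := mem_openSegment_iff.2 ⟨t, ht0, ht1, rfl⟩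
  have h2 := (isPolygon_subdivide_iff h1.ne hXm (by simp)).2 h1
  have hk2 : K.knotType = (knotOf _ h2).knotType :=
    knotType_subdivide hXm (hr.trans hr1) (.refl _) K.isPolygon h2
  refine ⟨X :: U :: (m ++ [Z]) ++ [V], Z, V, X, fun d hd0 hd B hc hBp hBd => ?_⟩
  have hVh := hc V (by simp)
  have hAp : B + d ∉ plane V B X := fun hm => by
    obtain ⟨a, b, e, hs, hA⟩ := exists_of_mem_plane hm
    have h1 : (1 - b) • B = (a + 1) • V + e • X + (-1 : ℝ) • (V + d) := by
      linear_combination (norm := module) hA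
    rcases eq_or_ne (1 - b) 0 with hb | hb
    · have h2 := congrArg ℓ h1
      rw [hb] at h2
      simp only [zero_smul, map_zero, map_add, map_smul, hd, smul_eq_mul] at h2
      have h3 : e * (ℓ X - ℓ V) = 0 := by linear_combination -h2 - ℓ V * (hs + hb)
      obtain rfl := (mul_eq_zero.1 h3).resolve_right (by linarith)
      obtain rfl : b = 1 := by linarith
      obtain rfl : a = 0 := by linarith
      exact hd0 (by linear_combination (norm := module) hA)
    · exact false_of_comb hBd hb h1 (by linarith)
  have hA : ℓ (B + d) = ℓ B := by rw [map_add, hd, add_zero]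
  generalize B + d = A at hA hAp
  have hle : ∀ x ∈ X :: U :: (m ++ [Z]), ℓ x ≤ ℓ X := by
    intro x hx
    rcases List.mem_cons.1 hx with rfl | hx
    exacts [le_rfl, ℓX ▸ (ht x hx).le]
  obtain ⟨h3, hk3⟩ := h2.exists_insert (C := B) (by simp)
    (fun hm => hBp (affineSpan_mono ℝ (by
      rintro _ ⟨i, rfl⟩
      fin_cases i
      exacts [⟨1, rfl⟩, ⟨2, rfl⟩, ⟨2, rfl⟩]) hm)) (fun a b d ha hb hd hs hP => by
      have hlP : ℓ X < ℓ (a • V + b • X + d • B) := by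
        simp only [map_add, map_smul, smul_eq_mul]
        have h4 := mul_nonneg ha (sub_nonneg.2 hXV.le)
        have h5 := mul_pos hd (sub_pos.2 (hXV.trans hVh))
        obtain rfl : b = 1 - a - d := by linarith
        linarith
      rw [show X :: (U :: (m ++ [Z]) ++ [V]) = (X :: U :: m) ++ Z :: [V] by simp,
        pathSupport_append, pathSupport_cons_cons, pathSupport_singleton, union_empty] at hP
      rcases hP with hP | hP
      · exact hlP.not_ge (le_of_mem_pathSupport (fun x hx => hle x (by simpa using hx)) hP)
      · obtain ⟨s, -, -, hs'⟩ := mem_segment_iff.1 hP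
        exact false_of_comb hBp hd.ne' (x := 1 - s) (y := s - a) (z := -b)
          (by linear_combination (norm := module) hs') (by linarith))
  obtain ⟨h4, hk4⟩ := h3.exists_insert (C := A) (by simp)
    (fun hm => hAp (affineSpan_mono ℝ (by
      rintro _ ⟨i, rfl⟩
      fin_cases i
      exacts [⟨0, rfl⟩, ⟨1, rfl⟩, ⟨1, rfl⟩]) hm)) (fun a b d ha hb hd hs hP => by
      rw [List.cons_append, pathSupport_cons_cons] at hP
      rcases hP with hP | hP
      · obtain ⟨s, -, -, hs'⟩ := mem_segment_iff.1 hP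
        exact false_of_comb hAp hd.ne' (x := -a) (y := 1 - s - b) (z := s)
          (by linear_combination (norm := module) hs') (by linarith)
      · have h5 := le_of_mem_pathSupport (t := ℓ V) (ℓ := ℓ) (fun x hx => by
          rw [← List.cons_append, List.mem_append, List.mem_singleton] at hx
          rcases hx with hx | rfl
          exacts [(hle x hx).trans hXV.le, le_rfl]) hP
        simp only [map_add, map_smul, smul_eq_mul, hA] at h5
        obtain rfl : a = 1 - b - d := by linarith
        have h6 := mul_nonneg hb (sub_nonneg.2 hVh.le)
        have h7 := mul_pos hd (sub_pos.2 hVh)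
        linarith)
  have hr5 : (V :: A :: B :: X :: U :: (m ++ [Z])) ~r (A :: B :: (X :: U :: (m ++ [Z]) ++ [V])) :=
    ⟨1, by simp⟩
  have h5 := h4.isRotated hr5
  exact ⟨h5, (hk2.trans (hk3.trans (hk4.trans (knotType_rotate hr5 h4 h5)))).symm⟩

end Finger

section Placement
variable {A B W : Space} {c L : List Space} {ℓ : Space →ₗ[ℝ] ℝ} {h : ℝ} {n : ℕ}

theorem exists_injOn {s : Set Space} (hs : s.Finite) : ∃ ℓ : Space →ₗ[ℝ] ℝ, InjOn ℓ s := by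
  have : Finite s := hs
  obtain ⟨ℓ, hl⟩ := Module.exists_dual_forall_apply_ne_zero (K := ℝ)
    (fun p : {p : s × s // p.1 ≠ p.2} => (p.1.1 : Space) - p.1.2)
    fun p => sub_ne_zero.2 fun e => p.2 (Subtype.ext e)
  refine ⟨ℓ, fun x hx y hy hxy => by_contra fun hne => ?_⟩
  refine hl ⟨(⟨x, hx⟩, ⟨y, hy⟩), fun e => hne (congrArg Subtype.val e)⟩ ?_
  rw [map_sub, hxy, sub_self]

/-- A point with an upper bound on a linear functional off the convex hull. -/
theorem notMem_convexHull_insert {s : Set Space} (hs : s.Nonempty) (hl : ∀ x ∈ s, ℓ x < h)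
    (hA : ℓ A = h) {M : Space} (hM : ℓ M = h) (hMA : M ≠ A) : M ∉ convexHull ℝ (insert A s) := by
  rw [convexHull_insert hs, convexJoin_singleton_left]
  intro hm
  obtain ⟨y, hy, hMy⟩ := mem_iUnion₂.1 hm
  have h1 : ℓ y < h := convexHull_min (t := {x | ℓ x < h}) hl (convex_halfSpace_lt ℓ.isLinear h) hy
  obtain ⟨t, -, -, rfl⟩ := mem_segment_iff.1 hMy
  simp only [map_add, map_smul, smul_eq_mul, hA] at hM
  have h2 : t * (h - ℓ y) = 0 := by linarith
  obtain rfl := (mul_eq_zero.1 h2).resolve_right (by linarith)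
  simp at hMA

theorem exists_norm_le_of_boxGauge (n : ℕ) (F : Space →L[ℝ] Space) :
    ∃ R : ℝ, 0 < R ∧ ∀ P, boxGauge n P < 2 → ‖F P‖ ≤ R := by
  obtain ⟨R, hR⟩ := (isCompact_Icc (a := (![-3, -5, -3] : Space)) (b := ![4 * n + 7, 3, 3])
    ).exists_bound_of_continuousOn F.continuous.continuousOn
  refine ⟨max R 1, by positivity, fun P hP => (hR P ?_).trans (le_max_left _ _)⟩
  rw [boxGauge_lt_iff] at hP
  obtain ⟨h0, h1, h2⟩ := hP
  simp only [Matrix.cons_val] at h0 h1 h2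
  constructor <;> intro i <;> fin_cases i <;> simp <;> linarith

theorem notMem_plane_map {Φ : Space ≃ᵃ[ℝ] Space} {u v w : Space} (hW : W ∉ plane u v w) :
    Φ W ∉ plane (Φ u) (Φ v) (Φ w) := by
  have e : plane (Φ u) (Φ v) (Φ w) = (plane u v w).map Φ.toAffineMap := by
    rw [plane, plane, AffineSubspace.map_span, ← range_comp]
    congr 2
    ext i : 1
    fin_cases i <;> rfl
  rw [e]
  exact fun hm => hW ((AffineSubspace.mem_map_iff_mem_of_injective Φ.injective).1 hm)

theorem exists_affineEquiv (n : ℕ) (hAB : A ≠ B) (hA : ℓ A = h) (hB : ℓ B = h) (hW : ℓ W < h)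
    (hL : ∀ x ∈ L, ℓ x < h) : ∃ Ψ : Space ≃ᵃ[ℝ] Space, ∀ c, (∀ x ∈ c, x ∈ L) →
      IsPolygon (A :: B :: c) → (∀ u ∈ A :: B :: c, ∀ v ∈ A :: B :: c, ∀ w ∈ A :: B :: c,
        W ∉ plane u v w) → ConeFrame n (Ψ A) (Ψ B) (Ψ W) (c.map Ψ) := by
  set M : Space := (1 / 2 : ℝ) • (A + B) with hM
  have ℓM : ℓ M = h := by simp only [hM, map_smul, map_add, hA, hB, smul_eq_mul]; ring
  set s : Set Space := {x | x ∈ W :: L} with hs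
  have hsf : s.Finite := List.finite_toSet _
  have hsn : s.Nonempty := ⟨W, by simp [hs]⟩
  have hsl : ∀ x ∈ s, ℓ x < h := by
    intro x hx
    rcases List.mem_cons.1 hx with rfl | hx
    exacts [hW, hL x hx]
  have hMA : M ≠ A := fun e => hAB (by
    linear_combination (norm := module) (-2 : ℝ) • (hM.symm.trans e))
  have hMB : M ≠ B := fun e => hAB (by
    linear_combination (norm := module) (2 : ℝ) • (hM.symm.trans e))
  obtain ⟨r, hr, hball⟩ : ∃ r > 0, ∀ P, ‖P - M‖ < r →
      P ∉ convexHull ℝ (insert A s) ∧ P ∉ convexHull ℝ (insert B s) := by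
    have e1 := (hsf.insert A).isClosed_convexHull ℝ |>.isOpen_compl.mem_nhds
      (notMem_convexHull_insert hsn hsl hA ℓM hMA)
    have e2 := (hsf.insert B).isClosed_convexHull ℝ |>.isOpen_compl.mem_nhds
      (notMem_convexHull_insert hsn hsl hB ℓM hMB)
    obtain ⟨r, hr, h1⟩ := Metric.mem_nhds_iff.1 (inter_mem e1 e2)
    exact ⟨r, hr, fun P hP => h1 (by simpa [dist_eq_norm] using hP)⟩
  obtain ⟨v, hv⟩ := exists_independent (sub_ne_zero.2 hAB.symm)
  obtain ⟨w, F, hF⟩ := exists_frame hv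
  have hn := n.cast_nonneg (α := ℝ)
  set x₀ : Space := ![2 * n + 2, 0, 0] with hx₀
  obtain ⟨R, hR, hRb⟩ := exists_norm_le_of_boxGauge n (F : Space →L[ℝ] Space)
  set t : ℝ := min (1 / (2 * (2 * n + 5))) (r / (2 * (R + ‖F x₀‖))) with ht
  have hR' : 0 < R + ‖F x₀‖ := by positivity
  have ht0 : 0 < t := lt_min (by positivity) (by positivity)
  have ht1 : 2 * n + 5 ≤ 1 / (2 * t) := by
    rw [le_div_iff₀ (by positivity)]
    have := (le_div_iff₀ (by positivity)).1 (ht ▸ min_le_left _ _ : t ≤ 1 / (2 * (2 * n + 5)))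
    linarith
  have ht2 : t * (R + ‖F x₀‖) < r := by
    have := (le_div_iff₀ (by positivity)).1 (ht ▸ min_le_right _ _ : t ≤ r / (2 * (R + ‖F x₀‖)))
    linarith
  set Φ : Space ≃ᵃ[ℝ] Space := (F.toLinearEquiv.trans (LinearEquiv.smulOfNeZero ℝ Space t
    ht0.ne')).toAffineEquiv.trans (AffineEquiv.constVAdd ℝ Space (M - t • F x₀)) with hΦ
  have Φe : ∀ x, Φ x = M - t • F x₀ + t • F x := fun x => rfl
  have Φx : ∀ z : ℝ, Φ ![2 * n + 2 + z, 0, 0] = M + (t * z) • (B - A) := by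
    intro z
    rw [Φe, hF, hF]
    simp only [hx₀, Matrix.cons_val]
    module
  have htt : t * (1 / (2 * t)) = 1 / 2 := by field_simp
  have ΦA : Φ.symm A = ![2 * n + 2 + -(1 / (2 * t)), 0, 0] := by
    rw [← Φ.symm_apply_apply ![2 * (n : ℝ) + 2 + -(1 / (2 * t)), 0, 0], Φx, mul_neg, htt, hM]
    congr 1; module
  have ΦB : Φ.symm B = ![2 * n + 2 + 1 / (2 * t), 0, 0] := by
    rw [← Φ.symm_apply_apply ![2 * (n : ℝ) + 2 + 1 / (2 * t), 0, 0], Φx, htt, hM]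
    congr 1; module
  refine ⟨Φ.symm, fun c hc hp hgen => ⟨⟨?_, ?_⟩, hp.map Φ.symm, ?_, ?_, ?_⟩⟩
  · rw [ΦA]
    exact ⟨by simp only [Matrix.cons_val]; linarith, rfl, rfl⟩
  · rw [ΦB]
    exact ⟨by simp only [Matrix.cons_val]; linarith, rfl, rfl⟩
  · intro X hX Y hY P hP
    by_contra hlt
    have hfar := hball (Φ P) (by
      have e : Φ P - M = t • (F P - F x₀) := by rw [Φe]; module
      rw [e, norm_smul, Real.norm_of_nonneg ht0.le]
      refine lt_of_le_of_lt ?_ ht2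
      gcongr
      exact (norm_sub_le _ _).trans (add_le_add_left (hRb P (not_le.1 hlt)) _))
    obtain ⟨X, hXc, rfl⟩ := List.mem_map.1 hX
    have hX' : X ∈ s := List.mem_cons_of_mem _ (hc X hXc)
    have hW' : W ∈ s := List.mem_cons_self
    have key : ∀ Y, Y ∈ s ∨ Y = A ∨ Y = B → P ∉ convexHull ℝ {Φ.symm W, Φ.symm X, Φ.symm Y} := by
      intro Y hY hP
      rw [triangle_map] at hP
      obtain ⟨Q, hQ, rfl⟩ := hP
      rw [Φ.apply_symm_apply] at hfar
      have sub : ∀ {Z : Space}, Y ∈ insert Z s → ({W, X, Y} : Set Space) ⊆ insert Z s := fun hZ =>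
        insert_subset (Or.inr hW') (insert_subset (Or.inr hX') (singleton_subset_iff.2 hZ))
      rcases hY with hY | rfl | rfl
      exacts [hfar.1 (convexHull_mono (sub (Or.inr hY)) hQ),
        hfar.1 (convexHull_mono (sub (Or.inl rfl)) hQ), hfar.2 (convexHull_mono (sub (Or.inl rfl)) hQ)]
    rcases hY with hY | rfl | rfl
    · obtain ⟨Y, hYc, rfl⟩ := List.mem_map.1 hY
      exact key Y (Or.inl (List.mem_cons_of_mem _ (hc Y hYc))) hP
    · exact key A (by simp) hP
    · exact key B (by simp) hP
  · have e : Φ.symm A :: Φ.symm B :: c.map Φ.symm = (A :: B :: c).map Φ.symm := rfl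
    rw [e]
    simp only [List.forall_mem_map]
    exact fun u hu v hv w hw => notMem_plane_map (hgen u hu v hv w hw)
  · refine ⟨(ℓ.toAffineMap - AffineMap.const ℝ Space h).comp Φ.toAffineMap, ?_, ?_, ?_, ?_⟩
    · simp [hA]
    · simp [hB]
    · simp [hW]
    · simp only [List.forall_mem_map]
      intro x hx
      simp [hL x (hc x hx)]

end Placement

section Connected
variable {n : ℕ}

theorem PolygonalKnot.map_symm_map (Ψ : Space ≃ᵃ[ℝ] Space) (K : PolygonalKnot) :
    (K.map Ψ).map Ψ.symm = K := by
  obtain ⟨l, h1, h2⟩ := K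
  have : Ψ.symm ∘ Ψ = id := funext Ψ.symm_apply_apply
  simp [PolygonalKnot.map, knotOf, this]

theorem linked_of_colorable_subset (hn : 1 ≤ n) {G : Set KnotType}
    (hG : ∀ K : PolygonalKnot, Colorable (4 * n + 1) K.support → K.knotType ∈ G)
    {K K' : PolygonalKnot} (hK : K.knotType ∈ G) (hK' : K'.knotType ∈ G) :
    Linked G K.knotType K'.knotType := by
  obtain ⟨ℓ, hℓ⟩ := exists_injOn (List.finite_toSet (K.vertices ++ K'.vertices))
  have hℓ0 : ℓ ≠ 0 := by
    rintro rfl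
    obtain ⟨x, y, z, l, hv⟩ := K.exists_vertices
    exact (hv ▸ K.isPolygon).ne (@hℓ x (by simp [hv]) y (by simp [hv]) rfl)
  have hsurj := LinearMap.surjective hℓ0
  obtain ⟨d, hd, hd0⟩ := Submodule.exists_mem_ne_zero_of_ne_bot
    (LinearMap.ker_ne_bot_of_finrank_lt (f := ℓ) (by simp))
  obtain ⟨c, Z, V, X, hc⟩ := K.exists_finger (hℓ.mono fun _ => List.mem_append_left _)
  obtain ⟨c', Z', V', X', hc'⟩ := K'.exists_finger (hℓ.mono fun _ => List.mem_append_right _)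
  have hℓc : Continuous ℓ := ℓ.continuous_of_finiteDimensional
  obtain ⟨B, hBp, hB⟩ := (dense_avoiding (s := {plane Z V X, plane V X (V + d), plane Z' V' X',
    plane V' X' (V' + d)}) (by simp) (by simp [plane_ne_top])).exists_mem_open
      (U := {B | ∀ x ∈ {x | x ∈ c ++ c'}, ℓ x < ℓ B})
      (by
        simp only [ofPred_forall]
        exact (List.finite_toSet _).isOpen_biInter fun x _ => isOpen_lt continuous_const hℓc) (by
        obtain ⟨t, ht⟩ := ((List.finite_toSet (c ++ c')).image ℓ).bddAbove
        obtain ⟨B, hB⟩ := hsurj (t + 1)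
        exact ⟨B, fun x hx => by
          rw [hB]; linarith [ht (mem_image_of_mem ℓ hx)]⟩)
  obtain ⟨hp, hk⟩ := hc d hd0 hd B (fun x hx => hB x (by simp [hx])) (hBp _ (by simp))
    (hBp _ (by simp))
  obtain ⟨hp', hk'⟩ := hc' d hd0 hd B (fun x hx => hB x (by simp [hx])) (hBp _ (by simp))
    (hBp _ (by simp))
  have hA : ℓ (B + d) = ℓ B := by rw [map_add, hd, add_zero]
  have hAB : B + d ≠ B := by simpa using hd0
  generalize B + d = A at hp hp' hA hAB
  set s : Set Space := {x | x ∈ A :: B :: (c ++ c')}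
  have hs : s.Finite := List.finite_toSet _
  obtain ⟨W, hWp, hW⟩ := (dense_avoiding ((hs.prod (hs.prod hs)).image fun q =>
    plane q.1 q.2.1 q.2.2) (by
      rintro _ ⟨q, -, rfl⟩; exact plane_ne_top _ _ _)).exists_mem_open
      (U := {x | ℓ x < ℓ B}) (isOpen_lt hℓc continuous_const) (by
        obtain ⟨x, hx⟩ := hsurj (ℓ B - 1)
        exact ⟨x, by simp [hx]⟩)
  obtain ⟨Ψ, hΨ⟩ := exists_affineEquiv n (L := c ++ c') hAB hA rfl hW hB
  have gen : ∀ q, (∀ x ∈ q, x ∈ c ++ c') → ∀ u ∈ A :: B :: q, ∀ v ∈ A :: B :: q,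
      ∀ w ∈ A :: B :: q, W ∉ plane u v w := fun q hq u hu v hv w hw => by
    have hsub : ∀ x ∈ A :: B :: q, x ∈ s :=
      List.cons_subset_cons _ (List.cons_subset_cons _ hq)
    exact hWp _ ⟨(u, v, w), ⟨hsub u hu, hsub v hv, hsub w hw⟩, rfl⟩
  have f := hΨ c (by simp +contextual) hp (gen _ (by simp +contextual))
  have f' := hΨ c' (by simp +contextual) hp' (gen _ (by simp +contextual))
  set G' : Set KnotType := {κ | κ.map Ψ.symm ∈ G} with hG'
  have hG1 : ∀ K : PolygonalKnot, Colorable (4 * n + 1) K.support → K.knotType ∈ G' :=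
    fun K hK => hG (K.map Ψ.symm) (PolygonalKnot.colorable_map hK)
  have back : ∀ {q} (hq : IsPolygon (A :: B :: q))
      (hq' : IsPolygon (Ψ A :: Ψ B :: q.map Ψ)),
      (knotOf _ hq').knotType.map Ψ.symm = (knotOf _ hq).knotType := fun hq hq' =>
    congrArg PolygonalKnot.knotType (PolygonalKnot.map_symm_map Ψ (knotOf _ hq))
  obtain ⟨e, le⟩ := f.linked hn hG1 (by
    rw [hG', mem_ofPred_eq, back hp, hk]; exact hK)
  obtain ⟨e', le'⟩ := f'.linked hn hG1 (by
    rw [hG', mem_ofPred_eq, back hp', hk']; exact hK')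
  have := (le.trans le'.symm).map (Φ := Ψ.symm) (G' := G) fun κ hκ => hκ
  rwa [back hp, back hp', hk, hk'] at this

theorem exists_colorable (hn : 1 ≤ n) :
    ∃ K : PolygonalKnot, Colorable (4 * n + 1) K.support := by
  have hn' := n.cast_nonneg (α := ℝ)
  set A : Space := ![-3, 0, 0] with hA
  set B : Space := ![4 * n + 7, 0, 0] with hB
  set C : Space := ![4 * n + 7, 9, 0] with hC
  set D : Space := ![-3, 9, 0] with hD
  have hp : IsPolygon [A, B, C, D] := by
    refine ⟨by simp, ?_⟩
    rw [polygonEdges_cons]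
    simp only [List.cons_append, List.nil_append, pathEdges_cons_cons, pathEdges_singleton,
      List.pairwise_cons, List.mem_cons, List.not_mem_nil, or_false, forall_eq_or_imp, forall_eq,
      Set.disjoint_left, mem_halfOpenEdge]
    refine ⟨⟨?_, ?_, ?_⟩, ⟨?_, ?_⟩, ?_, ?_⟩ <;> try simp
    all_goals
      rintro P t h1 h2 rfl s h3 h4 h
      have e0 := congrFun h 0
      have e1 := congrFun h 1
      simp [hA, hB, hC, hD] at e0 e1
      nlinarith
  have hf : AxisFrame n A B [C, D] := by
    refine ⟨⟨⟨le_rfl, rfl, rfl⟩, ⟨le_rfl, rfl, rfl⟩⟩, hp, fun P hP => ?_⟩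
    by_contra hlt
    rw [not_le, boxGauge_lt_iff] at hlt
    obtain ⟨⟨h1, h2⟩, ⟨h3, h4⟩, h5⟩ := hlt
    simp only [Matrix.cons_val] at h1 h2 h3 h4
    simp only [List.cons_append, List.nil_append, pathSupport_cons_cons, pathSupport_singleton,
      union_empty] at hP
    rcases hP with hP | hP | hP <;> obtain ⟨t, h6, h7, rfl⟩ := mem_segment_iff.1 hP <;>
      simp [hA, hB, hC, hD] at h1 h2 h3 h4 <;> nlinarith
  obtain ⟨h, -⟩ := hf.exists_linked
  exact ⟨knotOf _ h, hf.colorable hn h⟩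

theorem exists_prime_not_colorable {S : Set KnotType} (hS : S.Finite) : ∃ n : ℕ, 1 ≤ n ∧
    ∀ K : PolygonalKnot, Colorable (4 * n + 1) K.support → K.knotType ∈ Sᶜ := by
  have hb : ∀ κ : KnotType, ∃ N, ∀ K : PolygonalKnot, K.knotType = κ → ∀ p, p.Prime →
      Colorable p K.support → p ≤ N := fun κ => by
    obtain ⟨K, rfl⟩ := Quotient.exists_rep κ
    obtain ⟨N, hN⟩ := K.exists_bound_of_colorable
    exact ⟨N, fun K' hK' p hp hc => hN p hp (colorable_of_knotType_eq hK' hc)⟩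
  choose N hN using hb
  obtain ⟨M, hM⟩ := (hS.image N).bddAbove
  obtain ⟨p, hp, hMp, h4⟩ := Nat.exists_prime_gt_modEq_one M (k := 4) (by norm_num)
  have h1 := hp.two_le
  have h2 : p = 4 * (p / 4) + 1 := by unfold Nat.ModEq at h4; omega
  refine ⟨p / 4, by omega, fun K hK hKS => ?_⟩
  rw [← h2] at hK
  have := hN _ K rfl p hp hK
  have := hM (mem_image_of_mem N hKS)
  omega

theorem connected_compl {S : Set KnotType} (hS : S.Finite) :
    (gordianGraph.induce Sᶜ).Connected := by
  obtain ⟨n, hn, hG⟩ := exists_prime_not_colorable hS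
  obtain ⟨K, hK⟩ := exists_colorable hn
  have : Nonempty (Sᶜ : Set KnotType) := ⟨_, hG K hK⟩
  refine ⟨?_⟩
  rintro ⟨κ, hκ⟩ ⟨κ', hκ'⟩
  obtain ⟨K, rfl⟩ := Quotient.exists_rep κ
  obtain ⟨K', rfl⟩ := Quotient.exists_rep κ'
  exact (linked_of_colorable_subset hn hG hκ hκ').2.2

end Connected

end GordianGraph

theorem mainTheorem2 (S : Set GordianGraph.KnotType) (hS : S.Finite) :
    (GordianGraph.gordianGraph.induce Sᶜ).Connected :=
  GordianGraph.connected_compl hS
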